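/- **Setting.** Let $A_0,\omega_0>0$, $\mathbb R_+=(0,\infty)$, $\sigma_3=\mathrm{diag}(1,-1)$, $\mathbb C_\pm^{\rm cl}=\{z:\pm\Im z\ge 0\}$, and let $A[i]$ be the $i$-th column of $A$. Let $0<\Lambda\le+\infty$ (with $[-\Lambda,\Lambda]:=\mathbb R$ if $\Lambda=+\infty$) and let $n\ge0$ on $\mathbb R$ satisfy $\int n=1$ and one of: 1. $\Lambda=+\infty$; $n$ satisfies a Hölder condition (exponent in $(0,1]$) on $\mathbb R$ and a Hölder condition at infinity ($|n(a)-n(b)|\le C|a^{-1}-b^{-1}|^\mu$ for all large $|a|,|b|$), and $n(\lambda)\to0$ as $|\lambda|\to\infty$; 2. $\Lambda<\infty$; $n=0$ off $[-\Lambda,\Lambda]$, $n(\pm\Lambda)=0$, and either (2.1) $n$ is Hölder on $[-\Lambda,\Lambda]$, or (2.2) $n$ is constant on $(-\Lambda,\Lambda)$ (so $n=\frac1{2\Lambda}$ there). Let $J=\{\pm\Lambda\}$ in case (2.2) and $J=\varnothing$ otherwise ($J$ is the set of discontinuities of $n$). Let $S$ be a closed subset of the light cone $\{t=x\ge0\}$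 with $(0,0)\in S$. (For $S=\{(0,0)\}$ the field below is $C^1$ on $\mathbb R_+\times\mathbb R_+$; $S=\{t=x\ge 0\}$ admits a jump of the field across the light cone.) Let $\mathcal E(t,x)\in\mathbb C$, $\rho(t,x,\lambda)\in\mathbb C$, $\mathcal N(t,x,\lambda)\in\mathbb R$ be a solution of the Maxwell–Bloch problem $$\mathcal E_t+\mathcal E_x=\int_{\mathbb R} n(s)\rho(t,x,s)\,ds,\quad \rho_t+2i\lambda\rho=\mathcal N\mathcal E,\quad \mathcal N_t=-\tfrac12(\overline{\mathcal E}\rho+\mathcal E\overline\rho),\qquad (t,x)\in\mathbb R_+^2\setminus S,\ \lambda\in\mathbb R,$$ $$\mathcal E(0,x)=0,\quad \rho(0,x,\lambda)=0,\quad \mathcal N(0,x,\lambda)=-1\quad(x>0),\qquad \mathcal E(t,0)=A_0e^{i\omega_0t}\quad(t>0),$$ such that: $\mathcal E$ is continuous on $[0,\infty)^2\setminus S$, is $C^1$ on $\mathbb R_+^2\setminus S$, and is bounded together with $\mathcal E_t,\mathcal E_x$ on bounded subsets of $\mathbb R_+^2\setminus S$; $\rho,\mathcal N$ are continuous on $[0,\infty)\times\mathbb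 R_+\times\mathbb R$, their $t$-derivatives are continuous on $(\mathbb R_+^2\setminus S)\times\mathbb R$ and their $\lambda$-derivatives exist and are continuous on $\mathbb R_+^2\times\mathbb R$; and $\mathcal N(t,\cdot,\lambda)+1\in L^1(\mathbb R_+)$ for all $t\in\mathbb R_+$, $\lambda\in\mathbb R$. **Notation.** For $f$ on $\mathbb R$ write $\int\frac{f(s)\,ds}{s-\lambda\mp i0}={\rm p.v.}\!\int\frac{f(s)\,ds}{s-\lambda}\pm\pi i f(\lambda)$. Put $$\eta(z)=z+\frac14\int\frac{n(s)\,ds}{s-z}\ (z\notin\mathbb R),\qquad \eta_\pm(\lambda)=\lambda+\frac14\int\frac{n(s)\,ds}{s-\lambda\mp i0}\ (\lambda\in\mathbb R);$$ for $z\in\mathbb C_\pm^{\rm cl}$ real, $\eta(z)$ means $\eta_\pm(z)$. Put $$H=\tfrac12\begin{pmatrix}0&\mathcal E\\-\overline{\mathcal E}&0\end{pmatrix},\quad F=\begin{pmatrix}\mathcal N&\rho\\ \overline\rho&-\mathcal N\end{pmatrix},\quad U=-i\lambda\sigma_3-H,\quad V_\pm=i\lambda\sigma_3+H-\frac i4\int\frac{F(t,x,s)n(s)\,ds}{s-\lambda\mp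 i0}.$$ The $t$-equation is $Q_t=UQ$; the $x^\pm$-equation is $Q_x=V_\pm Q$. Let $E=-\frac{\omega_0}2+\frac{iA_0}2$; let $\varkappa(z)=\big(\frac{z-\overline E}{z-E}\big)^{1/4}$ and $w(z)=\sqrt{(z-E)(z-\overline E)}$ have their cut along the segment $[E,\overline E]$, with $\varkappa\to1$ and $w(z)\sim z$ as $z\to\infty$ (on the cut: limits from the right), and $$\Phi(t,\lambda)=e^{-i\Re E\,t\sigma_3}M_0(\lambda)e^{-iw(\lambda)t\sigma_3},\qquad M_0=\frac12\begin{pmatrix}\varkappa+\varkappa^{-1}&\varkappa-\varkappa^{-1}\\ \varkappa-\varkappa^{-1}&\varkappa+\varkappa^{-1}\end{pmatrix}.$$ **Theorem.** The principal values in $\eta_\pm(\lambda)$ and $V_\pm(t,x,\lambda)$ ($t\ge0$, $x>0$) exist for $\lambda\in\mathbb R\setminus J$, and $\Phi$ satisfies the $t$-equation for $x=0$. There exist $2\times2$ matrix functions $Y_\pm(t,x,\lambda)=W_\pm(t,x,\lambda)\Phi(t,\lambda)$ and $Z_\pm(t,x,\lambda)=\Psi(t,x,\lambda)w_\pm(x,\lambda)$,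 $t,x\ge0$, $\lambda\in\mathbb R$, such that (in all statements about equations, determinants and smoothness $\lambda\notin J$, and equations hold at the points of $\mathbb R_+^2\setminus S$): * for each $t>0$, $W_\pm$ is continuous in $x\ge0$, satisfies the $x^\pm$-equation, and $W_\pm(t,0,\lambda)=I$; for each $x>0$ and every $\lambda\in\mathbb R$, $\Psi$ is continuous in $t\ge0$, satisfies the $t$-equation, and $\Psi(0,x,\lambda)=I$; $w_\pm$ satisfies the $x^\pm$-equation for $t=0$, and $w_\pm(x,\lambda)e^{-i\eta_\pm(\lambda)x\sigma_3}\to I$ as $x\to+\infty$; * $Y_\pm$ and $Z_\pm$ satisfy the $t$- and the $x^\pm$-equations; $Y_+=Y_-$ and $Z_+=Z_-$ for $\lambda\notin[-\Lambda,\Lambda]$; * (a) $\det Y_\pm\equiv\det Z_\pm\equiv1$; * (b) $Y_\pm,Z_\pm$ are $C^1$ in $(t,x)$ on $\mathbb R_+^2\setminus S$ and continuous on $[0,\infty)^2$; * (c) for fixed $t,x\ge0$, with $E_+=E$, $E_-=\overline E$, and $\gamma_\pm$ the segment from $E_\pm$ to $\Re E$: $Y_\pm$ extends to a function $Y^\pm(t,x,z)$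 that is analytic in $z\in\mathbb C_\pm^{\rm cl}\setminus([-\Lambda,\Lambda]\cup\gamma_\pm)$, is continuous on $\mathbb C_\pm^{\rm cl}\setminus(\gamma_\pm\cup J)$, has limits from the left and from the right at each interior point of $\gamma_\pm$, is bounded near $\Re E$ and near the points of $J$, and is such that $(z-E_\pm)^{1/4}Y^\pm$ (for a branch of the root with the cut along $\gamma_\pm$ near $E_\pm$) tends to a nonzero matrix as $z\to E_\pm$ off $\gamma_\pm$; moreover, as $z\to\infty$, $$Y^-[1]e^{i(zt-\eta(z)x)}=\begin{pmatrix}1\\0\end{pmatrix}+O(z^{-1}),\ z\in\mathbb C_-^{\rm cl};\qquad Y^+[2]e^{-i(zt-\eta(z)x)}=\begin{pmatrix}0\\1\end{pmatrix}+O(z^{-1}),\ z\in\mathbb C_+^{\rm cl};$$ * (d) for fixed $t,x\ge0$, $Z_\pm$ extends to a function $Z^\pm(t,x,z)$ that is analytic in $z\in\mathbb C_\pm^{\rm cl}\setminus[-\Lambda,\Lambda]$, is continuous on $\mathbb C_\pm^{\rm cl}\setminus J$ and bounded near the points of $J$; as $z\to\infty$, $$Z^+[1]e^{i(zt-\eta(z)x)}=\begin{pmatrix}1\\0\end{pmatrix}+O(z^{-1}),\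 z\in\mathbb C_+^{\rm cl};\qquad Z^-[2]e^{-i(zt-\eta(z)x)}=\begin{pmatrix}0\\1\end{pmatrix}+O(z^{-1}),\ z\in\mathbb C_-^{\rm cl}.$$ -/

import Mathlib

open Filter Topology MeasureTheory Asymptotics
open scoped NNReal ComplexConjugate

attribute [local instance] Matrix.normedAddCommGroup Matrix.normedSpace

noncomputable section

/-- Complex `2 × 2` matrices (normed by the sup norm of the entries). -/
abbrev Mat2 : Type := Matrix (Fin 2) (Fin 2) ℂ

/-! Geometry of the `(t, x)`-quadrant -/

/-- `ℝ₊ × ℝ₊`. -/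
def openQuadrant : Set (ℝ × ℝ) := {p | 0 < p.1 ∧ 0 < p.2}

/-- `[0, ∞) × [0, ∞)`. -/
def closedQuadrant : Set (ℝ × ℝ) := {p | 0 ≤ p.1 ∧ 0 ≤ p.2}

/-- The characteristic (light cone) `t = x ≥ 0`. -/
def lightCone : Set (ℝ × ℝ) := {p | 0 ≤ p.1 ∧ p.1 = p.2}

/-! The inhomogeneous broadening `n` -/

/-- Hölder condition on a set, with some exponent in `(0, 1]`. -/
def HolderCondition (f : ℝ → ℝ) (s : Set ℝ) : Prop :=
  ∃ C μ : ℝ≥0, 0 < μ ∧ μ ≤ 1 ∧ HolderOnWith C μ f s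

/-- Hölder condition in a neighbourhood of infinity. -/
def HolderConditionAtInfinity (f : ℝ → ℝ) : Prop :=
  ∃ C μ R : ℝ, 0 < μ ∧ μ ≤ 1 ∧ 0 < R ∧
    ∀ a b : ℝ, R ≤ |a| → R ≤ |b| → |f a - f b| ≤ C * |a⁻¹ - b⁻¹| ^ μ

/-- Standing assumptions on the weight `n`, with `0 < Λ ≤ +∞`. -/
structure IsBroadening (Λ : EReal) (n : ℝ → ℝ) : Prop where
  nonneg : ∀ s, 0 ≤ n s
  integral_eq_one : ∫ s, n s = 1
  cases :
    (Λ = ⊤ ∧ HolderCondition n Set.univ ∧ HolderConditionAtInfinity n ∧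
      Tendsto n (cocompact ℝ) (𝓝 0)) ∨
    (∃ l : ℝ, 0 < l ∧ Λ = (l : EReal) ∧ (∀ s, l < |s| → n s = 0) ∧ n (-l) = 0 ∧ n l = 0 ∧
      (HolderCondition n (Set.Icc (-l) l) ∨ ∃ c : ℝ, ∀ s, |s| < l → n s = c))

/-- `[-Λ, Λ]` as a subset of `ℂ`; it is the whole real line for `Λ = +∞`. -/
def bandSet (Λ : EReal) : Set ℂ := {z | z.im = 0 ∧ ((|z.re| : ℝ) : EReal) ≤ Λ}

/-- The real points at which `n` is discontinuous, as a subset of `ℂ`. It is empty, except for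
the rectangular profile `n = 1 / (2 Λ)` on `(-Λ, Λ)`, when it is `{-Λ, Λ}`. -/
def jumpSet (n : ℝ → ℝ) : Set ℂ := {z | z.im = 0 ∧ ¬ ContinuousAt n z.re}

/-! Cauchy integrals and their boundary values -/

/-- The truncated Cauchy integral, over `|s - lam| > ε`. -/
def truncatedCauchy (f : ℝ → ℂ) (lam ε : ℝ) : ℂ :=
  ∫ s in {s : ℝ | ε < |s - lam|}, f s / ((s : ℂ) - (lam : ℂ))

/-- The principal value of `∫ f(s) / (s - lam) ds` exists. -/
def HasPrincipalValue (f : ℝ → ℂ) (lam : ℝ) : Prop :=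
  ∃ I : ℂ, Tendsto (truncatedCauchy f lam) (𝓝[>] 0) (𝓝 I)

/-- The principal value of `∫ f(s) / (s - lam) ds`. -/
def principalValue (f : ℝ → ℂ) (lam : ℝ) : ℂ :=
  limUnder (𝓝[>] (0 : ℝ)) (truncatedCauchy f lam)

/-- The real number `±1` given by a sign. -/
def sgnR (σ : ℤˣ) : ℝ := ((σ : ℤ) : ℝ)

/-- The Cauchy integral `∫ f(s) / (s - z) ds` for non-real `z`; for real `z = lam` its boundary
value `∫ f(s) / (s - lam ∓ i0) ds = p.v. ∫ f(s) / (s - lam) ds ± π i f(lam)` from the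
half-plane `ℂ_±`. -/
def cauchyIntegral (σ : ℤˣ) (f : ℝ → ℂ) (z : ℂ) : ℂ :=
  if z.im = 0 then
    principalValue f z.re + (sgnR σ : ℂ) * (Real.pi : ℂ) * Complex.I * f z.re
  else ∫ s : ℝ, f s / ((s : ℂ) - z)

/-- `η(z) = z + (1/4) ∫ n(s) / (s - z) ds`, with its boundary values `η_±` on the real line. -/
def etaFun (n : ℝ → ℝ) (σ : ℤˣ) (z : ℂ) : ℂ :=
  z + (1 / 4) * cauchyIntegral σ (fun s => (n s : ℂ)) z

/-! The initial-boundary value problem for the Maxwell-Bloch equations -/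

/-- A solution `(Ef, ρ, N)` of the Maxwell-Bloch equations on `ℝ₊ × ℝ₊` with
`Ef(0,x) = 0`, `ρ(0,x,lam) = 0`, `N(0,x,lam) = -1`, `Ef(t,0) = A₀ exp(i ω₀ t)`. The field `Ef` is
continuously differentiable off the set `S` and is bounded, with its first derivatives, on bounded
sets; `S` is a part of the light cone across which `Ef` may jump. -/
structure IsRegularSolution (A₀ ω₀ : ℝ) (n : ℝ → ℝ) (S : Set (ℝ × ℝ))
    (Ef : ℝ → ℝ → ℂ) (ρ : ℝ → ℝ → ℝ → ℂ) (N : ℝ → ℝ → ℝ → ℝ) : Prop where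
  /- regularity of the field -/
  field_contDiff : ContDiffOn ℝ 1 (fun p : ℝ × ℝ => Ef p.1 p.2) (openQuadrant \ S)
  field_continuous : ContinuousOn (fun p : ℝ × ℝ => Ef p.1 p.2) (closedQuadrant \ S)
  field_bounded : ∀ R : ℝ, ∃ C : ℝ, ∀ t x : ℝ, 0 < t → t ≤ R → 0 < x → x ≤ R → (t, x) ∉ S →
    ‖Ef t x‖ ≤ C ∧ ‖deriv (fun τ => Ef τ x) t‖ ≤ C ∧ ‖deriv (fun y => Ef t y) x‖ ≤ C
  /- regularity of the density matrix -/
  rho_continuous : ContinuousOn (fun q : ℝ × ℝ × ℝ => ρ q.1 q.2.1 q.2.2)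
    {q | 0 ≤ q.1 ∧ 0 < q.2.1}
  pop_continuous : ContinuousOn (fun q : ℝ × ℝ × ℝ => N q.1 q.2.1 q.2.2)
    {q | 0 ≤ q.1 ∧ 0 < q.2.1}
  rho_t_continuous : ContinuousOn
    (fun q : ℝ × ℝ × ℝ => deriv (fun τ => ρ τ q.2.1 q.2.2) q.1)
    {q | (q.1, q.2.1) ∈ openQuadrant \ S}
  pop_t_continuous : ContinuousOn
    (fun q : ℝ × ℝ × ℝ => deriv (fun τ => N τ q.2.1 q.2.2) q.1)
    {q | (q.1, q.2.1) ∈ openQuadrant \ S}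
  rho_lam_differentiable : ∀ t x : ℝ, 0 < t → 0 < x → Differentiable ℝ (ρ t x)
  pop_lam_differentiable : ∀ t x : ℝ, 0 < t → 0 < x → Differentiable ℝ (N t x)
  rho_lam_continuous : ContinuousOn
    (fun q : ℝ × ℝ × ℝ => deriv (ρ q.1 q.2.1) q.2.2) {q | 0 < q.1 ∧ 0 < q.2.1}
  pop_lam_continuous : ContinuousOn
    (fun q : ℝ × ℝ × ℝ => deriv (N q.1 q.2.1) q.2.2) {q | 0 < q.1 ∧ 0 < q.2.1}
  /- the Maxwell-Bloch equations -/
  eq_field : ∀ t x : ℝ, (t, x) ∈ openQuadrant \ S →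
    deriv (fun τ => Ef τ x) t + deriv (fun y => Ef t y) x = ∫ s : ℝ, (n s : ℂ) * ρ t x s
  eq_rho : ∀ t x lam : ℝ, (t, x) ∈ openQuadrant \ S →
    HasDerivAt (fun τ => ρ τ x lam)
      ((N t x lam : ℂ) * Ef t x - 2 * Complex.I * (lam : ℂ) * ρ t x lam) t
  eq_pop : ∀ t x lam : ℝ, (t, x) ∈ openQuadrant \ S →
    HasDerivAt (fun τ => (N τ x lam : ℂ))
      (-(1 / 2) * (conj (Ef t x) * ρ t x lam + Ef t x * conj (ρ t x lam))) t
  /- initial and boundary conditions -/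
  initial_field : ∀ x : ℝ, 0 < x → Ef 0 x = 0
  initial_rho : ∀ x lam : ℝ, 0 < x → ρ 0 x lam = 0
  initial_pop : ∀ x lam : ℝ, 0 < x → N 0 x lam = -1
  boundary_field : ∀ t : ℝ, 0 < t →
    Ef t 0 = (A₀ : ℂ) * Complex.exp (Complex.I * (ω₀ : ℂ) * (t : ℂ))
  /- decay as `x → ∞` -/
  pop_integrable : ∀ t lam : ℝ, 0 < t → IntegrableOn (fun x => N t x lam + 1) (Set.Ioi 0)

/-! The AKNS systems -/

/-- The Pauli matrix `σ₃`. -/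
def sigma3 : Mat2 := !![1, 0; 0, -1]

/-- `exp(c σ₃)`. -/
def expSigma3 (c : ℂ) : Mat2 := !![Complex.exp c, 0; 0, Complex.exp (-c)]

/-- `H(t,x)`. -/
def matH (Ef : ℝ → ℝ → ℂ) (t x : ℝ) : Mat2 :=
  !![0, Ef t x / 2; -(conj (Ef t x)) / 2, 0]

/-- The density matrix `F(t,x,s)`. -/
def matF (ρ : ℝ → ℝ → ℝ → ℂ) (N : ℝ → ℝ → ℝ → ℝ) (t x s : ℝ) : Mat2 :=
  !![(N t x s : ℂ), ρ t x s; conj (ρ t x s), -(N t x s : ℂ)]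

/-- `U(t,x,lam) = -i lam σ₃ - H(t,x)`. -/
def matU (Ef : ℝ → ℝ → ℂ) (t x lam : ℝ) : Mat2 :=
  -((Complex.I * (lam : ℂ)) • sigma3) - matH Ef t x

/-- `G_±(t,x,lam) = (1/4) ∫ F(t,x,s) n(s) / (s - lam ∓ i0) ds`, entry by entry. -/
def matG (n : ℝ → ℝ) (ρ : ℝ → ℝ → ℝ → ℂ) (N : ℝ → ℝ → ℝ → ℝ) (σ : ℤˣ) (t x lam : ℝ) : Mat2 :=
  Matrix.of fun i j =>
    (1 / 4) * cauchyIntegral σ (fun s => matF ρ N t x s i j * (n s : ℂ)) (lam : ℂ)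

/-- `V_±(t,x,lam) = i lam σ₃ + H(t,x) - i G_±(t,x,lam)`. -/
def matV (n : ℝ → ℝ) (Ef : ℝ → ℝ → ℂ) (ρ : ℝ → ℝ → ℝ → ℂ) (N : ℝ → ℝ → ℝ → ℝ)
    (σ : ℤˣ) (t x lam : ℝ) : Mat2 :=
  (Complex.I * (lam : ℂ)) • sigma3 + matH Ef t x - Complex.I • matG n ρ N σ t x lam

/-! The explicit solution `Φ` of the `t`-equation for `x = 0` -/

/-- The branch points: `E = -ω₀/2 + i A₀/2` for the sign `+`, its conjugate for the sign `-`. -/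
def branchPt (A₀ ω₀ : ℝ) (σ : ℤˣ) : ℂ := ⟨-ω₀ / 2, sgnR σ * A₀ / 2⟩

/-- `Re E`, as a complex number. -/
def reE (ω₀ : ℝ) : ℂ := ((-ω₀ / 2 : ℝ) : ℂ)

/-- The part of the cut `[E, Ē]` in the closed half-plane: `[E, Re E]` or `[Re E, Ē]`. -/
def cutSeg (A₀ ω₀ : ℝ) (σ : ℤˣ) : Set ℂ := segment ℝ (branchPt A₀ ω₀ σ) (reE ω₀)

/-- `ϰ(z) = ((z - Ē)/(z - E))^(1/4)`. The quotient is a negative real number exactly on the open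
segment from `E` to `Ē`, so that the principal power has its cut along `[E, Ē]` and tends
to `1` at infinity. On the segment it is the limit from the right; `ϰ(Re E) = exp(i π/4)`. -/
def kappaFun (A₀ ω₀ : ℝ) (z : ℂ) : ℂ :=
  ((z - branchPt A₀ ω₀ (-1)) / (z - branchPt A₀ ω₀ 1)) ^ (1 / 4 : ℂ)

/-- The branch `w(z) = (z - E) ϰ(z)²` of the square root of `(z - E)(z - Ē)` with its cut along
`[E, Ē]` and `w(z) ~ z` at infinity. -/
def wFun (A₀ ω₀ : ℝ) (z : ℂ) : ℂ :=
  (z - branchPt A₀ ω₀ 1) * kappaFun A₀ ω₀ z ^ 2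

/-- `M₀(z)`, with entries `(ϰ ± ϰ⁻¹)/2`. -/
def matM0 (A₀ ω₀ : ℝ) (z : ℂ) : Mat2 :=
  let a := (kappaFun A₀ ω₀ z + (kappaFun A₀ ω₀ z)⁻¹) / 2
  let b := (kappaFun A₀ ω₀ z - (kappaFun A₀ ω₀ z)⁻¹) / 2
  !![a, b; b, a]

/-- `Φ(t,lam) = exp(-i Re E t σ₃) M₀(lam) exp(-i w(lam) t σ₃)`. -/
def matPhi (A₀ ω₀ : ℝ) (t lam : ℝ) : Mat2 :=
  expSigma3 (-(Complex.I * reE ω₀ * (t : ℂ))) * matM0 A₀ ω₀ (lam : ℂ) *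
    expSigma3 (-(Complex.I * wFun A₀ ω₀ (lam : ℂ) * (t : ℂ)))

/-! Domains in the spectral plane and asymptotics -/

/-- The closed half-planes `ℂ_±ᶜˡ = ℂ_± ∪ ℝ`. -/
def closedHalfPlane (σ : ℤˣ) : Set ℂ := {z | 0 ≤ sgnR σ * z.im}

/-- `f` is bounded on the part of `D` in some neighbourhood of `z₀`. -/
def BoundedNear (f : ℂ → Mat2) (D : Set ℂ) (z₀ : ℂ) : Prop :=
  ∃ r C : ℝ, 0 < r ∧ ∀ z ∈ D, ‖z - z₀‖ < r → ‖f z‖ ≤ C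

/-- `z → ∞` in the closed half-plane. -/
def atInfinity (σ : ℤˣ) : Filter ℂ := Bornology.cobounded ℂ ⊓ 𝓟 (closedHalfPlane σ)

/-- `θ(t,x,z) = z t - η(z) x`. -/
def thetaFun (n : ℝ → ℝ) (σ : ℤˣ) (t x : ℝ) (z : ℂ) : ℂ :=
  z * (t : ℂ) - etaFun n σ z * (x : ℂ)

end

/-!
# Compatible solutions of the two linear systems of the Maxwell-Bloch equations

The Maxwell-Bloch equations are the compatibility condition of the `t`-equation `Q_t = U Q` and of
the `x^±`-equations `Q_x = V_± Q`. The common solutions of these systems can be written down in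
terms of one object, the propagator in the retarded time.

*Causality.* The length of the Bloch vector is conserved (`IsRegularSolution.norm_sq_add_sq`), so
that the density matrix is bounded. Ahead of the light cone, for `t < x`, the field vanishes and the
medium stays at rest (`IsRegularSolution.field_eq_zero`). Behind it, the field is a continuous
function of the retarded time `τ = t - x` and of `x` up to `τ = 0`, where it takes the value `A₀`
(`retardedField`, `IsRegularSolution.retardedField_eq`). The field thus jumps on the whole light
cone, and the set `S` is necessarily equal to it (`IsRegularSolution.lightCone_subset`).

*The solutions.* Let `X(τ, x, z)` be the propagator of the `t`-equation in the retarded time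
(`laxProp`); it is entire in `z`. Put `Ψ = X exp(-i z min(t, x) σ₃)` with `τ = max(t - x, 0)`
(`matPsi`), and
`Z_± = Ψ exp(i η_± x σ₃)` (`matZ`), `Y_± = Z_± M₀`. Hence `w_± = exp(i η_± x σ₃)`, and
`W_± = Z_± Ψ(t, 0)⁻¹` since `Φ = Ψ(t, 0) M₀` by uniqueness
(`IsRegularSolution.matPsi_mul_matM0`).

*The `x^±`-equation.* The Bloch equations read `F_t = [U, F]`, so that `F = -X σ₃ X⁻¹` at real
frequencies. Expanding `F` about a complex `z` gives `F(s) = -X σ₃ X⁻¹ + (s - z) D(s)`, with `X` at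
`z` and an explicit `D` (`IsRegularSolution.matF_eq_add_smul`). Therefore the Cauchy integral of
`F n` is the Cauchy integral of `n` times `-X σ₃ X⁻¹`, plus `∫ n D`. By Fubini's theorem and the
field equation the last integral is the `x`-derivative of the propagator given by Duhamel's formula
(`IsRegularSolution.integral_blochQuot`), and the first term is compensated by `exp(i η x σ₃)`
(`IsRegularSolution.laxMatX_mul_laxProp`, `IsRegularSolution.hasDerivAt_matZ_x`). The principal
values of `F n` exist for the same reason.

*Dependence on the spectral parameter.* The only non-entire ingredients are `η` and `M₀`. The
function `η` is analytic off the band and continuous up to the real line where `n` is continuous,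
because `n` is locally Hölder continuous there
(`IsBroadening.continuousWithinAt_cauchyIntegral`). Its imaginary part is locally bounded even near
the jumps of `n`, being a Poisson integral (`exists_abs_im_cauchyIntegral_le`); this bounds
`exp(± i η x)`.

*Asymptotics.* In the normalized columns of `Z_±` the function `η` cancels, and the columns of `X`
are within `O(1/z)` of their leading terms by integration by parts and Gronwall's inequality
(`exists_perturbation_bound`, `IsRegularSolution.exists_laxProp_bound`). The normalized column of
`Y_±` contains the other column of `X` with an off-diagonal entry of `M₀` and a relative exponential
`exp(± 2 i θ)`. Near the real line and ahead of the light cone this exponential is bounded. In the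
remaining region the same perturbation lemma is applied to the `x^±`-equation from `x = 0`, where
`Y_± = Φ`: since the medium is nearly at rest far from resonance
(`IsRegularSolution.exists_matF_add_sigma3_bound`), `V_±` is `i η σ₃ + H` up to `O(1/z)`
(`IsRegularSolution.exists_deviationMat_bound`,
`IsRegularSolution.exists_matZ_mul_matM0_bound`).
-/

/-! ### Calculus on an interval and for `2 × 2` matrices -/

/-- Mean value inequality for a function that is differentiable in the interior of an interval and
continuous up to its endpoints. -/
theorem norm_sub_le_of_hasDerivAt_Ioo {E : Type*} [NormedAddCommGroup E] [NormedSpace ℝ E]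
    {f f' : ℝ → E} {B B' : ℝ → ℝ} {a b : ℝ} (hab : a ≤ b)
    (hf : ContinuousOn f (Set.Icc a b)) (hB : ContinuousOn B (Set.Icc a b))
    (hf' : ∀ x ∈ Set.Ioo a b, HasDerivAt f (f' x) x)
    (hB' : ∀ x ∈ Set.Ioo a b, HasDerivAt B (B' x) x)
    (hle : ∀ x ∈ Set.Ioo a b, ‖f' x‖ ≤ B' x) : ‖f b - f a‖ ≤ B b - B a := by
  rcases hab.eq_or_lt with rfl | hab
  · simp
  have key : ∀ c ∈ Set.Ioo a b, ‖f b - f c‖ ≤ B b - B c := by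
    intro c hc
    have hsub : Set.Icc c b ⊆ Set.Icc a b := Set.Icc_subset_Icc_left hc.1.le
    refine image_norm_le_of_norm_deriv_right_le_deriv_boundary' (f := fun x => f x - f c)
      (f' := f') (B := fun x => B x - B c) (B' := B') (a := c) (b := b)
      ((hf.mono hsub).sub continuousOn_const) ?_ (by simp) ((hB.mono hsub).sub continuousOn_const)
      ?_ ?_ ⟨hc.2.le, le_rfl⟩
    · intro x hx
      exact ((hf' x ⟨hc.1.trans_le hx.1, hx.2⟩).sub_const _).hasDerivWithinAt
    · intro x hx
      exact ((hB' x ⟨hc.1.trans_le hx.1, hx.2⟩).sub_const _).hasDerivWithinAt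
    · intro x hx
      exact hle x ⟨hc.1.trans_le hx.1, hx.2⟩
  have hfa : Tendsto f (𝓝[>] a) (𝓝 (f a)) :=
    ((hf a ⟨le_rfl, hab.le⟩).mono_of_mem_nhdsWithin
      (mem_of_superset (Ioo_mem_nhdsGT hab) Set.Ioo_subset_Icc_self))
  have hBa : Tendsto B (𝓝[>] a) (𝓝 (B a)) :=
    ((hB a ⟨le_rfl, hab.le⟩).mono_of_mem_nhdsWithin
      (mem_of_superset (Ioo_mem_nhdsGT hab) Set.Ioo_subset_Icc_self))
  refine le_of_tendsto_of_tendsto ((tendsto_const_nhds.sub hfa).norm)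
    (tendsto_const_nhds.sub hBa) ?_
  filter_upwards [Ioo_mem_nhdsGT hab] with c hc using key c hc

theorem eq_of_hasDerivAt_zero_Ioo {E : Type*} [NormedAddCommGroup E] [NormedSpace ℝ E]
    {f : ℝ → E} {a b : ℝ} (hab : a ≤ b) (hf : ContinuousOn f (Set.Icc a b))
    (hf' : ∀ x ∈ Set.Ioo a b, HasDerivAt f 0 x) : f b = f a := by
  have := norm_sub_le_of_hasDerivAt_Ioo (B := fun _ => 0) (B' := fun _ => 0) hab hf
    continuousOn_const hf' (fun x _ => hasDerivAt_const x 0) (by simp)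
  simpa [sub_eq_zero] using this

/-- A function whose increments from `a` are the increments of the variable times a function that
is continuous at `a`. -/
theorem hasDerivAt_of_sub_eq_smul {𝕜 E : Type*} [NontriviallyNormedField 𝕜] [NormedAddCommGroup E]
    [NormedSpace 𝕜 E] {f g : 𝕜 → E} {a : 𝕜} (h : ∀ᶠ z in 𝓝 a, f z - f a = (z - a) • g z)
    (hg : ContinuousAt g a) : HasDerivAt f (g a) a := by
  rw [hasDerivAt_iff_tendsto_slope]
  refine (hg.tendsto.mono_left nhdsWithin_le_nhds).congr' ?_
  filter_upwards [nhdsWithin_le_nhds h, self_mem_nhdsWithin] with z hz hza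
  rw [slope_def_module, hz, smul_smul, inv_mul_cancel₀ (sub_ne_zero.2 hza), one_smul]

namespace Mat2

theorem norm_mul_le (A B : Mat2) : ‖A * B‖ ≤ 2 * ‖A‖ * ‖B‖ := by
  refine (Matrix.norm_le_iff (by positivity)).2 fun i j => ?_
  rw [Matrix.mul_apply, Fin.sum_univ_two]
  have h : ∀ k, ‖A i k * B k j‖ ≤ ‖A‖ * ‖B‖ := fun k => by
    rw [norm_mul]
    exact mul_le_mul (Matrix.norm_entry_le_entrywise_sup_norm A)
      (Matrix.norm_entry_le_entrywise_sup_norm B) (norm_nonneg _) (norm_nonneg _)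
  linarith [norm_add_le (A i 0 * B 0 j) (A i 1 * B 1 j), h 0, h 1]

theorem norm_le_of_entries {A : Mat2} {c : ℝ} (h : ∀ i j, ‖A i j‖ ≤ c) : ‖A‖ ≤ c :=
  (Matrix.norm_le_iff ((norm_nonneg _).trans (h 0 0))).2 h

end Mat2

section Deriv

variable {𝕜 : Type*} [NontriviallyNormedField 𝕜] [NormedAlgebra 𝕜 ℂ]

theorem hasDerivAt_mat2_iff {A : 𝕜 → Mat2} {A' : Mat2} {t : 𝕜} :
    HasDerivAt A A' t ↔ ∀ i j, HasDerivAt (fun τ => A τ i j) (A' i j) t := by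
  refine (hasDerivAt_pi (φ := A) (φ' := A')).trans (forall_congr' fun i => ?_)
  exact hasDerivAt_pi (φ := fun τ => A τ i) (φ' := A' i)

theorem HasDerivAt.mat2_mul {A B : 𝕜 → Mat2} {A' B' : Mat2} {t : 𝕜}
    (hA : HasDerivAt A A' t) (hB : HasDerivAt B B' t) :
    HasDerivAt (fun τ => A τ * B τ) (A' * B t + A t * B') t := by
  rw [hasDerivAt_mat2_iff] at *
  intro i j
  simp only [Matrix.mul_apply, Fin.sum_univ_two, Matrix.add_apply]
  convert! ((hA i 0).mul (hB 0 j)).add ((hA i 1).mul (hB 1 j)) using 1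
  ring

theorem HasDerivAt.mat2_mul_const {A : 𝕜 → Mat2} {A' : Mat2} {t : 𝕜}
    (hA : HasDerivAt A A' t) (B : Mat2) : HasDerivAt (fun τ => A τ * B) (A' * B) t := by
  simpa using hA.mat2_mul (hasDerivAt_const t B)

theorem HasDerivAt.mat2_const_mul {A : 𝕜 → Mat2} {A' : Mat2} {t : 𝕜}
    (B : Mat2) (hA : HasDerivAt A A' t) : HasDerivAt (fun τ => B * A τ) (B * A') t := by
  simpa using (hasDerivAt_const t B).mat2_mul hA

theorem HasDerivAt.mat2_adjugate {A : 𝕜 → Mat2} {A' : Mat2} {t : 𝕜}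
    (hA : HasDerivAt A A' t) :
    HasDerivAt (fun τ => (A τ).adjugate) A'.adjugate t := by
  rw [hasDerivAt_mat2_iff] at *
  intro i j
  simp only [Matrix.adjugate_fin_two]
  fin_cases i <;> fin_cases j
  · simpa using hA 1 1
  · simpa using! (hA 0 1).neg
  · simpa using! (hA 1 0).neg
  · simpa using hA 0 0

theorem HasDerivAt.expSigma3 {c : 𝕜 → ℂ} {c' : ℂ} {t : 𝕜} (hc : HasDerivAt c c' t) :
    HasDerivAt (fun τ => expSigma3 (c τ)) ((c' • sigma3) * _root_.expSigma3 (c t)) t := by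
  rw [hasDerivAt_mat2_iff]
  intro i j
  fin_cases i <;> fin_cases j
  · simpa [_root_.expSigma3, sigma3, mul_comm] using hc.cexp
  · simpa [_root_.expSigma3, sigma3] using hasDerivAt_const t (0 : ℂ)
  · simpa [_root_.expSigma3, sigma3] using hasDerivAt_const t (0 : ℂ)
  · simpa [_root_.expSigma3, sigma3, mul_comm] using hc.neg.cexp

end Deriv

theorem Matrix.adjugate_of_trace_zero {A : Mat2} (h : A 0 0 + A 1 1 = 0) : A.adjugate = -A := by
  rw [Matrix.adjugate_fin_two]
  ext i j
  fin_cases i <;> fin_cases j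
  · simpa using eq_neg_of_add_eq_zero_right h
  · simp
  · simp
  · simpa using eq_neg_of_add_eq_zero_left h

@[simp] theorem expSigma3_zero : expSigma3 0 = 1 := by
  ext i j; fin_cases i <;> fin_cases j <;> simp [expSigma3]

theorem expSigma3_add (a b : ℂ) : expSigma3 (a + b) = expSigma3 a * expSigma3 b := by
  ext i j
  fin_cases i <;> fin_cases j <;> simp [expSigma3, Matrix.mul_apply, Complex.exp_add, mul_comm]

theorem det_expSigma3 (c : ℂ) : (expSigma3 c).det = 1 := by
  simp [expSigma3, Matrix.det_fin_two, ← Complex.exp_add]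

theorem sigma3_mul_expSigma3 (c : ℂ) : sigma3 * expSigma3 c = expSigma3 c * sigma3 := by
  ext i j
  fin_cases i <;> fin_cases j <;> simp [expSigma3, sigma3, Matrix.mul_apply]

theorem continuous_expSigma3 : Continuous expSigma3 := by
  refine continuous_pi fun i => continuous_pi fun j => ?_
  fin_cases i <;> fin_cases j <;> simp [expSigma3] <;> fun_prop

instance : TopologicalSpace.PseudoMetrizableSpace Mat2 :=
  inferInstanceAs (TopologicalSpace.PseudoMetrizableSpace (Fin 2 → Fin 2 → ℂ))

/-! ### The propagator of a linear system with parameters -/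

section Propagator

variable {P : Type*}

/-- The terms of the Dyson series of `X' = A X`, `X(0) = 1`. -/
noncomputable def dysonTerm (A : ℝ → P → Mat2) : ℕ → ℝ → P → Mat2
  | 0 => fun _ _ => 1
  | k + 1 => fun τ p => ∫ s in (0 : ℝ)..τ, A s p * dysonTerm A k s p

/-- The solution of `X' = A X`, `X(0) = 1`, as the sum of the Dyson series. -/
noncomputable def propagator (A : ℝ → P → Mat2) (τ : ℝ) (p : P) : Mat2 :=
  ∑' k, dysonTerm A k τ p

theorem norm_dysonTerm_le {A : ℝ → P → Mat2} {T M : ℝ} {p : P}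
    (hM : ∀ s, |s| ≤ T → ‖A s p‖ ≤ M) (k : ℕ) :
    ∀ τ, |τ| ≤ T → ‖dysonTerm A k τ p‖ ≤ (2 * M * |τ|) ^ k / k.factorial := by
  induction k with
  | zero => intro τ _; simp [dysonTerm]
  | succ k ih =>
    intro τ hτ
    have hsub : ∀ s ∈ Set.uIoc 0 τ, |s| ≤ T := fun s hs => by
      have := Set.abs_sub_left_of_mem_uIcc (Set.uIoc_subset_uIcc hs)
      simp only [sub_zero] at this
      exact this.trans hτ
    have hM0 : 0 ≤ M := (norm_nonneg _).trans (hM τ hτ)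
    calc ‖dysonTerm A (k + 1) τ p‖
        ≤ |∫ s in (0 : ℝ)..τ, 2 * M * ((2 * M) ^ k / k.factorial) * |s - 0| ^ k| := by
          refine intervalIntegral.norm_integral_le_abs_of_norm_le ?_ ?_
          · refine (ae_restrict_iff' measurableSet_uIoc).2 (Eventually.of_forall fun s hs => ?_)
            refine (Mat2.norm_mul_le _ _).trans ?_
            have h1 := hM s (hsub s hs)
            have h2 := ih s (hsub s hs)
            calc 2 * ‖A s p‖ * ‖dysonTerm A k s p‖
                ≤ 2 * M * ((2 * M * |s|) ^ k / k.factorial) := by gcongr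
              _ = _ := by rw [sub_zero, mul_pow]; ring
          · exact (by fun_prop : Continuous fun s : ℝ =>
              2 * M * ((2 * M) ^ k / k.factorial) * |s - 0| ^ k).intervalIntegrable _ _
      _ = (2 * M * |τ|) ^ (k + 1) / (k + 1).factorial := by
          rw [intervalIntegral.integral_const_mul, abs_mul,
            intervalIntegral.abs_intervalIntegral_eq, integral_pow_abs_sub_uIoc]
          rw [abs_of_nonneg (by positivity), abs_of_nonneg (by positivity), sub_zero,
            Nat.factorial_succ]
          push_cast
          field_simp
          ring

variable [TopologicalSpace P]

theorem continuous_dysonTerm {A : ℝ → P → Mat2} (hA : Continuous fun q : ℝ × P => A q.1 q.2)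
    (k : ℕ) : Continuous fun q : ℝ × P => dysonTerm A k q.1 q.2 := by
  induction k with
  | zero => exact continuous_const
  | succ k ih =>
    refine intervalIntegral.continuous_parametric_intervalIntegral_of_continuous
      (f := fun (q : ℝ × P) s => A s q.2 * dysonTerm A k s q.2) ?_ continuous_fst
    have h1 : Continuous fun q : (ℝ × P) × ℝ => A q.2 q.1.2 :=
      hA.comp (by fun_prop : Continuous fun q : (ℝ × P) × ℝ => (q.2, q.1.2))
    have h2 : Continuous fun q : (ℝ × P) × ℝ => dysonTerm A k q.2 q.1.2 :=
      ih.comp (by fun_prop : Continuous fun q : (ℝ × P) × ℝ => (q.2, q.1.2))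
    exact h1.matrix_mul h2

theorem exists_norm_coeff_le [LocallyCompactSpace P] {A : ℝ → P → Mat2}
    (hA : Continuous fun q : ℝ × P => A q.1 q.2)
    (T : ℝ) (p : P) :
    ∃ K ∈ 𝓝 p, ∃ M, 0 ≤ M ∧ ∀ p' ∈ K, ∀ s, |s| ≤ T → ‖A s p'‖ ≤ M := by
  obtain ⟨K, hK, hpK⟩ := exists_compact_mem_nhds p
  obtain ⟨M, hM⟩ := ((isCompact_Icc (a := -T) (b := T)).prod hK).exists_bound_of_continuousOn
    hA.continuousOn
  exact ⟨K, hpK, max M 0, le_max_right _ _, fun p' hp' s hs =>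
    (hM (s, p') ⟨abs_le.1 hs, hp'⟩).trans (le_max_left _ _)⟩

theorem continuous_propagator [LocallyCompactSpace P] {A : ℝ → P → Mat2}
    (hA : Continuous fun q : ℝ × P => A q.1 q.2) :
    Continuous fun q : ℝ × P => propagator A q.1 q.2 := by
  rw [continuous_iff_continuousAt]
  rintro ⟨τ, p⟩
  obtain ⟨K, hK, M, hM0, hM⟩ := exists_norm_coeff_le hA (|τ| + 1) p
  have hmem : {s : ℝ | |s| ≤ |τ| + 1} ×ˢ K ∈ 𝓝 (τ, p) := by
    refine prod_mem_nhds ?_ hK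
    have h := (continuous_abs.tendsto τ).eventually (gt_mem_nhds (lt_add_one |τ|))
    exact h.mono fun s hs => le_of_lt hs
  have hcont : ContinuousOn (fun q : ℝ × P => ∑' k, dysonTerm A k q.1 q.2)
      ({s : ℝ | |s| ≤ |τ| + 1} ×ˢ K) := by
    have hsum := Real.summable_pow_div_factorial (2 * M * (|τ| + 1))
    refine continuousOn_tsum (fun k => (continuous_dysonTerm hA k).continuousOn) hsum ?_
    intro k q hq
    have hs : |q.1| ≤ |τ| + 1 := hq.1
    have h1 := norm_dysonTerm_le (hM q.2 hq.2) k q.1 hs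
    have h2 : (2 * M * |q.1|) ^ k / (k.factorial : ℝ) ≤
        (2 * M * (|τ| + 1)) ^ k / k.factorial := by gcongr
    exact h1.trans h2
  exact hcont.continuousAt hmem

theorem propagator_eq_integral [LocallyCompactSpace P] {A : ℝ → P → Mat2}
    (hA : Continuous fun q : ℝ × P => A q.1 q.2)
    (τ : ℝ) (p : P) :
    propagator A τ p = 1 + ∫ s in (0 : ℝ)..τ, A s p * propagator A s p := by
  obtain ⟨K, hK, M, hM0, hM⟩ := exists_norm_coeff_le hA |τ| p
  have hb := norm_dysonTerm_le (hM p (mem_of_mem_nhds hK))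
  have hsub : ∀ s ∈ Set.uIoc 0 τ, |s| ≤ |τ| := fun s hs => by
    simpa using Set.abs_sub_left_of_mem_uIcc (Set.uIoc_subset_uIcc hs)
  have hb' : ∀ k, ∀ s, |s| ≤ |τ| → ‖dysonTerm A k s p‖ ≤ (2 * M * |τ|) ^ k / k.factorial :=
    fun k s hs => (hb k s hs).trans (by gcongr)
  have hsum : ∀ s, |s| ≤ |τ| → Summable fun k => dysonTerm A k s p := fun s hs =>
    Summable.of_norm_bounded (Real.summable_pow_div_factorial _) fun k => hb' k s hs
  have hcont : ∀ k, Continuous fun s => A s p * dysonTerm A k s p := fun k =>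
    (hA.comp (by fun_prop : Continuous fun s : ℝ => (s, p))).matrix_mul
      ((continuous_dysonTerm hA k).comp (by fun_prop : Continuous fun s : ℝ => (s, p)))
  have h : HasSum (fun k => ∫ s in (0 : ℝ)..τ, A s p * dysonTerm A k s p)
      (∫ s in (0 : ℝ)..τ, A s p * propagator A s p) := by
    refine intervalIntegral.hasSum_integral_of_dominated_convergence
      (fun k _ => 2 * M * ((2 * M * |τ|) ^ k / k.factorial))
      (fun k => (hcont k).aestronglyMeasurable) ?_ ?_ ?_ ?_
    · refine fun k => Eventually.of_forall fun s hs => (Mat2.norm_mul_le _ _).trans ?_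
      have h1 := hM p (mem_of_mem_nhds hK) s (hsub s hs)
      have h2 := hb' k s (hsub s hs)
      gcongr
    · exact Eventually.of_forall fun s _ => (Real.summable_pow_div_factorial _).mul_left _
    · exact continuous_const.intervalIntegrable _ _
    · refine Eventually.of_forall fun s hs => ?_
      exact ((hsum s (hsub s hs)).hasSum).mapL
        (LinearMap.toContinuousLinearMap (LinearMap.mulLeft ℂ (A s p)))
  rw [propagator, (hsum τ le_rfl).tsum_eq_zero_add, ← h.tsum_eq]
  rfl

theorem hasDerivAt_propagator [LocallyCompactSpace P] {A : ℝ → P → Mat2}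
    (hA : Continuous fun q : ℝ × P => A q.1 q.2)
    (τ : ℝ) (p : P) :
    HasDerivAt (fun s => propagator A s p) (A τ p * propagator A τ p) τ := by
  have hc : Continuous fun s => A s p * propagator A s p :=
    (hA.comp (by fun_prop : Continuous fun s : ℝ => (s, p))).matrix_mul
      ((continuous_propagator hA).comp (by fun_prop : Continuous fun s : ℝ => (s, p)))
  have := (hc.integral_hasStrictDerivAt 0 τ).hasDerivAt.const_add (1 : Mat2)
  refine this.congr_of_eventuallyEq (Eventually.of_forall fun s => ?_)
  exact propagator_eq_integral hA s p

theorem propagator_zero [LocallyCompactSpace P] {A : ℝ → P → Mat2}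
    (hA : Continuous fun q : ℝ × P => A q.1 q.2) (p : P) :
    propagator A 0 p = 1 := by
  simpa using propagator_eq_integral hA 0 p

theorem hasDerivAt_adjugate_propagator [LocallyCompactSpace P] {A : ℝ → P → Mat2}
    (hA : Continuous fun q : ℝ × P => A q.1 q.2) (htr : ∀ s p, A s p 0 0 + A s p 1 1 = 0)
    (τ : ℝ) (p : P) :
    HasDerivAt (fun s => (propagator A s p).adjugate)
      (-((propagator A τ p).adjugate * A τ p)) τ := by
  have h := (hasDerivAt_propagator hA τ p).mat2_adjugate
  rwa [Matrix.adjugate_mul_distrib, Matrix.adjugate_of_trace_zero (htr τ p), mul_neg] at h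

theorem adjugate_mul_propagator [LocallyCompactSpace P] {A : ℝ → P → Mat2}
    (hA : Continuous fun q : ℝ × P => A q.1 q.2) (htr : ∀ s p, A s p 0 0 + A s p 1 1 = 0)
    (τ : ℝ) (p : P) :
    (propagator A τ p).adjugate * propagator A τ p = 1 := by
  have h : ∀ s, HasDerivAt (fun s => (propagator A s p).adjugate * propagator A s p) 0 s := by
    intro s
    have := (hasDerivAt_adjugate_propagator hA htr s p).mat2_mul (hasDerivAt_propagator hA s p)
    convert! this using 1
    rw [neg_mul, Matrix.mul_assoc]
    exact (neg_add_cancel _).symm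
  have h0 := is_const_of_deriv_eq_zero (fun s => (h s).differentiableAt) (fun s => (h s).deriv) τ 0
  simpa [propagator_zero hA] using h0

theorem propagator_mul_adjugate [LocallyCompactSpace P] {A : ℝ → P → Mat2}
    (hA : Continuous fun q : ℝ × P => A q.1 q.2) (htr : ∀ s p, A s p 0 0 + A s p 1 1 = 0)
    (τ : ℝ) (p : P) :
    propagator A τ p * (propagator A τ p).adjugate = 1 :=
  mul_eq_one_comm.1 (adjugate_mul_propagator hA htr τ p)

theorem det_propagator [LocallyCompactSpace P] {A : ℝ → P → Mat2}
    (hA : Continuous fun q : ℝ × P => A q.1 q.2) (htr : ∀ s p, A s p 0 0 + A s p 1 1 = 0)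
    (τ : ℝ) (p : P) : (propagator A τ p).det = 1 := by
  have h := adjugate_mul_propagator hA htr τ p
  rw [Matrix.adjugate_mul] at h
  simpa using congrFun (congrFun h 0) 0

/-- Duhamel's formula: the dependence of the propagator on the parameter. -/
theorem propagator_sub_propagator [LocallyCompactSpace P] {A : ℝ → P → Mat2}
    (hA : Continuous fun q : ℝ × P => A q.1 q.2) (htr : ∀ s p, A s p 0 0 + A s p 1 1 = 0)
    (τ : ℝ) (p p' : P) :
    propagator A τ p' - propagator A τ p = propagator A τ p *
      ∫ s in (0 : ℝ)..τ, (propagator A s p).adjugate * (A s p' - A s p) * propagator A s p' := by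
  have hcX : ∀ p, Continuous fun s => propagator A s p := fun p =>
    (continuous_propagator hA).comp (by fun_prop : Continuous fun s : ℝ => (s, p))
  have hcA : ∀ p, Continuous fun s => A s p := fun p =>
    hA.comp (by fun_prop : Continuous fun s : ℝ => (s, p))
  have hd : ∀ s, HasDerivAt (fun s => (propagator A s p).adjugate * propagator A s p')
      ((propagator A s p).adjugate * (A s p' - A s p) * propagator A s p') s := by
    intro s
    have := (hasDerivAt_adjugate_propagator hA htr s p).mat2_mul (hasDerivAt_propagator hA s p')
    convert! this using 1
    noncomm_ring
  rw [intervalIntegral.integral_eq_sub_of_hasDerivAt (fun s _ => hd s)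
    (Continuous.intervalIntegrable (((hcX p).matrix_adjugate.matrix_mul
      ((hcA p').sub (hcA p))).matrix_mul (hcX p')) _ _)]
  rw [propagator_zero hA, propagator_zero hA, mul_sub, ← Matrix.mul_assoc,
    propagator_mul_adjugate hA htr]
  simp

end Propagator

/-! ### Causality and the field in retarded coordinates -/

section MaxwellBloch

variable {A₀ ω₀ : ℝ} {n : ℝ → ℝ} {S : Set (ℝ × ℝ)} {Ef : ℝ → ℝ → ℂ} {ρ : ℝ → ℝ → ℝ → ℂ}
  {N : ℝ → ℝ → ℝ → ℝ}

theorem mem_openQuadrant_diff (hS : S ⊆ lightCone) {t x : ℝ} (ht : 0 < t) (hx : 0 < x)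
    (htx : t ≠ x) : (t, x) ∈ openQuadrant \ S :=
  ⟨⟨ht, hx⟩, fun h => htx (hS h).2⟩

theorem eq_of_hasDerivAt_zero_off_point {f : ℝ → ℂ} {a b c : ℝ} (hab : a ≤ b)
    (hf : ContinuousOn f (Set.Icc a b))
    (hf' : ∀ t ∈ Set.Ioo a b, t ≠ c → HasDerivAt f 0 t) : f b = f a := by
  by_cases hc : c ∈ Set.Ioo a b
  · have h1 : f c = f a := eq_of_hasDerivAt_zero_Ioo hc.1.le
      (hf.mono (Set.Icc_subset_Icc_right hc.2.le))
      fun t ht => hf' t ⟨ht.1, ht.2.trans hc.2⟩ ht.2.ne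
    have h2 : f b = f c := eq_of_hasDerivAt_zero_Ioo hc.2.le
      (hf.mono (Set.Icc_subset_Icc_left hc.1.le))
      fun t ht => hf' t ⟨hc.1.trans ht.1, ht.2⟩ ht.1.ne'
    exact h2.trans h1
  · exact eq_of_hasDerivAt_zero_Ioo hab hf fun t ht => hf' t ht fun h => hc (h ▸ ht)

theorem IsRegularSolution.continuousOn_rho_t (h : IsRegularSolution A₀ ω₀ n S Ef ρ N) {x : ℝ}
    (hx : 0 < x) (lam : ℝ) : ContinuousOn (fun t => ρ t x lam) (Set.Ici 0) :=
  h.rho_continuous.comp (f := fun t : ℝ => (t, x, lam)) (by fun_prop) fun _ ht => ⟨ht, hx⟩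

theorem IsRegularSolution.continuousOn_pop_t (h : IsRegularSolution A₀ ω₀ n S Ef ρ N) {x : ℝ}
    (hx : 0 < x) (lam : ℝ) : ContinuousOn (fun t => N t x lam) (Set.Ici 0) :=
  h.pop_continuous.comp (f := fun t : ℝ => (t, x, lam)) (by fun_prop) fun _ ht => ⟨ht, hx⟩

/-- The length of the Bloch vector is conserved. -/
theorem IsRegularSolution.norm_sq_add_sq (h : IsRegularSolution A₀ ω₀ n S Ef ρ N)
    (hS : S ⊆ lightCone) {t x : ℝ} (ht : 0 ≤ t) (hx : 0 < x) (lam : ℝ) :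
    ‖ρ t x lam‖ ^ 2 + N t x lam ^ 2 = 1 := by
  have key := eq_of_hasDerivAt_zero_off_point (c := x) ht
    (f := fun t => ρ t x lam * conj (ρ t x lam) + (N t x lam : ℂ) * (N t x lam : ℂ)) ?_ ?_
  · simp only [h.initial_rho x lam hx, h.initial_pop x lam hx, Complex.mul_conj] at key
    have h2 : ((Complex.normSq (ρ t x lam) + N t x lam * N t x lam : ℝ) : ℂ) = ((1 : ℝ) : ℂ) := by
      push_cast
      rw [key]
      simp
    rw [← Complex.normSq_eq_norm_sq, sq]
    exact_mod_cast h2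
  · have hsub : Set.Icc 0 t ⊆ Set.Ici 0 := Set.Icc_subset_Ici_self
    have h1 := (h.continuousOn_rho_t hx lam).mono hsub
    have h2 := (h.continuousOn_pop_t hx lam).mono hsub
    have h3 := Complex.continuous_ofReal.comp_continuousOn h2
    exact (h1.mul (Complex.continuous_conj.comp_continuousOn h1)).add (h3.mul h3)
  · intro s hs hsx
    have hm := mem_openQuadrant_diff hS hs.1 hx hsx
    have h1 := h.eq_rho s x lam hm
    have h2 := h.eq_pop s x lam hm
    convert! (h1.mul h1.star).add (h2.mul h2) using 1
    simp only [Complex.star_def, map_sub, map_mul, Complex.conj_I, Complex.conj_ofReal, map_ofNat]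
    ring

theorem IsRegularSolution.norm_rho_le (h : IsRegularSolution A₀ ω₀ n S Ef ρ N)
    (hS : S ⊆ lightCone) {t x : ℝ} (ht : 0 ≤ t) (hx : 0 < x) (lam : ℝ) : ‖ρ t x lam‖ ≤ 1 := by
  nlinarith [h.norm_sq_add_sq hS ht hx lam, sq_nonneg (N t x lam), norm_nonneg (ρ t x lam)]

theorem IsRegularSolution.abs_pop_le (h : IsRegularSolution A₀ ω₀ n S Ef ρ N)
    (hS : S ⊆ lightCone) {t x : ℝ} (ht : 0 ≤ t) (hx : 0 < x) (lam : ℝ) : |N t x lam| ≤ 1 := by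
  rw [← sq_le_one_iff_abs_le_one]
  nlinarith [h.norm_sq_add_sq hS ht hx lam, sq_nonneg ‖ρ t x lam‖]

/-- The polarization `∫ n(s) ρ(t,x,s) ds`. -/
noncomputable def polarization (n : ℝ → ℝ) (ρ : ℝ → ℝ → ℝ → ℂ) (t x : ℝ) : ℂ :=
  ∫ s : ℝ, (n s : ℂ) * ρ t x s

theorem IsRegularSolution.continuous_rho_lam (h : IsRegularSolution A₀ ω₀ n S Ef ρ N)
    {t x : ℝ} (ht : 0 ≤ t) (hx : 0 < x) : Continuous (ρ t x) :=
  continuousOn_univ.1 <|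
    h.rho_continuous.comp (f := fun s : ℝ => (t, x, s)) (by fun_prop) fun _ _ => ⟨ht, hx⟩

theorem IsRegularSolution.continuous_pop_lam (h : IsRegularSolution A₀ ω₀ n S Ef ρ N)
    {t x : ℝ} (ht : 0 ≤ t) (hx : 0 < x) : Continuous (N t x) :=
  continuousOn_univ.1 <|
    h.pop_continuous.comp (f := fun s : ℝ => (t, x, s)) (by fun_prop) fun _ _ => ⟨ht, hx⟩

theorem IsBroadening.integrable {Λ : EReal} (hn : IsBroadening Λ n) : Integrable n :=
  integrable_of_integral_eq_one hn.integral_eq_one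

theorem IsBroadening.norm_integral_mul_le {Λ : EReal} (hn : IsBroadening Λ n) {f : ℝ → ℂ} {c : ℝ}
    (hf : ∀ s, ‖f s‖ ≤ c) : ‖∫ s : ℝ, (n s : ℂ) * f s‖ ≤ c := by
  have h := norm_integral_le_of_norm_le (f := fun s : ℝ => (n s : ℂ) * f s)
    (hn.integrable.mul_const c) (Eventually.of_forall fun s => by
      rw [norm_mul, Complex.norm_real, Real.norm_of_nonneg (hn.nonneg s)]
      exact mul_le_mul_of_nonneg_left (hf s) (hn.nonneg s))
  rwa [integral_mul_const, hn.integral_eq_one, one_mul] at h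

theorem IsRegularSolution.norm_polarization_le {Λ : EReal}
    (h : IsRegularSolution A₀ ω₀ n S Ef ρ N) (hn : IsBroadening Λ n)
    (hS : S ⊆ lightCone) {t x : ℝ} (ht : 0 ≤ t) (hx : 0 < x) : ‖polarization n ρ t x‖ ≤ 1 :=
  hn.norm_integral_mul_le fun s => h.norm_rho_le hS ht hx s

theorem IsRegularSolution.continuousOn_polarization {Λ : EReal}
    (h : IsRegularSolution A₀ ω₀ n S Ef ρ N) (hn : IsBroadening Λ n) (hS : S ⊆ lightCone) :
    ContinuousOn (fun p : ℝ × ℝ => polarization n ρ p.1 p.2) {p | 0 ≤ p.1 ∧ 0 < p.2} := by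
  refine continuousOn_of_dominated (bound := n) ?_ ?_ hn.integrable ?_
  · rintro ⟨t, x⟩ ⟨ht, hx⟩
    exact (Complex.continuous_ofReal.comp_aestronglyMeasurable
      hn.integrable.aestronglyMeasurable).mul
      (h.continuous_rho_lam ht hx).aestronglyMeasurable
  · rintro ⟨t, x⟩ ⟨ht, hx⟩
    refine Eventually.of_forall fun s => ?_
    rw [norm_mul, Complex.norm_real, Real.norm_of_nonneg (hn.nonneg s)]
    exact mul_le_of_le_one_right (hn.nonneg s) (h.norm_rho_le hS ht hx s)
  · refine Eventually.of_forall fun s => continuousOn_const.mul ?_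
    exact h.rho_continuous.comp (f := fun p : ℝ × ℝ => (p.1, p.2, s)) (by fun_prop)
      fun p hp => hp

theorem IsRegularSolution.differentiableAt_field (h : IsRegularSolution A₀ ω₀ n S Ef ρ N)
    (hSc : IsClosed S) {t x : ℝ} (hm : (t, x) ∈ openQuadrant \ S) :
    DifferentiableAt ℝ (fun p : ℝ × ℝ => Ef p.1 p.2) (t, x) := by
  have ho : IsOpen (openQuadrant \ S) :=
    ((isOpen_lt continuous_const continuous_fst).inter
      (isOpen_lt continuous_const continuous_snd)).sdiff hSc
  exact (h.field_contDiff.differentiableOn one_ne_zero).differentiableAt (ho.mem_nhds hm)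

theorem IsRegularSolution.hasDerivAt_field_t (h : IsRegularSolution A₀ ω₀ n S Ef ρ N)
    (hSc : IsClosed S) {t x : ℝ} (hm : (t, x) ∈ openQuadrant \ S) :
    HasDerivAt (fun τ => Ef τ x) (deriv (fun τ => Ef τ x) t) t :=
  ((h.differentiableAt_field hSc hm).comp (f := fun τ : ℝ => (τ, x)) t
    (by fun_prop)).hasDerivAt

theorem IsRegularSolution.hasDerivAt_field_x (h : IsRegularSolution A₀ ω₀ n S Ef ρ N)
    (hSc : IsClosed S) {t x : ℝ} (hm : (t, x) ∈ openQuadrant \ S) :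
    HasDerivAt (fun y => Ef t y) (deriv (fun y => Ef t y) x) x :=
  ((h.differentiableAt_field hSc hm).comp (f := fun y : ℝ => (t, y)) x
    (by fun_prop)).hasDerivAt

/-- The field equation is an ordinary differential equation along the characteristics `t - x = c`.
-/
theorem IsRegularSolution.hasDerivAt_characteristic (h : IsRegularSolution A₀ ω₀ n S Ef ρ N)
    (hSc : IsClosed S) {c x : ℝ} (hm : (x + c, x) ∈ openQuadrant \ S) :
    HasDerivAt (fun y => Ef (y + c) y) (polarization n ρ (x + c) x) x := by
  have hd := (h.differentiableAt_field hSc hm).hasFDerivAt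
  have h1 := hd.comp_hasDerivAt (x + c)
    ((hasDerivAt_id (x + c)).prodMk (hasDerivAt_const (x + c) x))
  have h2 := hd.comp_hasDerivAt x ((hasDerivAt_const x (x + c)).prodMk (hasDerivAt_id x))
  have h3 := hd.comp_hasDerivAt (f := fun y : ℝ => (y + c, y)) x
    (((hasDerivAt_id x).add_const c).prodMk (hasDerivAt_id x))
  have h4 := h.eq_field (x + c) x hm
  have e1 : deriv (fun τ => Ef τ x) (x + c) = _ := h1.deriv
  have e2 : deriv (fun y => Ef (x + c) y) x = _ := h2.deriv
  rw [e1, e2, ← map_add] at h4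
  convert! h3 using 1
  rw [polarization, ← h4]
  simp

/-- Ahead of the light cone the density matrix stays at its initial value as long as the field
vanishes; with a bound on the field, the polarization is bounded by the time integral. -/
theorem IsRegularSolution.norm_rho_le_of_field (h : IsRegularSolution A₀ ω₀ n S Ef ρ N)
    (hS : S ⊆ lightCone) {t x K : ℝ} (ht : 0 ≤ t) (htx : t < x)
    (hE : ∀ s ∈ Set.Ioo 0 t, ‖Ef s x‖ ≤ K * Real.exp (2 * s)) (lam : ℝ) :
    ‖ρ t x lam‖ ≤ K / 2 * Real.exp (2 * t) - K / 2 := by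
  have hx : 0 < x := ht.trans_lt htx
  have key := norm_sub_le_of_hasDerivAt_Ioo ht
    (f := fun s => Complex.exp (2 * Complex.I * lam * s) * ρ s x lam)
    (f' := fun s => Complex.exp (2 * Complex.I * lam * s) * ((N s x lam : ℂ) * Ef s x))
    (B := fun s => K / 2 * Real.exp (2 * s)) (B' := fun s => K * Real.exp (2 * s))
    ?_ (by fun_prop) ?_ ?_ ?_
  · have hn : ∀ s : ℝ, ‖Complex.exp (2 * Complex.I * lam * s)‖ = 1 := fun s => by
      rw [Complex.norm_exp]; simp
    simpa [h.initial_rho x lam hx, hn] using key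
  · exact (by fun_prop :
      Continuous fun s : ℝ => Complex.exp (2 * Complex.I * lam * s)).continuousOn.mul
      ((h.continuousOn_rho_t hx lam).mono Set.Icc_subset_Ici_self)
  · intro s hs
    have h1 := h.eq_rho s x lam (mem_openQuadrant_diff hS hs.1 hx (hs.2.trans htx).ne)
    have h2 : HasDerivAt (fun s : ℝ => Complex.exp (2 * Complex.I * lam * s))
        (Complex.exp (2 * Complex.I * lam * s) * (2 * Complex.I * lam * 1)) s :=
      ((hasDerivAt_id s).ofReal_comp.const_mul (2 * Complex.I * (lam : ℂ))).cexp
    convert! h2.mul h1 using 1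
    ring
  · intro s _
    convert! (((hasDerivAt_id s).const_mul 2).exp).const_mul (K / 2) using 1
    simp; ring
  · intro s hs
    have hn : ‖Complex.exp (2 * Complex.I * lam * s)‖ = 1 := by
      rw [Complex.norm_exp]; simp
    rw [norm_mul, norm_mul, hn, one_mul, Complex.norm_real, Real.norm_eq_abs]
    exact (mul_le_of_le_one_left (norm_nonneg _) (h.abs_pop_le hS hs.1.le hx lam)).trans (hE s hs)

/-- The field vanishes ahead of the light cone: over a compact part of `t < x` the weighted
supremum of the field is at most a quarter of itself. -/
theorem IsRegularSolution.field_eq_zero {Λ : EReal} (h : IsRegularSolution A₀ ω₀ n S Ef ρ N)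
    (hn : IsBroadening Λ n) (hSc : IsClosed S) (hS : S ⊆ lightCone) {t x : ℝ} (ht : 0 ≤ t)
    (htx : t < x) : Ef t x = 0 := by
  set D : Set (ℝ × ℝ) := {p | 0 ≤ p.1 ∧ x - t ≤ p.2 - p.1 ∧ p.2 ≤ x} with hD
  have hDc : IsCompact D := by
    refine (isCompact_Icc (a := ((0 : ℝ), (0 : ℝ))) (b := (x, x))).of_isClosed_subset ?_ ?_
    · exact (isClosed_le continuous_const continuous_fst).inter
        ((isClosed_le continuous_const (continuous_snd.sub continuous_fst)).inter
          (isClosed_le continuous_snd continuous_const))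
    · rintro ⟨a, b⟩ ⟨h1, h2, h3⟩
      simp only at h1 h2 h3
      exact ⟨⟨h1, by simp only; linarith⟩, ⟨by simp only; linarith, h3⟩⟩
  have hDS : D ⊆ closedQuadrant \ S := by
    rintro ⟨a, b⟩ ⟨h1, h2, h3⟩
    simp only at h1 h2 h3
    refine ⟨⟨h1, by simp only; linarith⟩, fun hm => ?_⟩
    have : a = b := (hS hm).2
    linarith
  have hcont : ContinuousOn (fun p : ℝ × ℝ => ‖Ef p.1 p.2‖ * Real.exp (-(2 * p.1))) D :=
    ((h.field_continuous.mono hDS).norm).mul (by fun_prop)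
  have hmem : (t, x) ∈ D := ⟨ht, le_rfl, le_rfl⟩
  -- the maximum point of the weighted field; the weight `exp(-2 t)` makes the two time
  -- integrations below contribute the factor `1/4`
  obtain ⟨⟨t₀, x₀⟩, h₀, hmax⟩ := hDc.exists_isMaxOn ⟨_, hmem⟩ hcont
  set K := ‖Ef t₀ x₀‖ * Real.exp (-(2 * t₀)) with hK
  have hK0 : 0 ≤ K := by positivity
  have hb : ∀ s y, (s, y) ∈ D → ‖Ef s y‖ ≤ K * Real.exp (2 * s) := fun s y hsy => by
    have h1 : ‖Ef s y‖ * Real.exp (-(2 * s)) ≤ K := hmax hsy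
    rw [Real.exp_neg, ← div_eq_mul_inv, div_le_iff₀ (Real.exp_pos _)] at h1
    exact h1
  obtain ⟨h1, h2, h3⟩ := h₀
  simp only at h1 h2 h3
  set c := x₀ - t₀ with hc
  have hc0 : 0 < c := by linarith
  have hpol : ∀ s ∈ Set.Ioo 0 t₀, ‖polarization n ρ s (s + c)‖ ≤ K / 2 * Real.exp (2 * s) := by
    intro s hs
    refine hn.norm_integral_mul_le fun lam => ?_
    have := h.norm_rho_le_of_field hS hs.1.le (by linarith : s < s + c) (K := K)
      (fun s' hs' => hb s' (s + c) ⟨hs'.1.le, by simp only; linarith [hs'.2],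
        by simp only; linarith [hs.2]⟩) lam
    linarith
  have key := norm_sub_le_of_hasDerivAt_Ioo h1
    (f := fun s => Ef s (s + c)) (f' := fun s => polarization n ρ s (s + c))
    (B := fun s => K / 4 * Real.exp (2 * s)) (B' := fun s => K / 2 * Real.exp (2 * s))
    ?_ (by fun_prop) ?_ ?_ hpol
  · have e0 : Ef 0 (0 + c) = 0 := h.initial_field _ (by linarith)
    rw [e0, sub_zero, show t₀ + c = x₀ by simp [hc]] at key
    have h5 : K * Real.exp (2 * t₀) = ‖Ef t₀ x₀‖ := by
      rw [hK, mul_assoc, ← Real.exp_add]; simp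
    have h6 : Real.exp (2 * t₀) > 0 := Real.exp_pos _
    have h7 : K = 0 := by
      simp only [mul_zero, Real.exp_zero] at key
      nlinarith [mul_nonneg hK0 h6.le]
    have := hb t x hmem
    rw [h7, zero_mul] at this
    exact norm_le_zero_iff.1 this
  · refine h.field_continuous.comp (f := fun s : ℝ => (s, s + c)) (by fun_prop) fun s hs => ?_
    refine ⟨⟨hs.1, by simp only; linarith [hs.1]⟩, fun hm => ?_⟩
    have : s = s + c := (hS hm).2
    linarith
  · intro s hs
    have hm := mem_openQuadrant_diff hS hs.1 (by linarith [hs.1] : 0 < s + c)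
      (by linarith : s < s + c).ne
    have h5 := h.hasDerivAt_characteristic hSc (c := -c) (x := s + c) (by simpa using hm)
    simp only [add_neg_cancel_right] at h5
    have h6 := h5.comp_add_const s c
    simpa using! h6
  · intro s _
    convert! (((hasDerivAt_id s).const_mul 2).exp).const_mul (K / 4) using 1
    simp; ring

theorem IsRegularSolution.rho_eq_zero {Λ : EReal} (h : IsRegularSolution A₀ ω₀ n S Ef ρ N)
    (hn : IsBroadening Λ n) (hSc : IsClosed S) (hS : S ⊆ lightCone) {t x : ℝ} (ht : 0 ≤ t)
    (hx : 0 < x) (htx : t ≤ x) (lam : ℝ) : ρ t x lam = 0 := by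
  have key := eq_of_hasDerivAt_zero_Ioo ht
    (f := fun s : ℝ => Complex.exp (2 * Complex.I * lam * s) * ρ s x lam) ?_ ?_
  · simpa [h.initial_rho x lam hx, Complex.exp_ne_zero] using key
  · exact (by fun_prop :
      Continuous fun s : ℝ => Complex.exp (2 * Complex.I * lam * s)).continuousOn.mul
      ((h.continuousOn_rho_t hx lam).mono Set.Icc_subset_Ici_self)
  · intro s hs
    have hsx := hs.2.trans_le htx
    have h1 := h.eq_rho s x lam (mem_openQuadrant_diff hS hs.1 hx hsx.ne)
    rw [h.field_eq_zero hn hSc hS hs.1.le hsx] at h1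
    have h2 : HasDerivAt (fun s : ℝ => Complex.exp (2 * Complex.I * lam * s))
        (Complex.exp (2 * Complex.I * lam * s) * (2 * Complex.I * lam * 1)) s :=
      ((hasDerivAt_id s).ofReal_comp.const_mul (2 * Complex.I * (lam : ℂ))).cexp
    convert! h2.mul h1 using 1
    ring

theorem IsRegularSolution.pop_eq_neg_one {Λ : EReal} (h : IsRegularSolution A₀ ω₀ n S Ef ρ N)
    (hn : IsBroadening Λ n) (hSc : IsClosed S) (hS : S ⊆ lightCone) {t x : ℝ} (ht : 0 ≤ t)
    (hx : 0 < x) (htx : t ≤ x) (lam : ℝ) : N t x lam = -1 := by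
  have key := eq_of_hasDerivAt_zero_Ioo ht (f := fun s : ℝ => (N s x lam : ℂ)) ?_ ?_
  · simp only [h.initial_pop x lam hx] at key
    exact_mod_cast key
  · exact Complex.continuous_ofReal.comp_continuousOn
      ((h.continuousOn_pop_t hx lam).mono Set.Icc_subset_Ici_self)
  · intro s hs
    have hsx := hs.2.trans_le htx
    have h1 := h.eq_pop s x lam (mem_openQuadrant_diff hS hs.1 hx hsx.ne)
    simpa [h.field_eq_zero hn hSc hS hs.1.le hsx] using h1

/-- The integrand of the retarded field: the polarization along the characteristic `t = τ + y`. -/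
noncomputable def retardedPol (n : ℝ → ℝ) (ρ : ℝ → ℝ → ℝ → ℂ) (τ y : ℝ) : ℂ :=
  Set.indicator (Set.Ioi 0) (fun y => polarization n ρ (y + max τ 0) y) y

/-- The field in the retarded coordinates `τ = t - x`, `x`, written as the integral of the
polarization along the characteristic from `x = 0`. It is extended to all real `τ` and `x`, so as
to be continuous on the plane. -/
noncomputable def retardedField (A₀ ω₀ : ℝ) (n : ℝ → ℝ) (ρ : ℝ → ℝ → ℝ → ℂ) (τ x : ℝ) : ℂ :=
  (A₀ : ℂ) * Complex.exp (Complex.I * (ω₀ : ℂ) * ((max τ 0 : ℝ) : ℂ)) +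
    ∫ y in (0 : ℝ)..x, retardedPol n ρ τ y

theorem IsRegularSolution.norm_retardedPol_le {Λ : EReal}
    (h : IsRegularSolution A₀ ω₀ n S Ef ρ N) (hn : IsBroadening Λ n) (hS : S ⊆ lightCone)
    (τ y : ℝ) : ‖retardedPol n ρ τ y‖ ≤ 1 := by
  unfold retardedPol
  by_cases hy : y ∈ Set.Ioi (0 : ℝ)
  · rw [Set.indicator_of_mem hy]
    have hy' : 0 < y := hy
    exact h.norm_polarization_le hn hS (by positivity) hy
  · simp [Set.indicator_of_notMem hy]

theorem IsRegularSolution.continuousAt_retardedPol {Λ : EReal}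
    (h : IsRegularSolution A₀ ω₀ n S Ef ρ N) (hn : IsBroadening Λ n) (hS : S ⊆ lightCone)
    (τ : ℝ) {y : ℝ} (hy : 0 < y) :
    ContinuousAt (fun p : ℝ × ℝ => retardedPol n ρ p.1 p.2) (τ, y) := by
  have ho : {p : ℝ × ℝ | 0 < p.2} ∈ 𝓝 (τ, y) :=
    (isOpen_lt continuous_const continuous_snd).mem_nhds hy
  have h1 : ContinuousOn (fun p : ℝ × ℝ => polarization n ρ (p.2 + max p.1 0) p.2)
      {p : ℝ × ℝ | 0 < p.2} :=
    (h.continuousOn_polarization hn hS).comp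
      (f := fun p : ℝ × ℝ => (p.2 + max p.1 0, p.2)) (by fun_prop)
      fun p (hp : 0 < p.2) => ⟨by positivity, hp⟩
  refine (h1.continuousAt ho).congr ?_
  filter_upwards [ho] with p hp
  exact (Set.indicator_of_mem (s := Set.Ioi (0 : ℝ)) hp _).symm

theorem IsRegularSolution.aestronglyMeasurable_retardedPol {Λ : EReal}
    (h : IsRegularSolution A₀ ω₀ n S Ef ρ N) (hn : IsBroadening Λ n) (hS : S ⊆ lightCone)
    (τ : ℝ) : AEStronglyMeasurable (retardedPol n ρ τ) volume := by
  have h1 : ContinuousOn (fun y => polarization n ρ (y + max τ 0) y) (Set.Ioi 0) :=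
    (h.continuousOn_polarization hn hS).comp
      (f := fun y : ℝ => (y + max τ 0, y)) (by fun_prop)
      fun y (hy : 0 < y) => ⟨by positivity, hy⟩
  exact (aestronglyMeasurable_indicator_iff measurableSet_Ioi).2
    (h1.aestronglyMeasurable measurableSet_Ioi)

theorem IsRegularSolution.intervalIntegrable_retardedPol {Λ : EReal}
    (h : IsRegularSolution A₀ ω₀ n S Ef ρ N) (hn : IsBroadening Λ n) (hS : S ⊆ lightCone)
    (τ a b : ℝ) : IntervalIntegrable (retardedPol n ρ τ) volume a b :=
  (intervalIntegrable_const (c := (1 : ℝ))).mono_fun'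
    (h.aestronglyMeasurable_retardedPol hn hS τ).restrict
    (Eventually.of_forall fun y => h.norm_retardedPol_le hn hS τ y)

/-- The retarded field is continuous across `τ = 0`, although the field itself jumps on the light
cone: the polarization is bounded and continuous, and the boundary value is taken at `max τ 0`. -/
theorem IsRegularSolution.continuous_retardedField {Λ : EReal}
    (h : IsRegularSolution A₀ ω₀ n S Ef ρ N) (hn : IsBroadening Λ n) (hS : S ⊆ lightCone) :
    Continuous fun p : ℝ × ℝ => retardedField A₀ ω₀ n ρ p.1 p.2 := by
  unfold retardedField
  refine Continuous.add (by fun_prop) ?_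
  rw [continuous_iff_continuousAt]
  rintro ⟨τ, x⟩
  have hx := abs_nonneg x
  refine intervalIntegral.continuousAt_parametric_primitive_of_dominated (fun _ => (1 : ℝ))
    (-|x| - 1) (|x| + 1)
    (fun τ => (h.aestronglyMeasurable_retardedPol hn hS τ).restrict)
    (Eventually.of_forall fun τ => Eventually.of_forall fun y => h.norm_retardedPol_le hn hS τ y)
    intervalIntegrable_const (Eventually.of_forall fun y => ?_) ⟨by linarith, by linarith⟩
    ⟨by linarith [neg_abs_le x], by linarith [le_abs_self x]⟩ (by simp)
  by_cases hy : 0 < y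
  · exact ContinuousAt.comp (f := fun τ : ℝ => (τ, y)) (h.continuousAt_retardedPol hn hS τ hy)
      (by fun_prop)
  · have : (fun τ => retardedPol n ρ τ y) = fun _ => 0 := by
      funext τ; exact Set.indicator_of_notMem hy _
    rw [this]
    exact continuousAt_const

theorem retardedField_zero_right (τ : ℝ) : retardedField A₀ ω₀ n ρ τ 0 =
    (A₀ : ℂ) * Complex.exp (Complex.I * (ω₀ : ℂ) * ((max τ 0 : ℝ) : ℂ)) := by
  simp [retardedField]

theorem IsRegularSolution.hasDerivAt_retardedField_x {Λ : EReal}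
    (h : IsRegularSolution A₀ ω₀ n S Ef ρ N) (hn : IsBroadening Λ n) (hS : S ⊆ lightCone)
    (τ : ℝ) {x : ℝ} (hx : 0 < x) :
    HasDerivAt (fun y => retardedField A₀ ω₀ n ρ τ y) (retardedPol n ρ τ x) x :=
  (intervalIntegral.integral_hasDerivAt_right (h.intervalIntegrable_retardedPol hn hS τ 0 x)
    (h.aestronglyMeasurable_retardedPol hn hS τ).stronglyMeasurableAtFilter
    (ContinuousAt.comp (f := fun y : ℝ => (τ, y)) (h.continuousAt_retardedPol hn hS τ hx)
      (by fun_prop))).const_add _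

theorem IsRegularSolution.norm_retardedField_sub_le {Λ : EReal}
    (h : IsRegularSolution A₀ ω₀ n S Ef ρ N) (hn : IsBroadening Λ n) (hS : S ⊆ lightCone)
    (τ x x' : ℝ) :
    ‖retardedField A₀ ω₀ n ρ τ x' - retardedField A₀ ω₀ n ρ τ x‖ ≤ |x' - x| := by
  rw [retardedField, retardedField, add_sub_add_left_eq_sub,
    intervalIntegral.integral_interval_sub_left (h.intervalIntegrable_retardedPol hn hS τ _ _)
      (h.intervalIntegrable_retardedPol hn hS τ _ _)]
  simpa using intervalIntegral.norm_integral_le_of_norm_le_const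
    fun y _ => h.norm_retardedPol_le hn hS τ y

/-- Behind the light cone the retarded field is the field: both have the polarization as derivative
along the characteristic, and they agree for `x = 0`. -/
theorem IsRegularSolution.retardedField_eq {Λ : EReal}
    (h : IsRegularSolution A₀ ω₀ n S Ef ρ N) (hn : IsBroadening Λ n) (hSc : IsClosed S)
    (hS : S ⊆ lightCone) {τ x : ℝ} (hτ : 0 < τ) (hx : 0 ≤ x) :
    retardedField A₀ ω₀ n ρ τ x = Ef (x + τ) x := by
  have key := eq_of_hasDerivAt_zero_Ioo hx
    (f := fun y => retardedField A₀ ω₀ n ρ τ y - Ef (y + τ) y) ?_ ?_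
  · simp only [retardedField_zero_right, zero_add, h.boundary_field τ hτ, max_eq_left hτ.le,
      sub_self] at key
    exact sub_eq_zero.1 key
  · refine ContinuousOn.sub ?_ ?_
    · exact ((h.continuous_retardedField hn hS).comp
        (by fun_prop : Continuous fun y : ℝ => (τ, y))).continuousOn
    · refine h.field_continuous.comp (f := fun y : ℝ => (y + τ, y)) (by fun_prop) fun y hy => ?_
      refine ⟨⟨by simp only; linarith [hy.1], hy.1⟩, fun hm => ?_⟩
      have : y + τ = y := (hS hm).2
      linarith
  · intro y hy
    have hm := mem_openQuadrant_diff hS (by linarith [hy.1] : 0 < y + τ) hy.1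
      (by linarith : y < y + τ).ne'
    have h1 := h.hasDerivAt_retardedField_x hn hS τ hy.1
    have h2 := h.hasDerivAt_characteristic hSc hm
    have h3 : retardedPol n ρ τ y = polarization n ρ (y + τ) y := by
      unfold retardedPol
      rw [Set.indicator_of_mem (show y ∈ Set.Ioi (0 : ℝ) from hy.1), max_eq_left hτ.le]
    convert! h1.sub h2 using 1
    rw [h3, sub_self]

theorem IsRegularSolution.field_eq {Λ : EReal}
    (h : IsRegularSolution A₀ ω₀ n S Ef ρ N) (hn : IsBroadening Λ n) (hSc : IsClosed S)
    (hS : S ⊆ lightCone) {t x : ℝ} (hx : 0 ≤ x) (hxt : x < t) :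
    Ef t x = retardedField A₀ ω₀ n ρ (t - x) x := by
  rw [h.retardedField_eq hn hSc hS (sub_pos.2 hxt) hx, add_sub_cancel]

/-- The field jumps by `A₀` everywhere on the light cone, so that `S` is the whole light cone. -/
theorem IsRegularSolution.lightCone_subset {Λ : EReal} (hA₀ : 0 < A₀)
    (h : IsRegularSolution A₀ ω₀ n S Ef ρ N) (hn : IsBroadening Λ n) (hSc : IsClosed S)
    (hS : S ⊆ lightCone) (hS0 : ((0, 0) : ℝ × ℝ) ∈ S) : lightCone ⊆ S := by
  rintro ⟨t, x⟩ ⟨ht, htx⟩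
  simp only at ht htx
  subst htx
  rcases ht.eq_or_lt with rfl | ht
  · exact hS0
  by_contra hm
  have hc : ContinuousWithinAt (fun p : ℝ × ℝ => Ef p.1 p.2) (closedQuadrant \ S) (t, t) :=
    h.field_continuous (t, t) ⟨⟨ht.le, ht.le⟩, hm⟩
  have h1 : Tendsto (fun s : ℝ => Ef s t) (𝓝[<] t) (𝓝 (Ef t t)) := by
    refine Tendsto.comp (f := fun s : ℝ => (s, t)) hc (tendsto_nhdsWithin_iff.2 ⟨?_, ?_⟩)
    · exact ((by fun_prop : Continuous fun s : ℝ => (s, t)).tendsto t).mono_left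
        nhdsWithin_le_nhds
    · filter_upwards [Ioo_mem_nhdsLT ht] with s hs
      exact ⟨⟨hs.1.le, ht.le⟩, fun hm => hs.2.ne (hS hm).2⟩
  have h2 : Tendsto (fun s : ℝ => Ef s t) (𝓝[>] t) (𝓝 (Ef t t)) := by
    refine Tendsto.comp (f := fun s : ℝ => (s, t)) hc (tendsto_nhdsWithin_iff.2 ⟨?_, ?_⟩)
    · exact ((by fun_prop : Continuous fun s : ℝ => (s, t)).tendsto t).mono_left
        nhdsWithin_le_nhds
    · filter_upwards [self_mem_nhdsWithin] with s hs
      exact ⟨⟨ht.le.trans (le_of_lt hs), ht.le⟩, fun hm => (ne_of_gt hs) (hS hm).2⟩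
  -- if the field were continuous at `(t, t)`, its limits from `t < x` and `t > x` would agree
  have e1 : Ef t t = 0 := by
    refine tendsto_nhds_unique h1 (tendsto_const_nhds.congr' ?_)
    filter_upwards [Ioo_mem_nhdsLT ht] with s hs
    exact (h.field_eq_zero hn hSc hS hs.1.le hs.2).symm
  have e2 : Ef t t = retardedField A₀ ω₀ n ρ 0 t := by
    refine tendsto_nhds_unique h2 ?_
    have h3 : Tendsto (fun s : ℝ => retardedField A₀ ω₀ n ρ (s - t) t) (𝓝 t)
        (𝓝 (retardedField A₀ ω₀ n ρ (t - t) t)) :=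
      ((h.continuous_retardedField hn hS).comp
        (by fun_prop : Continuous fun s : ℝ => (s - t, t))).tendsto t
    rw [sub_self] at h3
    refine (h3.mono_left nhdsWithin_le_nhds).congr' ?_
    filter_upwards [self_mem_nhdsWithin] with s hs
    exact (h.field_eq hn hSc hS ht.le hs).symm
  -- on the light cone the polarization vanishes, so that the boundary value is transported
  -- unchanged
  have e3 : retardedField A₀ ω₀ n ρ 0 t = A₀ := by
    unfold retardedField
    have : ∀ y ∈ Set.uIcc 0 t, retardedPol n ρ 0 y = 0 := by
      intro y _
      unfold retardedPol
      by_cases hy : y ∈ Set.Ioi (0 : ℝ)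
      · have hy' : 0 < y := hy
        rw [Set.indicator_of_mem hy]
        simp [polarization, h.rho_eq_zero hn hSc hS hy'.le hy' le_rfl]
      · exact Set.indicator_of_notMem hy _
    rw [intervalIntegral.integral_congr this]
    simp
  rw [e1, e3] at e2
  exact hA₀.ne' (by exact_mod_cast e2.symm)

theorem IsRegularSolution.exists_bound_deriv_retardedField_t {Λ : EReal}
    (h : IsRegularSolution A₀ ω₀ n S Ef ρ N) (hn : IsBroadening Λ n) (hSc : IsClosed S)
    (hS : S ⊆ lightCone) (R : ℝ) :
    ∃ C : ℝ, ∀ τ x : ℝ, 0 < τ → τ ≤ R → 0 ≤ x → x ≤ R →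
      ∃ d : ℂ, ‖d‖ ≤ C ∧ HasDerivAt (fun s => retardedField A₀ ω₀ n ρ s x) d τ := by
  obtain ⟨C, hC⟩ := h.field_bounded (R + R)
  refine ⟨max C (|A₀| * |ω₀|), fun τ x hτ hτR hx hxR => ?_⟩
  rcases hx.eq_or_lt with rfl | hx
  · refine ⟨A₀ * (Complex.exp (Complex.I * ω₀ * τ) * (Complex.I * ω₀ * 1)), ?_, ?_⟩
    · have : ‖Complex.exp (Complex.I * ω₀ * τ)‖ = 1 := by rw [Complex.norm_exp]; simp
      rw [norm_mul, norm_mul, this]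
      simp
    · have h1 : HasDerivAt (fun s : ℝ => (A₀ : ℂ) * Complex.exp (Complex.I * ω₀ * s))
          (A₀ * (Complex.exp (Complex.I * ω₀ * τ) * (Complex.I * ω₀ * 1))) τ :=
        (((hasDerivAt_id τ).ofReal_comp.const_mul (Complex.I * (ω₀ : ℂ))).cexp).const_mul _
      refine h1.congr_of_eventuallyEq ?_
      filter_upwards [lt_mem_nhds hτ] with s hs
      rw [retardedField_zero_right, max_eq_left hs.le]
  · have hm := mem_openQuadrant_diff hS (by linarith : 0 < x + τ) hx (by linarith : x < x + τ).ne'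
    refine ⟨deriv (fun s => Ef s x) (x + τ), ?_, ?_⟩
    · exact ((hC (x + τ) x (by linarith) (by linarith) hx (by linarith) hm.2).2.1).trans
        (le_max_left _ _)
    · have h1 := (h.hasDerivAt_field_t hSc hm).comp_const_add x τ
      refine h1.congr_of_eventuallyEq ?_
      filter_upwards [lt_mem_nhds hτ] with s hs
      exact h.retardedField_eq hn hSc hS hs hx.le

theorem IsRegularSolution.exists_bound_deriv_retardedField_x {Λ : EReal}
    (h : IsRegularSolution A₀ ω₀ n S Ef ρ N) (hn : IsBroadening Λ n) (hSc : IsClosed S)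
    (hS : S ⊆ lightCone) (t : ℝ) :
    ∃ C : ℝ, ∀ x : ℝ, 0 < x → x < t →
      ∃ d : ℂ, ‖d‖ ≤ C ∧ HasDerivAt (fun y => retardedField A₀ ω₀ n ρ (t - y) y) d x := by
  obtain ⟨C, hC⟩ := h.field_bounded t
  refine ⟨C, fun x hx hxt => ?_⟩
  have hm := mem_openQuadrant_diff hS (hx.trans hxt) hx hxt.ne'
  refine ⟨deriv (fun y => Ef t y) x, (hC t x (hx.trans hxt) le_rfl hx hxt.le hm.2).2.2, ?_⟩
  refine (h.hasDerivAt_field_x hSc hm).congr_of_eventuallyEq ?_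
  filter_upwards [Ioo_mem_nhds hx hxt] with y hy
  exact (h.field_eq hn hSc hS hy.1.le hy.2).symm

end MaxwellBloch

/-! ### The propagator of the `t`-equation in retarded coordinates -/

/-- A function of two real variables with continuous partial derivatives is `C¹`. -/
theorem contDiffOn_one_of_partials {E : Type*} [NormedAddCommGroup E] [NormedSpace ℝ E]
    {f : ℝ → ℝ → E} {f₁ f₂ : ℝ → ℝ → E} {U : Set (ℝ × ℝ)}
    (hU : IsOpen U) (h₁ : ∀ p ∈ U, HasDerivAt (fun t => f t p.2) (f₁ p.1 p.2) p.1)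
    (h₂ : ∀ p ∈ U, HasDerivAt (fun x => f p.1 x) (f₂ p.1 p.2) p.2)
    (c₁ : ContinuousOn (fun p : ℝ × ℝ => f₁ p.1 p.2) U)
    (c₂ : ContinuousOn (fun p : ℝ × ℝ => f₂ p.1 p.2) U) :
    ContDiffOn ℝ 1 (fun p : ℝ × ℝ => f p.1 p.2) U ∧
      ∀ p ∈ U, HasFDerivAt (fun p : ℝ × ℝ => f p.1 p.2)
        ((ContinuousLinearMap.toSpanSingleton ℝ (f₁ p.1 p.2)).coprod
          (ContinuousLinearMap.toSpanSingleton ℝ (f₂ p.1 p.2))) p := by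
  have hsp : Continuous fun v : E => ContinuousLinearMap.toSpanSingleton ℝ v :=
    (ContinuousLinearMap.toSpanSingletonCLE (𝕜 := ℝ) (E := E)).continuous
  have hF : ∀ p ∈ U, HasFDerivAt (fun p : ℝ × ℝ => f p.1 p.2)
        ((ContinuousLinearMap.toSpanSingleton ℝ (f₁ p.1 p.2)).coprod
          (ContinuousLinearMap.toSpanSingleton ℝ (f₂ p.1 p.2))) p := by
    intro p hp
    have := hasStrictFDerivAt_uncurry_coprod (𝕜 := ℝ) (u := p) (f := f)
      (f₁ := fun t x => ContinuousLinearMap.toSpanSingleton ℝ (f₁ t x))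
      (f₂ := fun t x => ContinuousLinearMap.toSpanSingleton ℝ (f₂ t x))
      (by filter_upwards [hU.mem_nhds hp] with v hv using (h₁ v hv).hasFDerivAt)
      (by filter_upwards [hU.mem_nhds hp] with v hv using (h₂ v hv).hasFDerivAt)
      (hsp.continuousAt.comp (c₁.continuousAt (hU.mem_nhds hp)))
      (hsp.continuousAt.comp (c₂.continuousAt (hU.mem_nhds hp)))
    exact this.hasFDerivAt
  refine ⟨?_, hF⟩
  have h1 : (1 : WithTop ℕ∞) = 0 + 1 := (zero_add 1).symm
  rw [h1, contDiffOn_succ_iff_fderiv_of_isOpen hU]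
  refine ⟨fun p hp => (hF p hp).differentiableAt.differentiableWithinAt, by simp, ?_⟩
  rw [contDiffOn_zero]
  refine ContinuousOn.congr (f := fun p : ℝ × ℝ =>
    (ContinuousLinearMap.toSpanSingleton ℝ (f₁ p.1 p.2)).coprod
      (ContinuousLinearMap.toSpanSingleton ℝ (f₂ p.1 p.2))) ?_ fun p hp => (hF p hp).fderiv
  have hco : Continuous fun q : (ℝ →L[ℝ] E) × (ℝ →L[ℝ] E) => q.1.coprod q.2 :=
    (ContinuousLinearMap.coprodEquivL ℝ (𝕜 := ℝ) (E := ℝ) (F := ℝ) (G := E)).continuous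
  exact hco.comp_continuousOn ((hsp.comp_continuousOn c₁).prodMk (hsp.comp_continuousOn c₂))

/-- The coefficient `-i z σ₃ - H` of the `t`-equation, for the field value `e`. -/
noncomputable def laxMat (e z : ℂ) : Mat2 :=
  !![-(Complex.I * z), -(e / 2); conj e / 2, Complex.I * z]

/-- The off-diagonal part `-H` of the coefficient of the `t`-equation. -/
noncomputable def laxOff (e : ℂ) : Mat2 := !![0, -(e / 2); conj e / 2, 0]

theorem laxMat_sub (e e' z : ℂ) : laxMat e' z - laxMat e z = laxOff (e' - e) := by
  ext i j
  fin_cases i <;> fin_cases j <;> simp [laxMat, laxOff] <;> ring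

theorem laxMat_sub' (e z z' : ℂ) :
    laxMat e z' - laxMat e z = (z' - z) • (-(Complex.I • sigma3) : Mat2) := by
  ext i j
  fin_cases i <;> fin_cases j <;> simp [laxMat, sigma3] <;> ring

theorem laxOff_smul (c : ℝ) (e : ℂ) : laxOff (c • e) = c • laxOff e := by
  ext i j
  fin_cases i <;> fin_cases j <;> simp [laxOff] <;> ring

theorem norm_laxOff_le (e : ℂ) : ‖laxOff e‖ ≤ ‖e‖ := by
  refine Mat2.norm_le_of_entries fun i j => ?_
  fin_cases i <;> fin_cases j <;> simp [laxOff]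

theorem continuous_laxOff : Continuous laxOff := by
  refine continuous_pi fun i => continuous_pi fun j => ?_
  fin_cases i <;> fin_cases j <;> simp [laxOff] <;> fun_prop

theorem continuous_laxMat : Continuous fun q : ℂ × ℂ => laxMat q.1 q.2 := by
  refine continuous_pi fun i => continuous_pi fun j => ?_
  fin_cases i <;> fin_cases j <;> simp [laxMat] <;> fun_prop

/-- The solution `X` of `X_τ = U X`, `X = 1` for `τ = 0`, with `U` formed with the field `e(τ,x)`
and the spectral parameter `z`. -/
noncomputable def laxProp (e : ℝ → ℝ → ℂ) (τ x : ℝ) (z : ℂ) : Mat2 :=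
  propagator (fun s (p : ℝ × ℂ) => laxMat (e s p.1) p.2) τ (x, z)

section LaxProp

variable {e : ℝ → ℝ → ℂ}

theorem continuous_laxCoeff (he : Continuous fun p : ℝ × ℝ => e p.1 p.2) :
    Continuous fun q : ℝ × (ℝ × ℂ) => laxMat (e q.1 q.2.1) q.2.2 :=
  continuous_laxMat.comp (f := fun q : ℝ × (ℝ × ℂ) => (e q.1 q.2.1, q.2.2))
    ((he.comp (by fun_prop : Continuous fun q : ℝ × (ℝ × ℂ) => (q.1, q.2.1))).prodMk
      (by fun_prop))

theorem laxMat_trace (e z : ℂ) : laxMat e z 0 0 + laxMat e z 1 1 = 0 := by simp [laxMat]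

theorem continuous_laxProp (he : Continuous fun p : ℝ × ℝ => e p.1 p.2) :
    Continuous fun q : ℝ × ℝ × ℂ => laxProp e q.1 q.2.1 q.2.2 :=
  continuous_propagator (continuous_laxCoeff he)

theorem continuous_laxProp_fst (he : Continuous fun p : ℝ × ℝ => e p.1 p.2) (x : ℝ) (z : ℂ) :
    Continuous fun s => laxProp e s x z :=
  (continuous_laxProp he).comp (by fun_prop : Continuous fun s : ℝ => (s, x, z))

theorem hasDerivAt_laxProp (he : Continuous fun p : ℝ × ℝ => e p.1 p.2) (τ x : ℝ) (z : ℂ) :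
    HasDerivAt (fun s => laxProp e s x z) (laxMat (e τ x) z * laxProp e τ x z) τ :=
  hasDerivAt_propagator (continuous_laxCoeff he) τ (x, z)

theorem laxProp_zero (he : Continuous fun p : ℝ × ℝ => e p.1 p.2) (x : ℝ) (z : ℂ) :
    laxProp e 0 x z = 1 :=
  propagator_zero (continuous_laxCoeff he) (x, z)

theorem hasDerivAt_adjugate_laxProp (he : Continuous fun p : ℝ × ℝ => e p.1 p.2) (τ x : ℝ)
    (z : ℂ) : HasDerivAt (fun s => (laxProp e s x z).adjugate)
      (-((laxProp e τ x z).adjugate * laxMat (e τ x) z)) τ :=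
  hasDerivAt_adjugate_propagator (continuous_laxCoeff he) (fun _ _ => laxMat_trace _ _) τ (x, z)

theorem adjugate_mul_laxProp (he : Continuous fun p : ℝ × ℝ => e p.1 p.2) (τ x : ℝ) (z : ℂ) :
    (laxProp e τ x z).adjugate * laxProp e τ x z = 1 :=
  adjugate_mul_propagator (continuous_laxCoeff he) (fun _ _ => laxMat_trace _ _) τ (x, z)

theorem laxProp_mul_adjugate (he : Continuous fun p : ℝ × ℝ => e p.1 p.2) (τ x : ℝ) (z : ℂ) :
    laxProp e τ x z * (laxProp e τ x z).adjugate = 1 :=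
  propagator_mul_adjugate (continuous_laxCoeff he) (fun _ _ => laxMat_trace _ _) τ (x, z)

theorem det_laxProp (he : Continuous fun p : ℝ × ℝ => e p.1 p.2) (τ x : ℝ) (z : ℂ) :
    (laxProp e τ x z).det = 1 :=
  det_propagator (continuous_laxCoeff he) (fun _ _ => laxMat_trace _ _) τ (x, z)

/-- The propagator is an entire function of the spectral parameter. -/
theorem differentiable_laxProp (he : Continuous fun p : ℝ × ℝ => e p.1 p.2) (τ x : ℝ) :
    Differentiable ℂ fun z => laxProp e τ x z := by
  intro z
  refine (hasDerivAt_of_sub_eq_smul (g := fun z' => laxProp e τ x z *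
    ∫ s in (0 : ℝ)..τ, (laxProp e s x z).adjugate * (-(Complex.I • sigma3) : Mat2) *
      laxProp e s x z') (Eventually.of_forall fun z' => ?_) ?_).differentiableAt
  · have h := propagator_sub_propagator
      (A := fun s (p : ℝ × ℂ) => laxMat (e s p.1) p.2) (continuous_laxCoeff he)
      (fun _ _ => laxMat_trace _ _) τ (x, z) (x, z')
    rw [laxProp, laxProp, h, ← Matrix.mul_smul, ← intervalIntegral.integral_smul]
    simp only [laxMat_sub', Matrix.mul_smul, Matrix.smul_mul, laxProp]
  · refine Continuous.continuousAt (continuous_const.matrix_mul ?_)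
    refine intervalIntegral.continuous_parametric_intervalIntegral_of_continuous'
      (f := fun z' s => (laxProp e s x z).adjugate * (-(Complex.I • sigma3) : Mat2) *
      laxProp e s x z') ?_ 0 τ
    have h1 : Continuous fun q : ℂ × ℝ => laxProp e q.2 x z :=
      (continuous_laxProp_fst he x z).comp continuous_snd
    have h2 : Continuous fun q : ℂ × ℝ => laxProp e q.2 x q.1 :=
      (continuous_laxProp he).comp (by fun_prop : Continuous fun q : ℂ × ℝ => (q.2, x, q.1))
    exact (h1.matrix_adjugate.matrix_mul continuous_const).matrix_mul h2

/-- The derivative of the propagator in `x` at a fixed retarded time, if the field has the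
`x`-derivative `r`. -/
noncomputable def laxPropDerivX (e r : ℝ → ℝ → ℂ) (τ x : ℝ) (z : ℂ) : Mat2 :=
  laxProp e τ x z * ∫ s in (0 : ℝ)..τ,
    (laxProp e s x z).adjugate * laxOff (r s x) * laxProp e s x z

theorem hasDerivAt_laxProp_x (he : Continuous fun p : ℝ × ℝ => e p.1 p.2) {r : ℝ → ℝ → ℂ}
    (hlip : ∀ τ x x', ‖e τ x' - e τ x‖ ≤ |x' - x|) {x : ℝ}
    (hr : ∀ τ, HasDerivAt (fun y => e τ y) (r τ x) x) (τ : ℝ) (z : ℂ) :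
    HasDerivAt (fun y => laxProp e τ y z) (laxPropDerivX e r τ x z) x := by
  have hX2 : Continuous fun q : ℝ × ℝ => laxProp e q.1 q.2 z :=
    (continuous_laxProp he).comp (by fun_prop : Continuous fun q : ℝ × ℝ => (q.1, q.2, z))
  have hcX : ∀ y, Continuous fun s => laxProp e s y z := fun y => continuous_laxProp_fst he y z
  have hce : ∀ y, Continuous fun s => e s y := fun y =>
    he.comp (by fun_prop : Continuous fun s : ℝ => (s, y))
  obtain ⟨C, hC⟩ := ((isCompact_uIcc (a := (0 : ℝ)) (b := τ)).prod
    (isCompact_Icc (a := x - 1) (b := x + 1))).exists_bound_of_continuousOn hX2.continuousOn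
  obtain ⟨C', hC'⟩ := (isCompact_uIcc (a := (0 : ℝ)) (b := τ)).exists_bound_of_continuousOn
    (hcX x).matrix_adjugate.continuousOn
  refine hasDerivAt_iff_tendsto_slope.2 ?_
  have hlim : Tendsto (fun y => ∫ s in (0 : ℝ)..τ,
      (laxProp e s x z).adjugate * laxOff (slope (e s) x y) * laxProp e s y z) (𝓝[≠] x)
      (𝓝 (∫ s in (0 : ℝ)..τ,
        (laxProp e s x z).adjugate * laxOff (r s x) * laxProp e s x z)) := by
    refine intervalIntegral.tendsto_integral_filter_of_dominated_convergence
      (fun _ => 2 * (2 * C' * 1) * C) ?_ ?_ intervalIntegrable_const ?_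
    · refine Eventually.of_forall fun y => Continuous.aestronglyMeasurable ?_
      have : Continuous fun s => slope (e s) x y := by
        simp only [slope_def_module]
        exact continuous_const.smul ((hce y).sub (hce x))
      exact ((hcX x).matrix_adjugate.matrix_mul (continuous_laxOff.comp this)).matrix_mul (hcX y)
    · filter_upwards [nhdsWithin_le_nhds (Icc_mem_nhds (by linarith : x - 1 < x)
        (by linarith : x < x + 1)), self_mem_nhdsWithin] with y hy hyx
      refine Eventually.of_forall fun s hs => ?_
      have hs' := Set.uIoc_subset_uIcc hs
      have h1 : ‖laxOff (slope (e s) x y)‖ ≤ 1 := by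
        refine (norm_laxOff_le _).trans ?_
        rw [slope_def_module, norm_smul, norm_inv, Real.norm_eq_abs, inv_mul_le_iff₀
          (abs_pos.2 (sub_ne_zero.2 hyx)), mul_one]
        exact hlip s x y
      have h2 := hC (s, y) ⟨hs', hy⟩
      have h3 := hC' s hs'
      have hC0 : 0 ≤ C' := (norm_nonneg _).trans h3
      calc _ ≤ 2 * ‖(laxProp e s x z).adjugate * laxOff (slope (e s) x y)‖ *
              ‖laxProp e s y z‖ := Mat2.norm_mul_le _ _
        _ ≤ 2 * (2 * ‖(laxProp e s x z).adjugate‖ * ‖laxOff (slope (e s) x y)‖) *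
              ‖laxProp e s y z‖ := by gcongr; exact Mat2.norm_mul_le _ _
        _ ≤ _ := by gcongr
    · refine Eventually.of_forall fun s _ => ?_
      have h1 : Tendsto (slope (e s) x) (𝓝[≠] x) (𝓝 (r s x)) :=
        hasDerivAt_iff_tendsto_slope.1 (hr s)
      have h2 : Tendsto (fun y => laxProp e s y z) (𝓝[≠] x) (𝓝 (laxProp e s x z)) :=
        ((hX2.comp (by fun_prop : Continuous fun y : ℝ => (s, y))).tendsto x).mono_left
          nhdsWithin_le_nhds
      have h3 : Tendsto (fun y => laxOff (slope (e s) x y)) (𝓝[≠] x) (𝓝 (laxOff (r s x))) :=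
        (continuous_laxOff.tendsto _).comp h1
      exact (h3.const_mul _).mul h2
  have hslope : slope (fun y => laxProp e τ y z) x = fun y => laxProp e τ x z *
      ∫ s in (0 : ℝ)..τ,
        (laxProp e s x z).adjugate * laxOff (slope (e s) x y) * laxProp e s y z := by
    funext y
    have h := propagator_sub_propagator
      (A := fun s (p : ℝ × ℂ) => laxMat (e s p.1) p.2) (continuous_laxCoeff he)
      (fun _ _ => laxMat_trace _ _) τ (x, z) (y, z)
    rw [slope_def_module, laxProp, laxProp, h, ← Matrix.mul_smul,
      ← intervalIntegral.integral_smul]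
    simp only [laxMat_sub, slope_def_module, laxOff_smul, Matrix.mul_smul, Matrix.smul_mul, laxProp]
  rw [hslope]
  exact hlim.const_mul _

theorem continuousAt_laxPropDerivX (he : Continuous fun p : ℝ × ℝ => e p.1 p.2)
    {r : ℝ → ℝ → ℂ}
    (hr : ∀ τ x, 0 < x → ContinuousAt (fun p : ℝ × ℝ => r p.1 p.2) (τ, x)) (z : ℂ) (τ : ℝ) {x : ℝ}
    (hx : 0 < x) : ContinuousAt (fun p : ℝ × ℝ => laxPropDerivX e r p.1 p.2 z) (τ, x) := by
  have hr' : Continuous fun p : ℝ × ℝ => r p.1 (max p.2 (x / 2)) := by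
    rw [continuous_iff_continuousAt]
    intro p
    exact ContinuousAt.comp (f := fun p : ℝ × ℝ => (p.1, max p.2 (x / 2)))
      (hr _ _ (lt_max_of_lt_right (by linarith))) (by fun_prop)
  have hX2 : Continuous fun q : ℝ × ℝ => laxProp e q.1 q.2 z :=
    (continuous_laxProp he).comp (by fun_prop : Continuous fun q : ℝ × ℝ => (q.1, q.2, z))
  have hc : Continuous fun p : ℝ × ℝ => laxProp e p.1 p.2 z * ∫ s in (0 : ℝ)..p.1,
      (laxProp e s p.2 z).adjugate * laxOff (r s (max p.2 (x / 2))) * laxProp e s p.2 z := by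
    refine hX2.matrix_mul ?_
    refine intervalIntegral.continuous_parametric_intervalIntegral_of_continuous
      (f := fun (p : ℝ × ℝ) s =>
      (laxProp e s p.2 z).adjugate * laxOff (r s (max p.2 (x / 2))) * laxProp e s p.2 z) ?_
      continuous_fst
    have h1 : Continuous fun q : (ℝ × ℝ) × ℝ => laxProp e q.2 q.1.2 z :=
      hX2.comp (by fun_prop : Continuous fun q : (ℝ × ℝ) × ℝ => (q.2, q.1.2))
    have h2 : Continuous fun q : (ℝ × ℝ) × ℝ => r q.2 (max q.1.2 (x / 2)) :=
      hr'.comp (by fun_prop : Continuous fun q : (ℝ × ℝ) × ℝ => (q.2, q.1.2))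
    exact (h1.matrix_adjugate.matrix_mul (continuous_laxOff.comp h2)).matrix_mul h1
  refine hc.continuousAt.congr ?_
  have ho : {p : ℝ × ℝ | x / 2 < p.2} ∈ 𝓝 (τ, x) :=
    (isOpen_lt continuous_const continuous_snd).mem_nhds
      (by simp only [Set.mem_ofPred_eq]; linarith)
  filter_upwards [ho] with p hp
  have hp' : x / 2 < p.2 := hp
  simp only [laxPropDerivX, max_eq_left hp'.le]

theorem contDiffOn_laxProp (he : Continuous fun p : ℝ × ℝ => e p.1 p.2) {r : ℝ → ℝ → ℂ}
    (hlip : ∀ τ x x', ‖e τ x' - e τ x‖ ≤ |x' - x|)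
    (hr : ∀ τ x, 0 < x → HasDerivAt (fun y => e τ y) (r τ x) x)
    (hrc : ∀ τ x, 0 < x → ContinuousAt (fun p : ℝ × ℝ => r p.1 p.2) (τ, x)) (z : ℂ) :
    ContDiffOn ℝ 1 (fun p : ℝ × ℝ => laxProp e p.1 p.2 z) {p | 0 < p.2} ∧
      ∀ p ∈ {p : ℝ × ℝ | 0 < p.2}, HasFDerivAt (fun p : ℝ × ℝ => laxProp e p.1 p.2 z)
        ((ContinuousLinearMap.toSpanSingleton ℝ (laxMat (e p.1 p.2) z * laxProp e p.1 p.2 z)).coprod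
          (ContinuousLinearMap.toSpanSingleton ℝ (laxPropDerivX e r p.1 p.2 z))) p := by
  have hX2 : Continuous fun q : ℝ × ℝ => laxProp e q.1 q.2 z :=
    (continuous_laxProp he).comp (by fun_prop : Continuous fun q : ℝ × ℝ => (q.1, q.2, z))
  refine contDiffOn_one_of_partials (f := fun τ x => laxProp e τ x z)
    (f₁ := fun τ x => laxMat (e τ x) z * laxProp e τ x z)
    (f₂ := fun τ x => laxPropDerivX e r τ x z) (isOpen_lt continuous_const continuous_snd)
    (fun p _ => hasDerivAt_laxProp he p.1 p.2 z)
    (fun p hp => hasDerivAt_laxProp_x he hlip (fun τ => hr τ p.2 hp) p.1 z) ?_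
    fun p hp => (continuousAt_laxPropDerivX he hrc z p.1 hp).continuousWithinAt
  exact ((continuous_laxMat.comp (he.prodMk continuous_const)).matrix_mul hX2).continuousOn

end LaxProp

/-! ### The density matrix in terms of the propagator -/

/-- The commutator `-i [σ₃, F]` for a density matrix with off-diagonal entry `w`. -/
noncomputable def blochComm (w : ℂ) : Mat2 :=
  !![0, -(2 * Complex.I * w); 2 * Complex.I * conj w, 0]

theorem continuous_blochComm : Continuous blochComm := by
  refine continuous_pi fun i => continuous_pi fun j => ?_
  fin_cases i <;> fin_cases j <;> simp [blochComm] <;> fun_prop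

theorem norm_blochComm_le (w : ℂ) : ‖blochComm w‖ ≤ 2 * ‖w‖ := by
  refine Mat2.norm_le_of_entries fun i j => ?_
  fin_cases i <;> fin_cases j <;> simp [blochComm]

theorem laxOff_eq_smul_blochComm (w : ℂ) : laxOff w = -(Complex.I / 4) • blochComm w := by
  ext i j
  fin_cases i <;> fin_cases j
  · simp [laxOff, blochComm]
  · simp [laxOff, blochComm]
    linear_combination (-w / 2) * Complex.I_sq
  · simp [laxOff, blochComm]
    linear_combination (conj w / 2) * Complex.I_sq
  · simp [laxOff, blochComm]

noncomputable instance : ContinuousENorm Mat2 :=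
  inferInstanceAs (ContinuousENorm (Fin 2 → Fin 2 → ℂ))

/-- The density matrix `-X σ₃ X⁻¹` carried by a unimodular matrix `X`. -/
noncomputable def blochMat (X : Mat2) : Mat2 := -(X * sigma3 * X.adjugate)

/-- Interchange of the integrals over the frequency and over the retarded time. -/
theorem integral_weight_intervalIntegral {n : ℝ → ℝ} (hn : Integrable n)
    {b : ℝ → ℝ → ℂ} (hb : Continuous fun p : ℝ × ℝ => b p.1 p.2) (hb1 : ∀ σ s, ‖b σ s‖ ≤ 1)
    {M : ℝ → Mat2} (hM : Continuous M) {τ : ℝ} (hτ : 0 ≤ τ) :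
    Integrable (fun s => n s • ∫ σ in (0 : ℝ)..τ, (M σ).adjugate * blochComm (b σ s) * M σ) ∧
    ∫ s, n s • (∫ σ in (0 : ℝ)..τ, (M σ).adjugate * blochComm (b σ s) * M σ) =
      ∫ σ in (0 : ℝ)..τ, (M σ).adjugate * blochComm (∫ s, (n s : ℂ) * b σ s) * M σ := by
  let L : ℝ → ℂ →L[ℝ] Mat2 := fun σ => LinearMap.toContinuousLinearMap
    { toFun := fun w => (M σ).adjugate * blochComm w * M σ
      map_add' := fun w w' => by
        have : blochComm (w + w') = blochComm w + blochComm w' := by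
          ext i j; fin_cases i <;> fin_cases j <;> simp [blochComm] <;> ring
        rw [this, mul_add, add_mul]
      map_smul' := fun c w => by
        have : blochComm (c • w) = c • blochComm w := by
          ext i j; fin_cases i <;> fin_cases j <;> simp [blochComm] <;> ring
        rw [this, Matrix.mul_smul, Matrix.smul_mul, RingHom.id_apply] }
  obtain ⟨C, hC⟩ := (isCompact_Icc (a := (0 : ℝ)) (b := τ)).exists_bound_of_continuousOn
    hM.continuousOn
  obtain ⟨C', hC'⟩ := (isCompact_Icc (a := (0 : ℝ)) (b := τ)).exists_bound_of_continuousOn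
    hM.matrix_adjugate.continuousOn
  have hcont : Continuous fun p : ℝ × ℝ => (M p.2).adjugate * blochComm (b p.2 p.1) * M p.2 :=
    ((hM.matrix_adjugate.comp continuous_snd).matrix_mul
      (continuous_blochComm.comp (hb.comp continuous_swap))).matrix_mul (hM.comp continuous_snd)
  have hint : Integrable (Function.uncurry fun s σ =>
      n s • ((M σ).adjugate * blochComm (b σ s) * M σ))
      ((volume : Measure ℝ).prod (volume.restrict (Set.Ioc 0 τ))) := by
    refine Integrable.mono' ((hn.norm.mul_const (2 * (2 * C' * (2 * 1)) * C)).comp_fst _) ?_ ?_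
    · exact hn.aestronglyMeasurable.comp_fst.smul hcont.aestronglyMeasurable
    · have : (volume : Measure ℝ).prod (volume.restrict (Set.Ioc 0 τ)) =
          (((volume : Measure ℝ).prod volume).restrict (Set.univ ×ˢ Set.Ioc 0 τ)) := by
        rw [← Measure.prod_restrict, Measure.restrict_univ]
      rw [this]
      refine (ae_restrict_iff' (MeasurableSet.univ.prod measurableSet_Ioc)).2
        (Eventually.of_forall ?_)
      rintro ⟨s, σ⟩ ⟨-, hσ⟩
      have hσ' : σ ∈ Set.Icc 0 τ := Set.Ioc_subset_Icc_self hσ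
      have h1 := hC σ hσ'
      have h2 := hC' σ hσ'
      have h0 : 0 ≤ C' := (norm_nonneg _).trans h2
      have h3 : ‖blochComm (b σ s)‖ ≤ 2 * 1 :=
        (norm_blochComm_le _).trans (by linarith [hb1 σ s])
      simp only [Function.uncurry, norm_smul]
      refine mul_le_mul_of_nonneg_left ?_ (norm_nonneg _)
      calc _ ≤ 2 * ‖(M σ).adjugate * blochComm (b σ s)‖ * ‖M σ‖ := Mat2.norm_mul_le _ _
        _ ≤ 2 * (2 * ‖(M σ).adjugate‖ * ‖blochComm (b σ s)‖) * ‖M σ‖ := by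
            gcongr; exact Mat2.norm_mul_le _ _
        _ ≤ _ := by gcongr
  have hinner : ∀ s, ∫ σ in Set.Ioc 0 τ, n s • ((M σ).adjugate * blochComm (b σ s) * M σ) =
      n s • ∫ σ in (0 : ℝ)..τ, (M σ).adjugate * blochComm (b σ s) * M σ := fun s => by
    rw [intervalIntegral.integral_of_le hτ, integral_smul]
  constructor
  · exact hint.integral_prod_left.congr (Eventually.of_forall hinner)
  · rw [← integral_congr_ae (Eventually.of_forall hinner), integral_integral_swap hint,
      intervalIntegral.integral_of_le hτ]
    refine integral_congr_ae (Eventually.of_forall fun σ => ?_)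
    have hi : Integrable fun s => n s • b σ s := by
      refine Integrable.mono' hn.norm (hn.aestronglyMeasurable.smul
        (hb.comp (by fun_prop : Continuous fun s : ℝ => (σ, s))).aestronglyMeasurable)
        (Eventually.of_forall fun s => ?_)
      rw [norm_smul]
      exact mul_le_of_le_one_right (norm_nonneg _) (hb1 σ s)
    refine (integral_congr_ae
      (Eventually.of_forall fun s => ((L σ).map_smul (n s) (b σ s)).symm)).trans ?_
    refine ((L σ).integral_comp_comm hi).trans ?_
    simp only [Complex.real_smul]
    rfl

section Bloch

variable {A₀ ω₀ : ℝ} {n : ℝ → ℝ} {S : Set (ℝ × ℝ)} {Ef : ℝ → ℝ → ℂ} {ρ : ℝ → ℝ → ℝ → ℂ}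
  {N : ℝ → ℝ → ℝ → ℝ} {Λ : EReal}

theorem IsRegularSolution.matF_eq_neg_sigma3 (h : IsRegularSolution A₀ ω₀ n S Ef ρ N)
    (hn : IsBroadening Λ n) (hSc : IsClosed S) (hS : S ⊆ lightCone) {t x : ℝ} (ht : 0 ≤ t)
    (hx : 0 < x) (htx : t ≤ x) (s : ℝ) : matF ρ N t x s = -sigma3 := by
  ext i j
  fin_cases i <;> fin_cases j <;>
    simp [matF, sigma3, h.rho_eq_zero hn hSc hS ht hx htx, h.pop_eq_neg_one hn hSc hS ht hx htx]

/-- The last two Maxwell-Bloch equations in the form `F_t = [U, F]`. -/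
theorem IsRegularSolution.hasDerivAt_matF (h : IsRegularSolution A₀ ω₀ n S Ef ρ N)
    (hn : IsBroadening Λ n) (hSc : IsClosed S) (hS : S ⊆ lightCone) {τ x : ℝ} (hτ : 0 < τ)
    (hx : 0 < x) (s : ℝ) :
    HasDerivAt (fun σ => matF ρ N (x + σ) x s)
      (laxMat (retardedField A₀ ω₀ n ρ τ x) s * matF ρ N (x + τ) x s -
        matF ρ N (x + τ) x s * laxMat (retardedField A₀ ω₀ n ρ τ x) s) τ := by
  have hm := mem_openQuadrant_diff hS (by linarith : 0 < x + τ) hx (by linarith : x < x + τ).ne'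
  have h1 := (h.eq_rho (x + τ) x s hm).comp_const_add x τ
  have h2 := (h.eq_pop (x + τ) x s hm).comp_const_add x τ
  rw [h.retardedField_eq hn hSc hS hτ hx.le, hasDerivAt_mat2_iff]
  intro i j
  fin_cases i <;> fin_cases j
  · convert! h2 using 1
    simp [matF, laxMat]
    ring
  · convert! h1 using 1
    simp [matF, laxMat]
    ring
  · convert! h1.star using 1
    simp [matF, laxMat]
    ring
  · convert! h2.neg using 1
    simp [matF, laxMat]
    ring

theorem IsRegularSolution.continuous_rho_retarded (h : IsRegularSolution A₀ ω₀ n S Ef ρ N)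
    {x : ℝ} (hx : 0 < x) : Continuous fun p : ℝ × ℝ => ρ (x + max p.1 0) x p.2 :=
  continuousOn_univ.1 <|
    h.rho_continuous.comp (f := fun p : ℝ × ℝ => (x + max p.1 0, x, p.2)) (by fun_prop)
      fun p _ => ⟨by positivity, hx⟩

/-- The difference quotient in the frequency of the density matrix, conjugated by the propagator. -/
noncomputable def blochQuot (A₀ ω₀ : ℝ) (n : ℝ → ℝ) (ρ : ℝ → ℝ → ℝ → ℂ) (τ x : ℝ) (z : ℂ)
    (s : ℝ) : Mat2 :=
  ∫ σ in (0 : ℝ)..τ, (laxProp (retardedField A₀ ω₀ n ρ) σ x z).adjugate *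
    blochComm (ρ (x + max σ 0) x s) * laxProp (retardedField A₀ ω₀ n ρ) σ x z

/-- The derivative of `X⁻¹ F(s) X` in the retarded time, with `X` taken at `z`, is `X⁻¹ [U(s) -
U(z), F(s)] X`, and `U(s) - U(z) = -i (s - z) σ₃`; integration from `τ = 0`, where `F = -σ₃`. -/
theorem IsRegularSolution.adjugate_mul_matF_mul (h : IsRegularSolution A₀ ω₀ n S Ef ρ N)
    (hn : IsBroadening Λ n) (hSc : IsClosed S) (hS : S ⊆ lightCone) {τ x : ℝ} (hτ : 0 ≤ τ)
    (hx : 0 < x) (z : ℂ) (s : ℝ) :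
    (laxProp (retardedField A₀ ω₀ n ρ) τ x z).adjugate * matF ρ N (x + τ) x s *
        laxProp (retardedField A₀ ω₀ n ρ) τ x z =
      -sigma3 + ((s : ℂ) - z) • blochQuot A₀ ω₀ n ρ τ x z s := by
  have he := h.continuous_retardedField hn hS
  set e := retardedField A₀ ω₀ n ρ with hedef
  have hX := continuous_laxProp_fst he x z
  have hFc : ContinuousOn (fun σ => matF ρ N (x + σ) x s) (Set.Icc 0 τ) := by
    have hsub : Set.MapsTo (fun σ : ℝ => x + σ) (Set.Icc 0 τ) (Set.Ici 0) :=
      fun σ hσ => by simp only [Set.mem_Ici]; linarith [hσ.1]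
    have h1 : ContinuousOn (fun σ => ρ (x + σ) x s) (Set.Icc 0 τ) :=
      (h.continuousOn_rho_t hx s).comp (f := fun σ : ℝ => x + σ) (by fun_prop) hsub
    have h2 : ContinuousOn (fun σ => (N (x + σ) x s : ℂ)) (Set.Icc 0 τ) :=
      Complex.continuous_ofReal.comp_continuousOn
        ((h.continuousOn_pop_t hx s).comp (f := fun σ : ℝ => x + σ) (by fun_prop) hsub)
    refine continuousOn_pi.2 fun i => continuousOn_pi.2 fun j => ?_
    fin_cases i <;> fin_cases j
    · exact h2
    · exact h1
    · exact Complex.continuous_conj.comp_continuousOn h1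
    · exact h2.neg
  have hic : Continuous fun σ => (laxProp e σ x z).adjugate *
      blochComm (ρ (x + max σ 0) x s) * laxProp e σ x z :=
    (hX.matrix_adjugate.matrix_mul (continuous_blochComm.comp
      ((h.continuous_rho_retarded hx).comp (by fun_prop : Continuous fun σ : ℝ => (σ, s))))
      ).matrix_mul hX
  -- the adjugate of the propagator is its inverse
  have key := intervalIntegral.integral_eq_sub_of_hasDerivAt_of_le hτ
    (f := fun σ => (laxProp e σ x z).adjugate * matF ρ N (x + σ) x s * laxProp e σ x z)
    (f' := fun σ => ((s : ℂ) - z) • ((laxProp e σ x z).adjugate *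
      blochComm (ρ (x + max σ 0) x s) * laxProp e σ x z)) ?_ ?_ ?_
  · rw [intervalIntegral.integral_smul] at key
    rw [blochQuot, ← hedef, key, laxProp_zero he, add_zero,
      h.matF_eq_neg_sigma3 hn hSc hS hx.le hx le_rfl]
    simp
  · have hc1 : ContinuousOn (fun σ => (laxProp e σ x z).adjugate * matF ρ N (x + σ) x s)
        (Set.Icc 0 τ) := hX.matrix_adjugate.continuousOn.mul hFc
    exact hc1.mul hX.continuousOn
  · intro σ hσ
    have h1 := ((hasDerivAt_adjugate_laxProp he σ x z).mat2_mul
      (h.hasDerivAt_matF hn hSc hS hσ.1 hx s)).mat2_mul (hasDerivAt_laxProp he σ x z)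
    convert! h1 using 1
    have h2 : ((s : ℂ) - z) • blochComm (ρ (x + max σ 0) x s) =
        (laxMat (e σ x) s - laxMat (e σ x) z) * matF ρ N (x + σ) x s -
          matF ρ N (x + σ) x s * (laxMat (e σ x) s - laxMat (e σ x) z) := by
      rw [laxMat_sub', max_eq_left hσ.1.le]
      ext i j
      fin_cases i <;> fin_cases j <;>
        simp [matF, sigma3, blochComm] <;> ring
    rw [← Matrix.smul_mul, ← Matrix.mul_smul, h2, ← hedef]
    noncomm_ring
  · exact (hic.const_smul ((s : ℂ) - z)).intervalIntegrable _ _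

/-- The density matrix at the frequency `s`, expanded about a complex value `z` of the spectral
parameter. -/
theorem IsRegularSolution.matF_eq_add_smul (h : IsRegularSolution A₀ ω₀ n S Ef ρ N)
    (hn : IsBroadening Λ n) (hSc : IsClosed S) (hS : S ⊆ lightCone) {τ x : ℝ} (hτ : 0 ≤ τ)
    (hx : 0 < x) (z : ℂ) (s : ℝ) :
    matF ρ N (x + τ) x s = blochMat (laxProp (retardedField A₀ ω₀ n ρ) τ x z) +
      ((s : ℂ) - z) • (laxProp (retardedField A₀ ω₀ n ρ) τ x z * blochQuot A₀ ω₀ n ρ τ x z s *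
        (laxProp (retardedField A₀ ω₀ n ρ) τ x z).adjugate) := by
  have he := h.continuous_retardedField hn hS
  have h1 := h.adjugate_mul_matF_mul hn hSc hS hτ hx z s
  have h2 := laxProp_mul_adjugate he τ x z
  set X := laxProp (retardedField A₀ ω₀ n ρ) τ x z
  calc matF ρ N (x + τ) x s = (X * X.adjugate) * matF ρ N (x + τ) x s * (X * X.adjugate) := by
        rw [h2]; simp
    _ = X * (X.adjugate * matF ρ N (x + τ) x s * X) * X.adjugate := by noncomm_ring
    _ = _ := by
      rw [h1, blochMat, mul_add, add_mul, Matrix.mul_smul, Matrix.smul_mul]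
      simp

/-- At a real frequency the density matrix is carried by the propagator: `F = -X σ₃ X⁻¹`. -/
theorem IsRegularSolution.matF_eq_blochMat (h : IsRegularSolution A₀ ω₀ n S Ef ρ N)
    (hn : IsBroadening Λ n) (hSc : IsClosed S) (hS : S ⊆ lightCone) {t x : ℝ} (ht : 0 ≤ t)
    (hx : 0 < x) (s : ℝ) :
    matF ρ N t x s = blochMat (laxProp (retardedField A₀ ω₀ n ρ) (max (t - x) 0) x s) := by
  rcases le_total t x with htx | htx
  · rw [max_eq_right (by linarith), laxProp_zero (h.continuous_retardedField hn hS),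
      h.matF_eq_neg_sigma3 hn hSc hS ht hx htx]
    simp [blochMat]
  · have := h.matF_eq_add_smul hn hSc hS (sub_nonneg.2 htx) hx s s
    rw [max_eq_left (by linarith)]
    simpa using this

/-- The integral of the difference quotients of the density matrix gives the `x`-derivative of the
propagator: this is the compatibility of the `t`- and the `x`-equation. -/
theorem IsRegularSolution.integral_blochQuot (h : IsRegularSolution A₀ ω₀ n S Ef ρ N)
    (hn : IsBroadening Λ n) (hS : S ⊆ lightCone) {τ x : ℝ} (hτ : 0 ≤ τ)
    (hx : 0 < x) (z : ℂ) :
    Integrable (fun s => n s • blochQuot A₀ ω₀ n ρ τ x z s) ∧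
    -(Complex.I / 4) • (laxProp (retardedField A₀ ω₀ n ρ) τ x z *
        ∫ s, n s • blochQuot A₀ ω₀ n ρ τ x z s) =
      laxPropDerivX (retardedField A₀ ω₀ n ρ) (retardedPol n ρ) τ x z := by
  have he := h.continuous_retardedField hn hS
  have key := integral_weight_intervalIntegral (b := fun σ s => ρ (x + max σ 0) x s)
    hn.integrable (h.continuous_rho_retarded hx)
    (fun σ s => h.norm_rho_le hS (by positivity) hx s)
    (continuous_laxProp_fst he x z) hτ
  refine ⟨key.1, ?_⟩
  have h1 : ∀ σ, ∫ s, (n s : ℂ) * ρ (x + max σ 0) x s = retardedPol n ρ σ x := fun σ => by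
    rw [retardedPol, Set.indicator_of_mem (show x ∈ Set.Ioi (0 : ℝ) from hx)]
    rfl
  simp only [h1] at key
  simp only [blochQuot, laxPropDerivX]
  rw [key.2, ← Matrix.mul_smul, ← intervalIntegral.integral_smul]
  simp only [laxOff_eq_smul_blochComm, Matrix.mul_smul, Matrix.smul_mul]

end Bloch

/-! ### The broadening weight -/

section Broadening

variable {Λ : EReal} {n : ℝ → ℝ}

theorem sgnR_mul_self (σ : ℤˣ) : sgnR σ * sgnR σ = 1 := by
  rcases Int.units_eq_one_or σ with rfl | rfl <;> simp [sgnR]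

theorem sgnR_one : sgnR 1 = 1 := by simp [sgnR]

theorem sgnR_neg_one : sgnR (-1) = -1 := by simp [sgnR]

theorem sgnR_eq (σ : ℤˣ) : sgnR σ = 1 ∨ sgnR σ = -1 := by
  rcases Int.units_eq_one_or σ with rfl | rfl <;> simp [sgnR]

theorem sgnR_ne_zero (σ : ℤˣ) : sgnR σ ≠ 0 := by
  rcases sgnR_eq σ with h | h <;> rw [h] <;> norm_num

theorem HolderCondition.exists_abs_le {s : Set ℝ} (h : HolderCondition n s) :
    ∃ C μ : ℝ, 0 ≤ C ∧ 0 < μ ∧ ∀ a ∈ s, ∀ b ∈ s, |n a - n b| ≤ C * |a - b| ^ μ := by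
  obtain ⟨C, μ, hμ, -, hC⟩ := h
  exact ⟨C, μ, C.2, hμ, fun a ha b hb => hC.dist_le ha hb⟩

/-- A weight that is Hölder continuous on `[-l, l]`, vanishes at `±l` and outside, is Hölder
continuous on the line. -/
theorem exists_abs_le_of_vanish {l : ℝ} (hl : 0 < l) (h0 : ∀ s, l < |s| → n s = 0)
    (hm : n (-l) = 0) (hp : n l = 0) (h : HolderCondition n (Set.Icc (-l) l)) :
    ∃ C μ : ℝ, 0 ≤ C ∧ 0 < μ ∧ ∀ a b : ℝ, |n a - n b| ≤ C * |a - b| ^ μ := by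
  obtain ⟨C, μ, hC, hμ, hh⟩ := h.exists_abs_le
  -- the weight does not change when its argument is projected to `[-l, l]`
  have hle : -l ≤ l := by linarith
  have hproj : ∀ s, n (Set.projIcc (-l) l hle s) = n s := by
    intro s
    rcases lt_or_ge s (-l) with hs | hs
    · rw [Set.projIcc_of_le_left _ hs.le, h0 s (by rw [abs_of_neg (by linarith)]; linarith)]
      exact hm
    rcases lt_or_ge l s with hs' | hs'
    · rw [Set.projIcc_of_right_le _ hs'.le, h0 s (by rw [abs_of_pos (by linarith)]; linarith)]
      exact hp
    · rw [Set.projIcc_of_mem _ ⟨hs, hs'⟩]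
  refine ⟨C, μ, hC, hμ, fun a b => ?_⟩
  rw [← hproj a, ← hproj b]
  refine (hh _ (Subtype.mem _) _ (Subtype.mem _)).trans ?_
  have h1 := (LipschitzWith.projIcc hle).dist_le_mul a b
  simp only [NNReal.coe_one, one_mul, Subtype.dist_eq, Real.dist_eq] at h1
  gcongr

/-- At its points of continuity the weight satisfies a Hölder condition locally. -/
theorem IsBroadening.exists_local_holder (hn : IsBroadening Λ n) {lam : ℝ}
    (hc : ContinuousAt n lam) :
    ∃ δ C μ : ℝ, 0 < δ ∧ 0 ≤ C ∧ 0 < μ ∧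
      ∀ a b : ℝ, |a - lam| < δ → |b - lam| < δ → |n a - n b| ≤ C * |a - b| ^ μ := by
  rcases hn.cases with ⟨-, hH, -, -⟩ | ⟨l, hl, -, h0, hm, hp, hH | ⟨c, hcst⟩⟩
  · obtain ⟨C, μ, hC, hμ, hh⟩ := hH.exists_abs_le
    exact ⟨1, C, μ, one_pos, hC, hμ, fun a b _ _ => hh a trivial b trivial⟩
  · obtain ⟨C, μ, hC, hμ, hh⟩ := exists_abs_le_of_vanish hl h0 hm hp hH
    exact ⟨1, C, μ, one_pos, hC, hμ, fun a b _ _ => hh a b⟩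
  · have hconst : ∀ δ : ℝ, 0 < δ → ∀ c' : ℝ, (∀ a, |a - lam| < δ → n a = c') →
        ∃ δ C μ : ℝ, 0 < δ ∧ 0 ≤ C ∧ 0 < μ ∧
          ∀ a b : ℝ, |a - lam| < δ → |b - lam| < δ → |n a - n b| ≤ C * |a - b| ^ μ :=
      fun δ hδ c' hc' => ⟨δ, 0, 1, hδ, le_rfl, one_pos, fun a b ha hb => by
        simp [hc' a ha, hc' b hb]⟩
    rcases lt_trichotomy |lam| l with h | h | h
    · refine hconst (l - |lam|) (by linarith) c fun a ha => hcst a ?_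
      linarith [abs_sub_abs_le_abs_sub a lam]
    · -- continuity at `±l` forces the constant to vanish
      have hn0 : n lam = 0 := by
        rcases abs_eq hl.le |>.1 h with rfl | rfl
        · exact hp
        · exact hm
      have hfreq : ∃ᶠ s in 𝓝 lam, n s = c := by
        have hcl : lam ∈ closure (Set.Ioo (-l) l) := by
          rw [closure_Ioo (by linarith)]
          exact abs_le.1 h.le
        exact (mem_closure_iff_frequently.1 hcl).mono fun s hs => hcst s (abs_lt.2 hs)
      have hc0 : c = 0 := by
        by_contra hne
        have h1 : ∀ᶠ s in 𝓝 lam, n s ≠ c :=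
          hc.eventually_ne (by rw [hn0]; exact fun h => hne h.symm)
        exact (hfreq.and_eventually h1).exists.elim fun s hs => hs.2 hs.1
      refine hconst 1 one_pos 0 fun a _ => ?_
      rcases lt_trichotomy |a| l with ha | ha | ha
      · rw [hcst a ha, hc0]
      · rcases abs_eq hl.le |>.1 ha with rfl | rfl
        · exact hp
        · exact hm
      · exact h0 a ha
    · refine hconst (|lam| - l) (by linarith) 0 fun a ha => h0 a ?_
      have := abs_sub_abs_le_abs_sub lam a
      rw [abs_sub_comm] at this
      linarith

theorem IsBroadening.exists_bound (hn : IsBroadening Λ n) : ∃ M : ℝ, 0 ≤ M ∧ ∀ s, n s ≤ M := by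
  rcases hn.cases with ⟨-, hH, -, htend⟩ | ⟨l, hl, -, h0, hm, hp, hH | ⟨c, hcst⟩⟩
  · obtain ⟨C, μ, hμ, -, hC⟩ := hH
    have hcont : Continuous n := continuousOn_univ.1 (hC.continuousOn hμ)
    have h1 : ∀ᶠ s in cocompact ℝ, n s < 1 := htend.eventually (gt_mem_nhds one_pos)
    obtain ⟨K, hK, hKs⟩ := mem_cocompact.1 h1
    obtain ⟨M, hM⟩ := hK.exists_bound_of_continuousOn hcont.continuousOn
    refine ⟨max M 1, zero_le_one.trans (le_max_right _ _), fun s => ?_⟩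
    by_cases hs : s ∈ K
    · exact ((le_abs_self _).trans (hM s hs)).trans (le_max_left _ _)
    · exact (le_of_lt (hKs hs)).trans (le_max_right _ _)
  · obtain ⟨C, μ, hμ, -, hC⟩ := hH
    obtain ⟨M, hM⟩ := isCompact_Icc.exists_bound_of_continuousOn (hC.continuousOn hμ)
    refine ⟨max M 0, le_max_right _ _, fun s => ?_⟩
    by_cases hs : |s| ≤ l
    · exact ((le_abs_self _).trans (hM s (abs_le.1 hs))).trans (le_max_left _ _)
    · rw [h0 s (not_le.1 hs)]; exact le_max_right _ _
  · refine ⟨max c 0, le_max_right _ _, fun s => ?_⟩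
    rcases lt_trichotomy |s| l with ha | ha | ha
    · rw [hcst s ha]; exact le_max_left _ _
    · rcases abs_eq hl.le |>.1 ha with rfl | rfl
      · rw [hp]; exact le_max_right _ _
      · rw [hm]; exact le_max_right _ _
    · rw [h0 s ha]; exact le_max_right _ _

/-- The weight is discontinuous at most at two opposite points. -/
theorem IsBroadening.exists_jump (hn : IsBroadening Λ n) :
    ∃ l : ℝ, 0 < l ∧ ∀ s, ¬ ContinuousAt n s → |s| = l := by
  rcases hn.cases with ⟨-, hH, -, -⟩ | ⟨l, hl, -, h0, hm, hp, hH | ⟨c, hcst⟩⟩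
  · obtain ⟨C, μ, hμ, -, hC⟩ := hH
    have hcont : Continuous n := continuousOn_univ.1 (hC.continuousOn hμ)
    exact ⟨1, one_pos, fun s hs => absurd hcont.continuousAt hs⟩
  · refine ⟨l, hl, fun s hs => ?_⟩
    obtain ⟨C, μ, hμ, -, hC⟩ := hH
    rcases lt_trichotomy |s| l with h | h | h
    · exact absurd ((hC.continuousOn hμ).continuousAt (Icc_mem_nhds
        (abs_lt.1 h).1 (abs_lt.1 h).2)) hs
    · exact h
    · refine absurd (continuousAt_const.congr (f := fun _ => (0 : ℝ)) ?_) hs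
      filter_upwards [continuous_abs.continuousAt.eventually (lt_mem_nhds h)] with a ha
      exact (h0 a ha).symm
  · refine ⟨l, hl, fun s hs => ?_⟩
    rcases lt_trichotomy |s| l with h | h | h
    · refine absurd (continuousAt_const.congr (f := fun _ => c) ?_) hs
      filter_upwards [continuous_abs.continuousAt.eventually (gt_mem_nhds h)] with a ha
      exact (hcst a ha).symm
    · exact h
    · refine absurd (continuousAt_const.congr (f := fun _ => (0 : ℝ)) ?_) hs
      filter_upwards [continuous_abs.continuousAt.eventually (lt_mem_nhds h)] with a ha
      exact (h0 a ha).symm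

/-- Off the band the Cauchy kernel is bounded on the support of the weight, locally uniformly. -/
theorem IsBroadening.exists_dist_le (hn : IsBroadening Λ n) {z : ℂ} (hz : z ∉ bandSet Λ) :
    ∃ d : ℝ, 0 < d ∧ ∀ z' : ℂ, ‖z' - z‖ < d → ∀ s : ℝ, n s ≠ 0 → d ≤ ‖(s : ℂ) - z'‖ := by
  by_cases him : z.im = 0
  · rcases hn.cases with ⟨rfl, -⟩ | ⟨l, hl, rfl, h0, -⟩
    · exact absurd ⟨him, le_top⟩ hz
    · have hre : l < |z.re| := by
        by_contra hle
        exact hz ⟨him, EReal.coe_le_coe_iff.2 (not_lt.1 hle)⟩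
      refine ⟨(|z.re| - l) / 2, by linarith, fun z' hz' s hs => ?_⟩
      have hsl : |s| ≤ l := by
        by_contra hlt
        exact hs (h0 s (not_le.1 hlt))
      have h1 : |z'.re - z.re| ≤ ‖z' - z‖ := by simpa using Complex.abs_re_le_norm (z' - z)
      have h2 : |s - z'.re| ≤ ‖(s : ℂ) - z'‖ := by simpa using Complex.abs_re_le_norm ((s : ℂ) - z')
      have h3 := abs_sub_abs_le_abs_sub z.re z'.re
      have h4 := abs_sub_abs_le_abs_sub z'.re s
      rw [abs_sub_comm] at h3 h4
      linarith
  · refine ⟨|z.im| / 2, by positivity, fun z' hz' s _ => ?_⟩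
    have h1 : |z'.im - z.im| ≤ ‖z' - z‖ := by simpa using Complex.abs_im_le_norm (z' - z)
    have h2 : |z'.im| ≤ ‖(s : ℂ) - z'‖ := by simpa using Complex.abs_im_le_norm ((s : ℂ) - z')
    have h3 := abs_sub_abs_le_abs_sub z.im z'.im
    rw [abs_sub_comm] at h3
    linarith

theorem isOpen_compl_bandSet (hn : IsBroadening Λ n) : IsOpen (bandSet Λ)ᶜ := by
  rw [isOpen_compl_iff]
  rcases hn.cases with ⟨rfl, -⟩ | ⟨l, hl, rfl, h0, -⟩
  · simpa [bandSet] using isClosed_eq Complex.continuous_im continuous_const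
  · simp only [bandSet, EReal.coe_le_coe_iff]
    exact (isClosed_eq Complex.continuous_im continuous_const).inter
      (isClosed_le (continuous_abs.comp Complex.continuous_re) continuous_const)

/-! ### Cauchy integrals and principal values -/

theorem IsBroadening.integrable_ofReal (hn : IsBroadening Λ n) :
    Integrable fun s => (n s : ℂ) :=
  hn.integrable.ofReal

theorem norm_ofReal_sub_ge_im (s : ℝ) (z : ℂ) : |z.im| ≤ ‖(s : ℂ) - z‖ := by
  simpa using Complex.abs_im_le_norm ((s : ℂ) - z)

/-- Restriction of the domain of integration to where the Cauchy kernel is bounded. -/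
theorem integrableOn_div_sub {f : ℝ → ℂ} (hf : Integrable f) {z : ℂ} {d : ℝ} (hd : 0 < d)
    {A : Set ℝ} (hA : MeasurableSet A) (h : ∀ s ∈ A, d ≤ ‖(s : ℂ) - z‖) :
    IntegrableOn (fun s => f s / ((s : ℂ) - z)) A := by
  refine Integrable.mono' (hf.norm.div_const d).integrableOn ?_ ?_
  · exact (hf.aemeasurable.div
      (by fun_prop : Measurable fun s : ℝ => (s : ℂ) - z).aemeasurable
      ).aestronglyMeasurable.restrict
  · refine (ae_restrict_iff' hA).2 (Eventually.of_forall fun s hs => ?_)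
    rw [norm_div]
    exact div_le_div_of_nonneg_left (norm_nonneg _) hd (h s hs)

theorem integrable_div_sub {f : ℝ → ℂ} (hf : Integrable f) {z : ℂ} (hz : z.im ≠ 0) :
    Integrable fun s => f s / ((s : ℂ) - z) :=
  integrableOn_univ.1 <| integrableOn_div_sub hf (abs_pos.2 hz) MeasurableSet.univ
    fun s _ => norm_ofReal_sub_ge_im s z

theorem measurableSet_truncation (lam ε : ℝ) : MeasurableSet {s : ℝ | ε < |s - lam|} :=
  measurableSet_lt measurable_const (by fun_prop)

theorem integrableOn_truncation {f : ℝ → ℂ} (hf : Integrable f) (lam : ℝ) {ε : ℝ} (hε : 0 < ε) :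
    IntegrableOn (fun s => f s / ((s : ℂ) - (lam : ℂ))) {s : ℝ | ε < |s - lam|} :=
  integrableOn_div_sub hf hε (measurableSet_truncation lam ε) fun s hs => by
    rw [← Complex.ofReal_sub, Complex.norm_real]
    exact le_of_lt hs

theorem tendsto_truncation {g : ℝ → ℂ} (hg : Integrable g) (lam : ℝ) :
    Tendsto (fun ε : ℝ => ∫ s in {s : ℝ | ε < |s - lam|}, g s) (𝓝[>] 0) (𝓝 (∫ s, g s)) := by
  simp_rw [← integral_indicator (measurableSet_truncation lam _)]
  refine tendsto_integral_filter_of_dominated_convergence (fun s => ‖g s‖)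
    (Eventually.of_forall fun ε => hg.aestronglyMeasurable.indicator
      (measurableSet_truncation lam ε))
    (Eventually.of_forall fun ε => Eventually.of_forall fun s => norm_indicator_le_norm_self _ _)
    hg.norm ?_
  filter_upwards [compl_mem_ae_iff.2 (measure_singleton lam)] with s hs
  refine tendsto_const_nhds.congr' ?_
  have hpos : 0 < |s - lam| := abs_pos.2 (sub_ne_zero.2 hs)
  filter_upwards [Ioo_mem_nhdsGT hpos] with ε hε
  exact (Set.indicator_of_mem (s := {s : ℝ | ε < |s - lam|}) hε.2 g).symm

theorem HasPrincipalValue.tendsto {f : ℝ → ℂ} {lam : ℝ} (h : HasPrincipalValue f lam) :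
    Tendsto (truncatedCauchy f lam) (𝓝[>] 0) (𝓝 (principalValue f lam)) :=
  tendsto_nhds_limUnder h

/-- The principal value of the weight times a function that is smooth at the singular point. -/
theorem tendsto_truncatedCauchy_mul (hn : Integrable fun s => (n s : ℂ)) {lam : ℝ}
    (hpv : HasPrincipalValue (fun s => (n s : ℂ)) lam) {f d : ℝ → ℂ} {c : ℂ}
    (hf : ∀ s : ℝ, f s = c + ((s : ℂ) - (lam : ℂ)) * d s)
    (hd : Integrable fun s => (n s : ℂ) * d s) :
    Tendsto (truncatedCauchy (fun s => f s * (n s : ℂ)) lam) (𝓝[>] 0)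
      (𝓝 (c * principalValue (fun s => (n s : ℂ)) lam + ∫ s, (n s : ℂ) * d s)) := by
  refine ((hpv.tendsto.const_mul c).add (tendsto_truncation hd lam)).congr' ?_
  filter_upwards [self_mem_nhdsWithin] with ε hε
  have hε' : 0 < ε := hε
  rw [truncatedCauchy, truncatedCauchy, ← integral_const_mul, ← integral_add
    ((integrableOn_truncation hn lam hε').const_mul c) hd.integrableOn]
  refine setIntegral_congr_fun (measurableSet_truncation lam ε) fun s hs => ?_
  have hs' : ε < |s - lam| := hs
  have hne : (s : ℂ) - (lam : ℂ) ≠ 0 := by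
    rw [← Complex.ofReal_sub]
    exact Complex.ofReal_ne_zero.2 (abs_pos.1 (hε'.trans hs'))
  simp only [hf s]
  field_simp

theorem cauchyIntegral_mul (hn : Integrable fun s => (n s : ℂ)) {z : ℂ}
    (hpv : z.im = 0 → HasPrincipalValue (fun s => (n s : ℂ)) z.re) (σ : ℤˣ) {f d : ℝ → ℂ} {c : ℂ}
    (hf : ∀ s : ℝ, f s = c + ((s : ℂ) - z) * d s)
    (hd : Integrable fun s => (n s : ℂ) * d s) :
    cauchyIntegral σ (fun s => f s * (n s : ℂ)) z =
      c * cauchyIntegral σ (fun s => (n s : ℂ)) z + ∫ s, (n s : ℂ) * d s := by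
  unfold cauchyIntegral
  by_cases hz : z.im = 0
  · have hzr : z = (z.re : ℂ) := Complex.ext rfl (by simp [hz])
    have h1 := tendsto_truncatedCauchy_mul hn (hpv hz) (by rwa [hzr] at hf) hd
    have h2 : principalValue (fun s => f s * (n s : ℂ)) z.re = _ := h1.limUnder_eq
    have h3 : f z.re = c := by rw [hf, ← hzr]; simp
    simp only [hz, if_true, h2, h3]
    ring
  · simp only [hz, if_false]
    rw [← integral_const_mul, ← integral_add ((integrable_div_sub hn hz).const_mul c) hd]
    refine integral_congr_ae (Eventually.of_forall fun s => ?_)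
    have hne : (s : ℂ) - z ≠ 0 :=
      norm_pos_iff.1 ((abs_pos.2 hz).trans_le (norm_ofReal_sub_ge_im s z))
    simp only [hf s]
    field_simp

end Broadening

/-! ### Boundary values of the Cauchy integral -/

section Plemelj

variable {Λ : EReal} {n : ℝ → ℝ}

theorem intervalIntegrable_abs_rpow {r : ℝ} (hr : -1 < r) {δ : ℝ} (hδ : 0 ≤ δ) :
    IntervalIntegrable (fun u : ℝ => |u| ^ r) volume (-δ) δ := by
  have h1 : IntervalIntegrable (fun u : ℝ => |u| ^ r) volume 0 δ := by
    refine (intervalIntegral.intervalIntegrable_rpow' hr).congr ?_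
    intro u hu
    rw [Set.uIoc_of_le hδ] at hu
    simp only [abs_of_pos hu.1]
  have h2 : IntervalIntegrable (fun u : ℝ => |u| ^ r) volume (-δ) 0 := by
    rw [IntervalIntegrable.iff_comp_neg]
    simpa using h1.symm
  exact h2.trans h1

/-- The part of the Cauchy integral at distance more than `δ` from the real part of `z`. -/
noncomputable def cauchyFar (n : ℝ → ℝ) (δ : ℝ) (z : ℂ) : ℂ :=
  ∫ s in {s : ℝ | δ < |s - z.re|}, (n s : ℂ) / ((s : ℂ) - z)

/-- The part of the Cauchy integral at distance at most `δ` from the real part of `z`, with the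
value of the weight at the real part of `z` subtracted. -/
noncomputable def cauchyNear (n : ℝ → ℝ) (δ : ℝ) (z : ℂ) : ℂ :=
  ∫ u in (-δ)..δ, ((n (z.re + u) - n z.re : ℝ) : ℂ) / ((u : ℂ) - (z.im : ℂ) * Complex.I)

theorem abs_le_norm_sub_mul_I (u y : ℝ) : |u| ≤ ‖(u : ℂ) - (y : ℂ) * Complex.I‖ := by
  simpa using Complex.abs_re_le_norm ((u : ℂ) - (y : ℂ) * Complex.I)

theorem norm_near_integrand_le {lam y C μ u : ℝ} (hC : 0 ≤ C)
    (h : |n (lam + u) - n lam| ≤ C * |u| ^ μ) :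
    ‖((n (lam + u) - n lam : ℝ) : ℂ) / ((u : ℂ) - (y : ℂ) * Complex.I)‖ ≤
      C * |u| ^ (μ - 1) := by
  rcases eq_or_ne u 0 with rfl | hu
  · simpa using (by positivity : 0 ≤ C * |(0 : ℝ)| ^ (μ - 1))
  · have hu' : 0 < |u| := abs_pos.2 hu
    rw [norm_div, Complex.norm_real, Real.norm_eq_abs, Real.rpow_sub_one hu'.ne', ← mul_div_assoc]
    exact div_le_div₀ ((abs_nonneg _).trans h) h hu' (abs_le_norm_sub_mul_I u y)

theorem intervalIntegrable_near (hn : Integrable n) {lam y C μ δ : ℝ} (hδ : 0 ≤ δ) (hC : 0 ≤ C)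
    (hμ : 0 < μ)    (h : ∀ u, |u| ≤ δ → |n (lam + u) - n lam| ≤ C * |u| ^ μ) :
    IntervalIntegrable (fun u : ℝ => ((n (lam + u) - n lam : ℝ) : ℂ) /
      ((u : ℂ) - (y : ℂ) * Complex.I)) volume (-δ) δ := by
  refine ((intervalIntegrable_abs_rpow (by linarith : -1 < μ - 1) hδ).const_mul C).mono_fun' ?_ ?_
  · have h1 : AEMeasurable (fun u => ((n (lam + u) - n lam : ℝ) : ℂ)) :=
      Complex.measurable_ofReal.comp_aemeasurable
        ((hn.comp_add_left lam).aemeasurable.sub_const _)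
    exact (h1.div (by fun_prop : Measurable fun u : ℝ =>
      (u : ℂ) - (y : ℂ) * Complex.I).aemeasurable).aestronglyMeasurable.restrict
  · refine (ae_restrict_iff' measurableSet_uIoc).2 (Eventually.of_forall fun u hu => ?_)
    rw [Set.uIoc_of_le (by linarith)] at hu
    exact norm_near_integrand_le hC (h u (abs_le.2 ⟨hu.1.le, hu.2⟩))

/-- The integral of the Cauchy kernel over a symmetric interval. -/
theorem integral_inv_sub_mul_I {σ : ℤˣ} {y δ : ℝ} (hδ : 0 < δ) (hy : 0 < sgnR σ * y) :
    ∫ u in (-δ)..δ, ((u : ℂ) - (y : ℂ) * Complex.I)⁻¹ =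
      Complex.I * ((sgnR σ * Real.pi - 2 * Real.arctan (y / δ) : ℝ) : ℂ) := by
  have hy0 : y ≠ 0 := by rintro rfl; simp at hy
  have hpos : ∀ u : ℝ, 0 < u ^ 2 + y ^ 2 := fun u => by positivity
  have hne : ∀ u : ℝ, (u : ℂ) - (y : ℂ) * Complex.I ≠ 0 := fun u h => by
    have := congrArg Complex.im h
    simp at this
    exact hy0 this
  have hd : ∀ u : ℝ, HasDerivAt
      (fun u : ℝ => ((Real.log (u ^ 2 + y ^ 2) / 2 : ℝ) : ℂ) +
        Complex.I * ((Real.arctan (u / y) : ℝ) : ℂ)) ((u : ℂ) - (y : ℂ) * Complex.I)⁻¹ u := by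
    intro u
    have h1 : HasDerivAt (fun u : ℝ => Real.log (u ^ 2 + y ^ 2) / 2)
        (2 * u / (u ^ 2 + y ^ 2) / 2) u := by
      have h := ((hasDerivAt_pow 2 u).add_const (y ^ 2)).log (hpos u).ne'
      simpa using h.div_const 2
    have h2 : HasDerivAt (fun u : ℝ => Real.arctan (u / y))
        (1 / (1 + (u / y) ^ 2) * (1 / y)) u := ((hasDerivAt_id u).div_const y).arctan
    convert! h1.ofReal_comp.add (h2.ofReal_comp.const_mul Complex.I) using 1
    have e1 : ((u : ℂ) ^ 2 + (y : ℂ) ^ 2) ≠ 0 := by exact_mod_cast (hpos u).ne'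
    have e2 : (y : ℂ) ≠ 0 := by exact_mod_cast hy0
    have e3 : 1 / (1 + (u / y) ^ 2) * (1 / y) = y / (u ^ 2 + y ^ 2) := by
      have := (hpos u).ne'
      field_simp
      ring
    rw [e3]
    push_cast
    refine inv_eq_of_mul_eq_one_right ?_
    field_simp
    linear_combination (-(y : ℂ) ^ 2) * Complex.I_sq
  have hc : Continuous fun u : ℝ => ((u : ℂ) - (y : ℂ) * Complex.I)⁻¹ :=
    Continuous.inv₀ (by fun_prop) hne
  rw [intervalIntegral.integral_eq_sub_of_hasDerivAt (fun u _ => hd u)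
    (hc.intervalIntegrable _ _)]
  have harc : 2 * Real.arctan (δ / y) = sgnR σ * Real.pi - 2 * Real.arctan (y / δ) := by
    rw [← inv_div y δ]
    rcases sgnR_eq σ with h | h <;> rw [h] at hy ⊢
    · rw [Real.arctan_inv_of_pos (by have : 0 < y := by linarith
                                     positivity)]
      ring
    · rw [Real.arctan_inv_of_neg (div_neg_of_neg_of_pos (by linarith) hδ)]
      ring
  rw [← harc, neg_div, Real.arctan_neg]
  push_cast
  rw [neg_sq]
  ring

theorem integrable_cauchyNear_shift (hn : Integrable n) {lam C μ δ : ℝ} (hδ : 0 < δ)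
    (hC : 0 ≤ C) (hμ : 0 < μ) (h : ∀ u, |u| ≤ δ → |n (lam + u) - n lam| ≤ C * |u| ^ μ) :
    Integrable (fun s : ℝ => Set.indicator (Set.Ioc (-δ) δ)
      (fun u : ℝ => ((n (lam + u) - n lam : ℝ) : ℂ) / ((u : ℂ) - ((0 : ℝ) : ℂ) * Complex.I))
      (s - lam)) :=
  ((integrable_indicator_iff measurableSet_Ioc).2
    ((intervalIntegrable_iff_integrableOn_Ioc_of_le (by linarith)).1
      (intervalIntegrable_near hn hδ.le hC hμ h))).comp_sub_right lam

/-- The odd part of the truncated kernel integrates to zero. -/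
theorem integral_truncated_kernel (lam δ ε : ℝ) :
    ∫ s in {s : ℝ | ε < |s - lam|} ∩ Set.Icc (lam - δ) (lam + δ), ((s : ℂ) - (lam : ℂ))⁻¹ = 0 := by
  have hm : MeasurableSet ({s : ℝ | ε < |s - lam|} ∩ Set.Icc (lam - δ) (lam + δ)) :=
    (measurableSet_truncation lam ε).inter measurableSet_Icc
  rw [← integral_indicator hm]
  have h := integral_sub_left_eq_self (μ := volume)
    (fun s : ℝ => Set.indicator ({s : ℝ | ε < |s - lam|} ∩ Set.Icc (lam - δ) (lam + δ))
      (fun s : ℝ => ((s : ℂ) - (lam : ℂ))⁻¹) s) (2 * lam)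
  have h2 : ∀ s : ℝ, Set.indicator ({s : ℝ | ε < |s - lam|} ∩ Set.Icc (lam - δ) (lam + δ))
      (fun s : ℝ => ((s : ℂ) - (lam : ℂ))⁻¹) (2 * lam - s) =
      -Set.indicator ({s : ℝ | ε < |s - lam|} ∩ Set.Icc (lam - δ) (lam + δ))
      (fun s : ℝ => ((s : ℂ) - (lam : ℂ))⁻¹) s := by
    intro s
    have hiff : 2 * lam - s ∈ {s : ℝ | ε < |s - lam|} ∩ Set.Icc (lam - δ) (lam + δ) ↔
        s ∈ {s : ℝ | ε < |s - lam|} ∩ Set.Icc (lam - δ) (lam + δ) := by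
      have : |2 * lam - s - lam| = |s - lam| := by rw [← abs_neg]; congr 1; ring
      simp only [Set.mem_inter_iff, Set.mem_ofPred_eq, this, Set.mem_Icc]
      constructor <;> rintro ⟨h1, h2, h3⟩ <;> exact ⟨h1, by linarith, by linarith⟩
    by_cases hs : s ∈ {s : ℝ | ε < |s - lam|} ∩ Set.Icc (lam - δ) (lam + δ)
    · rw [Set.indicator_of_mem hs, Set.indicator_of_mem (hiff.2 hs), ← inv_neg]
      congr 1
      push_cast
      ring
    · rw [Set.indicator_of_notMem hs, Set.indicator_of_notMem (fun h => hs (hiff.1 h)), neg_zero]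
  simp only [h2, integral_neg] at h
  exact self_eq_neg.1 h.symm

/-- Existence of the principal value at a point where the weight is Hölder continuous. -/
theorem tendsto_truncatedCauchy (hn : Integrable n) {lam C μ δ : ℝ} (hδ : 0 < δ)
    (hC : 0 ≤ C) (hμ : 0 < μ) (h : ∀ u, |u| ≤ δ → |n (lam + u) - n lam| ≤ C * |u| ^ μ) :
    Tendsto (truncatedCauchy (fun s => (n s : ℂ)) lam) (𝓝[>] 0)
      (𝓝 (cauchyFar n δ (lam : ℂ) + cauchyNear n δ (lam : ℂ))) := by
  have hi := integrable_cauchyNear_shift hn hδ hC hμ h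
  have hlim := tendsto_truncation hi lam
  have hnear : cauchyNear n δ (lam : ℂ) = ∫ s : ℝ, Set.indicator (Set.Ioc (-δ) δ)
      (fun u : ℝ => ((n (lam + u) - n lam : ℝ) : ℂ) / ((u : ℂ) - ((0 : ℝ) : ℂ) * Complex.I))
      (s - lam) := by
    rw [integral_sub_right_eq_self (fun s : ℝ => Set.indicator (Set.Ioc (-δ) δ)
      (fun u : ℝ => ((n (lam + u) - n lam : ℝ) : ℂ) / ((u : ℂ) - ((0 : ℝ) : ℂ) * Complex.I)) s) lam,
      integral_indicator measurableSet_Ioc, cauchyNear,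
      intervalIntegral.integral_of_le (by linarith)]
    rfl
  rw [hnear]
  refine (hlim.const_add _).congr' ?_
  filter_upwards [Ioo_mem_nhdsGT hδ] with ε hε
  set B := {s : ℝ | ε < |s - lam|} ∩ Set.Icc (lam - δ) (lam + δ) with hB
  have hBm : MeasurableSet B := (measurableSet_truncation lam ε).inter measurableSet_Icc
  have hsplit : {s : ℝ | ε < |s - lam|} = {s : ℝ | δ < |s - (lam : ℂ).re|} ∪ B := by
    ext s
    simp only [hB, Set.mem_union, Set.mem_inter_iff, Set.mem_ofPred_eq, Set.mem_Icc,
      Complex.ofReal_re]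
    constructor
    · intro hs
      rcases lt_or_ge δ |s - lam| with h | h
      · exact Or.inl h
      · have := abs_le.1 h
        exact Or.inr ⟨hs, by linarith, by linarith⟩
    · rintro (h | h)
      · exact hε.2.trans h
      · exact h.1
  have hdisj : Disjoint {s : ℝ | δ < |s - (lam : ℂ).re|} B := by
    rw [Set.disjoint_left]
    rintro s hs ⟨-, h1, h2⟩
    have hs' : δ < |s - lam| := hs
    exact absurd hs' (not_lt.2 (abs_le.2 ⟨by linarith, by linarith⟩))
  have hint := integrableOn_truncation hn.ofReal lam hε.1 (f := fun s => (n s : ℂ))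
  rw [truncatedCauchy, hsplit, setIntegral_union hdisj hBm
    (hint.mono_set (by rw [hsplit]; exact Set.subset_union_left))
    (hint.mono_set (by rw [hsplit]; exact Set.subset_union_right)), ← hsplit, cauchyFar]
  congr 1
  -- on `B` the weight is its value at the centre plus the subtracted weight
  have hker : IntegrableOn (fun s : ℝ => ((s : ℂ) - (lam : ℂ))⁻¹) B := by
    have h1 := integrableOn_div_sub (f := Set.indicator (Set.Icc (lam - δ) (lam + δ)) fun _ => 1)
      ((integrable_indicator_iff measurableSet_Icc).2 (by simp)) (z := lam) hε.1
      (measurableSet_truncation lam ε) (fun s hs => by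
        rw [← Complex.ofReal_sub, Complex.norm_real]
        exact le_of_lt hs)
    refine (h1.mono_set Set.inter_subset_left).congr_fun (fun s hs => ?_) hBm
    simp only [Set.indicator_of_mem hs.2, one_div]
  have hz := integral_truncated_kernel lam δ ε
  have hrest : ∫ s in {s : ℝ | ε < |s - lam|}, Set.indicator (Set.Ioc (-δ) δ)
      (fun u : ℝ => ((n (lam + u) - n lam : ℝ) : ℂ) / ((u : ℂ) - ((0 : ℝ) : ℂ) * Complex.I))
      (s - lam) = ∫ s in B, Set.indicator (Set.Ioc (-δ) δ)
      (fun u : ℝ => ((n (lam + u) - n lam : ℝ) : ℂ) / ((u : ℂ) - ((0 : ℝ) : ℂ) * Complex.I))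
      (s - lam) := by
    refine setIntegral_eq_of_subset_of_forall_sdiff_eq_zero (measurableSet_truncation lam ε)
      Set.inter_subset_left ?_
    rintro s ⟨hs, hsB⟩
    refine Set.indicator_of_notMem (fun hm => hsB ⟨hs, ?_⟩) _
    exact ⟨by linarith [hm.1], by linarith [hm.2]⟩
  rw [hrest, ← add_zero (∫ s in B, _), ← mul_zero (n lam : ℂ), ← hz, ← integral_const_mul,
    ← integral_add hi.integrableOn (hker.const_mul _)]
  refine setIntegral_congr_ae hBm ?_
  filter_upwards [compl_mem_ae_iff.2 (measure_singleton (lam - δ))] with s hs hsB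
  have hs1 : lam - δ < s := lt_of_le_of_ne hsB.2.1 (Ne.symm hs)
  have hs2 : s - lam ∈ Set.Ioc (-δ) δ := ⟨by linarith, by linarith [hsB.2.2]⟩
  rw [Set.indicator_of_mem hs2]
  simp only [add_sub_cancel]
  push_cast
  rw [zero_mul, sub_zero]
  ring

theorem hasPrincipalValue_of_holder (hn : Integrable n) {lam C μ δ : ℝ} (hδ : 0 < δ)
    (hC : 0 ≤ C) (hμ : 0 < μ) (h : ∀ u, |u| ≤ δ → |n (lam + u) - n lam| ≤ C * |u| ^ μ) :
    HasPrincipalValue (fun s => (n s : ℂ)) lam :=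
  ⟨_, tendsto_truncatedCauchy hn hδ hC hμ h⟩

/-- The Cauchy integral and its boundary values by one formula, valid in the closed half-plane, in
which the singular part of the kernel has been integrated. -/
theorem cauchyIntegral_eq_far_add_near (hn : Integrable n) {σ : ℤˣ} {z : ℂ}
    (hz : z ∈ closedHalfPlane σ) {C μ δ : ℝ} (hδ : 0 < δ) (hC : 0 ≤ C) (hμ : 0 < μ)
    (h : ∀ u, |u| ≤ δ → |n (z.re + u) - n z.re| ≤ C * |u| ^ μ) :
    cauchyIntegral σ (fun s => (n s : ℂ)) z = cauchyFar n δ z + cauchyNear n δ z +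
      (n z.re : ℂ) * (Complex.I *
        ((sgnR σ * Real.pi - 2 * Real.arctan (z.im / δ) : ℝ) : ℂ)) := by
  by_cases him : z.im = 0
  · have hzr : z = (z.re : ℂ) := Complex.ext rfl (by simp [him])
    have h1 : principalValue (fun s => (n s : ℂ)) z.re = _ :=
      (tendsto_truncatedCauchy hn hδ hC hμ h).limUnder_eq
    rw [cauchyIntegral, if_pos him, h1, ← hzr, him]
    simp
    ring
  · have hz' : 0 ≤ sgnR σ * z.im := hz
    have hy : 0 < sgnR σ * z.im := lt_of_le_of_ne hz' (mul_ne_zero (sgnR_ne_zero σ) him).symm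
    rw [cauchyIntegral, if_neg him]
    have hi := integrable_div_sub (f := fun s => (n s : ℂ)) hn.ofReal him
    rw [← integral_add_compl (measurableSet_truncation z.re δ) hi, cauchyFar, add_assoc]
    congr 1
    have hcompl : {s : ℝ | δ < |s - z.re|}ᶜ = Set.Icc (z.re + -δ) (z.re + δ) := by
      ext s
      simp only [Set.mem_compl_iff, Set.mem_ofPred_eq, not_lt, abs_le, Set.mem_Icc]
      constructor <;> rintro ⟨h1, h2⟩ <;> exact ⟨by linarith, by linarith⟩
    rw [hcompl, integral_Icc_eq_integral_Ioc, ← intervalIntegral.integral_of_le (by linarith),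
      ← intervalIntegral.integral_comp_add_left (fun s : ℝ => (n s : ℂ) / ((s : ℂ) - z)) z.re,
      ← integral_inv_sub_mul_I hδ hy, cauchyNear, ← intervalIntegral.integral_const_mul,
      ← intervalIntegral.integral_add (intervalIntegrable_near hn hδ.le hC hμ h)]
    · refine intervalIntegral.integral_congr fun u _ => ?_
      have : ((z.re + u : ℝ) : ℂ) - z = (u : ℂ) - (z.im : ℂ) * Complex.I := by
        apply Complex.ext <;> simp
      simp only [this]
      push_cast
      ring
    · refine Continuous.intervalIntegrable ?_ _ _
      refine continuous_const.mul (Continuous.inv₀ (by fun_prop) fun u h => ?_)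
      have := congrArg Complex.im h
      simp at this
      exact him this

theorem continuousAt_cauchyFar (hn : Integrable n) {δ : ℝ} (hδ : 0 < δ) (lam : ℝ) :
    ContinuousAt (cauchyFar n δ) (lam : ℂ) := by
  have hcf : cauchyFar n δ = fun z : ℂ => ∫ s : ℝ, Set.indicator {s : ℝ | δ < |s - z.re|}
      (fun s : ℝ => (n s : ℂ) / ((s : ℂ) - z)) s := by
    funext z
    rw [integral_indicator (measurableSet_truncation z.re δ)]
    rfl
  rw [hcf]
  refine continuousAt_of_dominated (bound := fun s => |n s| / δ) (Eventually.of_forall fun z => ?_)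
    (Eventually.of_forall fun z => Eventually.of_forall fun s => ?_) (hn.abs.div_const δ) ?_
  · refine AEStronglyMeasurable.indicator ?_ (measurableSet_truncation z.re δ)
    exact (hn.ofReal.aemeasurable.div
      (by fun_prop : Measurable fun s : ℝ => (s : ℂ) - z).aemeasurable).aestronglyMeasurable
  · by_cases hs : s ∈ {s : ℝ | δ < |s - z.re|}
    · have hs' : δ < |s - z.re| := hs
      rw [Set.indicator_of_mem hs, norm_div, Complex.norm_real, Real.norm_eq_abs]
      refine div_le_div_of_nonneg_left (abs_nonneg _) hδ (hs'.le.trans ?_)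
      simpa using Complex.abs_re_le_norm ((s : ℂ) - z)
    · rw [Set.indicator_of_notMem hs, norm_zero]
      positivity
  · filter_upwards [compl_mem_ae_iff.2 (measure_singleton (lam + δ)),
      compl_mem_ae_iff.2 (measure_singleton (lam - δ))] with s hs1 hs2
    have hc : Continuous fun z : ℂ => |s - z.re| := by fun_prop
    rcases lt_trichotomy δ |s - lam| with h | h | h
    · have hne : (s : ℂ) - (lam : ℂ) ≠ 0 := by
        rw [← Complex.ofReal_sub]
        exact Complex.ofReal_ne_zero.2 (abs_pos.1 (hδ.trans h))
      have h1 : ContinuousAt (fun z : ℂ => (n s : ℂ) / ((s : ℂ) - z)) (lam : ℂ) :=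
        continuousAt_const.div (by fun_prop) hne
      refine h1.congr ?_
      filter_upwards [hc.continuousAt.eventually (lt_mem_nhds (b := |s - (lam : ℂ).re|)
        (by simpa using h))] with z hz
      exact (Set.indicator_of_mem (s := {s : ℝ | δ < |s - z.re|}) hz
        (fun s : ℝ => (n s : ℂ) / ((s : ℂ) - z))).symm
    · exfalso
      rcases abs_eq hδ.le |>.1 h.symm with h | h
      · exact hs1 (by rw [Set.mem_singleton_iff]; linarith)
      · exact hs2 (by rw [Set.mem_singleton_iff]; linarith)
    · refine (continuousAt_const (y := (0 : ℂ))).congr ?_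
      have h' : |s - (lam : ℂ).re| < δ := by simpa using h
      filter_upwards [hc.continuousAt.eventually (gt_mem_nhds h')] with z hz
      exact (Set.indicator_of_notMem (s := {s : ℝ | δ < |s - z.re|})
        (fun h => absurd hz (not_lt.2 (le_of_lt h)))
        (fun s : ℝ => (n s : ℂ) / ((s : ℂ) - z))).symm

theorem continuousAt_cauchyNear (hn : Integrable n) {lam C μ δ : ℝ} (hδ : 0 < δ)
    (hC : 0 ≤ C) (hμ : 0 < μ)
    (h : ∀ a b : ℝ, |a - lam| < 2 * δ → |b - lam| < 2 * δ → |n a - n b| ≤ C * |a - b| ^ μ) :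
    ContinuousAt (cauchyNear n δ) (lam : ℂ) := by
  have hcont : ∀ a : ℝ, |a - lam| < 2 * δ → ContinuousAt n a := by
    intro a ha
    rw [ContinuousAt, tendsto_iff_dist_tendsto_zero]
    have h0 : Tendsto (fun b : ℝ => C * |b - a| ^ μ) (𝓝 a) (𝓝 0) := by
      have h1 : Continuous fun b : ℝ => C * |b - a| ^ μ :=
        continuous_const.mul (Continuous.rpow_const (by fun_prop) fun _ => Or.inr hμ.le)
      have h2 := h1.tendsto a
      simpa [Real.zero_rpow hμ.ne'] using h2
    refine squeeze_zero' (Eventually.of_forall fun _ => dist_nonneg) ?_ h0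
    have ho : Continuous fun b : ℝ => |b - lam| := by fun_prop
    filter_upwards [ho.continuousAt.eventually (gt_mem_nhds ha)] with b hb
    exact h b a hb ha
  have hnear : ∀ᶠ z : ℂ in 𝓝 (lam : ℂ), |z.re - lam| < δ := by
    have hc : Continuous fun z : ℂ => |z.re - lam| := by fun_prop
    exact hc.continuousAt.eventually (gt_mem_nhds (by simpa using hδ))
  refine intervalIntegral.continuousAt_of_dominated_interval
    (bound := fun u => C * |u| ^ (μ - 1)) ?_ ?_
    ((intervalIntegrable_abs_rpow (by linarith : -1 < μ - 1) hδ.le).const_mul C) ?_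
  · refine Eventually.of_forall fun z => ?_
    have h1 : AEMeasurable (fun u => ((n (z.re + u) - n z.re : ℝ) : ℂ)) :=
      Complex.measurable_ofReal.comp_aemeasurable
        ((hn.comp_add_left z.re).aemeasurable.sub_const _)
    exact (h1.div (by fun_prop : Measurable fun u : ℝ =>
      (u : ℂ) - (z.im : ℂ) * Complex.I).aemeasurable).aestronglyMeasurable.restrict
  · filter_upwards [hnear] with z hz
    refine Eventually.of_forall fun u hu => norm_near_integrand_le hC ?_
    rw [Set.uIoc_of_le (by linarith)] at hu
    have hu' : |u| ≤ δ := abs_le.2 ⟨hu.1.le, hu.2⟩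
    have h1 : |z.re + u - lam| < 2 * δ := by
      have := abs_add_le (z.re - lam) u
      rw [show z.re - lam + u = z.re + u - lam by ring] at this
      linarith
    simpa using h (z.re + u) z.re h1 (by linarith)
  · filter_upwards [compl_mem_ae_iff.2 (measure_singleton (0 : ℝ))] with u hu0 hu
    rw [Set.uIoc_of_le (by linarith)] at hu
    have hu' : |u| ≤ δ := abs_le.2 ⟨hu.1.le, hu.2⟩
    have h1 : ContinuousAt (fun z : ℂ => n (z.re + u)) (lam : ℂ) :=
      ContinuousAt.comp (f := fun z : ℂ => z.re + u)
        (hcont _ (by simp only [Complex.ofReal_re, add_sub_cancel_left]; linarith)) (by fun_prop)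
    have h2 : ContinuousAt (fun z : ℂ => n z.re) (lam : ℂ) :=
      ContinuousAt.comp (f := fun z : ℂ => z.re) (hcont _ (by simpa using hδ)) (by fun_prop)
    refine ContinuousAt.div (Complex.continuous_ofReal.continuousAt.comp (h1.sub h2))
      (by fun_prop) ?_
    simpa using hu0

theorem IsBroadening.exists_holder_radius (hn : IsBroadening Λ n) {lam : ℝ}
    (hc : ContinuousAt n lam) : ∃ δ C μ : ℝ, 0 < δ ∧ 0 ≤ C ∧ 0 < μ ∧
      ∀ a b : ℝ, |a - lam| < 2 * δ → |b - lam| < 2 * δ → |n a - n b| ≤ C * |a - b| ^ μ := by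
  obtain ⟨δ, C, μ, hδ, hC, hμ, h⟩ := hn.exists_local_holder hc
  exact ⟨δ / 2, C, μ, by positivity, hC, hμ, by simpa [mul_div_cancel₀] using h⟩

/-- At its points of continuity the weight is Hölder continuous, hence has a principal value. -/
theorem IsBroadening.hasPrincipalValue (hn : IsBroadening Λ n) {lam : ℝ}
    (hc : ContinuousAt n lam) : HasPrincipalValue (fun s => (n s : ℂ)) lam := by
  obtain ⟨δ, C, μ, hδ, hC, hμ, h⟩ := hn.exists_holder_radius hc
  refine hasPrincipalValue_of_holder hn.integrable hδ hC hμ fun u hu => ?_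
  simpa using h (lam + u) lam (by simp only [add_sub_cancel_left]; linarith) (by simpa using hδ)

/-- The Cauchy integral of the weight is continuous up to the real axis at the points where the
weight is continuous. -/
theorem IsBroadening.continuousWithinAt_cauchyIntegral (hn : IsBroadening Λ n) (σ : ℤˣ) {lam : ℝ}
    (hc : ContinuousAt n lam) :
    ContinuousWithinAt (cauchyIntegral σ fun s => (n s : ℂ)) (closedHalfPlane σ) (lam : ℂ) := by
  obtain ⟨δ, C, μ, hδ, hC, hμ, h⟩ := hn.exists_holder_radius hc
  have hnear : ∀ᶠ z : ℂ in 𝓝 (lam : ℂ), |z.re - lam| < δ := by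
    have hc : Continuous fun z : ℂ => |z.re - lam| := by fun_prop
    exact hc.continuousAt.eventually (gt_mem_nhds (by simpa using hδ))
  have hform : ∀ z ∈ closedHalfPlane σ, |z.re - lam| < δ →
      cauchyIntegral σ (fun s => (n s : ℂ)) z = cauchyFar n δ z + cauchyNear n δ z +
      (n z.re : ℂ) * (Complex.I *
        ((sgnR σ * Real.pi - 2 * Real.arctan (z.im / δ) : ℝ) : ℂ)) := by
    intro z hz hzl
    refine cauchyIntegral_eq_far_add_near hn.integrable hz hδ hC hμ fun u hu => ?_
    have h1 : |z.re + u - lam| < 2 * δ := by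
      have := abs_add_le (z.re - lam) u
      rw [show z.re - lam + u = z.re + u - lam by ring] at this
      linarith
    simpa using h (z.re + u) z.re h1 (by linarith)
  have hmem : (lam : ℂ) ∈ closedHalfPlane σ := by simp [closedHalfPlane]
  have hc' : ContinuousAt (fun z : ℂ => cauchyFar n δ z + cauchyNear n δ z +
      (n z.re : ℂ) * (Complex.I *
        ((sgnR σ * Real.pi - 2 * Real.arctan (z.im / δ) : ℝ) : ℂ))) (lam : ℂ) := by
    refine ((continuousAt_cauchyFar hn.integrable hδ lam).add
      (continuousAt_cauchyNear hn.integrable hδ hC hμ h)).add (ContinuousAt.mul ?_ ?_)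
    · exact Complex.continuous_ofReal.continuousAt.comp
        (ContinuousAt.comp (f := fun z : ℂ => z.re) (by simpa using hc) (by fun_prop))
    · have : Continuous fun z : ℂ => Real.arctan (z.im / δ) :=
        Real.continuous_arctan.comp (by fun_prop)
      fun_prop
  refine hc'.continuousWithinAt.congr_of_eventuallyEq ?_ (hform _ hmem (by simpa using hδ))
  filter_upwards [nhdsWithin_le_nhds hnear, self_mem_nhdsWithin] with z hz1 hz2
  exact hform z hz2 hz1

end Plemelj

/-! ### The function `η` -/

section Eta

variable {Λ : EReal} {n : ℝ → ℝ}

theorem cauchyIntegral_eq_integral (hn : IsBroadening Λ n) (σ : ℤˣ) {z : ℂ} (hz : z ∉ bandSet Λ) :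
    cauchyIntegral σ (fun s => (n s : ℂ)) z = ∫ s, (n s : ℂ) / ((s : ℂ) - z) := by
  by_cases him : z.im = 0
  · obtain ⟨d, hd, h⟩ := hn.exists_dist_le hz
    have hzr : z = (z.re : ℂ) := Complex.ext rfl (by simp [him])
    have h1 : ∀ s, n s ≠ 0 → d ≤ |s - z.re| := by
      intro s hs
      have := h z (by simpa using hd) s hs
      rwa [hzr, ← Complex.ofReal_sub, Complex.norm_real, Real.norm_eq_abs] at this
    have h2 : n z.re = 0 := by
      by_contra h0
      have := h1 _ h0
      simp at this
      linarith
    have h3 : Tendsto (truncatedCauchy (fun s => (n s : ℂ)) z.re) (𝓝[>] 0)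
        (𝓝 (∫ s, (n s : ℂ) / ((s : ℂ) - z))) := by
      refine tendsto_const_nhds.congr' ?_
      filter_upwards [Ioo_mem_nhdsGT hd] with ε hε
      rw [truncatedCauchy, ← hzr, ← setIntegral_univ]
      refine setIntegral_eq_of_subset_of_forall_sdiff_eq_zero MeasurableSet.univ
        (Set.subset_univ _) fun s hs => ?_
      by_cases hs0 : n s = 0
      · simp [hs0]
      · exact absurd (lt_of_lt_of_le hε.2 (h1 s hs0)) hs.2
    have h4 : principalValue (fun s => (n s : ℂ)) z.re = _ := h3.limUnder_eq
    rw [cauchyIntegral, if_pos him, h4, h2]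
    simp
  · rw [cauchyIntegral, if_neg him]

theorem differentiableAt_integral_div_sub (hn : IsBroadening Λ n) {z : ℂ} (hz : z ∉ bandSet Λ) :
    DifferentiableAt ℂ (fun z : ℂ => ∫ s, (n s : ℂ) / ((s : ℂ) - z)) z := by
  obtain ⟨d, hd, h⟩ := hn.exists_dist_le hz
  have hmeas : ∀ w : ℂ, AEStronglyMeasurable (fun s : ℝ => (n s : ℂ) / ((s : ℂ) - w)) volume :=
    fun w => (hn.integrable_ofReal.aemeasurable.div
      (by fun_prop : Measurable fun s : ℝ => (s : ℂ) - w).aemeasurable).aestronglyMeasurable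
  refine (hasDerivAt_integral_of_dominated_loc_of_deriv_le (𝕜 := ℂ)
    (F := fun (z : ℂ) (s : ℝ) => (n s : ℂ) / ((s : ℂ) - z))
    (F' := fun (z : ℂ) (s : ℝ) => (n s : ℂ) / ((s : ℂ) - z) ^ 2) (bound := fun s => n s / d ^ 2)
    (s := Metric.ball z d) (Metric.ball_mem_nhds z hd) (Eventually.of_forall hmeas) ?_ ?_ ?_
    (hn.integrable.div_const _) ?_).2.differentiableAt
  · rw [← integrableOn_univ]
    refine Integrable.mono' ((hn.integrable.div_const d).integrableOn) ((hmeas z).restrict)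
      (Eventually.of_forall fun s => ?_)
    by_cases hs : n s = 0
    · simp [hs]
    · rw [norm_div, Complex.norm_real, Real.norm_of_nonneg (hn.nonneg s)]
      exact div_le_div_of_nonneg_left (hn.nonneg s) hd (h z (by simpa using hd) s hs)
  · exact (hn.integrable_ofReal.aemeasurable.div
      (by fun_prop : Measurable fun s : ℝ => ((s : ℂ) - z) ^ 2).aemeasurable).aestronglyMeasurable
  · refine Eventually.of_forall fun s w hw => ?_
    by_cases hs : n s = 0
    · simp [hs]
    · rw [norm_div, norm_pow, Complex.norm_real, Real.norm_of_nonneg (hn.nonneg s)]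
      have := h w (by simpa [dist_eq_norm] using hw) s hs
      exact div_le_div_of_nonneg_left (hn.nonneg s) (by positivity) (by gcongr)
  · refine Eventually.of_forall fun s w hw => ?_
    by_cases hs : n s = 0
    · simp only [hs, Complex.ofReal_zero, zero_div]
      exact hasDerivAt_const w 0
    · have h1 : (s : ℂ) - w ≠ 0 :=
        norm_pos_iff.1 (hd.trans_le (h w (by simpa [dist_eq_norm] using hw) s hs))
      have h2 : HasDerivAt (fun w : ℂ => (s : ℂ) - w) (-1) w := by
        simpa using (hasDerivAt_id w).const_sub (s : ℂ)
      convert! (hasDerivAt_const w (n s : ℂ)).div h2 h1 using 1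
      simp

/-- Off the band the two signs give the same function. -/
theorem etaFun_eq_integral (hn : IsBroadening Λ n) (σ : ℤˣ) {z : ℂ} (hz : z ∉ bandSet Λ) :
    etaFun n σ z = z + (1 / 4) * ∫ s, (n s : ℂ) / ((s : ℂ) - z) := by
  rw [etaFun, cauchyIntegral_eq_integral hn σ hz]

theorem differentiableOn_etaFun (hn : IsBroadening Λ n) (σ : ℤˣ) :
    DifferentiableOn ℂ (etaFun n σ) (bandSet Λ)ᶜ := by
  intro z hz
  have h : DifferentiableAt ℂ (fun z => z + (1 / 4) * ∫ s, (n s : ℂ) / ((s : ℂ) - z)) z :=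
    differentiableAt_id.add ((differentiableAt_integral_div_sub hn hz).const_mul _)
  exact h.differentiableWithinAt.congr (fun w hw => etaFun_eq_integral hn σ hw)
    (etaFun_eq_integral hn σ hz)

theorem notMem_bandSet_of_im_ne_zero {z : ℂ} (hz : z.im ≠ 0) : z ∉ bandSet Λ := fun h => hz h.1

theorem continuousWithinAt_cauchyIntegral (hn : IsBroadening Λ n) (σ : ℤˣ) {z : ℂ}
    (hz : z ∉ jumpSet n) :
    ContinuousWithinAt (cauchyIntegral σ fun s => (n s : ℂ)) (closedHalfPlane σ) z := by
  by_cases him : z.im = 0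
  · have hzr : z = (z.re : ℂ) := Complex.ext rfl (by simp [him])
    have hc : ContinuousAt n z.re := by
      by_contra h
      exact hz ⟨him, h⟩
    rw [hzr]
    exact hn.continuousWithinAt_cauchyIntegral σ hc
  · have hb : z ∉ bandSet Λ := notMem_bandSet_of_im_ne_zero him
    refine ContinuousAt.continuousWithinAt ?_
    refine (differentiableAt_integral_div_sub hn hb).continuousAt.congr ?_
    filter_upwards [(isOpen_compl_bandSet hn).mem_nhds hb] with w hw
    exact (cauchyIntegral_eq_integral hn σ hw).symm

theorem continuousOn_etaFun (hn : IsBroadening Λ n) (σ : ℤˣ) :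
    ContinuousOn (etaFun n σ) (closedHalfPlane σ \ jumpSet n) := by
  intro z hz
  refine ContinuousWithinAt.add continuousWithinAt_id (continuousWithinAt_const.mul ?_)
  exact (continuousWithinAt_cauchyIntegral hn σ hz.2).mono Set.sdiff_subset

/-- Off the real axis the imaginary part of the Cauchy integral is a Poisson integral. -/
theorem abs_im_integral_div_sub_le (hn : Integrable n) (hn0 : ∀ s, 0 ≤ n s) {M : ℝ}
    (hM : ∀ s, n s ≤ M) {z : ℂ} (hz : z.im ≠ 0) :
    |(∫ s, (n s : ℂ) / ((s : ℂ) - z)).im| ≤ Real.pi * M := by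
  have hi := integrable_div_sub (f := fun s => (n s : ℂ)) hn.ofReal hz
  have h1 : (∫ s, (n s : ℂ) / ((s : ℂ) - z)).im = ∫ s, ((n s : ℂ) / ((s : ℂ) - z)).im :=
    (Complex.imCLM.integral_comp_comm hi).symm
  set γ : ℝ≥0 := ⟨|z.im|, abs_nonneg _⟩ with hγ
  have hγ0 : γ ≠ 0 := fun h => hz (abs_eq_zero.1 (congrArg NNReal.toReal h))
  have hM0 : 0 ≤ M := (hn0 0).trans (hM 0)
  rw [h1, ← Real.norm_eq_abs]
  have h2 : ‖∫ s, ((n s : ℂ) / ((s : ℂ) - z)).im‖ ≤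
      ∫ s, (Real.pi * M) * ProbabilityTheory.cauchyPDFReal z.re γ s := by
    refine norm_integral_le_of_norm_le
      ((ProbabilityTheory.integrable_cauchyPDFReal z.re).const_mul _)
      (Eventually.of_forall fun s => ?_)
    have hpos : 0 < (s - z.re) ^ 2 + z.im ^ 2 := by positivity
    have h3 : ((n s : ℂ) / ((s : ℂ) - z)).im = n s * z.im / ((s - z.re) ^ 2 + z.im ^ 2) := by
      rw [Complex.div_im, Complex.normSq_apply]
      simp only [Complex.sub_re, Complex.sub_im, Complex.ofReal_re, Complex.ofReal_im, zero_sub]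
      ring
    have h4 : (γ : ℝ) = |z.im| := rfl
    rw [h3, ProbabilityTheory.cauchyPDFReal, h4, sq_abs, Real.norm_eq_abs, abs_div, abs_mul,
      abs_of_nonneg (hn0 s), abs_of_pos hpos, div_eq_mul_inv]
    have : Real.pi * M * (Real.pi⁻¹ * |z.im| * ((s - z.re) ^ 2 + z.im ^ 2)⁻¹) =
        M * |z.im| * ((s - z.re) ^ 2 + z.im ^ 2)⁻¹ := by
      field_simp
    rw [this]
    gcongr
    exact hM s
  rwa [integral_const_mul, ProbabilityTheory.integral_cauchyPDFReal_eq_one _ hγ0, mul_one] at h2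

/-- The imaginary part of the Cauchy integral is at most `π sup n`, also near the jumps of `n`,
where the real part is unbounded. -/
theorem exists_abs_im_cauchyIntegral_le (hn : IsBroadening Λ n) :
    ∃ K : ℝ, 0 ≤ K ∧ ∀ (σ : ℤˣ), ∀ z ∈ closedHalfPlane σ, z ∉ jumpSet n →
      |(cauchyIntegral σ (fun s => (n s : ℂ)) z).im| ≤ K := by
  obtain ⟨M, hM0, hM⟩ := hn.exists_bound
  refine ⟨Real.pi * M, by positivity, fun σ z hz hJ => ?_⟩
  have hne : ∀ w : ℂ, w.im ≠ 0 →
      |(cauchyIntegral σ (fun s => (n s : ℂ)) w).im| ≤ Real.pi * M := by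
    intro w hw
    rw [cauchyIntegral, if_neg hw]
    exact abs_im_integral_div_sub_le hn.integrable hn.nonneg hM hw
  by_cases him : z.im = 0
  · -- the real axis is approached along a vertical half-line
    have hpath : Tendsto (fun ε : ℝ => z + ((sgnR σ * ε : ℝ) : ℂ) * Complex.I) (𝓝[>] 0)
        (𝓝[closedHalfPlane σ] z) := by
      refine tendsto_nhdsWithin_iff.2 ⟨?_, ?_⟩
      · have : Continuous fun ε : ℝ => z + ((sgnR σ * ε : ℝ) : ℂ) * Complex.I := by fun_prop
        simpa using (this.tendsto 0).mono_left nhdsWithin_le_nhds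
      · filter_upwards [self_mem_nhdsWithin] with ε hε
        have hε' : 0 < ε := hε
        simp only [closedHalfPlane, Set.mem_ofPred_eq, Complex.add_im, him, Complex.mul_im,
          Complex.ofReal_re, Complex.I_im, Complex.ofReal_im, Complex.I_re]
        rw [mul_one, mul_zero, zero_add, add_zero, ← mul_assoc, sgnR_mul_self, one_mul]
        exact hε'.le
    have hl := (continuousWithinAt_cauchyIntegral hn σ hJ).tendsto.comp hpath
    have hl2 := ((Complex.continuous_im.tendsto _).comp hl).abs
    refine le_of_tendsto hl2 ?_
    filter_upwards [self_mem_nhdsWithin] with ε hε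
    have hε' : 0 < ε := hε
    refine hne _ ?_
    simp only [Complex.add_im, him, Complex.mul_im,
          Complex.ofReal_re, Complex.I_im, Complex.ofReal_im, Complex.I_re]
    simpa using ⟨sgnR_ne_zero σ, hε'.ne'⟩
  · exact hne z him

theorem norm_cauchyIntegral_le (hn : IsBroadening Λ n) (σ : ℤˣ) {z : ℂ} (hz : z.im ≠ 0) :
    ‖cauchyIntegral σ (fun s => (n s : ℂ)) z‖ ≤ |z.im|⁻¹ := by
  rw [cauchyIntegral, if_neg hz]
  calc ‖∫ s, (n s : ℂ) / ((s : ℂ) - z)‖ ≤ ∫ s, n s * |z.im|⁻¹ := by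
        refine norm_integral_le_of_norm_le (hn.integrable.mul_const _)
          (Eventually.of_forall fun s => ?_)
        rw [norm_div, Complex.norm_real, Real.norm_of_nonneg (hn.nonneg s), div_eq_mul_inv]
        exact mul_le_mul_of_nonneg_left
          (inv_anti₀ (abs_pos.2 hz) (norm_ofReal_sub_ge_im s z)) (hn.nonneg s)
    _ = |z.im|⁻¹ := by rw [integral_mul_const, hn.integral_eq_one, one_mul]

end Eta

/-! ### The background solution `Φ` -/

section Background

variable {A₀ ω₀ : ℝ}

/-- The segment `[E, Ē]`. -/
def branchCut (A₀ ω₀ : ℝ) : Set ℂ := {z | z.re = -ω₀ / 2 ∧ |z.im| ≤ A₀ / 2}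

/-- The quotient `(z - Ē) / (z - E)`, of which `ϰ` is the fourth root. -/
noncomputable def branchQuot (A₀ ω₀ : ℝ) (z : ℂ) : ℂ :=
  (z - branchPt A₀ ω₀ (-1)) / (z - branchPt A₀ ω₀ 1)

theorem kappaFun_eq (z : ℂ) : kappaFun A₀ ω₀ z = branchQuot A₀ ω₀ z ^ (1 / 4 : ℂ) := rfl

theorem isClosed_branchCut : IsClosed (branchCut A₀ ω₀) :=
  (isClosed_eq Complex.continuous_re continuous_const).inter
    (isClosed_le Complex.continuous_im.abs continuous_const)

theorem branchPt_mem_branchCut (hA₀ : 0 < A₀) (σ : ℤˣ) : branchPt A₀ ω₀ σ ∈ branchCut A₀ ω₀ := by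
  refine ⟨rfl, ?_⟩
  rcases sgnR_eq σ with h | h <;>
    simp [branchPt, h, abs_div, abs_of_pos hA₀]

/-- The part of the cut in the closed half-plane is the segment `cutSeg`. -/
theorem mem_cutSeg (hA₀ : 0 < A₀) {σ : ℤˣ} {z : ℂ} (hz : z ∈ branchCut A₀ ω₀)
    (hσ : z ∈ closedHalfPlane σ) : z ∈ cutSeg A₀ ω₀ σ := by
  obtain ⟨h1, h2⟩ := hz
  have h3 : 0 ≤ sgnR σ * z.im := hσ
  have h4 : sgnR σ * z.im ≤ A₀ / 2 := by
    refine (le_abs_self _).trans ?_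
    rw [abs_mul]
    rcases sgnR_eq σ with h | h <;> rw [h] <;> simpa using h2
  rw [cutSeg, segment_eq_image]
  have h5 : sgnR σ * z.im / (A₀ / 2) * (sgnR σ * A₀ / 2) = z.im := by
    have : sgnR σ * z.im / (A₀ / 2) * (sgnR σ * A₀ / 2) = (sgnR σ * sgnR σ) * z.im := by
      field_simp
    rw [this, sgnR_mul_self, one_mul]
  refine ⟨1 - sgnR σ * z.im / (A₀ / 2), ⟨?_, ?_⟩, ?_⟩
  · rw [sub_nonneg, div_le_one (by positivity)]
    exact h4
  · rw [sub_le_self_iff]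
    positivity
  · simp only [sub_sub_cancel]
    apply Complex.ext
    · simp only [branchPt, reE, Complex.add_re, Complex.real_smul, Complex.re_ofReal_mul,
        Complex.ofReal_re, h1]
      ring
    · simp only [branchPt, reE, Complex.add_im, Complex.real_smul, Complex.im_ofReal_mul,
        Complex.ofReal_im, mul_zero, add_zero]
      exact h5

theorem notMem_branchCut (hA₀ : 0 < A₀) {σ : ℤˣ} {z : ℂ}
    (hz : z ∈ closedHalfPlane σ \ cutSeg A₀ ω₀ σ) : z ∉ branchCut A₀ ω₀ :=
  fun h => hz.2 (mem_cutSeg hA₀ h hz.1)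

theorem sub_branchPt_ne_zero (hA₀ : 0 < A₀) {z : ℂ} (hz : |z.im| < A₀ / 2 ∨ z ∉ branchCut A₀ ω₀)
    (σ : ℤˣ) : z - branchPt A₀ ω₀ σ ≠ 0 := by
  intro h
  rw [sub_eq_zero] at h
  rcases hz with hz | hz
  · rw [h] at hz
    rcases sgnR_eq σ with h | h <;>
      simp [branchPt, h, abs_div, abs_of_pos hA₀] at hz
  · exact hz (h ▸ branchPt_mem_branchCut hA₀ σ)

theorem branchQuot_ne_zero {z : ℂ} (hz : ∀ σ, z - branchPt A₀ ω₀ σ ≠ 0) :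
    branchQuot A₀ ω₀ z ≠ 0 :=
  div_ne_zero (hz _) (hz _)

theorem branchQuot_re (z : ℂ) : (branchQuot A₀ ω₀ z).re =
    ((z.re + ω₀ / 2) ^ 2 + z.im ^ 2 - (A₀ / 2) ^ 2) /
      Complex.normSq (z - branchPt A₀ ω₀ 1) := by
  rw [branchQuot, Complex.div_re, ← add_div]
  congr 1
  simp [branchPt, sgnR_one, sgnR_neg_one]
  ring

theorem branchQuot_im (z : ℂ) : (branchQuot A₀ ω₀ z).im =
    A₀ * (z.re + ω₀ / 2) / Complex.normSq (z - branchPt A₀ ω₀ 1) := by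
  rw [branchQuot, Complex.div_im, ← sub_div]
  congr 1
  simp [branchPt, sgnR_one, sgnR_neg_one]
  ring

/-- Off the cut the quotient avoids the negative real axis. -/
theorem branchQuot_mem_slitPlane (hA₀ : 0 < A₀) {z : ℂ} (hz : z ∉ branchCut A₀ ω₀) :
    branchQuot A₀ ω₀ z ∈ Complex.slitPlane := by
  have hpos : 0 < Complex.normSq (z - branchPt A₀ ω₀ 1) :=
    Complex.normSq_pos.2 (sub_branchPt_ne_zero hA₀ (Or.inr hz) 1)
  rw [Complex.mem_slitPlane_iff, branchQuot_re, branchQuot_im]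
  by_cases h : z.re + ω₀ / 2 = 0
  · left
    refine div_pos ?_ hpos
    have h1 : A₀ / 2 < |z.im| := by
      by_contra h1
      exact hz ⟨by linarith, not_lt.1 h1⟩
    rw [h, ← sq_abs z.im]
    nlinarith
  · right
    exact div_ne_zero (mul_ne_zero hA₀.ne' h) hpos.ne'

theorem continuousAt_branchQuot {z : ℂ} (hz : z - branchPt A₀ ω₀ 1 ≠ 0) :
    ContinuousAt (branchQuot A₀ ω₀) z :=
  ContinuousAt.div (by fun_prop) (by fun_prop) hz

theorem kappaFun_ne_zero {z : ℂ} (hz : ∀ σ, z - branchPt A₀ ω₀ σ ≠ 0) :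
    kappaFun A₀ ω₀ z ≠ 0 := by
  rw [kappaFun_eq, Complex.cpow_def_of_ne_zero (branchQuot_ne_zero hz)]
  exact Complex.exp_ne_zero _

theorem kappaFun_pow_four (z : ℂ) : kappaFun A₀ ω₀ z ^ 4 = branchQuot A₀ ω₀ z := by
  rw [kappaFun_eq, show (1 / 4 : ℂ) = ((4 : ℕ) : ℂ)⁻¹ by norm_num]
  exact Complex.cpow_nat_inv_pow _ (by norm_num)

theorem differentiableAt_kappaFun (hA₀ : 0 < A₀) {z : ℂ} (hz : z ∉ branchCut A₀ ω₀) :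
    DifferentiableAt ℂ (kappaFun A₀ ω₀) z := by
  have h1 : DifferentiableAt ℂ (branchQuot A₀ ω₀) z :=
    DifferentiableAt.div (by fun_prop) (by fun_prop) (sub_branchPt_ne_zero hA₀ (Or.inr hz) 1)
  exact h1.cpow (differentiableAt_const _) (branchQuot_mem_slitPlane hA₀ hz)

theorem matM0_eq (z : ℂ) : matM0 A₀ ω₀ z =
    !![(kappaFun A₀ ω₀ z + (kappaFun A₀ ω₀ z)⁻¹) / 2,
      (kappaFun A₀ ω₀ z - (kappaFun A₀ ω₀ z)⁻¹) / 2;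
      (kappaFun A₀ ω₀ z - (kappaFun A₀ ω₀ z)⁻¹) / 2,
      (kappaFun A₀ ω₀ z + (kappaFun A₀ ω₀ z)⁻¹) / 2] := rfl

theorem det_matM0 {z : ℂ} (hz : ∀ σ, z - branchPt A₀ ω₀ σ ≠ 0) : (matM0 A₀ ω₀ z).det = 1 := by
  have := kappaFun_ne_zero hz
  rw [matM0_eq, Matrix.det_fin_two_of]
  field_simp
  ring

theorem differentiableAt_matM0 (hA₀ : 0 < A₀) {z : ℂ} (hz : z ∉ branchCut A₀ ω₀) :
    DifferentiableAt ℂ (matM0 A₀ ω₀) z := by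
  have h1 := (differentiableAt_kappaFun hA₀ hz).hasDerivAt
  have h2 := h1.inv (kappaFun_ne_zero (sub_branchPt_ne_zero hA₀ (Or.inr hz)))
  have h3 : HasDerivAt (matM0 A₀ ω₀) (Matrix.of fun i j => if i = j then
      (deriv (kappaFun A₀ ω₀) z + -deriv (kappaFun A₀ ω₀) z / kappaFun A₀ ω₀ z ^ 2) / 2 else
      (deriv (kappaFun A₀ ω₀) z - -deriv (kappaFun A₀ ω₀) z / kappaFun A₀ ω₀ z ^ 2) / 2) z := by
    refine hasDerivAt_mat2_iff.2 fun i j => ?_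
    fin_cases i <;> fin_cases j <;> simp [matM0_eq]
    · exact (h1.add h2).div_const 2
    · exact (h1.sub h2).div_const 2
    · exact (h1.sub h2).div_const 2
    · exact (h1.add h2).div_const 2
  exact h3.differentiableAt

theorem tendsto_matM0 {F : Filter ℂ} {k : ℂ} (hk : k ≠ 0)
    (h : Tendsto (kappaFun A₀ ω₀) F (𝓝 k)) :
    Tendsto (matM0 A₀ ω₀) F (𝓝 !![(k + k⁻¹) / 2, (k - k⁻¹) / 2; (k - k⁻¹) / 2, (k + k⁻¹) / 2]) := by
  have h2 := h.inv₀ hk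
  refine tendsto_pi_nhds.2 fun i => tendsto_pi_nhds.2 fun j => ?_
  fin_cases i <;> fin_cases j
  · exact (h.add h2).div_const 2
  · exact (h.sub h2).div_const 2
  · exact (h.sub h2).div_const 2
  · exact (h.add h2).div_const 2

theorem mem_openSegment_cut (hA₀ : 0 < A₀) {σ : ℤˣ} {ζ : ℂ}
    (h : ζ ∈ openSegment ℝ (branchPt A₀ ω₀ σ) (reE ω₀)) :
    ζ.re = -ω₀ / 2 ∧ |ζ.im| < A₀ / 2 ∧ 0 < sgnR σ * ζ.im := by
  rw [openSegment_eq_image] at h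
  obtain ⟨θ, ⟨h0, h1⟩, rfl⟩ := h
  have him : ((1 - θ) • branchPt A₀ ω₀ σ + θ • reE ω₀).im = (1 - θ) * (sgnR σ * A₀ / 2) := by
    simp [branchPt, reE]
  refine ⟨by simp [branchPt, reE]; ring, ?_, ?_⟩
  · rw [him, abs_mul, abs_div, abs_mul, abs_of_pos hA₀, abs_of_pos (by linarith : 0 < 1 - θ)]
    rcases sgnR_eq σ with h | h <;> rw [h] <;> norm_num <;> nlinarith
  · rw [him, show sgnR σ * ((1 - θ) * (sgnR σ * A₀ / 2)) =
      (sgnR σ * sgnR σ) * ((1 - θ) * (A₀ / 2)) by ring, sgnR_mul_self, one_mul]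
    exact mul_pos (by linarith) (by linarith)

/-- One-sided limits of `ϰ` at an interior point of the cut. -/
theorem exists_tendsto_kappaFun_cut (hA₀ : 0 < A₀) {ζ : ℂ} (hre : ζ.re = -ω₀ / 2)
    (him : |ζ.im| < A₀ / 2) :
    (∃ k : ℂ, k ≠ 0 ∧ Tendsto (kappaFun A₀ ω₀) (𝓝[{z | z.re < -ω₀ / 2}] ζ) (𝓝 k)) ∧
    (∃ k : ℂ, k ≠ 0 ∧ Tendsto (kappaFun A₀ ω₀) (𝓝[{z | -ω₀ / 2 < z.re}] ζ) (𝓝 k)) := by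
  have hne := sub_branchPt_ne_zero hA₀ (ω₀ := ω₀) (Or.inl him)
  have hpos : 0 < Complex.normSq (ζ - branchPt A₀ ω₀ 1) := Complex.normSq_pos.2 (hne 1)
  have hqre : (branchQuot A₀ ω₀ ζ).re < 0 := by
    rw [branchQuot_re]
    refine div_neg_of_neg_of_pos ?_ hpos
    rw [hre, ← sq_abs ζ.im]
    nlinarith [abs_nonneg ζ.im]
  have hqim : (branchQuot A₀ ω₀ ζ).im = 0 := by
    rw [branchQuot_im, hre]
    simp
    left; right; ring
  have hcont := continuousAt_branchQuot (hne 1)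
  have hev : ∀ᶠ z in 𝓝 ζ, z - branchPt A₀ ω₀ 1 ≠ 0 ∧ branchQuot A₀ ω₀ z ≠ 0 := by
    have h1 : ContinuousAt (fun z => z - branchPt A₀ ω₀ 1) ζ := by fun_prop
    exact (h1.eventually_ne (hne 1)).and (hcont.eventually_ne (branchQuot_ne_zero hne))
  have key : ∀ (s : Set ℂ) (T : Set ℂ) (l : ℂ),
      (∀ z ∈ s, z - branchPt A₀ ω₀ 1 ≠ 0 → branchQuot A₀ ω₀ z ∈ T) →
      Tendsto Complex.log (𝓝[T] (branchQuot A₀ ω₀ ζ)) (𝓝 l) →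
      ∃ k : ℂ, k ≠ 0 ∧ Tendsto (kappaFun A₀ ω₀) (𝓝[s] ζ) (𝓝 k) := by
    intro s T l hsT hl
    refine ⟨Complex.exp (l * (1 / 4)), Complex.exp_ne_zero _, ?_⟩
    have h1 : Tendsto (branchQuot A₀ ω₀) (𝓝[s] ζ) (𝓝[T] (branchQuot A₀ ω₀ ζ)) := by
      refine tendsto_nhdsWithin_iff.2 ⟨hcont.tendsto.mono_left nhdsWithin_le_nhds, ?_⟩
      filter_upwards [nhdsWithin_le_nhds hev, self_mem_nhdsWithin] with z hz hzs
      exact hsT z hzs hz.1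
    have h2 : Tendsto (fun z => Complex.exp (Complex.log (branchQuot A₀ ω₀ z) * (1 / 4)))
        (𝓝[s] ζ) (𝓝 (Complex.exp (l * (1 / 4)))) :=
      (Complex.continuous_exp.tendsto _).comp ((hl.comp h1).mul_const _)
    refine h2.congr' ?_
    filter_upwards [nhdsWithin_le_nhds hev] with z hz
    rw [kappaFun_eq, Complex.cpow_def_of_ne_zero hz.2]
  constructor
  · refine key _ {q | q.im < 0} _ (fun z hz hz1 => ?_)
      (Complex.tendsto_log_nhdsWithin_im_neg_of_re_neg_of_im_zero hqre hqim)
    have hz' : z.re < -ω₀ / 2 := hz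
    simp only [Set.mem_ofPred_eq, branchQuot_im]
    exact div_neg_of_neg_of_pos (mul_neg_of_pos_of_neg hA₀ (by linarith))
      (Complex.normSq_pos.2 hz1)
  · refine key _ {q | 0 ≤ q.im} _ (fun z hz hz1 => ?_)
      (Complex.tendsto_log_nhdsWithin_im_nonneg_of_re_neg_of_im_zero hqre hqim)
    have hz' : -ω₀ / 2 < z.re := hz
    simp only [Set.mem_ofPred_eq, branchQuot_im]
    exact (div_pos (mul_pos hA₀ (by linarith)) (Complex.normSq_pos.2 hz1)).le

theorem exists_tendsto_matM0_cut (hA₀ : 0 < A₀) {ζ : ℂ} (hre : ζ.re = -ω₀ / 2)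
    (him : |ζ.im| < A₀ / 2) :
    (∃ B : Mat2, Tendsto (matM0 A₀ ω₀) (𝓝[{z | z.re < -ω₀ / 2}] ζ) (𝓝 B)) ∧
    (∃ B : Mat2, Tendsto (matM0 A₀ ω₀) (𝓝[{z | -ω₀ / 2 < z.re}] ζ) (𝓝 B)) := by
  obtain ⟨⟨k, hk, h1⟩, k', hk', h2⟩ := exists_tendsto_kappaFun_cut hA₀ hre him
  exact ⟨⟨_, tendsto_matM0 hk h1⟩, _, tendsto_matM0 hk' h2⟩

/-- `M₀` is bounded near every point but the branch points, since `|ϰ|⁴` is continuous there. -/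
theorem boundedNear_matM0 (D : Set ℂ) {z₀ : ℂ} (hz : ∀ σ, z₀ - branchPt A₀ ω₀ σ ≠ 0) :
    BoundedNear (matM0 A₀ ω₀) D z₀ := by
  have hc : ContinuousAt (fun z => ‖branchQuot A₀ ω₀ z‖ ^ (1 / 4 : ℝ)) z₀ :=
    (continuousAt_branchQuot (hz 1)).norm.rpow_const (Or.inr (by norm_num))
  have hq0 : 0 < ‖branchQuot A₀ ω₀ z₀‖ ^ (1 / 4 : ℝ) :=
    Real.rpow_pos_of_pos (norm_pos_iff.2 (branchQuot_ne_zero hz)) _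
  set p := ‖branchQuot A₀ ω₀ z₀‖ ^ (1 / 4 : ℝ)
  obtain ⟨r, hr, h⟩ := Metric.eventually_nhds_iff.1 (hc.eventually
    (Ioo_mem_nhds (by linarith : p / 2 < p) (by linarith : p < p + 1)))
  refine ⟨r, (p + 1) + (p / 2)⁻¹, hr, fun z _ hzr => ?_⟩
  obtain ⟨h1, h2⟩ := h (by simpa [dist_eq_norm] using hzr)
  have hκ : ‖kappaFun A₀ ω₀ z‖ = ‖branchQuot A₀ ω₀ z‖ ^ (1 / 4 : ℝ) := by
    rw [kappaFun_eq, ← Complex.norm_cpow_real]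
    norm_num
  rw [← hκ] at h1 h2
  have h3 : ‖(kappaFun A₀ ω₀ z)⁻¹‖ ≤ (p / 2)⁻¹ := by
    rw [norm_inv]
    exact inv_anti₀ (by positivity) h1.le
  have hb : ∀ c : ℂ, ‖c‖ ≤ (p + 1) + (p / 2)⁻¹ → ‖c / 2‖ ≤ (p + 1) + (p / 2)⁻¹ := by
    intro c hc
    rw [norm_div, Complex.norm_ofNat]
    have : 0 ≤ ‖c‖ := norm_nonneg c
    linarith
  have hadd : ‖kappaFun A₀ ω₀ z + (kappaFun A₀ ω₀ z)⁻¹‖ ≤ (p + 1) + (p / 2)⁻¹ :=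
    (norm_add_le _ _).trans (add_le_add h2.le h3)
  have hsub : ‖kappaFun A₀ ω₀ z - (kappaFun A₀ ω₀ z)⁻¹‖ ≤ (p + 1) + (p / 2)⁻¹ :=
    (norm_sub_le _ _).trans (add_le_add h2.le h3)
  refine Mat2.norm_le_of_entries fun i j => ?_
  fin_cases i <;> fin_cases j
  · exact hb _ hadd
  · exact hb _ hsub
  · exact hb _ hsub
  · exact hb _ hadd

/-- The logarithm of a quotient whose two terms differ by a positive number is the difference of
the logarithms. -/
theorem log_add_div (v : ℂ) (hv : v ∈ Complex.slitPlane) {c : ℝ} (hc : 0 < c) :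
    Complex.log ((v + c) / v) = Complex.log (v + c) - Complex.log v ∧
    Complex.log (v / (v + c)) = Complex.log v - Complex.log (v + c) ∧ v + c ≠ 0 := by
  have hv0 : v ≠ 0 := Complex.slitPlane_ne_zero hv
  have him : (v + c).im = v.im := by simp
  -- both arguments lie in `(-π, π)` and have the same sign
  have harg : |(v + c).arg - v.arg| < Real.pi ∧ v + c ≠ 0 := by
    rcases lt_trichotomy v.im 0 with h | h | h
    · have h1 := Complex.arg_neg_iff.2 h
      have h2 := Complex.arg_neg_iff.2 (him ▸ h)
      have h3 := Complex.neg_pi_lt_arg v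
      have h4 := Complex.neg_pi_lt_arg (v + c)
      refine ⟨abs_lt.2 ⟨by linarith, by linarith⟩, fun h0 => ?_⟩
      rw [h0] at him
      simp [← him] at h
    · have hre : 0 < v.re := by
        rcases Complex.mem_slitPlane_iff.1 hv with h' | h'
        · exact h'
        · exact absurd h h'
      have h1 : v.arg = 0 := Complex.arg_eq_zero_iff.2 ⟨hre.le, h⟩
      have h2 : (v + c).arg = 0 :=
        Complex.arg_eq_zero_iff.2 ⟨by simp; linarith, by rw [him, h]⟩
      refine ⟨by rw [h1, h2]; simpa using Real.pi_pos, fun h0 => ?_⟩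
      have := congrArg Complex.re h0
      simp at this
      linarith
    · have h1 := Complex.arg_nonneg_iff.2 h.le
      have h2 := Complex.arg_nonneg_iff.2 (him ▸ h.le)
      have h3 := Complex.arg_lt_pi_iff.2 (Or.inr h.ne')
      have h4 := Complex.arg_lt_pi_iff.2 (Or.inr (him ▸ h.ne' : (v + c).im ≠ 0))
      refine ⟨abs_lt.2 ⟨by linarith, by linarith⟩, fun h0 => ?_⟩
      rw [h0] at him
      simp [← him] at h
  obtain ⟨h1, h2⟩ := abs_lt.1 harg.1
  have key : ∀ a b : ℂ, a ≠ 0 → b ≠ 0 → -Real.pi < a.arg - b.arg → a.arg - b.arg < Real.pi →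
      Complex.log (a / b) = Complex.log a - Complex.log b := by
    intro a b ha hb h1 h2
    have : a / b = Complex.exp (Complex.log a - Complex.log b) := by
      rw [Complex.exp_sub, Complex.exp_log ha, Complex.exp_log hb]
    rw [this, Complex.log_exp] <;> simp only [Complex.sub_im, Complex.log_im]
    · exact h1
    · exact h2.le
  exact ⟨key _ _ harg.2 hv0 h1 h2, key _ _ hv0 harg.2 (by linarith) (by linarith), harg.2⟩

/-- The singularity of `M₀` at the branch points. -/
theorem tendsto_matM0_branchPt (hA₀ : 0 < A₀) (σ : ℤˣ) :
    Tendsto (fun z => ((-((sgnR σ : ℂ) * Complex.I) * (z - branchPt A₀ ω₀ σ)) ^ (1 / 4 : ℂ)) •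
        matM0 A₀ ω₀ z) (𝓝[(cutSeg A₀ ω₀ σ)ᶜ] (branchPt A₀ ω₀ σ))
      (𝓝 ((Complex.exp (Complex.log (A₀ : ℂ) * (1 / 4)) / 2) •
        !![1, (sgnR σ : ℂ); (sgnR σ : ℂ), 1])) := by
  set v : ℂ → ℂ := fun z => -((sgnR σ : ℂ) * Complex.I) * (z - branchPt A₀ ω₀ σ) with hv
  have hvre : ∀ z, (v z).re = sgnR σ * z.im - A₀ / 2 := by
    intro z
    have : sgnR σ * (sgnR σ * A₀ / 2) = A₀ / 2 := by
      rw [← mul_div_assoc, ← mul_assoc, sgnR_mul_self, one_mul]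
    simp [hv, branchPt]
    linarith
  have hvim : ∀ z, (v z).im = -(sgnR σ * (z.re + ω₀ / 2)) := by
    intro z
    simp only [hv, branchPt, Complex.mul_im, Complex.neg_re, Complex.neg_im, Complex.sub_im,
      Complex.sub_re, Complex.mul_re, Complex.ofReal_re, Complex.ofReal_im, Complex.I_re,
      Complex.I_im]
    ring
  have hcont : Continuous v := by fun_prop
  have hv0 : v (branchPt A₀ ω₀ σ) = 0 := by simp [hv]
  have hlim : Tendsto v (𝓝[(cutSeg A₀ ω₀ σ)ᶜ] (branchPt A₀ ω₀ σ)) (𝓝 0) := by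
    have := (hcont.tendsto (branchPt A₀ ω₀ σ)).mono_left
      (nhdsWithin_le_nhds (s := (cutSeg A₀ ω₀ σ)ᶜ))
    rwa [hv0] at this
  have hslit : ∀ᶠ z in 𝓝[(cutSeg A₀ ω₀ σ)ᶜ] (branchPt A₀ ω₀ σ), v z ∈ Complex.slitPlane := by
    have h1 : ∀ᶠ z in 𝓝[(cutSeg A₀ ω₀ σ)ᶜ] (branchPt A₀ ω₀ σ), ‖v z‖ < A₀ / 2 :=
      hlim.norm.eventually (gt_mem_nhds (by simpa using hA₀))
    filter_upwards [h1, self_mem_nhdsWithin] with z hz1 hz2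
    rw [Complex.mem_slitPlane_iff_not_le_zero]
    intro hle
    obtain ⟨hre, him⟩ := Complex.le_def.1 hle
    rw [hvre, Complex.zero_re] at hre
    rw [hvim, Complex.zero_im, neg_eq_zero, mul_eq_zero_iff_left (sgnR_ne_zero σ)] at him
    have hre2 := (Complex.abs_re_le_norm (v z)).trans_lt hz1
    rw [hvre] at hre2
    have hnn : 0 ≤ sgnR σ * z.im := by linarith [(abs_lt.1 hre2).1]
    refine hz2 (mem_cutSeg hA₀ ⟨by linarith, ?_⟩ hnn)
    have : |z.im| = |sgnR σ * z.im| := by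
      rw [abs_mul]
      rcases sgnR_eq σ with h | h <;> simp [h]
    rw [this, abs_of_nonneg hnn]
    linarith
  -- the fourth root of `(v + A₀) / v`
  set p : ℂ → ℂ := fun z =>
    Complex.exp ((Complex.log (v z + A₀) - Complex.log (v z)) * (1 / 4)) with hp
  have hM : ∀ z, v z ∈ Complex.slitPlane → matM0 A₀ ω₀ z =
      !![(p z + (p z)⁻¹) / 2, sgnR σ * ((p z - (p z)⁻¹) / 2);
        sgnR σ * ((p z - (p z)⁻¹) / 2), (p z + (p z)⁻¹) / 2] := by
    intro z hz
    obtain ⟨hl1, hl2, hne⟩ := log_add_div (v z) hz hA₀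
    have hvne : v z ≠ 0 := Complex.slitPlane_ne_zero hz
    rcases Int.units_eq_one_or σ with rfl | rfl
    · have hva : v z + A₀ = -Complex.I * (z - branchPt A₀ ω₀ (-1)) := by
        apply Complex.ext <;> simp [hv, branchPt, sgnR_one, sgnR_neg_one]; ring
      have hvb : v z = -Complex.I * (z - branchPt A₀ ω₀ 1) := by simp [hv, sgnR_one]
      have hq : branchQuot A₀ ω₀ z = (v z + A₀) / v z := by
        rw [hva, hvb, branchQuot, mul_div_mul_left _ _ (neg_ne_zero.2 Complex.I_ne_zero)]
      have hκ : kappaFun A₀ ω₀ z = p z := by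
        rw [kappaFun_eq, hq, Complex.cpow_def_of_ne_zero (div_ne_zero hne hvne), hl1]
      rw [matM0_eq, hκ, sgnR_one]
      simp
    · have hva : v z + A₀ = Complex.I * (z - branchPt A₀ ω₀ 1) := by
        apply Complex.ext <;> simp [hv, branchPt, sgnR_one, sgnR_neg_one]; ring
      have hvb : v z = Complex.I * (z - branchPt A₀ ω₀ (-1)) := by simp [hv, sgnR_neg_one]
      have hq : branchQuot A₀ ω₀ z = v z / (v z + A₀) := by
        rw [hva, hvb, branchQuot, mul_div_mul_left _ _ Complex.I_ne_zero]
      have hκ : kappaFun A₀ ω₀ z = (p z)⁻¹ := by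
        rw [kappaFun_eq, hq, Complex.cpow_def_of_ne_zero (div_ne_zero hvne hne), hl2, hp,
          ← Complex.exp_neg]
        ring_nf
      rw [matM0_eq, hκ, sgnR_neg_one, inv_inv]
      ext i j
      fin_cases i <;> fin_cases j <;> simp <;> ring
  have hlog : Tendsto (fun z => Complex.exp (Complex.log (v z + A₀) * (1 / 4)))
      (𝓝[(cutSeg A₀ ω₀ σ)ᶜ] (branchPt A₀ ω₀ σ))
      (𝓝 (Complex.exp (Complex.log (A₀ : ℂ) * (1 / 4)))) := by
    have h1 := hlim.add_const (A₀ : ℂ)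
    rw [zero_add] at h1
    exact (Complex.continuous_exp.tendsto _).comp
      ((h1.clog (Complex.ofReal_mem_slitPlane.2 hA₀)).mul_const _)
  have hroot : Tendsto (fun z => v z ^ (1 / 2 : ℂ))
      (𝓝[(cutSeg A₀ ω₀ σ)ᶜ] (branchPt A₀ ω₀ σ)) (𝓝 0) := by
    rw [tendsto_zero_iff_norm_tendsto_zero]
    have h1 : Tendsto (fun z => ‖v z‖ ^ (1 / 2 : ℝ))
        (𝓝[(cutSeg A₀ ω₀ σ)ᶜ] (branchPt A₀ ω₀ σ)) (𝓝 0) := by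
      have := (hlim.norm).rpow_const (p := 1 / 2) (Or.inr (by norm_num))
      simpa using! this
    refine h1.congr fun z => ?_
    rw [← Complex.norm_cpow_real]
    norm_num
  set L := Complex.exp (Complex.log (A₀ : ℂ) * (1 / 4)) with hL
  have h1 : Tendsto (fun z => v z ^ (1 / 4 : ℂ) * p z)
      (𝓝[(cutSeg A₀ ω₀ σ)ᶜ] (branchPt A₀ ω₀ σ)) (𝓝 L) := by
    refine hlog.congr' ?_
    filter_upwards [hslit] with z hz
    rw [Complex.cpow_def_of_ne_zero (Complex.slitPlane_ne_zero hz), hp, ← Complex.exp_add]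
    ring_nf
  have h2 : Tendsto (fun z => v z ^ (1 / 4 : ℂ) * (p z)⁻¹)
      (𝓝[(cutSeg A₀ ω₀ σ)ᶜ] (branchPt A₀ ω₀ σ)) (𝓝 0) := by
    have h3 := hroot.mul (hlog.inv₀ (Complex.exp_ne_zero _))
    rw [zero_mul] at h3
    refine h3.congr' ?_
    filter_upwards [hslit] with z hz
    rw [Complex.cpow_def_of_ne_zero (Complex.slitPlane_ne_zero hz),
      Complex.cpow_def_of_ne_zero (Complex.slitPlane_ne_zero hz), hp, ← Complex.exp_neg,
      ← Complex.exp_neg, ← Complex.exp_add, ← Complex.exp_add]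
    ring_nf
  have hd : Tendsto (fun z => v z ^ (1 / 4 : ℂ) * ((p z + (p z)⁻¹) / 2))
      (𝓝[(cutSeg A₀ ω₀ σ)ᶜ] (branchPt A₀ ω₀ σ)) (𝓝 (L / 2 * 1)) := by
    have := (h1.add h2).div_const 2
    rw [add_zero] at this
    rw [mul_one]
    exact this.congr fun z => by ring
  have ho : Tendsto (fun z => v z ^ (1 / 4 : ℂ) * (sgnR σ * ((p z - (p z)⁻¹) / 2)))
      (𝓝[(cutSeg A₀ ω₀ σ)ᶜ] (branchPt A₀ ω₀ σ)) (𝓝 (L / 2 * sgnR σ)) := by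
    have := ((h1.sub h2).div_const 2).mul_const (sgnR σ : ℂ)
    rw [sub_zero] at this
    exact this.congr fun z => by ring
  have hmat : Tendsto (fun z => v z ^ (1 / 4 : ℂ) •
      !![(p z + (p z)⁻¹) / 2, sgnR σ * ((p z - (p z)⁻¹) / 2);
        sgnR σ * ((p z - (p z)⁻¹) / 2), (p z + (p z)⁻¹) / 2])
      (𝓝[(cutSeg A₀ ω₀ σ)ᶜ] (branchPt A₀ ω₀ σ))
      (𝓝 ((L / 2) • !![1, (sgnR σ : ℂ); (sgnR σ : ℂ), 1])) := by
    refine tendsto_pi_nhds.2 fun i => tendsto_pi_nhds.2 fun j => ?_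
    fin_cases i <;> fin_cases j
    · exact hd
    · exact ho
    · exact ho
    · exact hd
  refine hmat.congr' ?_
  filter_upwards [hslit] with z hz
  rw [hM z hz]

theorem isBigO_kappaFun_sub_one :
    (fun z => kappaFun A₀ ω₀ z - 1) =O[Bornology.cobounded ℂ] (fun z : ℂ => z⁻¹) ∧
    (fun z => (kappaFun A₀ ω₀ z)⁻¹ - 1) =O[Bornology.cobounded ℂ] (fun z : ℂ => z⁻¹) := by
  have hinv : Tendsto (fun z : ℂ => (z - branchPt A₀ ω₀ 1)⁻¹) (Bornology.cobounded ℂ) (𝓝 0) :=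
    tendsto_inv₀_cobounded.comp (by simp)
  have hbig : (fun z : ℂ => (z - branchPt A₀ ω₀ 1)⁻¹) =O[Bornology.cobounded ℂ]
      (fun z : ℂ => z⁻¹) := by
    refine IsBigO.of_bound 2 ?_
    filter_upwards [tendsto_norm_cobounded_atTop.eventually
      (eventually_ge_atTop (2 * ‖branchPt A₀ ω₀ 1‖ + 1))] with z hz
    have h0 : 0 ≤ ‖branchPt A₀ ω₀ 1‖ := norm_nonneg _
    have h1 : ‖z‖ / 2 ≤ ‖z - branchPt A₀ ω₀ 1‖ := by
      have := norm_sub_norm_le z (branchPt A₀ ω₀ 1)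
      linarith
    rw [norm_inv, norm_inv]
    calc ‖z - branchPt A₀ ω₀ 1‖⁻¹ ≤ (‖z‖ / 2)⁻¹ := inv_anti₀ (by linarith) h1
      _ = 2 * ‖z‖⁻¹ := by rw [inv_div]; ring
  have hq : ∀ᶠ z in Bornology.cobounded ℂ, branchQuot A₀ ω₀ z - 1 =
      (branchPt A₀ ω₀ 1 - branchPt A₀ ω₀ (-1)) * (z - branchPt A₀ ω₀ 1)⁻¹ := by
    filter_upwards [tendsto_norm_cobounded_atTop.eventually
      (eventually_gt_atTop ‖branchPt A₀ ω₀ 1‖)] with z hz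
    have hne : z - branchPt A₀ ω₀ 1 ≠ 0 := by
      rintro h
      rw [sub_eq_zero] at h
      rw [h] at hz
      exact lt_irrefl _ hz
    rw [branchQuot]
    field_simp
    ring
  have hqO : (fun z => branchQuot A₀ ω₀ z - 1) =O[Bornology.cobounded ℂ] (fun z : ℂ => z⁻¹) :=
    (hbig.const_mul_left _).congr' (hq.mono fun z hz => hz.symm) EventuallyEq.rfl
  have hqlim : Tendsto (branchQuot A₀ ω₀) (Bornology.cobounded ℂ) (𝓝 1) := by
    have := (hinv.const_mul (branchPt A₀ ω₀ 1 - branchPt A₀ ω₀ (-1))).const_add 1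
    rw [mul_zero, add_zero] at this
    refine this.congr' ?_
    filter_upwards [hq] with z hz
    rw [← hz]
    ring
  have hd : HasDerivAt (fun q : ℂ => q ^ (1 / 4 : ℂ)) _ 1 :=
    (hasDerivAt_id (1 : ℂ)).cpow_const (c := 1 / 4) Complex.one_mem_slitPlane
  have hd2 := hd.inv (by simp)
  constructor
  · have := (hd.isBigO_sub.comp_tendsto hqlim).trans hqO
    simpa [Function.comp_def, kappaFun_eq] using this
  · have := (hd2.isBigO_sub.comp_tendsto hqlim).trans hqO
    simpa [Function.comp_def, kappaFun_eq] using this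

theorem isBigO_matM0_sub_one :
    (fun z => matM0 A₀ ω₀ z - 1) =O[Bornology.cobounded ℂ] (fun z : ℂ => z⁻¹) := by
  obtain ⟨h1, h2⟩ := isBigO_kappaFun_sub_one (A₀ := A₀) (ω₀ := ω₀)
  have ha := (h1.add h2).const_mul_left (1 / 2)
  have hb := (h1.sub h2).const_mul_left (1 / 2)
  refine isBigO_pi.2 fun i => isBigO_pi.2 fun j => ?_
  fin_cases i <;> fin_cases j
  · exact ha.congr_left fun z => by simp [matM0_eq]; ring
  · exact hb.congr_left fun z => by simp [matM0_eq]; ring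
  · exact hb.congr_left fun z => by simp [matM0_eq]; ring
  · exact ha.congr_left fun z => by simp [matM0_eq]; ring

/-- `M₀` diagonalizes the matrix of the `t`-equation for a plane wave, in the rotating frame. -/
theorem laxMat_mul_matM0 {z : ℂ} (hz : ∀ σ, z - branchPt A₀ ω₀ σ ≠ 0) :
    laxMat (A₀ : ℂ) (z - reE ω₀) * matM0 A₀ ω₀ z =
      matM0 A₀ ω₀ z * (-(Complex.I * wFun A₀ ω₀ z) • sigma3) := by
  have hκ := kappaFun_ne_zero hz
  have h4 := kappaFun_pow_four (A₀ := A₀) (ω₀ := ω₀) z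
  rw [branchQuot, eq_div_iff (hz 1)] at h4
  have hE : branchPt A₀ ω₀ 1 = reE ω₀ + Complex.I * (A₀ / 2) := by
    apply Complex.ext <;> simp [branchPt, reE, sgnR_one]
  have hE' : branchPt A₀ ω₀ (-1) = reE ω₀ - Complex.I * (A₀ / 2) := by
    apply Complex.ext <;> simp [branchPt, reE, sgnR_neg_one]
    ring
  rw [hE, hE'] at h4
  rw [wFun, hE, matM0_eq]
  set k := kappaFun A₀ ω₀ z
  set u := z - reE ω₀ with hu
  have hz' : z = u + reE ω₀ := by rw [hu]; ring
  rw [hz'] at h4 ⊢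
  have hkk : k * k⁻¹ = 1 := mul_inv_cancel₀ hκ
  have h5 : k⁻¹ * (u + Complex.I * (A₀ / 2)) = k ^ 3 * (u - Complex.I * (A₀ / 2)) := by
    linear_combination (-k⁻¹) * h4 + k ^ 3 * (u - Complex.I * (A₀ / 2)) * hkk
  have hI := Complex.I_sq
  have hu2 : u + reE ω₀ - (reE ω₀ + Complex.I * (A₀ / 2)) = u - Complex.I * (A₀ / 2) := by ring
  rw [hu2]
  ext i j
  fin_cases i <;> fin_cases j <;>
    simp only [laxMat, sigma3, Matrix.mul_apply, Fin.sum_univ_two, Complex.conj_ofReal]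
  · simp
    linear_combination (-(Complex.I / 2)) * h5 +
      (Complex.I * (u - Complex.I * (A₀ / 2)) * k / 2) * hkk + (A₀ / 4 * k⁻¹ - A₀ / 4 * k) * hI
  · simp
    linear_combination (Complex.I / 2) * h5 +
      (Complex.I * (u - Complex.I * (A₀ / 2)) * k / 2) * hkk + (-A₀ / 4 * k⁻¹ - A₀ / 4 * k) * hI
  · simp
    linear_combination (-(Complex.I / 2)) * h5 -
      (Complex.I * (u - Complex.I * (A₀ / 2)) * k / 2) * hkk - (-A₀ / 4 * k⁻¹ - A₀ / 4 * k) * hI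
  · simp
    linear_combination (Complex.I / 2) * h5 -
      (Complex.I * (u - Complex.I * (A₀ / 2)) * k / 2) * hkk - (A₀ / 4 * k⁻¹ - A₀ / 4 * k) * hI

/-- Passage to the rotating frame, in which the plane wave at the boundary is constant. -/
theorem laxMat_mul_expSigma3 (t : ℝ) (z : ℂ) :
    laxMat (A₀ * Complex.exp (Complex.I * ω₀ * t)) z * expSigma3 (-(Complex.I * reE ω₀ * t)) =
      (-(Complex.I * reE ω₀) • sigma3) * expSigma3 (-(Complex.I * reE ω₀ * t)) +
        expSigma3 (-(Complex.I * reE ω₀ * t)) * laxMat (A₀ : ℂ) (z - reE ω₀) := by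
  have h1 : Complex.exp (Complex.I * ω₀ * t) =
      Complex.exp (-(Complex.I * reE ω₀ * t)) * Complex.exp (-(Complex.I * reE ω₀ * t)) := by
    rw [← Complex.exp_add]
    congr 1
    simp only [reE]
    push_cast
    ring
  have h2 : conj (Complex.exp (Complex.I * ω₀ * t)) =
      Complex.exp (Complex.I * reE ω₀ * t) * Complex.exp (Complex.I * reE ω₀ * t) := by
    rw [← Complex.exp_add, ← Complex.exp_conj]
    congr 1
    simp only [reE, map_mul, Complex.conj_I, Complex.conj_ofReal]
    push_cast
    ring
  have h3 : Complex.exp (-(Complex.I * reE ω₀ * t)) * Complex.exp (Complex.I * reE ω₀ * t) = 1 := by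
    rw [← Complex.exp_add]
    simp
  generalize Complex.exp (Complex.I * ω₀ * t) = e at h1 h2 ⊢
  ext i j
  fin_cases i <;> fin_cases j <;>
    simp only [laxMat, sigma3, expSigma3, Matrix.mul_apply, Fin.sum_univ_two, Complex.conj_ofReal,
      neg_neg, map_mul]
  · simp
    ring
  · simp
    linear_combination (A₀ / 2 * Complex.exp (Complex.I * reE ω₀ * t)) * h1 +
      (A₀ / 2 * Complex.exp (-(Complex.I * reE ω₀ * t))) * h3
  · simp
    linear_combination (A₀ / 2 * Complex.exp (-(Complex.I * reE ω₀ * t))) * h2 +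
      (A₀ / 2 * Complex.exp (Complex.I * reE ω₀ * t)) * h3
  · simp
    ring

/-- The background solution for a complex spectral parameter; on the real line it is `matPhi` by
definition. -/
noncomputable def matPhiC (A₀ ω₀ t : ℝ) (z : ℂ) : Mat2 :=
  expSigma3 (-(Complex.I * reE ω₀ * (t : ℂ))) * matM0 A₀ ω₀ z *
    expSigma3 (-(Complex.I * wFun A₀ ω₀ z * (t : ℂ)))

/-- The background solution satisfies the `t`-equation with the plane wave as field. -/
theorem hasDerivAt_matPhiC {z : ℂ} (hz : ∀ σ, z - branchPt A₀ ω₀ σ ≠ 0) (t : ℝ) :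
    HasDerivAt (fun τ => matPhiC A₀ ω₀ τ z)
      (laxMat (A₀ * Complex.exp (Complex.I * ω₀ * t)) z * matPhiC A₀ ω₀ t z) t := by
  have hlin : ∀ c : ℂ, HasDerivAt (fun τ : ℝ => -(c * (τ : ℂ))) (-c) t := by
    intro c
    simpa using! ((Complex.ofRealCLM.hasDerivAt (x := t)).const_mul c).neg
  have h1 := ((hlin (Complex.I * reE ω₀)).expSigma3.mat2_mul_const (matM0 A₀ ω₀ z)).mat2_mul
    (hlin (Complex.I * wFun A₀ ω₀ z)).expSigma3
  convert! h1 using 1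
  simp only [matPhiC, ← Matrix.mul_assoc, laxMat_mul_expSigma3]
  have h2 := laxMat_mul_matM0 hz
  rw [add_mul, add_mul, Matrix.mul_assoc (expSigma3 _) (laxMat _ _), h2, ← Matrix.mul_assoc]

theorem wFun_sq {z : ℂ} (hz : ∀ σ, z - branchPt A₀ ω₀ σ ≠ 0) :
    (wFun A₀ ω₀ z - (z - reE ω₀)) * (wFun A₀ ω₀ z + (z - reE ω₀)) = ((A₀ / 2 : ℝ) : ℂ) ^ 2 := by
  have h4 := kappaFun_pow_four (A₀ := A₀) (ω₀ := ω₀) z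
  rw [branchQuot, eq_div_iff (hz 1)] at h4
  have h1 : (z - branchPt A₀ ω₀ 1) * (z - branchPt A₀ ω₀ (-1)) =
      (z - reE ω₀) ^ 2 + ((A₀ / 2 : ℝ) : ℂ) ^ 2 := by
    have hE : branchPt A₀ ω₀ 1 = reE ω₀ + Complex.I * (A₀ / 2 : ℝ) := by
      apply Complex.ext <;> simp [branchPt, reE, sgnR_one]
    have hE' : branchPt A₀ ω₀ (-1) = reE ω₀ - Complex.I * (A₀ / 2 : ℝ) := by
      apply Complex.ext <;> simp [branchPt, reE, sgnR_neg_one]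
      ring
    rw [hE, hE']
    linear_combination (-((A₀ / 2 : ℝ) : ℂ) ^ 2) * Complex.I_sq
  rw [wFun]
  linear_combination (z - branchPt A₀ ω₀ 1) * h4 + h1

theorem eventually_sub_branchPt_ne_zero :
    ∀ᶠ z in Bornology.cobounded ℂ, ∀ σ, z - branchPt A₀ ω₀ σ ≠ 0 := by
  filter_upwards [tendsto_norm_cobounded_atTop.eventually (eventually_gt_atTop
    (max ‖branchPt A₀ ω₀ 1‖ ‖branchPt A₀ ω₀ (-1)‖))] with z hz σ h
  rw [sub_eq_zero] at h
  rcases Int.units_eq_one_or σ with rfl | rfl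
  · exact absurd ((le_max_left _ _).trans_lt hz) (by rw [← h]; exact lt_irrefl _)
  · exact absurd ((le_max_right _ _).trans_lt hz) (by rw [← h]; exact lt_irrefl _)

/-- The function `w` is `z - Re E` up to `O(1/z)`: the term of order zero is cancelled by the
factor `exp(-i Re E t σ₃)` of the background solution. -/
theorem isBigO_wFun : (fun z => wFun A₀ ω₀ z - (z - reE ω₀)) =O[Bornology.cobounded ℂ]
    (fun z : ℂ => z⁻¹) := by
  have hinv : Tendsto (fun z : ℂ => z⁻¹) (Bornology.cobounded ℂ) (𝓝 0) := tendsto_inv₀_cobounded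
  have hκ : Tendsto (kappaFun A₀ ω₀) (Bornology.cobounded ℂ) (𝓝 1) := by
    have h1 := (isBigO_kappaFun_sub_one (A₀ := A₀) (ω₀ := ω₀)).1.trans_tendsto hinv
    simpa using h1.add_const 1
  have h1 : Tendsto (fun z => (1 - branchPt A₀ ω₀ 1 * z⁻¹) * kappaFun A₀ ω₀ z ^ 2 +
      (1 - reE ω₀ * z⁻¹)) (Bornology.cobounded ℂ) (𝓝 2) := by
    have := (((hinv.const_mul (branchPt A₀ ω₀ 1)).const_sub 1).mul (hκ.pow 2)).add
      ((hinv.const_mul (reE ω₀)).const_sub 1)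
    norm_num at this
    exact this
  refine IsBigO.of_bound (A₀ / 2 * (A₀ / 2)) ?_
  filter_upwards [eventually_sub_branchPt_ne_zero (A₀ := A₀) (ω₀ := ω₀),
    h1.norm.eventually (lt_mem_nhds (by norm_num : (1 : ℝ) < ‖(2 : ℂ)‖)),
    tendsto_norm_cobounded_atTop.eventually (eventually_gt_atTop 0)] with z hz h2 h3
  have hz0 : z ≠ 0 := norm_pos_iff.1 h3
  have h4 : wFun A₀ ω₀ z + (z - reE ω₀) = z * ((1 - branchPt A₀ ω₀ 1 * z⁻¹) *
      kappaFun A₀ ω₀ z ^ 2 + (1 - reE ω₀ * z⁻¹)) := by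
    rw [wFun]
    field_simp
  have h5 : ‖z‖ ≤ ‖wFun A₀ ω₀ z + (z - reE ω₀)‖ := by
    rw [h4, norm_mul]
    exact le_mul_of_one_le_right h3.le h2.le
  have h6 := congrArg norm (wFun_sq hz)
  rw [norm_mul, norm_pow, Complex.norm_real, Real.norm_eq_abs, sq_abs] at h6
  rw [norm_inv, ← div_eq_mul_inv, le_div_iff₀ h3]
  calc _ ≤ ‖wFun A₀ ω₀ z - (z - reE ω₀)‖ * ‖wFun A₀ ω₀ z + (z - reE ω₀)‖ := by gcongr
    _ = A₀ / 2 * (A₀ / 2) := by rw [h6, sq]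

theorem isBigO_exp_sub_one {l : Filter ℂ} {f : ℂ → ℂ} (hl : l ≤ Bornology.cobounded ℂ)
    (hf : f =O[l] fun z : ℂ => z⁻¹) :
    (fun z => Complex.exp (f z) - 1) =O[l] fun z : ℂ => z⁻¹ := by
  have h0 : Tendsto f l (𝓝 0) := hf.trans_tendsto (tendsto_inv₀_cobounded.mono_left hl)
  have h1 := ((Complex.hasDerivAt_exp 0).isBigO_sub.comp_tendsto h0).trans
    (by simpa [Function.comp_def] using hf)
  simpa [Function.comp_def] using h1

theorem isBigO_inv_one {l : Filter ℂ} (hl : l ≤ Bornology.cobounded ℂ) :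
    (fun z : ℂ => z⁻¹) =O[l] fun _ => (1 : ℂ) :=
  (tendsto_inv₀_cobounded.mono_left hl).isBigO_one ℂ

theorem isBigO_one_of_sub_one {l : Filter ℂ} {f : ℂ → ℂ} (hl : l ≤ Bornology.cobounded ℂ)
    (hf : (fun z => f z - 1) =O[l] fun z : ℂ => z⁻¹) : f =O[l] fun _ => (1 : ℂ) := by
  have := (hf.trans (isBigO_inv_one hl)).add (isBigO_refl (fun _ : ℂ => (1 : ℂ)) l)
  simpa using this

theorem isBigO_mul_sub_one {l : Filter ℂ} {f g : ℂ → ℂ} (hl : l ≤ Bornology.cobounded ℂ)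
    (hf : (fun z => f z - 1) =O[l] fun z : ℂ => z⁻¹)
    (hg : (fun z => g z - 1) =O[l] fun z : ℂ => z⁻¹) :
    (fun z => f z * g z - 1) =O[l] fun z : ℂ => z⁻¹ := by
  have h1 := hf.mul (isBigO_one_of_sub_one hl hg)
  simp only [mul_one] at h1
  exact (h1.add hg).congr_left fun z => by ring

theorem isBigO_mul_of_one {l : Filter ℂ} {f g : ℂ → ℂ}
    (hf : f =O[l] fun _ => (1 : ℂ)) (hg : g =O[l] fun z : ℂ => z⁻¹) :
    (fun z => f z * g z) =O[l] fun z : ℂ => z⁻¹ := by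
  simpa using hf.mul hg

theorem isBigO_matM0_apply (i j : Fin 2) :
    (fun z => matM0 A₀ ω₀ z i j - (1 : Mat2) i j) =O[Bornology.cobounded ℂ] (fun z : ℂ => z⁻¹) :=
  isBigO_pi.1 (isBigO_pi.1 (isBigO_matM0_sub_one (A₀ := A₀) (ω₀ := ω₀)) i) j

theorem expSigma3_mul_zero (c : ℂ) (M : Mat2) (j : Fin 2) :
    (expSigma3 c * M) 0 j = Complex.exp c * M 0 j := by
  rw [Matrix.mul_apply, Fin.sum_univ_two]
  simp [expSigma3]

theorem expSigma3_mul_one (c : ℂ) (M : Mat2) (j : Fin 2) :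
    (expSigma3 c * M) 1 j = Complex.exp (-c) * M 1 j := by
  rw [Matrix.mul_apply, Fin.sum_univ_two]
  simp [expSigma3]

theorem mul_expSigma3_zero (c : ℂ) (M : Mat2) (i : Fin 2) :
    (M * expSigma3 c) i 0 = M i 0 * Complex.exp c := by
  rw [Matrix.mul_apply, Fin.sum_univ_two]
  simp [expSigma3]

theorem mul_expSigma3_one (c : ℂ) (M : Mat2) (i : Fin 2) :
    (M * expSigma3 c) i 1 = M i 1 * Complex.exp (-c) := by
  rw [Matrix.mul_apply, Fin.sum_univ_two]
  simp [expSigma3]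

/-- The columns of the background solution at infinity. -/
theorem isBigO_matPhiC (t : ℝ) :
    (fun z : ℂ => matPhiC A₀ ω₀ t z 0 0 * Complex.exp (Complex.I * z * t) - 1)
      =O[Bornology.cobounded ℂ] (fun z : ℂ => z⁻¹) ∧
    (fun z : ℂ => matPhiC A₀ ω₀ t z 1 0 * Complex.exp (Complex.I * z * t))
      =O[Bornology.cobounded ℂ] (fun z : ℂ => z⁻¹) ∧
    (fun z : ℂ => matPhiC A₀ ω₀ t z 1 1 * Complex.exp (-(Complex.I * z * t)) - 1)
      =O[Bornology.cobounded ℂ] (fun z : ℂ => z⁻¹) ∧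
    (fun z : ℂ => matPhiC A₀ ω₀ t z 0 1 * Complex.exp (-(Complex.I * z * t)))
      =O[Bornology.cobounded ℂ] (fun z : ℂ => z⁻¹) := by
  have hw := isBigO_wFun (A₀ := A₀) (ω₀ := ω₀)
  have e1 := isBigO_exp_sub_one le_rfl (hw.const_mul_left (-(Complex.I * t)))
  have e2 := isBigO_exp_sub_one le_rfl (hw.const_mul_left (Complex.I * t))
  have m := isBigO_matM0_apply (A₀ := A₀) (ω₀ := ω₀)
  have m10 : (fun z => matM0 A₀ ω₀ z 1 0) =O[Bornology.cobounded ℂ] (fun z : ℂ => z⁻¹) := by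
    simpa using m 1 0
  have m01 : (fun z => matM0 A₀ ω₀ z 0 1) =O[Bornology.cobounded ℂ] (fun z : ℂ => z⁻¹) := by
    simpa using m 0 1
  have m00 : (fun z => matM0 A₀ ω₀ z 0 0 - 1) =O[Bornology.cobounded ℂ] (fun z : ℂ => z⁻¹) := by
    simpa using m 0 0
  have m11 : (fun z => matM0 A₀ ω₀ z 1 1 - 1) =O[Bornology.cobounded ℂ] (fun z : ℂ => z⁻¹) := by
    simpa using m 1 1
  refine ⟨?_, ?_, ?_, ?_⟩
  · refine (isBigO_mul_sub_one le_rfl e1 m00).congr_left fun z => ?_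
    have : Complex.exp (-(Complex.I * t) * (wFun A₀ ω₀ z - (z - reE ω₀))) =
        Complex.exp (-(Complex.I * reE ω₀ * t)) * Complex.exp (-(Complex.I * wFun A₀ ω₀ z * t)) *
          Complex.exp (Complex.I * z * t) := by
      rw [← Complex.exp_add, ← Complex.exp_add]
      congr 1
      ring
    rw [this]
    simp only [matPhiC, expSigma3_mul_zero, mul_expSigma3_zero]
    ring
  · refine ((isBigO_mul_of_one (isBigO_one_of_sub_one le_rfl e1) m10).const_mul_left
      (Complex.exp (2 * Complex.I * reE ω₀ * t))).congr_left fun z => ?_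
    have : Complex.exp (-(Complex.I * t) * (wFun A₀ ω₀ z - (z - reE ω₀))) =
        Complex.exp (-(2 * Complex.I * reE ω₀ * t)) * Complex.exp (Complex.I * reE ω₀ * t) *
          Complex.exp (-(Complex.I * wFun A₀ ω₀ z * t)) * Complex.exp (Complex.I * z * t) := by
      rw [← Complex.exp_add, ← Complex.exp_add, ← Complex.exp_add]
      congr 1
      ring
    have h2 : Complex.exp (2 * Complex.I * reE ω₀ * t) *
        Complex.exp (-(2 * Complex.I * reE ω₀ * t)) = 1 := by
      rw [← Complex.exp_add]
      simp
    rw [this]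
    simp only [matPhiC, expSigma3_mul_one, mul_expSigma3_zero, neg_neg]
    linear_combination (Complex.exp (Complex.I * reE ω₀ * t) * matM0 A₀ ω₀ z 1 0 *
      Complex.exp (-(Complex.I * wFun A₀ ω₀ z * t)) * Complex.exp (Complex.I * z * t)) * h2
  · refine (isBigO_mul_sub_one le_rfl e2 m11).congr_left fun z => ?_
    have : Complex.exp (Complex.I * t * (wFun A₀ ω₀ z - (z - reE ω₀))) =
        Complex.exp (Complex.I * reE ω₀ * t) * Complex.exp (Complex.I * wFun A₀ ω₀ z * t) *
          Complex.exp (-(Complex.I * z * t)) := by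
      rw [← Complex.exp_add, ← Complex.exp_add]
      congr 1
      ring
    rw [this]
    simp only [matPhiC, expSigma3_mul_one, mul_expSigma3_one, neg_neg]
    ring
  · refine ((isBigO_mul_of_one (isBigO_one_of_sub_one le_rfl e2) m01).const_mul_left
      (Complex.exp (-(2 * Complex.I * reE ω₀ * t)))).congr_left fun z => ?_
    have : Complex.exp (Complex.I * t * (wFun A₀ ω₀ z - (z - reE ω₀))) =
        Complex.exp (2 * Complex.I * reE ω₀ * t) * Complex.exp (-(Complex.I * reE ω₀ * t)) *
          Complex.exp (Complex.I * wFun A₀ ω₀ z * t) * Complex.exp (-(Complex.I * z * t)) := by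
      rw [← Complex.exp_add, ← Complex.exp_add, ← Complex.exp_add]
      congr 1
      ring
    have h2 : Complex.exp (2 * Complex.I * reE ω₀ * t) *
        Complex.exp (-(2 * Complex.I * reE ω₀ * t)) = 1 := by
      rw [← Complex.exp_add]
      simp
    rw [this]
    simp only [matPhiC, expSigma3_mul_zero, mul_expSigma3_one, neg_neg]
    linear_combination (Complex.exp (-(Complex.I * reE ω₀ * t)) * matM0 A₀ ω₀ z 0 1 *
      Complex.exp (Complex.I * wFun A₀ ω₀ z * t) * Complex.exp (-(Complex.I * z * t))) * h2

end Background

/-! ### The two systems and their common solutions -/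

section Solutions

variable {A₀ ω₀ : ℝ} {n : ℝ → ℝ} {S : Set (ℝ × ℝ)} {Ef : ℝ → ℝ → ℂ} {ρ : ℝ → ℝ → ℝ → ℂ}
  {N : ℝ → ℝ → ℝ → ℝ} {Λ : EReal}

theorem matU_eq_laxMat (t x lam : ℝ) : matU Ef t x lam = laxMat (Ef t x) lam := by
  ext i j
  fin_cases i <;> fin_cases j <;> simp [matU, laxMat, sigma3, matH]; ring

theorem matH_eq_neg_laxMat (t x : ℝ) (z : ℂ) :
    (Complex.I * z) • sigma3 + matH Ef t x = -laxMat (Ef t x) z := by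
  ext i j
  fin_cases i <;> fin_cases j <;> simp [matH, laxMat, sigma3]; ring

/-- The coefficient `V_±` of the `x^±`-equation for a complex spectral parameter; on the real line
it is `matV` by definition. -/
noncomputable def laxMatX (n : ℝ → ℝ) (Ef : ℝ → ℝ → ℂ) (ρ : ℝ → ℝ → ℝ → ℂ) (N : ℝ → ℝ → ℝ → ℝ)
    (σ : ℤˣ) (t x : ℝ) (z : ℂ) : Mat2 :=
  (Complex.I * z) • sigma3 + matH Ef t x - Complex.I • Matrix.of fun i j =>
    (1 / 4) * cauchyIntegral σ (fun s => matF ρ N t x s i j * (n s : ℂ)) z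

/-- The density matrix at the frequency `s` is a linear function of `s - z` with an integrable
coefficient, whose integral is the derivative of the propagator along the characteristics. -/
theorem IsRegularSolution.exists_matF_eq (h : IsRegularSolution A₀ ω₀ n S Ef ρ N)
    (hn : IsBroadening Λ n) (hSc : IsClosed S) (hS : S ⊆ lightCone) {t x : ℝ} (ht : 0 ≤ t)
    (hx : 0 < x) (z : ℂ) :
    ∃ D : ℝ → Mat2,
      (∀ s : ℝ, matF ρ N t x s =
        blochMat (laxProp (retardedField A₀ ω₀ n ρ) (max (t - x) 0) x z) +
          ((s : ℂ) - z) • D s) ∧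
      Integrable (fun s => n s • D s) ∧
      -(Complex.I / 4) • ((∫ s, n s • D s) *
          laxProp (retardedField A₀ ω₀ n ρ) (max (t - x) 0) x z) =
        laxPropDerivX (retardedField A₀ ω₀ n ρ) (retardedPol n ρ) (max (t - x) 0) x z := by
  have he := h.continuous_retardedField hn hS
  rcases le_total t x with htx | htx
  · rw [max_eq_right (by linarith : t - x ≤ 0)]
    refine ⟨fun _ => 0, fun s => ?_, ?_, by simp [laxPropDerivX]⟩
    · rw [h.matF_eq_neg_sigma3 hn hSc hS ht hx htx, laxProp_zero he]
      simp [blochMat]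
    · simp only [smul_zero]
      exact integrable_zero ℝ (Fin 2 → Fin 2 → ℂ) volume
  · have hτ : 0 ≤ t - x := by linarith
    rw [max_eq_left hτ]
    obtain ⟨hi, heq⟩ := h.integral_blochQuot hn hS hτ hx z
    set X := laxProp (retardedField A₀ ω₀ n ρ) (t - x) x z with hX
    let L : Mat2 →L[ℝ] Mat2 := LinearMap.toContinuousLinearMap
      { toFun := fun M => X * M * X.adjugate
        map_add' := fun M M' => by rw [mul_add, add_mul]
        map_smul' := fun c M => by
          rw [Matrix.mul_smul, Matrix.smul_mul, RingHom.id_apply] }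
    have hL : ∀ s, L (n s • blochQuot A₀ ω₀ n ρ (t - x) x z s) =
        n s • (X * blochQuot A₀ ω₀ n ρ (t - x) x z s * X.adjugate) := fun s => L.map_smul _ _
    refine ⟨fun s => X * blochQuot A₀ ω₀ n ρ (t - x) x z s * X.adjugate, fun s => ?_, ?_, ?_⟩
    · have := h.matF_eq_add_smul hn hSc hS hτ hx z s
      rwa [add_sub_cancel] at this
    · exact (L.integrable_comp hi).congr (Eventually.of_forall hL)
    · have h1 : ∫ s, n s • (X * blochQuot A₀ ω₀ n ρ (t - x) x z s * X.adjugate) =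
          X * (∫ s, n s • blochQuot A₀ ω₀ n ρ (t - x) x z s) * X.adjugate := by
        rw [← integral_congr_ae (Eventually.of_forall hL)]
        exact L.integral_comp_comm hi
      rw [h1, ← heq, Matrix.mul_assoc _ X.adjugate, adjugate_mul_laxProp he, mul_one]

/-- An entry of a matrix, as a continuous linear functional. -/
noncomputable def entryCLM (i j : Fin 2) : Mat2 →L[ℝ] ℂ := LinearMap.toContinuousLinearMap
  { toFun := fun M => M i j
    map_add' := fun _ _ => rfl
    map_smul' := fun _ _ => rfl }

/-- The density matrix depends smoothly on the frequency, so that the principal value of `F n`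
exists where that of `n` does. -/
theorem IsRegularSolution.hasPrincipalValue_matF (h : IsRegularSolution A₀ ω₀ n S Ef ρ N)
    (hn : IsBroadening Λ n) (hSc : IsClosed S) (hS : S ⊆ lightCone) {t x : ℝ} (ht : 0 ≤ t)
    (hx : 0 < x) {lam : ℝ} (hc : ContinuousAt n lam) (i j : Fin 2) :
    HasPrincipalValue (fun s => matF ρ N t x s i j * (n s : ℂ)) lam := by
  obtain ⟨D, hD, hi, -⟩ := h.exists_matF_eq hn hSc hS ht hx lam
  refine ⟨_, tendsto_truncatedCauchy_mul hn.integrable_ofReal (hn.hasPrincipalValue hc)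
    (f := fun s => matF ρ N t x s i j) (d := fun s => D s i j)
    (c := blochMat (laxProp (retardedField A₀ ω₀ n ρ) (max (t - x) 0) x lam) i j) (fun s => ?_)
    ((entryCLM i j).integrable_comp hi)⟩
  simp only [hD s, Matrix.add_apply, Matrix.smul_apply, smul_eq_mul]

/-- The coefficient of the `x^±`-equation applied to the propagator. The Cauchy integral of `F n`
is evaluated by expanding `F` about `z`: the value at `z` contributes the Cauchy integral of `n`,
hence `η`, and the difference quotient contributes the `x`-derivative of the propagator. -/
theorem IsRegularSolution.laxMatX_mul_laxProp (h : IsRegularSolution A₀ ω₀ n S Ef ρ N)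
    (hn : IsBroadening Λ n) (hSc : IsClosed S) (hS : S ⊆ lightCone) {t x : ℝ} (ht : 0 ≤ t)
    (hx : 0 < x) {z : ℂ} (hz : z ∉ jumpSet n) (σ : ℤˣ) :
    laxMatX n Ef ρ N σ t x z * laxProp (retardedField A₀ ω₀ n ρ) (max (t - x) 0) x z =
      -(laxMat (Ef t x) z * laxProp (retardedField A₀ ω₀ n ρ) (max (t - x) 0) x z) +
      laxPropDerivX (retardedField A₀ ω₀ n ρ) (retardedPol n ρ) (max (t - x) 0) x z +
      (Complex.I * (etaFun n σ z - z)) •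
        (laxProp (retardedField A₀ ω₀ n ρ) (max (t - x) 0) x z * sigma3) := by
  obtain ⟨D, hD, hi, hDx⟩ := h.exists_matF_eq hn hSc hS ht hx z
  have he := h.continuous_retardedField hn hS
  have hadj := adjugate_mul_laxProp he (max (t - x) 0) x z
  have hpv : z.im = 0 → HasPrincipalValue (fun s => (n s : ℂ)) z.re := fun him => by
    refine hn.hasPrincipalValue ?_
    by_contra hc
    exact hz ⟨him, hc⟩
  set X := laxProp (retardedField A₀ ω₀ n ρ) (max (t - x) 0) x z
  have hG : (Matrix.of fun i j =>
      (1 / 4) * cauchyIntegral σ (fun s => matF ρ N t x s i j * (n s : ℂ)) z : Mat2) =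
      (1 / 4 : ℂ) • (cauchyIntegral σ (fun s => (n s : ℂ)) z • blochMat X + ∫ s, n s • D s) := by
    ext i j
    have h1 := cauchyIntegral_mul hn.integrable_ofReal hpv σ (f := fun s => matF ρ N t x s i j)
      (c := blochMat X i j) (d := fun s => D s i j)
      (fun s => by simp only [hD s, Matrix.add_apply, Matrix.smul_apply, smul_eq_mul])
      ((entryCLM i j).integrable_comp hi)
    have h2 : ∫ s, (n s : ℂ) * D s i j = (∫ s, n s • D s) i j :=
      (entryCLM i j).integral_comp_comm hi
    simp only [Matrix.of_apply, h1, h2, Matrix.smul_apply, Matrix.add_apply, smul_eq_mul]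
    ring
  have hB : blochMat X * X = -(X * sigma3) := by
    rw [blochMat, neg_mul, Matrix.mul_assoc, hadj, mul_one]
  rw [laxMatX, hG, sub_mul, matH_eq_neg_laxMat, ← hDx, neg_mul, Matrix.smul_mul, Matrix.smul_mul,
    add_mul, Matrix.smul_mul, hB, etaFun]
  simp only [smul_add, smul_neg, smul_smul, neg_smul]
  rw [show z + 1 / 4 * cauchyIntegral σ (fun s => (n s : ℂ)) z - z =
    1 / 4 * cauchyIntegral σ (fun s => (n s : ℂ)) z by ring]
  simp only [← mul_assoc]
  rw [show Complex.I * (1 / 4 : ℂ) = Complex.I / 4 by ring]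
  abel

/-- The solution `Ψ` of the `t`-equation with `Ψ(0, x, z) = I`: the free solution up to the light
cone, continued by the propagator in the retarded time. -/
noncomputable def matPsi (e : ℝ → ℝ → ℂ) (t x : ℝ) (z : ℂ) : Mat2 :=
  laxProp e (max (t - x) 0) x z * expSigma3 (-(Complex.I * z * (min t x : ℝ)))

/-- The common solution `Z_±` of both systems, for a complex spectral parameter. -/
noncomputable def matZ (n : ℝ → ℝ) (e : ℝ → ℝ → ℂ) (σ : ℤˣ) (t x : ℝ) (z : ℂ) : Mat2 :=
  matPsi e t x z * expSigma3 (Complex.I * etaFun n σ z * x)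

theorem hasDerivAt_expSigma3_mul (c : ℂ) (t : ℝ) :
    HasDerivAt (fun τ : ℝ => expSigma3 (c * τ)) ((c • sigma3) * expSigma3 (c * t)) t := by
  have : HasDerivAt (fun τ : ℝ => c * (τ : ℂ)) c t := by
    simpa using! (Complex.ofRealCLM.hasDerivAt (x := t)).const_mul c
  exact this.expSigma3

theorem matPsi_zero_left {e : ℝ → ℝ → ℂ} (he : Continuous fun p : ℝ × ℝ => e p.1 p.2) {x : ℝ}
    (hx : 0 ≤ x) (z : ℂ) : matPsi e 0 x z = 1 := by
  rw [matPsi, max_eq_right (by linarith), min_eq_left hx, laxProp_zero he]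
  simp

theorem det_matPsi {e : ℝ → ℝ → ℂ} (he : Continuous fun p : ℝ × ℝ => e p.1 p.2) (t x : ℝ)
    (z : ℂ) : (matPsi e t x z).det = 1 := by
  rw [matPsi, Matrix.det_mul, det_laxProp he, det_expSigma3, one_mul]

theorem continuous_matPsi {e : ℝ → ℝ → ℂ} (he : Continuous fun p : ℝ × ℝ => e p.1 p.2) :
    Continuous fun q : ℝ × ℝ × ℂ => matPsi e q.1 q.2.1 q.2.2 := by
  refine ((continuous_laxProp he).comp
    (by fun_prop : Continuous fun q : ℝ × ℝ × ℂ => (max (q.1 - q.2.1) 0, q.2.1, q.2.2))).matrix_mul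
    (continuous_expSigma3.comp ?_)
  have : Continuous fun q : ℝ × ℝ × ℂ => min q.1 q.2.1 := by fun_prop
  fun_prop

theorem continuous_matZ {e : ℝ → ℝ → ℂ} (he : Continuous fun p : ℝ × ℝ => e p.1 p.2) (σ : ℤˣ)
    (z : ℂ) : Continuous fun p : ℝ × ℝ => matZ n e σ p.1 p.2 z :=
  ((continuous_matPsi he).comp
    (by fun_prop : Continuous fun p : ℝ × ℝ => (p.1, p.2, z))).matrix_mul
    (continuous_expSigma3.comp (by fun_prop))

theorem det_matZ {e : ℝ → ℝ → ℂ} (he : Continuous fun p : ℝ × ℝ => e p.1 p.2) (σ : ℤˣ) (t x : ℝ)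
    (z : ℂ) : (matZ n e σ t x z).det = 1 := by
  rw [matZ, Matrix.det_mul, det_matPsi he, det_expSigma3, one_mul]

/-- Behind the light cone, in the retarded time `t - x`. -/
theorem matZ_of_ge {e : ℝ → ℝ → ℂ} {t x : ℝ} (hxt : x ≤ t) (σ : ℤˣ) (z : ℂ) :
    matZ n e σ t x z =
      laxProp e (t - x) x z * expSigma3 (Complex.I * (etaFun n σ z - z) * x) := by
  rw [matZ, matPsi, max_eq_left (by linarith), min_eq_right hxt, Matrix.mul_assoc,
    ← expSigma3_add]
  congr 2
  ring

/-- Ahead of the light cone, where the medium is at rest and the solution is explicit. -/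
theorem matZ_of_le {e : ℝ → ℝ → ℂ} (he : Continuous fun p : ℝ × ℝ => e p.1 p.2) {t x : ℝ}
    (htx : t ≤ x) (σ : ℤˣ) (z : ℂ) :
    matZ n e σ t x z =
      expSigma3 (-(Complex.I * z) * t) * expSigma3 (Complex.I * etaFun n σ z * x) := by
  rw [matZ, matPsi, max_eq_right (by linarith), min_eq_left htx, laxProp_zero he, one_mul,
    ← neg_mul]

theorem IsRegularSolution.hasDerivAt_matPsi_t (h : IsRegularSolution A₀ ω₀ n S Ef ρ N)
    (hn : IsBroadening Λ n) (hSc : IsClosed S) (hS : S ⊆ lightCone) {t x : ℝ} (ht : 0 < t)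
    (hx : 0 < x) (htx : t ≠ x) (z : ℂ) :
    HasDerivAt (fun τ => matPsi (retardedField A₀ ω₀ n ρ) τ x z)
      (laxMat (Ef t x) z * matPsi (retardedField A₀ ω₀ n ρ) t x z) t := by
  have he := h.continuous_retardedField hn hS
  rcases htx.lt_or_gt with htx | htx
  · have hΨ : ∀ τ ≤ x, matPsi (retardedField A₀ ω₀ n ρ) τ x z =
        expSigma3 (-(Complex.I * z) * τ) := fun τ hτ => by
      rw [matPsi, max_eq_right (by linarith), min_eq_left hτ, laxProp_zero he, one_mul, neg_mul]
    rw [hΨ t htx.le, h.field_eq_zero hn hSc hS ht.le htx]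
    have h0 : laxMat 0 z = -(Complex.I * z) • sigma3 := by
      ext i j
      fin_cases i <;> fin_cases j <;> simp [laxMat, sigma3]
    rw [h0]
    refine (hasDerivAt_expSigma3_mul (-(Complex.I * z)) t).congr_of_eventuallyEq ?_
    filter_upwards [gt_mem_nhds htx] with τ hτ
    exact hΨ τ (le_of_lt hτ)
  · have hΨ : ∀ τ, x ≤ τ → matPsi (retardedField A₀ ω₀ n ρ) τ x z =
        laxProp (retardedField A₀ ω₀ n ρ) (τ - x) x z *
          expSigma3 (-(Complex.I * z * x)) := fun τ hτ => by
      rw [matPsi, max_eq_left (by linarith), min_eq_right hτ]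
    rw [hΨ t htx.le, h.field_eq hn hSc hS hx.le htx, ← Matrix.mul_assoc]
    refine (((hasDerivAt_laxProp he (t - x) x z).comp_sub_const t x).mat2_mul_const
      _).congr_of_eventuallyEq ?_
    filter_upwards [lt_mem_nhds htx] with τ hτ
    exact hΨ τ (le_of_lt hτ)

theorem IsRegularSolution.hasDerivAt_matZ_t (h : IsRegularSolution A₀ ω₀ n S Ef ρ N)
    (hn : IsBroadening Λ n) (hSc : IsClosed S) (hS : S ⊆ lightCone) {t x : ℝ} (ht : 0 < t)
    (hx : 0 < x) (htx : t ≠ x) (σ : ℤˣ) (z : ℂ) :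
    HasDerivAt (fun τ => matZ n (retardedField A₀ ω₀ n ρ) σ τ x z)
      (laxMat (Ef t x) z * matZ n (retardedField A₀ ω₀ n ρ) σ t x z) t := by
  simp only [matZ, ← Matrix.mul_assoc]
  exact (h.hasDerivAt_matPsi_t hn hSc hS ht hx htx z).mat2_mul_const _

/-- The `x`-derivative of the propagator along a horizontal line `t = const`. -/
theorem IsRegularSolution.hasDerivAt_laxProp_horizontal (h : IsRegularSolution A₀ ω₀ n S Ef ρ N)
    (hn : IsBroadening Λ n) (hS : S ⊆ lightCone) {t x : ℝ} (hx : 0 < x) (z : ℂ) :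
    HasDerivAt (fun y => laxProp (retardedField A₀ ω₀ n ρ) (t - y) y z)
      (-(laxMat (retardedField A₀ ω₀ n ρ (t - x) x) z *
          laxProp (retardedField A₀ ω₀ n ρ) (t - x) x z) +
        laxPropDerivX (retardedField A₀ ω₀ n ρ) (retardedPol n ρ) (t - x) x z) x := by
  have he := h.continuous_retardedField hn hS
  have h1 := (contDiffOn_laxProp he (h.norm_retardedField_sub_le hn hS)
    (fun τ x hx => h.hasDerivAt_retardedField_x hn hS τ hx)
    (fun τ x hx => h.continuousAt_retardedPol hn hS τ hx) z).2 (t - x, x) hx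
  have h2 : HasDerivAt (fun y : ℝ => (t - y, y)) ((-1 : ℝ), (1 : ℝ)) x := by
    have := ((hasDerivAt_id x).const_sub t).prodMk (hasDerivAt_id x)
    simpa using! this
  have h3 := HasFDerivAt.comp_hasDerivAt (f := fun y : ℝ => (t - y, y)) x h1 h2
  convert! h3 using 1
  change _ = (-1 : ℝ) • (_ : Mat2) + (1 : ℝ) • (_ : Mat2)
  rw [neg_one_smul, one_smul]

/-- The factor `exp(i η x σ₃)` in `Z_±` compensates the term with `η` that `V_±` produces on the
propagator. -/
theorem IsRegularSolution.hasDerivAt_matZ_x (h : IsRegularSolution A₀ ω₀ n S Ef ρ N)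
    (hn : IsBroadening Λ n) (hSc : IsClosed S) (hS : S ⊆ lightCone) {t x : ℝ} (ht : 0 ≤ t)
    (hx : 0 < x) (htx : t ≠ x) (σ : ℤˣ) {z : ℂ} (hz : z ∉ jumpSet n) :
    HasDerivAt (fun y => matZ n (retardedField A₀ ω₀ n ρ) σ t y z)
      (laxMatX n Ef ρ N σ t x z * matZ n (retardedField A₀ ω₀ n ρ) σ t x z) x := by
  have he := h.continuous_retardedField hn hS
  have hV := h.laxMatX_mul_laxProp hn hSc hS ht hx hz σ
  rcases htx.lt_or_gt with htx | htx
  · rw [max_eq_right (by linarith : t - x ≤ 0), laxProp_zero he, mul_one,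
      h.field_eq_zero hn hSc hS ht htx] at hV
    have h0 : laxMat 0 z = -((Complex.I * z) • sigma3) := by
      ext i j
      fin_cases i <;> fin_cases j <;> simp [laxMat, sigma3]
    -- ahead of the light cone the coefficient is constant
    have hV' : laxMatX n Ef ρ N σ t x z = (Complex.I * etaFun n σ z) • sigma3 := by
      rw [hV, h0, laxPropDerivX]
      simp only [mul_one, neg_neg, one_mul, intervalIntegral.integral_same, mul_zero, add_zero]
      rw [← add_smul]
      congr 1
      ring
    rw [hV', matZ_of_le he htx.le, Matrix.smul_mul, ← Matrix.mul_assoc, sigma3_mul_expSigma3,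
      Matrix.mul_assoc, ← Matrix.mul_smul, ← Matrix.smul_mul]
    refine ((hasDerivAt_expSigma3_mul (Complex.I * etaFun n σ z) x).mat2_const_mul
      (expSigma3 (-(Complex.I * z) * t))).congr_of_eventuallyEq ?_
    filter_upwards [lt_mem_nhds htx] with y hy
    exact matZ_of_le he (le_of_lt hy) σ z
  · rw [max_eq_left (by linarith : 0 ≤ t - x), h.field_eq hn hSc hS hx.le htx] at hV
    rw [matZ_of_ge htx.le, ← Matrix.mul_assoc, hV]
    have h1 := (h.hasDerivAt_laxProp_horizontal hn hS (t := t) hx z).mat2_mul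
      (hasDerivAt_expSigma3_mul (Complex.I * (etaFun n σ z - z)) x)
    convert! h1.congr_of_eventuallyEq ?_ using 1
    · rw [add_mul, Matrix.smul_mul, Matrix.smul_mul, Matrix.mul_smul, Matrix.mul_assoc _ sigma3]
    · filter_upwards [gt_mem_nhds htx] with y hy
      exact matZ_of_ge (le_of_lt hy) σ z

/-- The `C¹` regularity of the solutions off the light cone. -/
theorem IsRegularSolution.contDiffOn_matZ (h : IsRegularSolution A₀ ω₀ n S Ef ρ N)
    (hn : IsBroadening Λ n) (hSc : IsClosed S) (hS : S ⊆ lightCone) (σ : ℤˣ) {z : ℂ}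
    (hz : z ∉ jumpSet n) (B : Mat2) :
    ContDiffOn ℝ 1 (fun p : ℝ × ℝ => matZ n (retardedField A₀ ω₀ n ρ) σ p.1 p.2 z * B)
      (openQuadrant \ lightCone) := by
  have he := h.continuous_retardedField hn hS
  set e := retardedField A₀ ω₀ n ρ with hedef
  have hsplit : openQuadrant \ lightCone =
      {p : ℝ × ℝ | 0 < p.2 ∧ p.2 < p.1} ∪ {p : ℝ × ℝ | 0 < p.1 ∧ p.1 < p.2} := by
    ext ⟨t, x⟩
    simp only [openQuadrant, lightCone, Set.mem_sdiff, Set.mem_ofPred_eq, Set.mem_union, not_and]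
    constructor
    · rintro ⟨⟨h1, h2⟩, h3⟩
      rcases lt_or_gt_of_ne (h3 h1.le) with h4 | h4
      · exact Or.inr ⟨h1, h4⟩
      · exact Or.inl ⟨h2, h4⟩
    · rintro (⟨h1, h2⟩ | ⟨h1, h2⟩)
      · exact ⟨⟨h1.trans h2, h1⟩, fun _ => h2.ne'⟩
      · exact ⟨⟨h1, h1.trans h2⟩, fun _ => h2.ne⟩
  have ho1 : IsOpen {p : ℝ × ℝ | 0 < p.2 ∧ p.2 < p.1} :=
    (isOpen_lt continuous_const continuous_snd).inter (isOpen_lt continuous_snd continuous_fst)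
  have ho2 : IsOpen {p : ℝ × ℝ | 0 < p.1 ∧ p.1 < p.2} :=
    (isOpen_lt continuous_const continuous_fst).inter (isOpen_lt continuous_fst continuous_snd)
  have hex : Continuous fun p : ℝ × ℝ => expSigma3 (Complex.I * (etaFun n σ z - z) * p.2) :=
    continuous_expSigma3.comp (by fun_prop)
  have hZ := continuous_matZ (n := n) he σ z
  have hder : ∀ p ∈ openQuadrant \ lightCone,
      HasDerivAt (fun t => matZ n e σ t p.2 z * B)
        (laxMat (Ef p.1 p.2) z * matZ n e σ p.1 p.2 z * B) p.1 ∧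
      HasDerivAt (fun x => matZ n e σ p.1 x z * B)
        (laxMatX n Ef ρ N σ p.1 p.2 z * matZ n e σ p.1 p.2 z * B) p.2 := by
    rintro ⟨t, x⟩ ⟨⟨h1, h2⟩, h3⟩
    have htx : t ≠ x := fun heq => h3 ⟨h1.le, heq⟩
    exact ⟨(h.hasDerivAt_matZ_t hn hSc hS h1 h2 htx σ z).mat2_mul_const B,
      (h.hasDerivAt_matZ_x hn hSc hS h1.le h2 htx σ hz).mat2_mul_const B⟩
  rw [hsplit] at hder ⊢
  refine ContDiffOn.union_of_isOpen ?_ ?_ ho1 ho2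
  · refine (contDiffOn_one_of_partials (f := fun t x => matZ n e σ t x z * B)
      (f₁ := fun t x => laxMat (Ef t x) z * matZ n e σ t x z * B)
      (f₂ := fun t x => laxMatX n Ef ρ N σ t x z * matZ n e σ t x z * B) ho1
      (fun p hp => (hder p (Or.inl hp)).1) (fun p hp => (hder p (Or.inl hp)).2) ?_ ?_).1
    · have hc : Continuous fun p : ℝ × ℝ =>
          laxMat (e (p.1 - p.2) p.2) z * matZ n e σ p.1 p.2 z * B :=
        ((continuous_laxMat.comp ((he.comp (by fun_prop :
          Continuous fun p : ℝ × ℝ => (p.1 - p.2, p.2))).prodMk continuous_const)).matrix_mul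
          hZ).matrix_mul continuous_const
      refine hc.continuousOn.congr ?_
      rintro ⟨t, x⟩ ⟨h1, h2⟩
      simp only [h.field_eq hn hSc hS h1.le h2, hedef]
    · have hc : ContinuousOn (fun p : ℝ × ℝ =>
          (-(laxMat (e (p.1 - p.2) p.2) z * laxProp e (p.1 - p.2) p.2 z) +
            laxPropDerivX e (retardedPol n ρ) (p.1 - p.2) p.2 z +
            (Complex.I * (etaFun n σ z - z)) • (laxProp e (p.1 - p.2) p.2 z * sigma3)) *
          expSigma3 (Complex.I * (etaFun n σ z - z) * p.2) * B)
          {p : ℝ × ℝ | 0 < p.2 ∧ p.2 < p.1} := by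
        have hX : Continuous fun p : ℝ × ℝ => laxProp e (p.1 - p.2) p.2 z :=
          (continuous_laxProp he).comp (by fun_prop :
            Continuous fun p : ℝ × ℝ => (p.1 - p.2, p.2, z))
        have hU : Continuous fun p : ℝ × ℝ => laxMat (e (p.1 - p.2) p.2) z :=
          continuous_laxMat.comp ((he.comp (by fun_prop :
            Continuous fun p : ℝ × ℝ => (p.1 - p.2, p.2))).prodMk continuous_const)
        have hXx : ContinuousOn (fun p : ℝ × ℝ =>
            laxPropDerivX e (retardedPol n ρ) (p.1 - p.2) p.2 z)
            {p : ℝ × ℝ | 0 < p.2 ∧ p.2 < p.1} := fun p hp =>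
          (ContinuousAt.comp (f := fun p : ℝ × ℝ => (p.1 - p.2, p.2))
            (continuousAt_laxPropDerivX he
              (fun τ x hx => h.continuousAt_retardedPol hn hS τ hx) z (p.1 - p.2) hp.1)
            (by fun_prop)).continuousWithinAt
        have h1 := ((hU.matrix_mul hX).neg.continuousOn.add hXx).add
          ((hX.matrix_mul continuous_const (B := fun _ => sigma3)).const_smul
            (Complex.I * (etaFun n σ z - z))).continuousOn
        exact (h1.mul hex.continuousOn).mul continuousOn_const
      refine hc.congr ?_
      rintro ⟨t, x⟩ ⟨h1, h2⟩
      have hV := h.laxMatX_mul_laxProp hn hSc hS (h1.trans h2).le h1 hz σ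
      simp only at h1 h2
      rw [max_eq_left (by linarith : 0 ≤ t - x), h.field_eq hn hSc hS h1.le h2] at hV
      simp only [matZ_of_ge h2.le, ← Matrix.mul_assoc]
      rw [hV]
  · refine (contDiffOn_one_of_partials (f := fun t x => matZ n e σ t x z * B)
      (f₁ := fun t x => laxMat (Ef t x) z * matZ n e σ t x z * B)
      (f₂ := fun t x => laxMatX n Ef ρ N σ t x z * matZ n e σ t x z * B) ho2
      (fun p hp => (hder p (Or.inr hp)).1) (fun p hp => (hder p (Or.inr hp)).2) ?_ ?_).1
    · have hc : Continuous fun p : ℝ × ℝ => laxMat 0 z * matZ n e σ p.1 p.2 z * B :=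
        (continuous_const.matrix_mul hZ).matrix_mul continuous_const
      refine hc.continuousOn.congr ?_
      rintro ⟨t, x⟩ ⟨h1, h2⟩
      simp only [h.field_eq_zero hn hSc hS h1.le h2]
    · have hc : Continuous fun p : ℝ × ℝ =>
          (-laxMat 0 z + (Complex.I * (etaFun n σ z - z)) • sigma3) * matZ n e σ p.1 p.2 z * B :=
        (continuous_const.matrix_mul hZ).matrix_mul continuous_const
      refine hc.continuousOn.congr ?_
      rintro ⟨t, x⟩ ⟨h1, h2⟩
      have hV := h.laxMatX_mul_laxProp hn hSc hS h1.le (h1.trans h2) hz σ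
      simp only at h1 h2
      rw [max_eq_right (by linarith : t - x ≤ 0), laxProp_zero he,
        h.field_eq_zero hn hSc hS h1.le h2, laxPropDerivX] at hV
      simp only [mul_one, one_mul, intervalIntegral.integral_same, mul_zero, add_zero] at hV
      simp only [hV]

/-- The background solution in terms of the propagator, by uniqueness for the `t`-equation. -/
theorem IsRegularSolution.matPsi_mul_matM0 (h : IsRegularSolution A₀ ω₀ n S Ef ρ N)
    (hn : IsBroadening Λ n) (hS : S ⊆ lightCone) {t : ℝ} (ht : 0 ≤ t) {z : ℂ}
    (hz : ∀ σ, z - branchPt A₀ ω₀ σ ≠ 0) :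
    matPsi (retardedField A₀ ω₀ n ρ) t 0 z * matM0 A₀ ω₀ z = matPhiC A₀ ω₀ t z := by
  have he := h.continuous_retardedField hn hS
  set e := retardedField A₀ ω₀ n ρ with hedef
  have hΨ : matPsi e t 0 z = laxProp e t 0 z := by
    rw [matPsi, sub_zero, max_eq_left ht, min_eq_right ht]
    simp
  have hΦ : Continuous fun τ => matPhiC A₀ ω₀ τ z :=
    continuous_iff_continuousAt.2 fun τ => (hasDerivAt_matPhiC hz τ).continuousAt
  have key := eq_of_hasDerivAt_zero_Ioo ht
    (f := fun τ => (laxProp e τ 0 z).adjugate * matPhiC A₀ ω₀ τ z)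
    ((continuous_laxProp_fst he 0 z).matrix_adjugate.matrix_mul hΦ).continuousOn
    (fun τ hτ => by
      have h1 := (hasDerivAt_adjugate_laxProp he τ 0 z).mat2_mul (hasDerivAt_matPhiC hz τ)
      rw [hedef, retardedField_zero_right, max_eq_left hτ.1.le] at h1
      convert! h1 using 1
      rw [neg_mul, Matrix.mul_assoc, neg_add_cancel])
  have h0 : matPhiC A₀ ω₀ 0 z = matM0 A₀ ω₀ z := by simp [matPhiC]
  simp only [laxProp_zero he, h0, Matrix.adjugate_one, one_mul] at key
  rw [hΨ, ← key, ← Matrix.mul_assoc, laxProp_mul_adjugate he, one_mul]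

end Solutions

/-! ### Solutions of a singularly perturbed system -/

section Perturbation

/-- Gronwall's inequality for a function that is differentiable in the interior of an interval. -/
theorem le_mul_exp_of_hasDerivAt_le {f f' : ℝ → ℝ} {K L : ℝ} (hf : ContinuousOn f (Set.Icc 0 L))
    (hf' : ∀ s ∈ Set.Ioo 0 L, HasDerivAt f (f' s) s) (hle : ∀ s ∈ Set.Ioo 0 L, f' s ≤ K * f s)
    {s : ℝ} (hs : s ∈ Set.Icc 0 L) : f s ≤ f 0 * Real.exp (K * s) := by
  have hexp : ∀ s, HasDerivAt (fun s : ℝ => Real.exp (-(K * s)))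
      (Real.exp (-(K * s)) * -(K * 1)) s :=
    fun s => (((hasDerivAt_id s).const_mul K).neg).exp
  have hd : ∀ s ∈ Set.Ioo 0 L, HasDerivAt (fun s => f s * Real.exp (-(K * s)))
      (f' s * Real.exp (-(K * s)) + f s * (Real.exp (-(K * s)) * -(K * 1))) s :=
    fun s hs => (hf' s hs).mul (hexp s)
  have hanti : AntitoneOn (fun s => f s * Real.exp (-(K * s))) (Set.Icc 0 L) := by
    refine antitoneOn_of_deriv_nonpos (convex_Icc 0 L)
      (hf.mul (by fun_prop : Continuous fun s : ℝ => Real.exp (-(K * s))).continuousOn) ?_ ?_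
    · rw [interior_Icc]
      exact fun s hs => (hd s hs).differentiableAt.differentiableWithinAt
    · rw [interior_Icc]
      intro s hs
      rw [(hd s hs).deriv]
      have := mul_nonneg (sub_nonneg.2 (hle s hs)) (Real.exp_pos (-(K * s))).le
      linarith
  have h1 := hanti (Set.left_mem_Icc.2 (hs.1.trans hs.2)) hs hs.1
  simp only [mul_zero, neg_zero, Real.exp_zero, mul_one] at h1
  calc f s = f s * Real.exp (-(K * s)) * Real.exp (K * s) := by
        rw [mul_assoc, ← Real.exp_add]
        simp
    _ ≤ f 0 * Real.exp (K * s) := mul_le_mul_of_nonneg_right h1 (Real.exp_pos _).le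

theorem inner_mul_self_left (μ h : ℂ) : inner ℝ h (μ * h) = μ.re * ‖h‖ ^ 2 := by
  rw [Complex.inner, ← Complex.normSq_eq_norm_sq, Complex.normSq_apply]
  simp
  ring

set_option maxHeartbeats 1000000 in
/-- A linear system whose second component has the large coefficient `2 i ζ`, with `Im ζ` bounded
below: a solution that starts near `(1, 0)` stays there. The second component is corrected by
its quasi-static value, after which the squares of the moduli satisfy a differential inequality
that uses the coefficient only through its real part. -/
theorem exists_perturbation_bound (c T : ℝ) (hc : 1 ≤ c) : ∃ C : ℝ, 0 ≤ C ∧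
    ∀ (ε L : ℝ) (ζ : ℂ) (u v A₁₁ A₁₂ A₂₁ A₂₂ q q' : ℝ → ℂ), 0 ≤ L → L ≤ T → 0 < ε → ε ≤ 1 →
      1 ≤ 2 * ε * ‖ζ‖ → -1 ≤ ζ.im →
      ContinuousOn u (Set.Icc 0 L) → ContinuousOn v (Set.Icc 0 L) →
      ContinuousOn q (Set.Icc 0 L) →
      (∀ s ∈ Set.Ioo 0 L, HasDerivAt u (A₁₁ s * u s + A₁₂ s * v s) s) →
      (∀ s ∈ Set.Ioo 0 L,
        HasDerivAt v ((2 * Complex.I * ζ + A₂₂ s) * v s + (q s + A₂₁ s) * u s) s) →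
      (∀ s ∈ Set.Ioo 0 L, HasDerivAt q (q' s) s) →
      (∀ s ∈ Set.Ioo 0 L, ‖A₁₁ s‖ ≤ c * ε ∧ ‖A₁₂ s‖ ≤ c ∧ ‖A₂₁ s‖ ≤ c * ε ∧ ‖A₂₂ s‖ ≤ c ∧
        ‖q' s‖ ≤ c) → (∀ s ∈ Set.Icc 0 L, ‖q s‖ ≤ c) → ‖u 0 - 1‖ ≤ c * ε → ‖v 0‖ ≤ c * ε →
      ∀ s ∈ Set.Icc 0 L, ‖u s - 1‖ ≤ C * ε ∧ ‖v s‖ ≤ C * ε := by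
  set C₁ : ℝ := 4 * c ^ 2 * Real.exp (42 * c ^ 3 * |T|) with hC₁
  have hE : 1 ≤ Real.exp (42 * c ^ 3 * |T|) := Real.one_le_exp (by positivity)
  have hc0 : 0 ≤ c := by linarith
  refine ⟨c * (1 + 2 * C₁), by positivity, ?_⟩
  intro ε L ζ u v A₁₁ A₁₂ A₂₁ A₂₂ q q' hL hLT hε hε1 hζ him hu hv hq hu' hv' hq' hA hqb hu0 hv0
  have hζ0 : ζ ≠ 0 := by
    rintro rfl
    norm_num at hζ
  -- the quasi-static value of `v` is `-κ q u`
  set κ : ℂ := (2 * Complex.I * ζ)⁻¹ with hκ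
  have hκζ : 2 * Complex.I * ζ * κ = 1 :=
    mul_inv_cancel₀ (mul_ne_zero (mul_ne_zero two_ne_zero Complex.I_ne_zero) hζ0)
  have hκn : ‖κ‖ ≤ ε := by
    rw [hκ, norm_inv, norm_mul, norm_mul, Complex.norm_I, Complex.norm_ofNat, mul_one]
    rw [inv_le_comm₀ (by positivity) hε, inv_le_iff_one_le_mul₀ hε]
    linarith
  set g : ℝ → ℂ := fun s => u s - 1 with hg
  set h : ℝ → ℂ := fun s => v s + κ * (q s * u s) with hh
  set P : ℝ → ℝ := fun s => ε + ‖g s‖ + ‖h s‖ with hP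
  have hP0 : ∀ s, 0 ≤ P s := fun s => by positivity
  have hεu : ∀ s, ε * ‖u s‖ ≤ ε + ‖g s‖ := by
    intro s
    have h1 : ‖u s‖ ≤ 1 + ‖g s‖ := by
      calc ‖u s‖ = ‖1 + g s‖ := by simp [hg]
        _ ≤ _ := (norm_add_le _ _).trans (by simp)
    nlinarith [norm_nonneg (g s)]
  have hεuP : ∀ s, ε * ‖u s‖ ≤ P s := fun s => (hεu s).trans (by simp [hP])
  have hκqu : ∀ s ∈ Set.Icc 0 L, ‖κ * (q s * u s)‖ ≤ c * (ε * ‖u s‖) := by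
    intro s hs
    rw [norm_mul, norm_mul]
    calc ‖κ‖ * (‖q s‖ * ‖u s‖) ≤ ε * (c * ‖u s‖) := by gcongr; exact hqb s hs
      _ = c * (ε * ‖u s‖) := by ring
  have hvP : ∀ s ∈ Set.Icc 0 L, ‖v s‖ ≤ c * P s := by
    intro s hs
    have h1 : v s = h s - κ * (q s * u s) := by simp [hh]
    calc ‖v s‖ ≤ ‖h s‖ + c * (ε * ‖u s‖) := by
          rw [h1]; exact (norm_sub_le _ _).trans (by gcongr; exact hκqu s hs)
      _ ≤ c * ‖h s‖ + c * (ε + ‖g s‖) := by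
          gcongr
          · nlinarith [norm_nonneg (h s)]
          · exact hεu s
      _ = c * P s := by simp only [hP]; ring
  set f : ℝ → ℝ := fun s => ‖g s‖ ^ 2 + ‖h s‖ ^ 2 + ε ^ 2 with hf
  have hP2 : ∀ s, P s ^ 2 ≤ 3 * f s := by
    intro s
    simp only [hP, hf]
    nlinarith [sq_nonneg (ε - ‖g s‖), sq_nonneg (ε - ‖h s‖), sq_nonneg (‖g s‖ - ‖h s‖)]
  have hgc : ContinuousOn g (Set.Icc 0 L) := hu.sub continuousOn_const
  have hhc : ContinuousOn h (Set.Icc 0 L) := hv.add (continuousOn_const.mul (hq.mul hu))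
  have hfc : ContinuousOn f (Set.Icc 0 L) :=
    ((hgc.norm.pow 2).add (hhc.norm.pow 2)).add continuousOn_const
  set g' : ℝ → ℂ := fun s => A₁₁ s * u s + A₁₂ s * v s with hg'
  set r : ℝ → ℂ := fun s =>
    A₂₁ s * u s + κ * (q' s * u s) + κ * (q s * g' s) - A₂₂ s * (κ * (q s * u s)) with hr
  have hgd : ∀ s ∈ Set.Ioo 0 L, HasDerivAt g (g' s) s := fun s hs => (hu' s hs).sub_const 1
  have hhd : ∀ s ∈ Set.Ioo 0 L, HasDerivAt h ((2 * Complex.I * ζ + A₂₂ s) * h s + r s) s := by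
    intro s hs
    refine ((hv' s hs).add (((hq' s hs).mul (hu' s hs)).const_mul κ)).congr_deriv ?_
    simp only [hh, hr, hg']
    linear_combination (-(q s * u s)) * hκζ
  have hg'P : ∀ s ∈ Set.Ioo 0 L, ‖g' s‖ ≤ 2 * c ^ 2 * P s := by
    intro s hs
    obtain ⟨h1, h2, -, -, -⟩ := hA s hs
    have hv1 := hvP s (Set.Ioo_subset_Icc_self hs)
    calc ‖g' s‖ ≤ ‖A₁₁ s‖ * ‖u s‖ + ‖A₁₂ s‖ * ‖v s‖ := by
          simpa only [norm_mul] using norm_add_le (A₁₁ s * u s) (A₁₂ s * v s)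
      _ ≤ c * ε * ‖u s‖ + c * (c * P s) := by gcongr
      _ = c * (ε * ‖u s‖) + c ^ 2 * P s := by ring
      _ ≤ c * P s + c ^ 2 * P s := by gcongr; exact hεuP s
      _ ≤ 2 * c ^ 2 * P s := by nlinarith [mul_nonneg (mul_nonneg hc0 (sub_nonneg.2 hc)) (hP0 s)]
  have hrP : ∀ s ∈ Set.Ioo 0 L, ‖r s‖ ≤ 6 * c ^ 3 * P s := by
    intro s hs
    obtain ⟨-, -, h3, h4, h5⟩ := hA s hs
    have hs' := Set.Ioo_subset_Icc_self hs
    have e1 : ‖A₂₁ s * u s‖ ≤ c * P s := by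
      rw [norm_mul]
      calc ‖A₂₁ s‖ * ‖u s‖ ≤ c * ε * ‖u s‖ := by gcongr
        _ = c * (ε * ‖u s‖) := by ring
        _ ≤ c * P s := by gcongr; exact hεuP s
    have e2 : ‖κ * (q' s * u s)‖ ≤ c * P s := by
      rw [norm_mul, norm_mul]
      calc ‖κ‖ * (‖q' s‖ * ‖u s‖) ≤ ε * (c * ‖u s‖) := by gcongr
        _ = c * (ε * ‖u s‖) := by ring
        _ ≤ c * P s := by gcongr; exact hεuP s
    have e3 : ‖κ * (q s * g' s)‖ ≤ 2 * c ^ 3 * P s := by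
      rw [norm_mul, norm_mul]
      calc ‖κ‖ * (‖q s‖ * ‖g' s‖) ≤ 1 * (c * (2 * c ^ 2 * P s)) := by
            gcongr
            · exact hκn.trans hε1
            · exact hqb s hs'
            · exact hg'P s hs
        _ = 2 * c ^ 3 * P s := by ring
    have e4 : ‖A₂₂ s * (κ * (q s * u s))‖ ≤ c ^ 2 * P s := by
      rw [norm_mul]
      calc ‖A₂₂ s‖ * ‖κ * (q s * u s)‖ ≤ c * (c * (ε * ‖u s‖)) := by
            gcongr; exact hκqu s hs'
        _ ≤ c * (c * P s) := by gcongr; exact hεuP s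
        _ = c ^ 2 * P s := by ring
    have e5 : c * P s ≤ c ^ 3 * P s :=
      mul_le_mul_of_nonneg_right (by nlinarith [mul_nonneg hc0 (sub_nonneg.2 hc)]) (hP0 s)
    have e6 : c ^ 2 * P s ≤ c ^ 3 * P s :=
      mul_le_mul_of_nonneg_right (pow_le_pow_right₀ hc (by norm_num)) (hP0 s)
    have e7 : 0 ≤ c ^ 3 * P s := mul_nonneg (by positivity) (hP0 s)
    calc ‖r s‖ ≤ ‖A₂₁ s * u s‖ + ‖κ * (q' s * u s)‖ + ‖κ * (q s * g' s)‖ +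
          ‖A₂₂ s * (κ * (q s * u s))‖ := (norm_sub_le _ _).trans
            (add_le_add_left (norm_add₃_le) _)
      _ ≤ c * P s + c * P s + 2 * c ^ 3 * P s + c ^ 2 * P s := by gcongr
      _ ≤ 6 * c ^ 3 * P s := by linarith
  have hfd : ∀ s ∈ Set.Ioo 0 L, HasDerivAt f (2 * inner ℝ (g s) (g' s) +
      2 * inner ℝ (h s) ((2 * Complex.I * ζ + A₂₂ s) * h s + r s)) s := fun s hs =>
    ((hgd s hs).norm_sq.add (hhd s hs).norm_sq).add_const _
  have hfle : ∀ s ∈ Set.Ioo 0 L, 2 * inner ℝ (g s) (g' s) +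
      2 * inner ℝ (h s) ((2 * Complex.I * ζ + A₂₂ s) * h s + r s) ≤ 42 * c ^ 3 * f s := by
    intro s hs
    obtain ⟨-, -, -, h4, -⟩ := hA s hs
    have i1 : inner ℝ (g s) (g' s) ≤ ‖g s‖ * (2 * c ^ 2 * P s) :=
      (real_inner_le_norm _ _).trans (by gcongr; exact hg'P s hs)
    have i2 : inner ℝ (h s) (r s) ≤ ‖h s‖ * (6 * c ^ 3 * P s) :=
      (real_inner_le_norm _ _).trans (by gcongr; exact hrP s hs)
    have i3 : (2 * Complex.I * ζ + A₂₂ s).re ≤ 3 * c := by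
      have : (2 * Complex.I * ζ + A₂₂ s).re = -(2 * ζ.im) + (A₂₂ s).re := by simp
      rw [this]
      have := (Complex.re_le_norm (A₂₂ s)).trans h4
      linarith
    have i4 : (2 * Complex.I * ζ + A₂₂ s).re * ‖h s‖ ^ 2 ≤ 3 * c * ‖h s‖ ^ 2 := by gcongr
    rw [inner_add_right (h s), inner_mul_self_left]
    have hc23 : c ^ 2 ≤ c ^ 3 := by gcongr; norm_num
    have hc13 : c ≤ c ^ 3 := by nlinarith [mul_nonneg hc0 (sub_nonneg.2 hc)]
    have j1 : ‖g s‖ * (2 * c ^ 2 * P s) ≤ 6 * c ^ 3 * (P s * ‖g s‖) := by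
      have := mul_le_mul_of_nonneg_right hc23 (mul_nonneg (hP0 s) (norm_nonneg (g s)))
      nlinarith [mul_nonneg (by positivity : 0 ≤ c ^ 3) (mul_nonneg (hP0 s) (norm_nonneg (g s)))]
    have j2 : 3 * c * ‖h s‖ ^ 2 ≤ 3 * c ^ 3 * f s := by
      have h1 : ‖h s‖ ^ 2 ≤ f s := by
        simp only [hf]
        nlinarith [sq_nonneg ‖g s‖, sq_nonneg ε]
      have := mul_le_mul hc13 h1 (by positivity) (by positivity)
      linarith
    have j3 : P s * ‖g s‖ + P s * ‖h s‖ ≤ 3 * f s := by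
      refine le_trans ?_ (hP2 s)
      have : P s ^ 2 = P s * ε + P s * ‖g s‖ + P s * ‖h s‖ := by simp only [hP]; ring
      rw [this]
      nlinarith [mul_nonneg (hP0 s) hε.le]
    have j4 := mul_le_mul_of_nonneg_left j3 (by positivity : 0 ≤ 12 * c ^ 3)
    nlinarith
  -- `1 + 1 + 9 = 11` from the three squares
  have hf0 : f 0 ≤ 11 * c ^ 4 * ε ^ 2 := by
    have h0 : (0 : ℝ) ∈ Set.Icc 0 L := Set.left_mem_Icc.2 hL
    have h1 : ε * ‖u 0‖ ≤ 2 * c * ε := by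
      have : ‖u 0‖ ≤ 1 + c * ε := by
        calc ‖u 0‖ = ‖1 + (u 0 - 1)‖ := by simp
          _ ≤ 1 + c * ε := (norm_add_le _ _).trans (by simpa using hu0)
      have : ‖u 0‖ ≤ 2 * c := by nlinarith
      nlinarith
    have h2 : ‖h 0‖ ≤ 3 * c ^ 2 * ε := by
      calc ‖h 0‖ ≤ c * ε + c * (2 * c * ε) :=
            (norm_add_le _ _).trans (add_le_add hv0 ((hκqu 0 h0).trans (by gcongr)))
        _ ≤ 3 * c ^ 2 * ε := by nlinarith [mul_nonneg (mul_nonneg hc0 (sub_nonneg.2 hc)) hε.le]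
    have h3 : ‖g 0‖ ^ 2 ≤ (c * ε) ^ 2 := by gcongr
    have h4 : ‖h 0‖ ^ 2 ≤ (3 * c ^ 2 * ε) ^ 2 := by gcongr
    have h5 : 1 ≤ c ^ 2 := one_le_pow₀ hc
    have h6 : c ^ 2 ≤ c ^ 4 := by gcongr; norm_num
    have h7 := mul_le_mul_of_nonneg_right h6 (sq_nonneg ε)
    have h8 := mul_le_mul_of_nonneg_right (h5.trans h6) (sq_nonneg ε)
    simp only [hf]
    nlinarith
  intro s hs
  have hfs : f s ≤ (C₁ * ε) ^ 2 := by
    refine (le_mul_exp_of_hasDerivAt_le hfc hfd hfle hs).trans ?_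
    have h1 : Real.exp (42 * c ^ 3 * s) ≤ Real.exp (42 * c ^ 3 * |T|) := by
      gcongr
      exact hs.2.trans (hLT.trans (le_abs_self T))
    set E := Real.exp (42 * c ^ 3 * |T|)
    calc f 0 * Real.exp (42 * c ^ 3 * s) ≤ 11 * c ^ 4 * ε ^ 2 * E := by
          gcongr
      _ ≤ 16 * c ^ 4 * ε ^ 2 * (E * E) := by
          have : 0 ≤ c ^ 4 * ε ^ 2 := by positivity
          have h2 : E ≤ E * E := by nlinarith
          nlinarith [mul_le_mul_of_nonneg_left h2 this,
            mul_nonneg this (by positivity : 0 ≤ E)]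
      _ = (C₁ * ε) ^ 2 := by rw [hC₁]; ring
  have hC₁0 : 0 ≤ C₁ * ε := by positivity
  have hgs : ‖g s‖ ≤ C₁ * ε := by
    refine abs_le_of_sq_le_sq' ?_ hC₁0 |>.2
    refine le_trans ?_ hfs
    simp only [hf]
    nlinarith [sq_nonneg ‖h s‖, sq_nonneg ε]
  have hhs : ‖h s‖ ≤ C₁ * ε := by
    refine abs_le_of_sq_le_sq' ?_ hC₁0 |>.2
    refine le_trans ?_ hfs
    simp only [hf]
    nlinarith [sq_nonneg ‖g s‖, sq_nonneg ε]
  constructor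
  · refine hgs.trans ?_
    nlinarith
  · refine (hvP s hs).trans ?_
    have : P s ≤ (1 + 2 * C₁) * ε := by simp only [hP]; linarith
    calc c * P s ≤ c * ((1 + 2 * C₁) * ε) := by gcongr
      _ = c * (1 + 2 * C₁) * ε := by ring

end Perturbation

/-! ### The propagator for large spectral parameters -/

section PropagatorAsymptotics

variable {A₀ ω₀ : ℝ} {n : ℝ → ℝ} {S : Set (ℝ × ℝ)} {Ef : ℝ → ℝ → ℂ} {ρ : ℝ → ℝ → ℝ → ℂ}
  {N : ℝ → ℝ → ℝ → ℝ} {Λ : EReal}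

theorem hasDerivAt_exp_mul_ofReal (c : ℂ) (s : ℝ) :
    HasDerivAt (fun s : ℝ => Complex.exp (c * s)) (Complex.exp (c * s) * c) s := by
  have : HasDerivAt (fun s : ℝ => c * (s : ℂ)) c s := by
    simpa using! (Complex.ofRealCLM.hasDerivAt (x := s)).const_mul c
  exact this.cexp

/-- The columns of the propagator, without their leading exponentials, are within `O(1/z)` of
those of the identity, uniformly in bounded sets of `(τ, x)`. -/
theorem IsRegularSolution.exists_laxProp_bound (h : IsRegularSolution A₀ ω₀ n S Ef ρ N)
    (hn : IsBroadening Λ n) (hSc : IsClosed S) (hS : S ⊆ lightCone) (T : ℝ) :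
    ∃ C : ℝ, 0 ≤ C ∧ ∀ (z : ℂ) (τ x : ℝ), 1 ≤ ‖z‖ → τ ∈ Set.Icc 0 T → x ∈ Set.Icc 0 T →
      (-1 ≤ z.im ∨ τ = 0 →
        ‖laxProp (retardedField A₀ ω₀ n ρ) τ x z 0 0 * Complex.exp (Complex.I * z * τ) - 1‖
            ≤ C * ‖z‖⁻¹ ∧
          ‖laxProp (retardedField A₀ ω₀ n ρ) τ x z 1 0 * Complex.exp (Complex.I * z * τ)‖
            ≤ C * ‖z‖⁻¹) ∧
      (z.im ≤ 1 ∨ τ = 0 →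
        ‖laxProp (retardedField A₀ ω₀ n ρ) τ x z 1 1 * Complex.exp (-(Complex.I * z) * τ) - 1‖
            ≤ C * ‖z‖⁻¹ ∧
          ‖laxProp (retardedField A₀ ω₀ n ρ) τ x z 0 1 * Complex.exp (-(Complex.I * z) * τ)‖
            ≤ C * ‖z‖⁻¹) := by
  have he := h.continuous_retardedField hn hS
  obtain ⟨D, hD⟩ := h.exists_bound_deriv_retardedField_t hn hSc hS T
  obtain ⟨K, hK⟩ := ((isCompact_Icc (a := (0 : ℝ)) (b := T)).prod
    (isCompact_Icc (a := (0 : ℝ)) (b := T))).exists_bound_of_continuousOn he.continuousOn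
  set e := retardedField A₀ ω₀ n ρ with hedef
  set c : ℝ := |K| + |D| + 1 with hc
  have hc1 : 1 ≤ c := by rw [hc]; linarith [abs_nonneg K, abs_nonneg D]
  obtain ⟨C, hC0, hC⟩ := exists_perturbation_bound c T hc1
  refine ⟨C, hC0, fun z τ x hz hτ hx => ?_⟩
  have hz0 : 0 < ‖z‖ := by linarith
  have hX := continuous_laxProp_fst he x z
  have hXe : ∀ i j, Continuous fun s => laxProp e s x z i j := fun i j =>
    (continuous_apply j).comp ((continuous_apply i).comp hX)
  have hd := fun (s : ℝ) => hasDerivAt_mat2_iff.1 (hasDerivAt_laxProp he s x z)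
  have hcomp : Continuous fun s => e s x := he.comp (by fun_prop : Continuous fun s : ℝ => (s, x))
  have hKs : ∀ s ∈ Set.Icc 0 τ, ‖e s x‖ ≤ |K| := fun s hs =>
    (hK (s, x) ⟨⟨hs.1, hs.2.trans hτ.2⟩, hx⟩).trans (le_abs_self K)
  choose! d hd1 hd2 using fun (s : ℝ) (hs : s ∈ Set.Ioo 0 τ) =>
    hD s x hs.1 (hs.2.le.trans hτ.2) hx.1 hx.2
  have hhalf : ∀ w : ℂ, ‖w / 2‖ ≤ ‖w‖ := fun w => by
    rw [norm_div, Complex.norm_ofNat]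
    linarith [norm_nonneg w]
  have hKc : ∀ s ∈ Set.Icc 0 τ, ‖e s x / 2‖ ≤ c := fun s hs =>
    (hhalf _).trans ((hKs s hs).trans (by rw [hc]; linarith [abs_nonneg D]))
  have hKc' : ∀ s ∈ Set.Icc 0 τ, ‖conj (e s x) / 2‖ ≤ c := fun s hs =>
    (hhalf _).trans (by
      rw [RCLike.norm_conj]
      exact (hKs s hs).trans (by rw [hc]; linarith [abs_nonneg D]))
  have hDc : ∀ s ∈ Set.Ioo 0 τ, ‖d s / 2‖ ≤ c := fun s hs =>
    (hhalf _).trans ((hd1 s hs).trans ((le_abs_self D).trans (by rw [hc]; linarith [abs_nonneg K])))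
  have hDc' : ∀ s ∈ Set.Ioo 0 τ, ‖conj (d s) / 2‖ ≤ c := fun s hs =>
    (hhalf _).trans (by
      rw [RCLike.norm_conj]
      exact (hd1 s hs).trans ((le_abs_self D).trans (by rw [hc]; linarith [abs_nonneg K])))
  have hε : 0 < ‖z‖⁻¹ := inv_pos.2 hz0
  have hε1 : ‖z‖⁻¹ ≤ 1 := inv_le_one_of_one_le₀ hz
  have hζ : 1 ≤ 2 * ‖z‖⁻¹ * ‖z‖ := by
    rw [mul_assoc, inv_mul_cancel₀ hz0.ne']
    norm_num
  have hc0 : 0 ≤ c := by linarith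
  constructor
  · rintro (him | rfl)
    · exact hC ‖z‖⁻¹ τ z (fun s => laxProp e s x z 0 0 * Complex.exp (Complex.I * z * s))
        (fun s => laxProp e s x z 1 0 * Complex.exp (Complex.I * z * s)) (fun _ => 0)
        (fun s => -(e s x / 2)) (fun _ => 0) (fun _ => 0) (fun s => conj (e s x) / 2)
        (fun s => conj (d s) / 2) hτ.1 hτ.2 hε hε1 hζ him
        ((hXe 0 0).mul (by fun_prop)).continuousOn ((hXe 1 0).mul (by fun_prop)).continuousOn
        ((Complex.continuous_conj.comp hcomp).div_const 2).continuousOn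
        (fun s hs => by
          refine ((hd s 0 0).mul (hasDerivAt_exp_mul_ofReal (Complex.I * z) s)).congr_deriv ?_
          simp [laxMat, Matrix.mul_apply, Fin.sum_univ_two]
          ring)
        (fun s hs => by
          refine ((hd s 1 0).mul (hasDerivAt_exp_mul_ofReal (Complex.I * z) s)).congr_deriv ?_
          simp [laxMat, Matrix.mul_apply, Fin.sum_univ_two]
          ring)
        (fun s hs => (hd2 s hs).star.div_const 2)
        (fun s hs => ⟨by simpa using by positivity, by
          rw [norm_neg]; exact hKc s (Set.Ioo_subset_Icc_self hs), by simpa using by positivity,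
          by simpa using hc0, hDc' s hs⟩)
        hKc' (by simpa [laxProp_zero he] using by positivity)
        (by simpa [laxProp_zero he] using by positivity) τ (Set.right_mem_Icc.2 hτ.1)
    · simp only [laxProp_zero he, Complex.ofReal_zero, mul_zero, Complex.exp_zero, mul_one]
      simpa using by positivity
  · rintro (him | rfl)
    · exact hC ‖z‖⁻¹ τ (-z) (fun s => laxProp e s x z 1 1 * Complex.exp (-(Complex.I * z) * s))
        (fun s => laxProp e s x z 0 1 * Complex.exp (-(Complex.I * z) * s)) (fun _ => 0)
        (fun s => conj (e s x) / 2) (fun _ => 0) (fun _ => 0) (fun s => -(e s x / 2))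
        (fun s => -(d s / 2)) hτ.1 hτ.2 hε hε1 (by rwa [norm_neg])
        (by rw [Complex.neg_im]; linarith)
        ((hXe 1 1).mul (by fun_prop)).continuousOn ((hXe 0 1).mul (by fun_prop)).continuousOn
        (hcomp.div_const 2).neg.continuousOn
        (fun s hs => by
          refine ((hd s 1 1).mul (hasDerivAt_exp_mul_ofReal (-(Complex.I * z)) s)).congr_deriv ?_
          simp [laxMat, Matrix.mul_apply, Fin.sum_univ_two]
          ring)
        (fun s hs => by
          refine ((hd s 0 1).mul (hasDerivAt_exp_mul_ofReal (-(Complex.I * z)) s)).congr_deriv ?_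
          simp [laxMat, Matrix.mul_apply, Fin.sum_univ_two]
          ring)
        (fun s hs => ((hd2 s hs).div_const 2).neg)
        (fun s hs => ⟨by simpa using by positivity, hKc' s (Set.Ioo_subset_Icc_self hs),
          by simpa using by positivity, by simpa using hc0, by rw [norm_neg]; exact hDc s hs⟩)
        (fun s hs => by rw [norm_neg]; exact hKc s hs)
        (by simpa [laxProp_zero he] using by positivity)
        (by simpa [laxProp_zero he] using by positivity) τ (Set.right_mem_Icc.2 hτ.1)
    · simp only [laxProp_zero he, Complex.ofReal_zero, mul_zero, Complex.exp_zero, mul_one]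
      simpa using by positivity

/-- The deviation of `-X σ₃ X⁻¹` from `-σ₃` is quadratic, with an off-diagonal entry of `X` in each
term. -/
theorem blochMat_add_sigma3 {X : Mat2} (hX : X.det = 1) : blochMat X + sigma3 =
    !![-(2 * (X 0 1 * X 1 0)), 2 * (X 0 0 * X 0 1);
      -(2 * (X 1 0 * X 1 1)), 2 * (X 0 1 * X 1 0)] := by
  rw [Matrix.det_fin_two] at hX
  rw [blochMat, Matrix.adjugate_fin_two]
  ext i j
  fin_cases i <;> fin_cases j <;> simp [sigma3, Matrix.mul_apply, Fin.sum_univ_two]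
  · linear_combination -hX
  · ring
  · ring
  · linear_combination hX

/-- The medium is nearly in its initial state at frequencies far from resonance. -/
theorem IsRegularSolution.exists_matF_add_sigma3_bound (h : IsRegularSolution A₀ ω₀ n S Ef ρ N)
    (hn : IsBroadening Λ n) (hSc : IsClosed S) (hS : S ⊆ lightCone) (T : ℝ) :
    ∃ C : ℝ, 0 ≤ C ∧ ∀ t x s : ℝ, t ∈ Set.Icc 0 T → x ∈ Set.Ioc 0 T → ∀ i j,
      ‖matF ρ N t x s i j + sigma3 i j‖ ≤ C / (1 + |s|) := by
  have he := h.continuous_retardedField hn hS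
  obtain ⟨C, hC0, hC⟩ := h.exists_laxProp_bound hn hSc hS T
  refine ⟨4 * (C * (1 + C)) + 4, by positivity, fun t x s ht hx i j => ?_⟩
  have hs0 : 0 < 1 + |s| := by positivity
  rw [le_div_iff₀ hs0]
  rcases le_total 1 |s| with hs | hs
  · have hτ : max (t - x) 0 ∈ Set.Icc 0 T :=
      ⟨le_max_right _ _, max_le (by linarith [ht.2, hx.1]) (ht.1.trans ht.2)⟩
    have hns : ‖(s : ℂ)‖ = |s| := by rw [Complex.norm_real, Real.norm_eq_abs]
    obtain ⟨h1, h2⟩ := hC s (max (t - x) 0) x (by rwa [hns]) hτ ⟨hx.1.le, hx.2⟩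
    obtain ⟨h00, h10⟩ := h1 (Or.inl (by simp))
    obtain ⟨h11, h01⟩ := h2 (Or.inl (by simp))
    have hF := h.matF_eq_blochMat hn hSc hS ht.1 hx.1 s
    have hdet := det_laxProp he (max (t - x) 0) x s
    set X := laxProp (retardedField A₀ ω₀ n ρ) (max (t - x) 0) x s
    have hu1 : ‖Complex.exp (Complex.I * s * (max (t - x) 0 : ℝ))‖ = 1 := by
      rw [Complex.norm_exp]
      simp
    have hu2 : ‖Complex.exp (-(Complex.I * s) * (max (t - x) 0 : ℝ))‖ = 1 := by
      rw [Complex.norm_exp]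
      simp
    have hbig : ∀ a u : ℂ, ‖u‖ = 1 → ‖a * u - 1‖ ≤ C * ‖(s : ℂ)‖⁻¹ → ‖a‖ ≤ 1 + C := by
      intro a u hu ha
      have : ‖a‖ = ‖a * u‖ := by rw [norm_mul, hu, mul_one]
      rw [this]
      calc ‖a * u‖ = ‖1 + (a * u - 1)‖ := by simp
        _ ≤ ‖(1 : ℂ)‖ + ‖a * u - 1‖ := norm_add_le _ _
        _ ≤ 1 + C := by
          rw [norm_one]
          have : C * ‖(s : ℂ)‖⁻¹ ≤ C * 1 := by
            gcongr
            rw [hns]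
            exact inv_le_one_of_one_le₀ hs
          linarith
    have b00 := hbig _ _ hu1 h00
    have b11 := hbig _ _ hu2 h11
    have b10 : ‖X 1 0‖ ≤ C * |s|⁻¹ := by rwa [norm_mul, hu1, mul_one, hns] at h10
    have b01 : ‖X 0 1‖ ≤ C * |s|⁻¹ := by rwa [norm_mul, hu2, mul_one, hns] at h01
    have hCs : C * |s|⁻¹ ≤ 1 + C := by
      have : C * |s|⁻¹ ≤ C * 1 := by
        gcongr
        exact inv_le_one_of_one_le₀ hs
      linarith
    have hent : ‖(blochMat X + sigma3) i j‖ ≤ 2 * (C * |s|⁻¹ * (1 + C)) := by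
      rw [blochMat_add_sigma3 hdet]
      have k : ∀ a b : ℂ, ‖a‖ ≤ C * |s|⁻¹ → ‖b‖ ≤ 1 + C →
          ‖2 * (a * b)‖ ≤ 2 * (C * |s|⁻¹ * (1 + C)) := by
        intro a b ha hb
        rw [norm_mul, norm_mul, Complex.norm_ofNat]
        gcongr
      fin_cases i <;> fin_cases j
      · simpa using k _ _ b01 (b10.trans hCs)
      · simpa [mul_comm] using k _ _ b01 b00
      · simpa using k _ _ b10 b11
      · simpa using k _ _ b01 (b10.trans hCs)
    have hent' : ‖matF ρ N t x s i j + sigma3 i j‖ ≤ 2 * (C * |s|⁻¹ * (1 + C)) := by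
      rw [hF]
      exact hent
    calc _ ≤ 2 * (C * |s|⁻¹ * (1 + C)) * (1 + |s|) := by gcongr
      _ ≤ 2 * (C * |s|⁻¹ * (1 + C)) * (2 * |s|) := by gcongr; linarith
      _ = 4 * (C * (1 + C)) * (|s|⁻¹ * |s|) := by ring
      _ = 4 * (C * (1 + C)) := by rw [inv_mul_cancel₀ (by linarith), mul_one]
      _ ≤ _ := by linarith
  · have hN := h.abs_pop_le hS ht.1 hx.1 s
    have hρ := h.norm_rho_le hS ht.1 hx.1 s
    have h2 : ‖matF ρ N t x s i j + sigma3 i j‖ ≤ 2 := by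
      have hN' : ‖(N t x s : ℂ)‖ ≤ 1 := by rwa [Complex.norm_real, Real.norm_eq_abs]
      fin_cases i <;> fin_cases j
      · simp only [matF, sigma3]
        exact (norm_add_le _ _).trans (by simpa using by linarith)
      · simpa [matF, sigma3] using by linarith
      · simpa [matF, sigma3] using by linarith
      · simp only [matF, sigma3]
        exact (norm_add_le _ _).trans (by simpa using by linarith)
    calc _ ≤ 2 * (1 + 1) := by gcongr
      _ ≤ 4 * (C * (1 + C)) + 4 := by
          nlinarith [mul_nonneg hC0 (by linarith : (0 : ℝ) ≤ 1 + C)]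

/-- The Cauchy integral of the deviation of the density matrix from its initial state. -/
noncomputable def deviationMat (n : ℝ → ℝ) (ρ : ℝ → ℝ → ℝ → ℂ) (N : ℝ → ℝ → ℝ → ℝ) (t x : ℝ)
    (z : ℂ) : Mat2 :=
  Matrix.of fun i j =>
    (1 / 4) * ∫ s, ((matF ρ N t x s i j + sigma3 i j) * (n s : ℂ)) / ((s : ℂ) - z)

theorem IsRegularSolution.continuous_matF (h : IsRegularSolution A₀ ω₀ n S Ef ρ N) {t x : ℝ}
    (ht : 0 ≤ t) (hx : 0 < x) (i j : Fin 2) : Continuous fun s => matF ρ N t x s i j := by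
  have h1 := h.continuous_rho_lam ht hx
  have h2 := h.continuous_pop_lam ht hx
  fin_cases i <;> fin_cases j <;> simp [matF] <;> fun_prop

theorem IsRegularSolution.norm_matF_le (h : IsRegularSolution A₀ ω₀ n S Ef ρ N)
    (hS : S ⊆ lightCone) {t x : ℝ} (ht : 0 ≤ t) (hx : 0 < x) (s : ℝ) (i j : Fin 2) :
    ‖matF ρ N t x s i j‖ ≤ 1 := by
  have hN := h.abs_pop_le hS ht hx s
  have hρ := h.norm_rho_le hS ht hx s
  have hN' : ‖(N t x s : ℂ)‖ ≤ 1 := by rwa [Complex.norm_real, Real.norm_eq_abs]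
  fin_cases i <;> fin_cases j <;> simp [matF] <;> assumption

/-- Off the real line the coefficient of the `x^±`-equation is `i η σ₃ + H` up to the Cauchy
integral of the deviation of the medium from its initial state. -/
theorem IsRegularSolution.laxMatX_eq (h : IsRegularSolution A₀ ω₀ n S Ef ρ N)
    (hn : IsBroadening Λ n) (hS : S ⊆ lightCone) {t x : ℝ} (ht : 0 ≤ t) (hx : 0 < x) {z : ℂ}
    (hz : z.im ≠ 0) (σ : ℤˣ) :
    laxMatX n Ef ρ N σ t x z =
      (Complex.I * etaFun n σ z) • sigma3 + matH Ef t x - Complex.I • deviationMat n ρ N t x z := by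
  have hint : ∀ i j, Integrable fun s : ℝ => matF ρ N t x s i j * (n s : ℂ) / ((s : ℂ) - z) := by
    intro i j
    refine integrable_div_sub ?_ hz
    refine hn.integrable_ofReal.bdd_mul (c := 1)
      (h.continuous_matF ht hx i j).aestronglyMeasurable
      (Eventually.of_forall fun s => h.norm_matF_le hS ht hx s i j)
  have hn' := integrable_div_sub hn.integrable_ofReal hz
  have hdev : ∀ i j, deviationMat n ρ N t x z i j =
      (1 / 4) * ((∫ s : ℝ, matF ρ N t x s i j * (n s : ℂ) / ((s : ℂ) - z)) +
        sigma3 i j * ∫ s : ℝ, (n s : ℂ) / ((s : ℂ) - z)) := by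
    intro i j
    rw [← integral_const_mul, ← integral_add (hint i j) (hn'.const_mul _), deviationMat,
      Matrix.of_apply]
    congr 1
    refine integral_congr_ae (Eventually.of_forall fun s => ?_)
    simp only
    ring
  ext i j
  simp only [laxMatX, Matrix.sub_apply, Matrix.add_apply, Matrix.smul_apply, Matrix.of_apply,
    smul_eq_mul, hdev, etaFun, cauchyIntegral, if_neg hz]
  ring

theorem norm_le_add_abs_mul_norm_sub (s : ℝ) {z : ℂ} (hz : 1 ≤ |z.im|) :
    ‖z‖ ≤ (1 + |s|) * ‖(s : ℂ) - z‖ := by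
  have h1 : 1 ≤ ‖(s : ℂ) - z‖ := hz.trans (norm_ofReal_sub_ge_im s z)
  have h2 : ‖z‖ ≤ |s| + ‖(s : ℂ) - z‖ := by
    calc ‖z‖ = ‖(s : ℂ) - ((s : ℂ) - z)‖ := by ring_nf
      _ ≤ _ := (norm_sub_le _ _).trans (by rw [Complex.norm_real, Real.norm_eq_abs])
  nlinarith [abs_nonneg s]

/-- The decay of `F + σ₃` in the frequency turns into decay of its Cauchy integral in `z`, since
`(1 + |s|) |s - z| ≥ |z|`. -/
theorem IsRegularSolution.exists_deviationMat_bound (h : IsRegularSolution A₀ ω₀ n S Ef ρ N)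
    (hn : IsBroadening Λ n) (hSc : IsClosed S) (hS : S ⊆ lightCone) (T : ℝ) :
    ∃ C : ℝ, 0 ≤ C ∧ ∀ (t x : ℝ) (z : ℂ), t ∈ Set.Icc 0 T → x ∈ Set.Ioc 0 T → 1 ≤ |z.im| → ∀ i j,
      ‖deviationMat n ρ N t x z i j‖ ≤ C * ‖z‖⁻¹ := by
  obtain ⟨C, hC0, hC⟩ := h.exists_matF_add_sigma3_bound hn hSc hS T
  refine ⟨C, hC0, fun t x z ht hx hz i j => ?_⟩
  have hz0 : 0 < ‖z‖ := by linarith [Complex.abs_im_le_norm z]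
  have h1 : ‖∫ s, ((matF ρ N t x s i j + sigma3 i j) * (n s : ℂ)) / ((s : ℂ) - z)‖ ≤
      ∫ s, n s * (C * ‖z‖⁻¹) := by
    refine norm_integral_le_of_norm_le (hn.integrable.mul_const _)
      (Eventually.of_forall fun s => ?_)
    have h2 := norm_le_add_abs_mul_norm_sub s hz
    have h3 : 0 < ‖(s : ℂ) - z‖ := by linarith [norm_ofReal_sub_ge_im s z]
    have hs0 : 0 < 1 + |s| := by positivity
    rw [norm_div, norm_mul, Complex.norm_real, Real.norm_of_nonneg (hn.nonneg s)]
    calc _ ≤ C / (1 + |s|) * n s / ‖(s : ℂ) - z‖ := by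
          gcongr
          · exact hn.nonneg s
          · exact hC t x s ht hx i j
      _ = n s * (C * ((1 + |s|) * ‖(s : ℂ) - z‖)⁻¹) := by
          field_simp
      _ ≤ n s * (C * ‖z‖⁻¹) := by
          refine mul_le_mul_of_nonneg_left ?_ (hn.nonneg s)
          gcongr
  rw [integral_mul_const, hn.integral_eq_one, one_mul] at h1
  rw [deviationMat, Matrix.of_apply, norm_mul]
  norm_num
  nlinarith [norm_nonneg (∫ s, ((matF ρ N t x s i j + sigma3 i j) * (n s : ℂ)) / ((s : ℂ) - z))]

end PropagatorAsymptotics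

/-! ### The normalized columns as the spectral parameter tends to infinity -/

section ColumnAsymptotics

variable {A₀ ω₀ : ℝ} {n : ℝ → ℝ} {S : Set (ℝ × ℝ)} {Ef : ℝ → ℝ → ℂ} {ρ : ℝ → ℝ → ℝ → ℂ}
  {N : ℝ → ℝ → ℝ → ℝ} {Λ : EReal}

/-- With the normalizing exponential the columns of `Z_±` are those of the propagator at the
retarded time: `η` cancels. -/
theorem matZ_mul_exp_theta (e : ℝ → ℝ → ℂ) (σ : ℤˣ) (t x : ℝ) (z : ℂ) (i : Fin 2) :
    matZ n e σ t x z i 0 * Complex.exp (Complex.I * thetaFun n σ t x z) =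
        laxProp e (max (t - x) 0) x z i 0 *
          Complex.exp (Complex.I * z * (max (t - x) 0 : ℝ)) ∧
      matZ n e σ t x z i 1 * Complex.exp (-(Complex.I * thetaFun n σ t x z)) =
        laxProp e (max (t - x) 0) x z i 1 *
          Complex.exp (-(Complex.I * z) * (max (t - x) 0 : ℝ)) := by
  have hm : ((max (t - x) 0 : ℝ) : ℂ) = t - (min t x : ℝ) := by
    rw [← Complex.ofReal_sub]
    congr 1
    rcases le_total t x with h | h
    · rw [max_eq_right (by linarith), min_eq_left h, sub_self]
    · rw [max_eq_left (by linarith), min_eq_right h]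
  rw [matZ, matPsi, mul_expSigma3_zero, mul_expSigma3_one, mul_expSigma3_zero, mul_expSigma3_one,
    hm, thetaFun]
  generalize laxProp e (max (t - x) 0) x z = X
  constructor
  · rw [mul_assoc, mul_assoc, ← Complex.exp_add, ← Complex.exp_add]
    congr 2
    ring
  · rw [mul_assoc, mul_assoc, ← Complex.exp_add, ← Complex.exp_add]
    congr 2
    ring

/-- Asymptotics of the first column of `Z_±`; the factor `exp(± i η x)` cancels. -/
theorem IsRegularSolution.isBigO_matZ_col_zero (h : IsRegularSolution A₀ ω₀ n S Ef ρ N)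
    (hn : IsBroadening Λ n) (hSc : IsClosed S) (hS : S ⊆ lightCone) {t x : ℝ} (ht : 0 ≤ t)
    (hx : 0 ≤ x) (σ : ℤˣ) {l : Filter ℂ} (hl : l ≤ Bornology.cobounded ℂ)
    (him : ∀ᶠ z in l, -1 ≤ z.im ∨ t ≤ x) :
    (fun z => matZ n (retardedField A₀ ω₀ n ρ) σ t x z 0 0 *
        Complex.exp (Complex.I * thetaFun n σ t x z) - 1) =O[l] (fun z : ℂ => z⁻¹) ∧
      (fun z => matZ n (retardedField A₀ ω₀ n ρ) σ t x z 1 0 *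
        Complex.exp (Complex.I * thetaFun n σ t x z)) =O[l] (fun z : ℂ => z⁻¹) := by
  obtain ⟨C, -, hC⟩ := h.exists_laxProp_bound hn hSc hS (max t x)
  have hz1 : ∀ᶠ z : ℂ in l, 1 ≤ ‖z‖ := hl (tendsto_norm_cobounded_atTop.eventually_ge_atTop 1)
  have key := (hz1.and him).mono fun z ⟨hz, hzim⟩ =>
    (hC z (max (t - x) 0) x hz ⟨le_max_right _ _, max_le ((sub_le_self t hx).trans
      (le_max_left _ _)) (ht.trans (le_max_left _ _))⟩ ⟨hx, le_max_right _ _⟩).1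
      (hzim.imp_right fun h => max_eq_right (by linarith))
  refine ⟨IsBigO.of_bound C ?_, IsBigO.of_bound C ?_⟩ <;>
  · filter_upwards [key] with z hz
    rw [(matZ_mul_exp_theta _ σ t x z _).1, norm_inv]
    first | exact hz.1 | exact hz.2

/-- Asymptotics of the second column of `Z_±`. -/
theorem IsRegularSolution.isBigO_matZ_col_one (h : IsRegularSolution A₀ ω₀ n S Ef ρ N)
    (hn : IsBroadening Λ n) (hSc : IsClosed S) (hS : S ⊆ lightCone) {t x : ℝ} (ht : 0 ≤ t)
    (hx : 0 ≤ x) (σ : ℤˣ) {l : Filter ℂ} (hl : l ≤ Bornology.cobounded ℂ)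
    (him : ∀ᶠ z in l, z.im ≤ 1 ∨ t ≤ x) :
    (fun z => matZ n (retardedField A₀ ω₀ n ρ) σ t x z 1 1 *
        Complex.exp (-(Complex.I * thetaFun n σ t x z)) - 1) =O[l] (fun z : ℂ => z⁻¹) ∧
      (fun z => matZ n (retardedField A₀ ω₀ n ρ) σ t x z 0 1 *
        Complex.exp (-(Complex.I * thetaFun n σ t x z))) =O[l] (fun z : ℂ => z⁻¹) := by
  obtain ⟨C, -, hC⟩ := h.exists_laxProp_bound hn hSc hS (max t x)
  have hz1 : ∀ᶠ z : ℂ in l, 1 ≤ ‖z‖ := hl (tendsto_norm_cobounded_atTop.eventually_ge_atTop 1)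
  have key := (hz1.and him).mono fun z ⟨hz, hzim⟩ =>
    (hC z (max (t - x) 0) x hz ⟨le_max_right _ _, max_le ((sub_le_self t hx).trans
      (le_max_left _ _)) (ht.trans (le_max_left _ _))⟩ ⟨hx, le_max_right _ _⟩).2
      (hzim.imp_right fun h => max_eq_right (by linarith))
  refine ⟨IsBigO.of_bound C ?_, IsBigO.of_bound C ?_⟩ <;>
  · filter_upwards [key] with z hz
    rw [(matZ_mul_exp_theta _ σ t x z _).2, norm_inv]
    first | exact hz.1 | exact hz.2

/-- The exponential `exp(∓ 2 i θ)` is bounded in the part of the half-plane `ℂ_±` where it can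
multiply a decaying off-diagonal entry. -/
theorem IsBroadening.exists_norm_exp_theta_le (hn : IsBroadening Λ n) (t : ℝ) {x : ℝ}
    (hx : 0 ≤ x) :
    ∃ C : ℝ, ∀ σ : ℤˣ, ∀ z ∈ closedHalfPlane σ, z ∉ jumpSet n → |z.im| ≤ 1 ∨ t ≤ x →
      ‖Complex.exp (-(2 * sgnR σ * (Complex.I * thetaFun n σ t x z)))‖ ≤ C := by
  obtain ⟨K, hK0, hK⟩ := exists_abs_im_cauchyIntegral_le hn
  refine ⟨Real.exp (2 * |t - x| + x * K), fun σ z hz hJ hzt => ?_⟩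
  have h1 := hK σ z hz hJ
  rw [Complex.norm_exp, Real.exp_le_exp]
  have him : (thetaFun n σ t x z).im =
      z.im * (t - x) - x * ((cauchyIntegral σ (fun s => (n s : ℂ)) z).im / 4) := by
    have : (1 / 4 : ℂ) = ((1 / 4 : ℝ) : ℂ) := by push_cast; rfl
    rw [thetaFun, etaFun, this, Complex.sub_im, Complex.mul_im, Complex.mul_im, Complex.add_im,
      Complex.im_ofReal_mul]
    simp only [Complex.ofReal_re, Complex.ofReal_im]
    ring
  have hre : (-(2 * sgnR σ * (Complex.I * thetaFun n σ t x z))).re =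
      2 * (sgnR σ * (thetaFun n σ t x z).im) := by
    simp
    ring
  rw [hre, him]
  set γ := (cauchyIntegral σ (fun s => (n s : ℂ)) z).im with hγ
  have hs : |sgnR σ| = 1 := by
    rcases Int.units_eq_one_or σ with rfl | rfl <;> simp [sgnR]
  have h2 : 2 * (sgnR σ * (z.im * (t - x))) ≤ 2 * |t - x| := by
    rcases hzt with hz1 | htx
    · have : |sgnR σ * (z.im * (t - x))| ≤ |t - x| := by
        rw [abs_mul, hs, one_mul, abs_mul]
        exact mul_le_of_le_one_left (abs_nonneg _) hz1
      linarith [le_abs_self (sgnR σ * (z.im * (t - x)))]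
    · have hz' : 0 ≤ sgnR σ * z.im := hz
      nlinarith [abs_nonneg (t - x), mul_nonneg hz' (sub_nonneg.2 htx)]
  have h3 : -(2 * (sgnR σ * (x * (γ / 4)))) ≤ x * K := by
    have : |sgnR σ * (x * (γ / 4))| ≤ x * (K / 4) := by
      rw [abs_mul, hs, one_mul, abs_mul, abs_of_nonneg hx, abs_div,
        abs_of_pos (by norm_num : (0 : ℝ) < 4)]
      gcongr
    have h4 := neg_abs_le (sgnR σ * (x * (γ / 4)))
    nlinarith [mul_nonneg hx hK0]
  linarith

theorem IsBroadening.eventually_notMem_jumpSet (hn : IsBroadening Λ n) :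
    ∀ᶠ z in Bornology.cobounded ℂ, z ∉ jumpSet n := by
  obtain ⟨l, -, hl⟩ := hn.exists_jump
  filter_upwards [tendsto_norm_cobounded_atTop.eventually_gt_atTop l] with z hz hJ
  have h1 := hl _ hJ.2
  have h2 : ‖z‖ = |z.re| := (Complex.abs_re_eq_norm.2 hJ.1).symm
  linarith

/-- The normalized columns of `Y_±` in terms of those of `Z_±`. The second term carries the
relative exponential `exp(± 2 i θ)` and an off-diagonal entry of `M₀`. -/
theorem matZ_mul_matM0_exp_theta (e : ℝ → ℝ → ℂ) (σ : ℤˣ) (t x : ℝ) (z : ℂ) (i : Fin 2) :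
    (matZ n e σ t x z * matM0 A₀ ω₀ z) i 0 * Complex.exp (Complex.I * thetaFun n σ t x z) =
        matZ n e σ t x z i 0 * Complex.exp (Complex.I * thetaFun n σ t x z) * matM0 A₀ ω₀ z 0 0 +
        Complex.exp (2 * (Complex.I * thetaFun n σ t x z)) *
          (matZ n e σ t x z i 1 * Complex.exp (-(Complex.I * thetaFun n σ t x z)) *
            matM0 A₀ ω₀ z 1 0) ∧
      (matZ n e σ t x z * matM0 A₀ ω₀ z) i 1 * Complex.exp (-(Complex.I * thetaFun n σ t x z)) =
        matZ n e σ t x z i 1 * Complex.exp (-(Complex.I * thetaFun n σ t x z)) *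
          matM0 A₀ ω₀ z 1 1 +
        Complex.exp (-(2 * (Complex.I * thetaFun n σ t x z))) *
          (matZ n e σ t x z i 0 * Complex.exp (Complex.I * thetaFun n σ t x z) *
            matM0 A₀ ω₀ z 0 1) := by
  set q := Complex.I * thetaFun n σ t x z with hq
  have h1 : Complex.exp (2 * q) * Complex.exp (-q) = Complex.exp q := by
    rw [← Complex.exp_add]
    congr 1
    ring
  have h2 : Complex.exp (-(2 * q)) * Complex.exp q = Complex.exp (-q) := by
    rw [← Complex.exp_add]
    congr 1
    ring
  rw [Matrix.mul_apply, Fin.sum_univ_two, Matrix.mul_apply, Fin.sum_univ_two]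
  constructor
  · linear_combination -(matZ n e σ t x z i 1 * matM0 A₀ ω₀ z 1 0) * h1
  · linear_combination -(matZ n e σ t x z i 0 * matM0 A₀ ω₀ z 0 1) * h2

/-- Column asymptotics of `Y_±` where the product representation `Y = Z M₀` suffices: in a strip
along the real line, and outside the light cone. -/
theorem IsRegularSolution.isBigO_matZ_mul_matM0_of_strip (h : IsRegularSolution A₀ ω₀ n S Ef ρ N)
    (hn : IsBroadening Λ n) (hSc : IsClosed S) (hS : S ⊆ lightCone) {t x : ℝ} (ht : 0 ≤ t)
    (hx : 0 ≤ x) {l : Filter ℂ} (hl : l ≤ Bornology.cobounded ℂ)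
    (him : ∀ᶠ z in l, |z.im| ≤ 1 ∨ t ≤ x) :
    ((∀ᶠ z in l, z ∈ closedHalfPlane (-1)) →
      (fun z => (matZ n (retardedField A₀ ω₀ n ρ) (-1) t x z * matM0 A₀ ω₀ z) 0 0 *
        Complex.exp (Complex.I * thetaFun n (-1) t x z) - 1) =O[l] (fun z : ℂ => z⁻¹) ∧
      (fun z => (matZ n (retardedField A₀ ω₀ n ρ) (-1) t x z * matM0 A₀ ω₀ z) 1 0 *
        Complex.exp (Complex.I * thetaFun n (-1) t x z)) =O[l] (fun z : ℂ => z⁻¹)) ∧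
    ((∀ᶠ z in l, z ∈ closedHalfPlane 1) →
      (fun z => (matZ n (retardedField A₀ ω₀ n ρ) 1 t x z * matM0 A₀ ω₀ z) 1 1 *
        Complex.exp (-(Complex.I * thetaFun n 1 t x z)) - 1) =O[l] (fun z : ℂ => z⁻¹) ∧
      (fun z => (matZ n (retardedField A₀ ω₀ n ρ) 1 t x z * matM0 A₀ ω₀ z) 0 1 *
        Complex.exp (-(Complex.I * thetaFun n 1 t x z))) =O[l] (fun z : ℂ => z⁻¹)) := by
  obtain ⟨C, hC⟩ := hn.exists_norm_exp_theta_le t hx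
  have hJ : ∀ᶠ z in l, z ∉ jumpSet n := hl hn.eventually_notMem_jumpSet
  have hZ0 := fun σ => h.isBigO_matZ_col_zero hn hSc hS ht hx σ hl
    (him.mono fun z hz => hz.imp_left fun hz => (abs_le.1 hz).1)
  have hZ1 := fun σ => h.isBigO_matZ_col_one hn hSc hS ht hx σ hl
    (him.mono fun z hz => hz.imp_left fun hz => (abs_le.1 hz).2)
  have m := fun i j => (isBigO_matM0_apply (A₀ := A₀) (ω₀ := ω₀) i j).mono hl
  have m10 : (fun z => matM0 A₀ ω₀ z 1 0) =O[l] (fun z : ℂ => z⁻¹) := by simpa using m 1 0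
  have m01 : (fun z => matM0 A₀ ω₀ z 0 1) =O[l] (fun z : ℂ => z⁻¹) := by simpa using m 0 1
  have m00 : (fun z => matM0 A₀ ω₀ z 0 0 - 1) =O[l] (fun z : ℂ => z⁻¹) := by simpa using m 0 0
  have m11 : (fun z => matM0 A₀ ω₀ z 1 1 - 1) =O[l] (fun z : ℂ => z⁻¹) := by simpa using m 1 1
  have hone : ∀ {f : ℂ → ℂ}, f =O[l] (fun z : ℂ => z⁻¹) → f =O[l] fun _ => (1 : ℂ) :=
    fun hf => hf.trans (isBigO_inv_one hl)
  constructor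
  · intro hσ
    have hb : (fun z => Complex.exp (2 * (Complex.I * thetaFun n (-1) t x z))) =O[l]
        fun _ => (1 : ℂ) := by
      refine IsBigO.of_bound C ?_
      filter_upwards [hσ, hJ, him] with z h1 h2 h3
      simpa [sgnR] using hC (-1) z h1 h2 h3
    constructor
    · refine ((isBigO_mul_sub_one hl (hZ0 (-1)).1 m00).add (isBigO_mul_of_one hb
        (isBigO_mul_of_one (hone (hZ1 (-1)).2) m10))).congr_left fun z => ?_
      rw [(matZ_mul_matM0_exp_theta _ (-1) t x z 0).1]
      ring
    · refine ((isBigO_mul_of_one (isBigO_one_of_sub_one hl m00) (hZ0 (-1)).2).add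
        (isBigO_mul_of_one hb (isBigO_mul_of_one (isBigO_one_of_sub_one hl (hZ1 (-1)).1)
        m10))).congr_left fun z => ?_
      rw [(matZ_mul_matM0_exp_theta _ (-1) t x z 1).1]
      ring
  · intro hσ
    have hb : (fun z => Complex.exp (-(2 * (Complex.I * thetaFun n 1 t x z)))) =O[l]
        fun _ => (1 : ℂ) := by
      refine IsBigO.of_bound C ?_
      filter_upwards [hσ, hJ, him] with z h1 h2 h3
      simpa [sgnR] using hC 1 z h1 h2 h3
    constructor
    · refine ((isBigO_mul_sub_one hl (hZ1 1).1 m11).add (isBigO_mul_of_one hb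
        (isBigO_mul_of_one (hone (hZ0 1).2) m01))).congr_left fun z => ?_
      rw [(matZ_mul_matM0_exp_theta _ 1 t x z 1).2]
      ring
    · refine ((isBigO_mul_of_one (isBigO_one_of_sub_one hl m11) (hZ1 1).2).add
        (isBigO_mul_of_one hb (isBigO_mul_of_one (isBigO_one_of_sub_one hl (hZ0 1).1)
        m01))).congr_left fun z => ?_
      rw [(matZ_mul_matM0_exp_theta _ 1 t x z 0).2]
      ring

theorem isBigO_exists_bound {f : ℂ → ℂ} (hf : f =O[Bornology.cobounded ℂ] fun z : ℂ => z⁻¹) :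
    ∃ C : ℝ, 0 ≤ C ∧ ∀ᶠ z in Bornology.cobounded ℂ, ‖f z‖ ≤ C * ‖z‖⁻¹ := by
  obtain ⟨C, hC0, hC⟩ := hf.exists_nonneg
  exact ⟨C, hC0, hC.bound.mono fun z hz => by rwa [norm_inv] at hz⟩

theorem continuous_matZ_mul_apply {e : ℝ → ℝ → ℂ} (he : Continuous fun p : ℝ × ℝ => e p.1 p.2)
    (σ : ℤˣ) (t : ℝ) (z : ℂ) (B : Mat2) (i j : Fin 2) :
    Continuous fun y => (matZ n e σ t y z * B) i j := by
  have h0 : Continuous fun y : ℝ => (t, y) := by fun_prop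
  have h1 := Continuous.matrix_mul (B := fun _ => B)
    (Continuous.comp (g := fun p : ℝ × ℝ => matZ n e σ p.1 p.2 z) (continuous_matZ he σ z) h0)
    continuous_const
  exact (continuous_apply j).comp ((continuous_apply i).comp h1)

theorem norm_etaFun_sub_le (hn : IsBroadening Λ n) (σ : ℤˣ) {z : ℂ} (hz : 1 ≤ |z.im|) :
    ‖etaFun n σ z - z‖ ≤ 1 / 4 := by
  have hz' : z.im ≠ 0 := by
    rintro h0
    norm_num [h0] at hz
  rw [etaFun, add_sub_cancel_left, norm_mul]
  have h1 := norm_cauchyIntegral_le hn σ hz'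
  have h2 : |z.im|⁻¹ ≤ 1 := inv_le_one_of_one_le₀ hz
  norm_num
  linarith

/-- The `x^±`-equation away from the real line, entry by entry. -/
theorem IsRegularSolution.hasDerivAt_matZ_mul_apply (h : IsRegularSolution A₀ ω₀ n S Ef ρ N)
    (hn : IsBroadening Λ n) (hSc : IsClosed S) (hS : S ⊆ lightCone) {t s : ℝ}
    (hs : 0 < s) (hst : s < t) (σ : ℤˣ) {z : ℂ} (hz : z.im ≠ 0) (B : Mat2) (i j : Fin 2) :
    HasDerivAt (fun y => (matZ n (retardedField A₀ ω₀ n ρ) σ t y z * B) i j)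
      ((((Complex.I * etaFun n σ z) • sigma3 +
        !![0, retardedField A₀ ω₀ n ρ (t - s) s / 2;
          -(conj (retardedField A₀ ω₀ n ρ (t - s) s)) / 2, 0] -
        Complex.I • deviationMat n ρ N t s z) *
          (matZ n (retardedField A₀ ω₀ n ρ) σ t s z * B)) i j) s := by
  have ht : 0 ≤ t := (hs.trans hst).le
  have h1 := (h.hasDerivAt_matZ_x hn hSc hS ht hs hst.ne' σ
    (fun hJ => hz hJ.1)).mat2_mul_const B
  rw [h.laxMatX_eq hn hS ht hs hz σ, matH, h.field_eq hn hSc hS hs.le hst,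
    Matrix.mul_assoc] at h1
  exact hasDerivAt_mat2_iff.1 h1 i j

/-- Column asymptotics of `Y_±` inside the light cone and away from the real line, from the
`x^±`-equation: there the diagonal entries of `V_±` are `± i η` up to `O(1/z)`, and `Im η` has the
sign that makes the normalized column stable. -/
theorem IsRegularSolution.exists_matZ_mul_matM0_bound (h : IsRegularSolution A₀ ω₀ n S Ef ρ N)
    (hn : IsBroadening Λ n) (hSc : IsClosed S) (hS : S ⊆ lightCone) {t x : ℝ}
    (hx : 0 ≤ x) (hxt : x < t) (σ : ℤˣ) :
    ∃ C : ℝ, ∀ᶠ z in Bornology.cobounded ℂ,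
      (z.im ≤ -1 →
        ‖(matZ n (retardedField A₀ ω₀ n ρ) σ t x z * matM0 A₀ ω₀ z) 0 0 *
          Complex.exp (Complex.I * thetaFun n σ t x z) - 1‖ ≤ C * ‖z‖⁻¹ ∧
        ‖(matZ n (retardedField A₀ ω₀ n ρ) σ t x z * matM0 A₀ ω₀ z) 1 0 *
          Complex.exp (Complex.I * thetaFun n σ t x z)‖ ≤ C * ‖z‖⁻¹) ∧
      (1 ≤ z.im →
        ‖(matZ n (retardedField A₀ ω₀ n ρ) σ t x z * matM0 A₀ ω₀ z) 1 1 *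
          Complex.exp (-(Complex.I * thetaFun n σ t x z)) - 1‖ ≤ C * ‖z‖⁻¹ ∧
        ‖(matZ n (retardedField A₀ ω₀ n ρ) σ t x z * matM0 A₀ ω₀ z) 0 1 *
          Complex.exp (-(Complex.I * thetaFun n σ t x z))‖ ≤ C * ‖z‖⁻¹) := by
  have he := h.continuous_retardedField hn hS
  have ht : 0 ≤ t := hx.trans hxt.le
  obtain ⟨D, hD⟩ := h.exists_bound_deriv_retardedField_x hn hSc hS t
  obtain ⟨G, hG0, hG⟩ := h.exists_deviationMat_bound hn hSc hS t
  obtain ⟨p00, p10, p11, p01⟩ := isBigO_matPhiC (A₀ := A₀) (ω₀ := ω₀) t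
  obtain ⟨B00, hB00, p00⟩ := isBigO_exists_bound p00
  obtain ⟨B10, hB10, p10⟩ := isBigO_exists_bound p10
  obtain ⟨B11, hB11, p11⟩ := isBigO_exists_bound p11
  obtain ⟨B01, hB01, p01⟩ := isBigO_exists_bound p01
  set e := retardedField A₀ ω₀ n ρ with hedef
  have hec : Continuous fun y => e (t - y) y :=
    he.comp (by fun_prop : Continuous fun y : ℝ => (t - y, y))
  obtain ⟨K, hK⟩ := (isCompact_Icc (a := (0 : ℝ)) (b := x)).exists_bound_of_continuousOn
    hec.continuousOn
  set c : ℝ := 1 + |K| + |D| + G + B00 + B10 + B11 + B01 with hc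
  have hK0 := abs_nonneg K
  have hD0 := abs_nonneg D
  have hc1 : 1 ≤ c := by rw [hc]; linarith
  obtain ⟨C, hC0, hC⟩ := exists_perturbation_bound c x hc1
  choose! d hd1 hd2 using fun (s : ℝ) (hs : s ∈ Set.Ioo 0 x) => hD s hs.1 (hs.2.trans hxt)
  have hhalf : ∀ w : ℂ, ‖w / 2‖ ≤ ‖w‖ := fun w => by
    rw [norm_div, Complex.norm_ofNat]
    linarith [norm_nonneg w]
  have hKs : ∀ s ∈ Set.Icc 0 x, ‖e (t - s) s / 2‖ ≤ |K| := fun s hs =>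
    (hhalf _).trans ((hK s hs).trans (le_abs_self K))
  have hKs' : ∀ s ∈ Set.Icc 0 x, ‖conj (e (t - s) s) / 2‖ ≤ |K| := fun s hs =>
    (hhalf _).trans (by rw [RCLike.norm_conj]; exact (hK s hs).trans (le_abs_self K))
  have hDs : ∀ s ∈ Set.Ioo 0 x, ‖d s / 2‖ ≤ |D| := fun s hs =>
    (hhalf _).trans ((hd1 s hs).trans (le_abs_self D))
  have hDs' : ∀ s ∈ Set.Ioo 0 x, ‖conj (d s) / 2‖ ≤ |D| := fun s hs =>
    (hhalf _).trans (by rw [RCLike.norm_conj]; exact (hd1 s hs).trans (le_abs_self D))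
  refine ⟨C, ?_⟩
  filter_upwards [p00, p10, p11, p01, tendsto_norm_cobounded_atTop.eventually_ge_atTop 1,
    eventually_sub_branchPt_ne_zero (A₀ := A₀) (ω₀ := ω₀)] with z p00 p10 p11 p01 hz1 hzE
  have hz0 : 0 < ‖z‖ := by linarith
  have hε : 0 < ‖z‖⁻¹ := inv_pos.2 hz0
  have hε1 : ‖z‖⁻¹ ≤ 1 := inv_le_one_of_one_le₀ hz1
  -- an opaque name for `Y_±` as a function of `x`, of which only the facts below are used
  obtain ⟨Y, hY⟩ : ∃ Y : ℝ → Mat2, ∀ y, matZ n e σ t y z * matM0 A₀ ω₀ z = Y y := ⟨_, fun _ => rfl⟩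
  have hYc : ∀ i j, Continuous fun y => Y y i j := fun i j =>
    (continuous_matZ_mul_apply (n := n) he σ t z (matM0 A₀ ω₀ z) i j).congr fun y => by rw [hY]
  have hY0 : Y 0 = matPhiC A₀ ω₀ t z := by
    rw [← h.matPsi_mul_matM0 hn hS ht hzE, ← hY, hedef]
    simp [matZ]
  -- facts valid away from the real line
  have hmain : 1 ≤ |z.im| → (1 ≤ 2 * ‖z‖⁻¹ * ‖etaFun n σ z‖ ∧
      |(etaFun n σ z).im - z.im| ≤ 1 / 4 ∧
      (∀ s ∈ Set.Ioo 0 x, ∀ i j, ‖deviationMat n ρ N t s z i j‖ ≤ G * ‖z‖⁻¹ ∧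
        ‖deviationMat n ρ N t s z i j‖ ≤ G) ∧
      ∀ s ∈ Set.Ioo 0 x, ∀ i j, HasDerivAt (fun y => Y y i j)
        ((((Complex.I * etaFun n σ z) • sigma3 +
          !![0, e (t - s) s / 2; -(conj (e (t - s) s)) / 2, 0] -
          Complex.I • deviationMat n ρ N t s z) * Y s) i j) s) := by
    intro him
    have hz' : z.im ≠ 0 := by
      rintro h0
      norm_num [h0] at him
    have hηz := norm_etaFun_sub_le hn σ him
    refine ⟨?_, (by rw [← Complex.sub_im]; exact (Complex.abs_im_le_norm _).trans hηz), ?_, ?_⟩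
    · have h1 : ‖z‖ - ‖etaFun n σ z‖ ≤ 1 / 4 :=
        (norm_sub_norm_le _ _).trans (by rwa [norm_sub_rev])
      have h2 : ‖z‖ ≤ 2 * ‖etaFun n σ z‖ := by linarith
      calc (1 : ℝ) = ‖z‖⁻¹ * ‖z‖ := (inv_mul_cancel₀ hz0.ne').symm
        _ ≤ ‖z‖⁻¹ * (2 * ‖etaFun n σ z‖) := by gcongr
        _ = 2 * ‖z‖⁻¹ * ‖etaFun n σ z‖ := by ring
    · intro s hs i j
      have h1 := hG t s z ⟨ht, le_rfl⟩ ⟨hs.1, (hs.2.trans hxt).le⟩ him i j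
      exact ⟨h1, h1.trans (mul_le_of_le_one_right hG0 hε1)⟩
    · intro s hs i j
      have h1 := h.hasDerivAt_matZ_mul_apply hn hSc hS hs.1 (hs.2.trans hxt) σ hz'
        (matM0 A₀ ω₀ z) i j
      simpa only [← hedef, hY] using h1
  simp only [hY]
  clear hY hzE hG hC0
  generalize hη : etaFun n σ z = η at hmain
  have hexp : ∀ s : ℝ, HasDerivAt (fun y : ℝ => Complex.exp (Complex.I * thetaFun n σ t y z))
      (Complex.exp (Complex.I * thetaFun n σ t s z) * (-(Complex.I * η))) s := by
    intro s
    have h1 : HasDerivAt (fun y : ℝ => Complex.I * thetaFun n σ t y z) (-(Complex.I * η)) s := by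
      have h2 := (((Complex.ofRealCLM.hasDerivAt (x := s)).const_mul η).const_sub
        (z * t)).const_mul Complex.I
      simpa [thetaFun, hη] using! h2
    exact h1.cexp
  have hexp' : ∀ s : ℝ, HasDerivAt (fun y : ℝ => Complex.exp (-(Complex.I * thetaFun n σ t y z)))
      (Complex.exp (-(Complex.I * thetaFun n σ t s z)) * (Complex.I * η)) s := by
    intro s
    have h1 : HasDerivAt (fun y : ℝ => -(Complex.I * thetaFun n σ t y z)) (Complex.I * η) s := by
      have h2 := ((((Complex.ofRealCLM.hasDerivAt (x := s)).const_mul η).const_sub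
        (z * t)).const_mul Complex.I).neg
      simpa [thetaFun, hη] using! h2
    exact h1.cexp
  have hexpc : Continuous fun y : ℝ => Complex.exp (Complex.I * thetaFun n σ t y z) :=
    continuous_iff_continuousAt.2 fun s => (hexp s).continuousAt
  have hexpc' : Continuous fun y : ℝ => Complex.exp (-(Complex.I * thetaFun n σ t y z)) :=
    continuous_iff_continuousAt.2 fun s => (hexp' s).continuousAt
  have hθ0 : thetaFun n σ t 0 z = z * t := by simp [thetaFun]
  have hle : ∀ {a : ℝ}, a ≤ c → a * ‖z‖⁻¹ ≤ c * ‖z‖⁻¹ := fun ha => by gcongr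
  have hIG : ∀ w : ℂ, ‖-(Complex.I * w)‖ = ‖w‖ := fun w => by
    rw [norm_neg, norm_mul, Complex.norm_I, one_mul]
  constructor
  · intro him
    obtain ⟨hζ, hηim, hdev, hder⟩ := hmain (by rw [abs_of_nonpos (by linarith)]; linarith)
    -- the second entry of the first column has the coefficient `-2 i η`
    refine hC ‖z‖⁻¹ x (-η) (fun s => Y s 0 0 * Complex.exp (Complex.I * thetaFun n σ t s z))
      (fun s => Y s 1 0 * Complex.exp (Complex.I * thetaFun n σ t s z))
      (fun s => -(Complex.I * deviationMat n ρ N t s z 0 0))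
      (fun s => e (t - s) s / 2 + -(Complex.I * deviationMat n ρ N t s z 0 1))
      (fun s => -(Complex.I * deviationMat n ρ N t s z 1 0))
      (fun s => -(Complex.I * deviationMat n ρ N t s z 1 1))
      (fun s => -(conj (e (t - s) s) / 2)) (fun s => -(conj (d s) / 2)) hx le_rfl hε hε1
      (by rwa [norm_neg]) (by rw [Complex.neg_im]; linarith [abs_le.1 hηim])
      ((hYc 0 0).mul hexpc).continuousOn ((hYc 1 0).mul hexpc).continuousOn
      ((Complex.continuous_conj.comp hec).div_const 2).neg.continuousOn ?_ ?_ ?_ ?_ ?_ ?_ ?_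
      x (Set.right_mem_Icc.2 hx)
    · intro s hs
      refine ((hder s hs 0 0).mul (hexp s)).congr_deriv ?_
      simp [Matrix.mul_apply, Fin.sum_univ_two, sigma3]
      ring
    · intro s hs
      refine ((hder s hs 1 0).mul (hexp s)).congr_deriv ?_
      simp [Matrix.mul_apply, Fin.sum_univ_two, sigma3]
      ring
    · intro s hs
      exact ((hd2 s hs).star.div_const 2).neg
    · intro s hs
      refine ⟨?_, ?_, ?_, ?_, ?_⟩
      · rw [hIG]
        exact (hdev s hs 0 0).1.trans (hle (by rw [hc]; linarith))
      · refine (norm_add_le _ _).trans ?_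
        rw [hIG]
        linarith [hKs s (Set.Ioo_subset_Icc_self hs), (hdev s hs 0 1).2]
      · rw [hIG]
        exact (hdev s hs 1 0).1.trans (hle (by rw [hc]; linarith))
      · rw [hIG]
        linarith [(hdev s hs 1 1).2]
      · rw [norm_neg]
        linarith [hDs' s hs]
    · intro s hs
      rw [norm_neg]
      linarith [hKs' s hs]
    · rw [hY0, hθ0, ← mul_assoc]
      exact p00.trans (hle (by rw [hc]; linarith))
    · rw [hY0, hθ0, ← mul_assoc]
      exact p10.trans (hle (by rw [hc]; linarith))
  · intro him
    obtain ⟨hζ, hηim, hdev, hder⟩ := hmain (by rw [abs_of_nonneg (by linarith)]; linarith)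
    -- in the second column the roles of the entries are exchanged and the coefficient is `2 i η`
    refine hC ‖z‖⁻¹ x η (fun s => Y s 1 1 * Complex.exp (-(Complex.I * thetaFun n σ t s z)))
      (fun s => Y s 0 1 * Complex.exp (-(Complex.I * thetaFun n σ t s z)))
      (fun s => -(Complex.I * deviationMat n ρ N t s z 1 1))
      (fun s => -(conj (e (t - s) s) / 2) + -(Complex.I * deviationMat n ρ N t s z 1 0))
      (fun s => -(Complex.I * deviationMat n ρ N t s z 0 1))
      (fun s => -(Complex.I * deviationMat n ρ N t s z 0 0))
      (fun s => e (t - s) s / 2) (fun s => d s / 2) hx le_rfl hε hε1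
      hζ (by linarith [abs_le.1 hηim])
      ((hYc 1 1).mul hexpc').continuousOn ((hYc 0 1).mul hexpc').continuousOn
      (hec.div_const 2).continuousOn ?_ ?_ ?_ ?_ ?_ ?_ ?_
      x (Set.right_mem_Icc.2 hx)
    · intro s hs
      refine ((hder s hs 1 1).mul (hexp' s)).congr_deriv ?_
      simp [Matrix.mul_apply, Fin.sum_univ_two, sigma3]
      ring
    · intro s hs
      refine ((hder s hs 0 1).mul (hexp' s)).congr_deriv ?_
      simp [Matrix.mul_apply, Fin.sum_univ_two, sigma3]
      ring
    · intro s hs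
      exact (hd2 s hs).div_const 2
    · intro s hs
      refine ⟨?_, ?_, ?_, ?_, ?_⟩
      · rw [hIG]
        exact (hdev s hs 1 1).1.trans (hle (by rw [hc]; linarith))
      · refine (norm_add_le _ _).trans ?_
        rw [hIG, norm_neg]
        linarith [hKs' s (Set.Ioo_subset_Icc_self hs), (hdev s hs 1 0).2]
      · rw [hIG]
        exact (hdev s hs 0 1).1.trans (hle (by rw [hc]; linarith))
      · rw [hIG]
        linarith [(hdev s hs 0 0).2]
      · linarith [hDs s hs]
    · intro s hs
      linarith [hKs s hs]
    · rw [hY0, hθ0, ← mul_assoc]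
      exact p11.trans (hle (by rw [hc]; linarith))
    · rw [hY0, hθ0, ← mul_assoc]
      exact p01.trans (hle (by rw [hc]; linarith))

theorem isBigO_inf_principal_of_union {f g : ℂ → ℂ} {l : Filter ℂ} {s : Set ℂ}
    (h1 : f =O[l ⊓ 𝓟 s] g) (h2 : f =O[l ⊓ 𝓟 sᶜ] g) : f =O[l] g := by
  have := h1.sup h2
  rwa [← inf_sup_left, sup_principal, Set.union_compl_self, principal_univ, inf_top_eq] at this

theorem closedHalfPlane_one : closedHalfPlane 1 = {z | 0 ≤ z.im} := by
  simp [closedHalfPlane, sgnR]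

theorem closedHalfPlane_neg_one : closedHalfPlane (-1) = {z | z.im ≤ 0} := by
  ext z
  simp [closedHalfPlane, sgnR]

/-- Asymptotics of the column of `Y_-` and of `Y_+` that is normalized at infinity. -/
theorem IsRegularSolution.isBigO_matZ_mul_matM0 (h : IsRegularSolution A₀ ω₀ n S Ef ρ N)
    (hn : IsBroadening Λ n) (hSc : IsClosed S) (hS : S ⊆ lightCone) {t x : ℝ} (ht : 0 ≤ t)
    (hx : 0 ≤ x) :
    ((fun z => (matZ n (retardedField A₀ ω₀ n ρ) (-1) t x z * matM0 A₀ ω₀ z) 0 0 *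
        Complex.exp (Complex.I * thetaFun n (-1) t x z) - 1)
          =O[atInfinity (-1)] (fun z : ℂ => z⁻¹) ∧
      (fun z => (matZ n (retardedField A₀ ω₀ n ρ) (-1) t x z * matM0 A₀ ω₀ z) 1 0 *
        Complex.exp (Complex.I * thetaFun n (-1) t x z))
          =O[atInfinity (-1)] (fun z : ℂ => z⁻¹)) ∧
    ((fun z => (matZ n (retardedField A₀ ω₀ n ρ) 1 t x z * matM0 A₀ ω₀ z) 1 1 *
        Complex.exp (-(Complex.I * thetaFun n 1 t x z)) - 1)
          =O[atInfinity 1] (fun z : ℂ => z⁻¹) ∧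
      (fun z => (matZ n (retardedField A₀ ω₀ n ρ) 1 t x z * matM0 A₀ ω₀ z) 0 1 *
        Complex.exp (-(Complex.I * thetaFun n 1 t x z)))
          =O[atInfinity 1] (fun z : ℂ => z⁻¹)) := by
  have hmem : ∀ σ, ∀ᶠ z in atInfinity σ, z ∈ closedHalfPlane σ := fun σ =>
    mem_inf_of_right (mem_principal_self _)
  rcases le_or_gt t x with htx | hxt
  · exact ⟨(h.isBigO_matZ_mul_matM0_of_strip hn hSc hS ht hx inf_le_left
        (Eventually.of_forall fun _ => Or.inr htx)).1 (hmem _),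
      (h.isBigO_matZ_mul_matM0_of_strip hn hSc hS ht hx inf_le_left
        (Eventually.of_forall fun _ => Or.inr htx)).2 (hmem _)⟩
  -- behind the light cone the half-plane is divided into a strip along the real line and the rest
  · set s : Set ℂ := {z | |z.im| ≤ 1} with hs
    have hstrip : ∀ σ, ∀ᶠ z in atInfinity σ ⊓ 𝓟 s, |z.im| ≤ 1 ∨ t ≤ x := fun σ =>
      (mem_inf_of_right (mem_principal_self s) : s ∈ atInfinity σ ⊓ 𝓟 s) |> fun hz => by
        filter_upwards [hz] with z hz using Or.inl hz
    have hcompl : ∀ σ, ∀ᶠ z in atInfinity σ ⊓ 𝓟 sᶜ, z ∈ closedHalfPlane σ ∧ 1 < |z.im| := by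
      intro σ
      have h1 : sᶜ ∈ atInfinity σ ⊓ 𝓟 sᶜ := mem_inf_of_right (mem_principal_self _)
      have h2 : closedHalfPlane σ ∈ atInfinity σ ⊓ 𝓟 sᶜ := mem_inf_of_left (hmem σ)
      filter_upwards [h1, h2] with z hz1 hz2
      exact ⟨hz2, not_le.1 hz1⟩
    have hl : ∀ σ (u : Set ℂ), atInfinity σ ⊓ 𝓟 u ≤ Bornology.cobounded ℂ := fun σ u =>
      inf_le_left.trans inf_le_left
    constructor
    · obtain ⟨C, hC⟩ := h.exists_matZ_mul_matM0_bound hn hSc hS hx hxt (-1)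
      have hin := (h.isBigO_matZ_mul_matM0_of_strip hn hSc hS ht hx (hl _ s) (hstrip (-1))).1
        (mem_inf_of_left (hmem (-1)))
      have hout := ((hC.filter_mono (hl (-1) sᶜ)).and (hcompl (-1))).mono fun z ⟨hz, hz'⟩ => by
        have h0 : z.im ≤ 0 := by simpa [closedHalfPlane_neg_one] using hz'.1
        have h1 := hz'.2
        rw [abs_of_nonpos h0] at h1
        exact hz.1 (by linarith)
      refine ⟨isBigO_inf_principal_of_union hin.1 (IsBigO.of_bound C ?_),
        isBigO_inf_principal_of_union hin.2 (IsBigO.of_bound C ?_)⟩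
      · filter_upwards [hout] with z hz
        rw [norm_inv]
        exact hz.1
      · filter_upwards [hout] with z hz
        rw [norm_inv]
        exact hz.2
    · obtain ⟨C, hC⟩ := h.exists_matZ_mul_matM0_bound hn hSc hS hx hxt 1
      have hin := (h.isBigO_matZ_mul_matM0_of_strip hn hSc hS ht hx (hl _ s) (hstrip 1)).2
        (mem_inf_of_left (hmem 1))
      have hout := ((hC.filter_mono (hl 1 sᶜ)).and (hcompl 1)).mono fun z ⟨hz, hz'⟩ => by
        have h0 : 0 ≤ z.im := by simpa [closedHalfPlane_one] using hz'.1
        have h1 := hz'.2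
        rw [abs_of_nonneg h0] at h1
        exact hz.2 (by linarith)
      refine ⟨isBigO_inf_principal_of_union hin.1 (IsBigO.of_bound C ?_),
        isBigO_inf_principal_of_union hin.2 (IsBigO.of_bound C ?_)⟩
      · filter_upwards [hout] with z hz
        rw [norm_inv]
        exact hz.1
      · filter_upwards [hout] with z hz
        rw [norm_inv]
        exact hz.2

end ColumnAsymptotics

/-! ### Dependence of the solutions on the spectral parameter -/

section SpectralParameter

variable {A₀ ω₀ : ℝ} {n : ℝ → ℝ} {Λ : EReal} {e : ℝ → ℝ → ℂ}

theorem continuous_matPsi_spectral (he : Continuous fun p : ℝ × ℝ => e p.1 p.2) (t x : ℝ) :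
    Continuous (matPsi e t x) := by
  have h0 : Continuous fun z : ℂ => (t, x, z) := by fun_prop
  exact Continuous.comp (g := fun q : ℝ × ℝ × ℂ => matPsi e q.1 q.2.1 q.2.2)
    (continuous_matPsi he) h0

theorem differentiable_matPsi (he : Continuous fun p : ℝ × ℝ => e p.1 p.2) (t x : ℝ) :
    Differentiable ℂ (matPsi e t x) := by
  intro z
  have h1 : HasDerivAt (fun z : ℂ => -(Complex.I * z * (min t x : ℝ)))
      (-(Complex.I * 1 * (min t x : ℝ))) z :=
    (((hasDerivAt_id z).const_mul Complex.I).mul_const _).neg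
  exact (((differentiable_laxProp he (max (t - x) 0) x) z).hasDerivAt.mat2_mul
    h1.expSigma3).differentiableAt

theorem differentiableAt_matZ (he : Continuous fun p : ℝ × ℝ => e p.1 p.2)
    (hn : IsBroadening Λ n) (σ : ℤˣ) (t x : ℝ) {z : ℂ} (hz : z ∉ bandSet Λ) :
    DifferentiableAt ℂ (matZ n e σ t x) z := by
  have h1 : DifferentiableAt ℂ (etaFun n σ) z :=
    (differentiableOn_etaFun hn σ).differentiableAt ((isOpen_compl_bandSet hn).mem_nhds hz)
  exact ((differentiable_matPsi he t x z).hasDerivAt.mat2_mul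
    ((h1.hasDerivAt.const_mul Complex.I).mul_const (x : ℂ)).expSigma3).differentiableAt

theorem continuousOn_matZ (he : Continuous fun p : ℝ × ℝ => e p.1 p.2) (hn : IsBroadening Λ n)
    (σ : ℤˣ) (t x : ℝ) : ContinuousOn (matZ n e σ t x) (closedHalfPlane σ \ jumpSet n) := by
  have h1 : ContinuousOn (fun z => Complex.I * etaFun n σ z * x) (closedHalfPlane σ \ jumpSet n) :=
    (continuousOn_const.mul (continuousOn_etaFun hn σ)).mul continuousOn_const
  exact (continuous_matPsi_spectral he t x).continuousOn.mul
    (continuous_expSigma3.comp_continuousOn h1)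

theorem norm_expSigma3_le (c : ℂ) : ‖expSigma3 c‖ ≤ Real.exp |c.re| := by
  refine Mat2.norm_le_of_entries fun i j => ?_
  fin_cases i <;> fin_cases j
  · simpa [expSigma3, Complex.norm_exp] using le_abs_self c.re
  · simpa [expSigma3] using Real.exp_nonneg _
  · simpa [expSigma3] using Real.exp_nonneg _
  · simpa [expSigma3, Complex.norm_exp] using neg_le_abs c.re

/-- `Z_±` is bounded in bounded parts of its half-plane: off the discontinuities of `n` the
function `η` has a locally bounded imaginary part, and there are at most two discontinuities. -/
theorem boundedNear_matZ (he : Continuous fun p : ℝ × ℝ => e p.1 p.2) (hn : IsBroadening Λ n)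
    (σ : ℤˣ) (t : ℝ) {x : ℝ} (hx : 0 ≤ x) (z₀ : ℂ) :
    BoundedNear (matZ n e σ t x) (closedHalfPlane σ) z₀ := by
  obtain ⟨K, hK0, hK⟩ := exists_abs_im_cauchyIntegral_le hn
  obtain ⟨l, hl0, hl⟩ := hn.exists_jump
  obtain ⟨M, hM⟩ := (isCompact_closedBall z₀ 1).exists_bound_of_continuousOn
    (continuous_matPsi_spectral he t x).continuousOn
  have hM0 : 0 ≤ M := (norm_nonneg _).trans (hM z₀ (Metric.mem_closedBall_self zero_le_one))
  set R : ℝ := 2 * M * Real.exp ((‖z₀‖ + 1 + K / 4) * x) with hR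
  have hR0 : 0 ≤ R := by positivity
  refine ⟨1, R + ‖matZ n e σ t x (l : ℂ)‖ + ‖matZ n e σ t x ((-l : ℝ) : ℂ)‖, one_pos,
    fun z hz hzr => ?_⟩
  by_cases hJ : z ∈ jumpSet n
  · have hz1 : z = (z.re : ℂ) := Complex.ext rfl hJ.1
    rcases eq_or_eq_neg_of_abs_eq (hl _ hJ.2) with h | h
    · rw [hz1, h]
      linarith [norm_nonneg (matZ n e σ t x ((-l : ℝ) : ℂ))]
    · rw [hz1, h]
      linarith [norm_nonneg (matZ n e σ t x (l : ℂ))]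
  · have hzn : ‖z‖ ≤ ‖z₀‖ + 1 := by
      have := norm_add_le z₀ (z - z₀)
      rw [add_sub_cancel] at this
      linarith
    have him : |(etaFun n σ z).im| ≤ ‖z₀‖ + 1 + K / 4 := by
      have h4 : (1 / 4 : ℂ) = ((1 / 4 : ℝ) : ℂ) := by push_cast; rfl
      rw [etaFun, h4, Complex.add_im, Complex.im_ofReal_mul]
      refine (abs_add_le _ _).trans (add_le_add ((Complex.abs_im_le_norm z).trans hzn) ?_)
      rw [abs_mul, abs_of_pos (by norm_num : (0 : ℝ) < 1 / 4)]
      linarith [hK σ z hz hJ]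
    have hre : |(Complex.I * etaFun n σ z * x).re| ≤ (‖z₀‖ + 1 + K / 4) * x := by
      rw [Complex.re_mul_ofReal, Complex.I_mul_re, abs_mul, abs_neg, abs_of_nonneg hx]
      gcongr
    have h1 : ‖matZ n e σ t x z‖ ≤ R := by
      rw [matZ, hR]
      refine (Mat2.norm_mul_le _ _).trans ?_
      gcongr
      · exact hM z (by rw [Metric.mem_closedBall, dist_eq_norm]; exact hzr.le)
      · exact (norm_expSigma3_le _).trans (Real.exp_le_exp.2 hre)
    linarith [norm_nonneg (matZ n e σ t x (l : ℂ)), norm_nonneg (matZ n e σ t x ((-l : ℝ) : ℂ))]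

theorem BoundedNear.mul {f g : ℂ → Mat2} {D D' : Set ℂ} {z₀ : ℂ} (hf : BoundedNear f D z₀)
    (hg : BoundedNear g D' z₀) : BoundedNear (fun z => f z * g z) (D ∩ D') z₀ := by
  obtain ⟨r, C, hr, h⟩ := hf
  obtain ⟨r', C', hr', h'⟩ := hg
  refine ⟨min r r', 2 * |C| * |C'|, lt_min hr hr', fun z hz hzr => ?_⟩
  refine (Mat2.norm_mul_le _ _).trans ?_
  gcongr
  · exact (h z hz.1 (hzr.trans_le (min_le_left _ _))).trans (le_abs_self C)
  · exact (h' z hz.2 (hzr.trans_le (min_le_right _ _))).trans (le_abs_self C')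

theorem boundedNear_matZ_mul_matM0 (hA₀ : 0 < A₀)
    (he : Continuous fun p : ℝ × ℝ => e p.1 p.2) (hn : IsBroadening Λ n)
    (σ : ℤˣ) (t : ℝ) {x : ℝ} (hx : 0 ≤ x) {z₀ : ℂ} (hz₀ : z₀.im = 0) :
    BoundedNear (fun z => matZ n e σ t x z * matM0 A₀ ω₀ z)
      (closedHalfPlane σ \ cutSeg A₀ ω₀ σ) z₀ := by
  have h := (boundedNear_matZ he hn σ t hx z₀).mul
    (boundedNear_matM0 (A₀ := A₀) (ω₀ := ω₀) (cutSeg A₀ ω₀ σ)ᶜ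
      (sub_branchPt_ne_zero hA₀ (Or.inl (by rw [hz₀, abs_zero]; positivity))))
  rwa [← Set.sdiff_eq] at h

theorem analyticOn_matZ (he : Continuous fun p : ℝ × ℝ => e p.1 p.2) (hn : IsBroadening Λ n)
    (σ : ℤˣ) (t x : ℝ) : AnalyticOn ℂ (matZ n e σ t x) (closedHalfPlane σ \ bandSet Λ) := by
  have h : DifferentiableOn ℂ (matZ n e σ t x) (bandSet Λ)ᶜ := fun z hz =>
    (differentiableAt_matZ he hn σ t x hz).differentiableWithinAt
  exact ((h.analyticOnNhd (isOpen_compl_bandSet hn)).mono fun z hz => hz.2).analyticOn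

theorem analyticOn_matZ_mul_matM0 (hA₀ : 0 < A₀) (he : Continuous fun p : ℝ × ℝ => e p.1 p.2)
    (hn : IsBroadening Λ n) (σ : ℤˣ) (t x : ℝ) :
    AnalyticOn ℂ (fun z => matZ n e σ t x z * matM0 A₀ ω₀ z)
      (closedHalfPlane σ \ (bandSet Λ ∪ cutSeg A₀ ω₀ σ)) := by
  have h : DifferentiableOn ℂ (fun z => matZ n e σ t x z * matM0 A₀ ω₀ z)
      ((bandSet Λ)ᶜ ∩ (branchCut A₀ ω₀)ᶜ) := fun z hz =>
    ((differentiableAt_matZ he hn σ t x hz.1).hasDerivAt.mat2_mul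
      (differentiableAt_matM0 hA₀ hz.2).hasDerivAt).differentiableAt.differentiableWithinAt
  exact ((h.analyticOnNhd ((isOpen_compl_bandSet hn).inter
    isClosed_branchCut.isOpen_compl)).mono fun z hz => ⟨fun hb => hz.2 (Or.inl hb),
      notMem_branchCut hA₀ ⟨hz.1, fun hc => hz.2 (Or.inr hc)⟩⟩).analyticOn

theorem continuousOn_matZ_mul_matM0 (hA₀ : 0 < A₀) (he : Continuous fun p : ℝ × ℝ => e p.1 p.2)
    (hn : IsBroadening Λ n) (σ : ℤˣ) (t x : ℝ) :
    ContinuousOn (fun z => matZ n e σ t x z * matM0 A₀ ω₀ z)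
      (closedHalfPlane σ \ (cutSeg A₀ ω₀ σ ∪ jumpSet n)) := by
  have h1 : ContinuousOn (matM0 A₀ ω₀) (closedHalfPlane σ \ (cutSeg A₀ ω₀ σ ∪ jumpSet n)) :=
    fun z hz => (differentiableAt_matM0 hA₀ (notMem_branchCut hA₀
      ⟨hz.1, fun hc => hz.2 (Or.inl hc)⟩)).continuousAt.continuousWithinAt
  exact ((continuousOn_matZ he hn σ t x).mono fun z hz =>
    ⟨hz.1, fun hJ => hz.2 (Or.inr hJ)⟩).mul h1

/-- One-sided limits on the cut, where `Z_±` is continuous and only `M₀` jumps. -/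
theorem exists_tendsto_matZ_mul_matM0_cut (hA₀ : 0 < A₀)
    (he : Continuous fun p : ℝ × ℝ => e p.1 p.2) (hn : IsBroadening Λ n) (σ : ℤˣ) (t x : ℝ) {ζ : ℂ}
    (hζ : ζ ∈ openSegment ℝ (branchPt A₀ ω₀ σ) (reE ω₀)) :
    (∃ B : Mat2, Tendsto (fun z => matZ n e σ t x z * matM0 A₀ ω₀ z)
      (𝓝[{z | z.re < (reE ω₀).re}] ζ) (𝓝 B)) ∧
    (∃ B : Mat2, Tendsto (fun z => matZ n e σ t x z * matM0 A₀ ω₀ z)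
      (𝓝[{z | (reE ω₀).re < z.re}] ζ) (𝓝 B)) := by
  obtain ⟨hre, him, hpos⟩ := mem_openSegment_cut hA₀ hζ
  have hZ := (differentiableAt_matZ he hn σ t x
    (notMem_bandSet_of_im_ne_zero (right_ne_zero_of_mul hpos.ne'))).continuousAt
  obtain ⟨⟨B, hB⟩, B', hB'⟩ := exists_tendsto_matM0_cut hA₀ hre him
  have h0 : (reE ω₀).re = -ω₀ / 2 := by simp [reE]
  rw [h0]
  exact ⟨⟨_, (hZ.tendsto.mono_left nhdsWithin_le_nhds).mul hB⟩,
    _, (hZ.tendsto.mono_left nhdsWithin_le_nhds).mul hB'⟩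

/-- At the branch point `M₀` has a fourth-root singularity with a nonzero coefficient, and `Z_±` is
continuous and invertible. -/
theorem exists_tendsto_matZ_mul_matM0_branchPt (hA₀ : 0 < A₀)
    (he : Continuous fun p : ℝ × ℝ => e p.1 p.2) (hn : IsBroadening Λ n) (σ : ℤˣ) (t x : ℝ) :
    ∃ B : Mat2, B ≠ 0 ∧
      Tendsto (fun z =>
        ((-((sgnR σ : ℂ) * Complex.I) * (z - branchPt A₀ ω₀ σ)) ^ (1 / 4 : ℂ)) •
          (matZ n e σ t x z * matM0 A₀ ω₀ z))
        (𝓝[(cutSeg A₀ ω₀ σ)ᶜ] (branchPt A₀ ω₀ σ)) (𝓝 B) := by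
  have him : (branchPt A₀ ω₀ σ).im ≠ 0 := by
    rcases Int.units_eq_one_or σ with rfl | rfl <;> simp [branchPt, sgnR, hA₀.ne']
  have hZ := (differentiableAt_matZ he hn σ t x (notMem_bandSet_of_im_ne_zero him)).continuousAt
  have hlim := (hZ.tendsto.mono_left nhdsWithin_le_nhds).mul
    (tendsto_matM0_branchPt (ω₀ := ω₀) hA₀ σ)
  refine ⟨_, fun h0 => ?_, hlim.congr fun z => Matrix.mul_smul _ _ _⟩
  have h1 : (matZ n e σ t x (branchPt A₀ ω₀ σ)).adjugate *
      matZ n e σ t x (branchPt A₀ ω₀ σ) = 1 := by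
    rw [Matrix.adjugate_mul, det_matZ he, one_smul]
  have h2 := congrArg ((matZ n e σ t x (branchPt A₀ ω₀ σ)).adjugate * ·) h0
  simp only [← Matrix.mul_assoc, h1, one_mul, mul_zero] at h2
  have h3 := congrFun (congrFun h2 0) 0
  simp at h3

end SpectralParameter

/-! ### Existence of the compatible solutions -/

section Existence

variable {A₀ ω₀ : ℝ} {n : ℝ → ℝ} {S : Set (ℝ × ℝ)} {Ef : ℝ → ℝ → ℂ} {ρ : ℝ → ℝ → ℝ → ℂ}
  {N : ℝ → ℝ → ℝ → ℝ} {Λ : EReal}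

theorem ofReal_mem_jumpSet_iff {lam : ℝ} : (lam : ℂ) ∈ jumpSet n ↔ ¬ ContinuousAt n lam := by
  simp [jumpSet]

theorem ofReal_sub_branchPt_ne_zero (hA₀ : 0 < A₀) (lam : ℝ) (σ : ℤˣ) :
    (lam : ℂ) - branchPt A₀ ω₀ σ ≠ 0 :=
  sub_branchPt_ne_zero hA₀ (Or.inl (by simpa using hA₀)) σ

theorem IsRegularSolution.hasDerivAt_matPhi (h : IsRegularSolution A₀ ω₀ n S Ef ρ N)
    (hA₀ : 0 < A₀) {t : ℝ} (ht : 0 < t) (lam : ℝ) :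
    HasDerivAt (fun τ => matPhi A₀ ω₀ τ lam) (matU Ef t 0 lam * matPhi A₀ ω₀ t lam) t := by
  rw [matU_eq_laxMat, h.boundary_field t ht]
  exact hasDerivAt_matPhiC (ofReal_sub_branchPt_ne_zero hA₀ lam) t

/-- For `t = 0` the factor `Ψ` is trivial, so that `exp(i η x σ₃)` solves the `x^±`-equation. -/
theorem IsRegularSolution.hasDerivAt_expSigma3_eta (h : IsRegularSolution A₀ ω₀ n S Ef ρ N)
    (hn : IsBroadening Λ n) (hSc : IsClosed S) (hS : S ⊆ lightCone) (σ : ℤˣ) {z : ℂ}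
    (hz : z ∉ jumpSet n) {x : ℝ} (hx : 0 < x) :
    HasDerivAt (fun y : ℝ => expSigma3 (Complex.I * etaFun n σ z * y))
      (laxMatX n Ef ρ N σ 0 x z * expSigma3 (Complex.I * etaFun n σ z * x)) x := by
  have he := h.continuous_retardedField hn hS
  have hZ : ∀ y : ℝ, 0 ≤ y → matZ n (retardedField A₀ ω₀ n ρ) σ 0 y z =
      expSigma3 (Complex.I * etaFun n σ z * y) := fun y hy => by
    rw [matZ, matPsi_zero_left he hy, one_mul]
  have h1 := h.hasDerivAt_matZ_x hn hSc hS le_rfl hx hx.ne σ hz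
  rw [hZ x hx.le] at h1
  refine h1.congr_of_eventuallyEq ?_
  filter_upwards [lt_mem_nhds hx] with y hy using (hZ y hy.le).symm

theorem matZ_mul_adjugate_mul {e : ℝ → ℝ → ℂ} (he : Continuous fun p : ℝ × ℝ => e p.1 p.2)
    (A B : Mat2) (t : ℝ) (z : ℂ) :
    A * (matPsi e t 0 z).adjugate * (matPsi e t 0 z * B) = A * B := by
  rw [Matrix.mul_assoc, ← Matrix.mul_assoc _ _ B, Matrix.adjugate_mul, det_matPsi he, one_smul,
    one_mul]

theorem isBigO_smul_col_sub {l : Filter ℂ} {f : ℂ → ℂ} {M : ℂ → Mat2} {j : Fin 2} {a b : ℂ}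
    (h0 : (fun z => M z 0 j * f z - a) =O[l] fun z : ℂ => z⁻¹)
    (h1 : (fun z => M z 1 j * f z - b) =O[l] fun z : ℂ => z⁻¹) :
    (fun z => f z • (M z).col j - ![a, b]) =O[l] fun z : ℂ => z⁻¹ := by
  refine isBigO_pi.2 fun i => ?_
  fin_cases i
  · exact h0.congr_left fun z => by simp [Matrix.col, mul_comm]
  · exact h1.congr_left fun z => by simp [Matrix.col, mul_comm]

end Existence


theorem mainTheorem4
    (A₀ ω₀ : ℝ) (hA₀ : 0 < A₀) (hω₀ : 0 < ω₀)
    (Λ : EReal) (n : ℝ → ℝ) (hn : IsBroadening Λ n)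
    (S : Set (ℝ × ℝ)) (hS_closed : IsClosed S) (hS_cone : S ⊆ lightCone)
    (hS_zero : ((0, 0) : ℝ × ℝ) ∈ S)
    (Ef : ℝ → ℝ → ℂ) (ρ : ℝ → ℝ → ℝ → ℂ) (N : ℝ → ℝ → ℝ → ℝ)
    (hsol : IsRegularSolution A₀ ω₀ n S Ef ρ N) :
    -- the principal values in `η_±` and `G_±` exist
    (∀ lam : ℝ, ContinuousAt n lam →
      HasPrincipalValue (fun s => (n s : ℂ)) lam ∧
      ∀ t x : ℝ, 0 ≤ t → 0 < x → ∀ i j : Fin 2,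
        HasPrincipalValue (fun s => matF ρ N t x s i j * (n s : ℂ)) lam) ∧
    -- `Φ` solves the `t`-equation for `x = 0`
    (∀ t lam : ℝ, 0 < t →
      HasDerivAt (fun τ => matPhi A₀ ω₀ τ lam) (matU Ef t 0 lam * matPhi A₀ ω₀ t lam) t) ∧
    ∃ (W : ℤˣ → ℝ → ℝ → ℝ → Mat2) (Ψ : ℝ → ℝ → ℝ → Mat2) (w : ℤˣ → ℝ → ℝ → Mat2)
      (Y Z : ℤˣ → ℝ → ℝ → ℝ → Mat2) (Yc Zc : ℤˣ → ℝ → ℝ → ℂ → Mat2),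
      -- `Y_± = W_± Φ` and `Z_± = Ψ w_±`
      (∀ (σ : ℤˣ) (t x lam : ℝ), 0 ≤ t → 0 ≤ x →
        Y σ t x lam = W σ t x lam * matPhi A₀ ω₀ t lam ∧
        Z σ t x lam = Ψ t x lam * w σ x lam) ∧
      -- `W_±` solves the `x^±`-equation, `W_±(t,0,lam) = I`
      (∀ (σ : ℤˣ) (t lam : ℝ), 0 < t → ContinuousAt n lam →
        W σ t 0 lam = 1 ∧ ContinuousOn (fun x => W σ t x lam) (Set.Ici 0) ∧
        ∀ x : ℝ, 0 < x → (t, x) ∉ S →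
          HasDerivAt (fun y => W σ t y lam) (matV n Ef ρ N σ t x lam * W σ t x lam) x) ∧
      -- `Ψ` solves the `t`-equation, `Ψ(0,x,lam) = I`
      (∀ x lam : ℝ, 0 < x →
        Ψ 0 x lam = 1 ∧ ContinuousOn (fun t => Ψ t x lam) (Set.Ici 0) ∧
        ∀ t : ℝ, 0 < t → (t, x) ∉ S →
          HasDerivAt (fun τ => Ψ τ x lam) (matU Ef t x lam * Ψ t x lam) t) ∧
      -- `w_±` solves the `x^±`-equation for `t = 0`, normalized as `x → ∞`
      (∀ (σ : ℤˣ) (lam : ℝ), ContinuousAt n lam →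
        (∀ x : ℝ, 0 < x →
          HasDerivAt (fun y => w σ y lam) (matV n Ef ρ N σ 0 x lam * w σ x lam) x) ∧
        Tendsto
          (fun x : ℝ => w σ x lam * expSigma3 (-(Complex.I * etaFun n σ (lam : ℂ) * (x : ℂ))))
          atTop (𝓝 1)) ∧
      -- `Y_±` and `Z_±` solve the `t`- and `x^±`-equations
      (∀ (σ : ℤˣ) (t x lam : ℝ), (t, x) ∈ openQuadrant \ S → ContinuousAt n lam →
        HasDerivAt (fun τ => Y σ τ x lam) (matU Ef t x lam * Y σ t x lam) t ∧
        HasDerivAt (fun y => Y σ t y lam) (matV n Ef ρ N σ t x lam * Y σ t x lam) x ∧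
        HasDerivAt (fun τ => Z σ τ x lam) (matU Ef t x lam * Z σ t x lam) t ∧
        HasDerivAt (fun y => Z σ t y lam) (matV n Ef ρ N σ t x lam * Z σ t x lam) x) ∧
      -- the two signs agree off `[-Λ, Λ]`
      (∀ t x lam : ℝ, 0 ≤ t → 0 ≤ x → (lam : ℂ) ∉ bandSet Λ →
        Y 1 t x lam = Y (-1) t x lam ∧ Z 1 t x lam = Z (-1) t x lam) ∧
      -- (a) unit determinants
      (∀ (σ : ℤˣ) (t x lam : ℝ), 0 ≤ t → 0 ≤ x → ContinuousAt n lam →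
        (Y σ t x lam).det = 1 ∧ (Z σ t x lam).det = 1) ∧
      -- (b) smoothness in `(t, x)`
      (∀ (σ : ℤˣ) (lam : ℝ), ContinuousAt n lam →
        ContDiffOn ℝ 1 (fun p : ℝ × ℝ => Y σ p.1 p.2 lam) (openQuadrant \ S) ∧
        ContDiffOn ℝ 1 (fun p : ℝ × ℝ => Z σ p.1 p.2 lam) (openQuadrant \ S) ∧
        ContinuousOn (fun p : ℝ × ℝ => Y σ p.1 p.2 lam) closedQuadrant ∧
        ContinuousOn (fun p : ℝ × ℝ => Z σ p.1 p.2 lam) closedQuadrant) ∧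
      -- (c) analytic continuation of `Y_±`
      (∀ t x : ℝ, 0 ≤ t → 0 ≤ x →
        (∀ σ : ℤˣ,
          (∀ lam : ℝ, Yc σ t x (lam : ℂ) = Y σ t x lam) ∧
          AnalyticOn ℂ (Yc σ t x) (closedHalfPlane σ \ (bandSet Λ ∪ cutSeg A₀ ω₀ σ)) ∧
          ContinuousOn (Yc σ t x) (closedHalfPlane σ \ (cutSeg A₀ ω₀ σ ∪ jumpSet n)) ∧
          -- one-sided boundary values on the cut
          (∀ ζ ∈ openSegment ℝ (branchPt A₀ ω₀ σ) (reE ω₀),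
            (∃ B : Mat2, Tendsto (Yc σ t x) (𝓝[{z | z.re < (reE ω₀).re}] ζ) (𝓝 B)) ∧
            (∃ B : Mat2, Tendsto (Yc σ t x) (𝓝[{z | (reE ω₀).re < z.re}] ζ) (𝓝 B))) ∧
          -- the singularity at the branch point
          (∃ B : Mat2, B ≠ 0 ∧
            Tendsto
              (fun z => ((-((sgnR σ : ℂ) * Complex.I) * (z - branchPt A₀ ω₀ σ)) ^ (1 / 4 : ℂ)) •
                Yc σ t x z)
              (𝓝[(cutSeg A₀ ω₀ σ)ᶜ] (branchPt A₀ ω₀ σ)) (𝓝 B)) ∧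
          -- boundedness near `Re E` and near the discontinuities of `n`
          BoundedNear (Yc σ t x) (closedHalfPlane σ \ cutSeg A₀ ω₀ σ) (reE ω₀) ∧
          (∀ ζ ∈ jumpSet n,
            BoundedNear (Yc σ t x) (closedHalfPlane σ \ cutSeg A₀ ω₀ σ) ζ)) ∧
        (fun z => Complex.exp (Complex.I * thetaFun n (-1) t x z) • (Yc (-1) t x z).col 0
          - ![1, 0]) =O[atInfinity (-1)] (fun z : ℂ => z⁻¹) ∧
        (fun z => Complex.exp (-(Complex.I * thetaFun n 1 t x z)) • (Yc 1 t x z).col 1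
          - ![0, 1]) =O[atInfinity 1] (fun z : ℂ => z⁻¹)) ∧
      -- (d) analytic continuation of `Z_±`
      (∀ t x : ℝ, 0 ≤ t → 0 ≤ x →
        (∀ σ : ℤˣ,
          (∀ lam : ℝ, Zc σ t x (lam : ℂ) = Z σ t x lam) ∧
          AnalyticOn ℂ (Zc σ t x) (closedHalfPlane σ \ bandSet Λ) ∧
          ContinuousOn (Zc σ t x) (closedHalfPlane σ \ jumpSet n) ∧
          (∀ ζ ∈ jumpSet n, BoundedNear (Zc σ t x) (closedHalfPlane σ) ζ)) ∧
        (fun z => Complex.exp (Complex.I * thetaFun n 1 t x z) • (Zc 1 t x z).col 0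
          - ![1, 0]) =O[atInfinity 1] (fun z : ℂ => z⁻¹) ∧
        (fun z => Complex.exp (-(Complex.I * thetaFun n (-1) t x z)) • (Zc (-1) t x z).col 1
          - ![0, 1]) =O[atInfinity (-1)] (fun z : ℂ => z⁻¹)) := by
  -- the field jumps on the whole light cone, so that the equations hold for `t ≠ x` only
  have hS : S = lightCone :=
    hS_cone.antisymm (hsol.lightCone_subset hA₀ hn hS_closed hS_cone hS_zero)
  have he := hsol.continuous_retardedField hn hS_cone
  have hE := ofReal_sub_branchPt_ne_zero (ω₀ := ω₀) hA₀
  have hJ : ∀ {lam : ℝ}, ContinuousAt n lam → (lam : ℂ) ∉ jumpSet n := fun hc hJ =>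
    ofReal_mem_jumpSet_iff.1 hJ hc
  have hne : ∀ {t x : ℝ}, 0 < t → (t, x) ∉ S → t ≠ x := fun ht hm heq =>
    hm (hS ▸ ⟨ht.le, heq⟩)
  refine ⟨fun lam hc => ⟨hn.hasPrincipalValue hc, fun t x ht hx i j =>
      hsol.hasPrincipalValue_matF hn hS_closed hS_cone ht hx hc i j⟩,
    fun t lam ht => hsol.hasDerivAt_matPhi hA₀ ht lam, ?_⟩
  set e := retardedField A₀ ω₀ n ρ with hedef
  -- `Ψ` and `M₀` are unimodular, and the adjugate of `Ψ` is its inverse; `Y_±` and `Z_±` are given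
  -- by the same formulas at real and at complex values of the spectral parameter
  refine ⟨fun σ t x lam => matZ n e σ t x lam * (matPsi e t 0 lam).adjugate,
    fun t x lam => matPsi e t x lam, fun σ x lam => expSigma3 (Complex.I * etaFun n σ lam * x),
    fun σ t x lam => matZ n e σ t x lam * matM0 A₀ ω₀ lam, fun σ t x lam => matZ n e σ t x lam,
    fun σ t x z => matZ n e σ t x z * matM0 A₀ ω₀ z, fun σ t x z => matZ n e σ t x z,
    ?_, ?_, ?_, ?_, ?_, ?_, ?_, ?_, ?_, ?_⟩
  · intro σ t x lam ht hx
    refine ⟨?_, rfl⟩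
    have hΦ : matPhi A₀ ω₀ t lam = matPsi e t 0 lam * matM0 A₀ ω₀ lam :=
      (hsol.matPsi_mul_matM0 hn hS_cone ht (hE lam)).symm
    simp only [hΦ, matZ_mul_adjugate_mul he]
  · intro σ t lam ht hc
    refine ⟨?_, ?_, fun x hx hm => ?_⟩
    · simp only [matZ, Complex.ofReal_zero, mul_zero, expSigma3_zero, mul_one,
        Matrix.mul_adjugate, det_matPsi he, one_smul]
    · have h0 : Continuous fun x : ℝ => (t, x) := by fun_prop
      exact (Continuous.matrix_mul (B := fun _ => (matPsi e t 0 lam).adjugate)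
        (Continuous.comp (g := fun p : ℝ × ℝ => matZ n e σ p.1 p.2 lam)
          (continuous_matZ he σ lam) h0) continuous_const).continuousOn
    · have h1 := (hsol.hasDerivAt_matZ_x hn hS_closed hS_cone ht.le hx (hne ht hm) σ
        (hJ hc)).mat2_mul_const (matPsi e t 0 lam).adjugate
      rwa [Matrix.mul_assoc] at h1
  · intro x lam hx
    refine ⟨matPsi_zero_left he hx.le _, ?_, fun t ht hm => ?_⟩
    · have h0 : Continuous fun t : ℝ => (t, x, (lam : ℂ)) := by fun_prop
      exact (Continuous.comp (g := fun q : ℝ × ℝ × ℂ => matPsi e q.1 q.2.1 q.2.2)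
        (continuous_matPsi he) h0).continuousOn
    · rw [matU_eq_laxMat]
      exact hsol.hasDerivAt_matPsi_t hn hS_closed hS_cone ht hx (hne ht hm) lam
  · intro σ lam hc
    refine ⟨fun x hx => hsol.hasDerivAt_expSigma3_eta hn hS_closed hS_cone σ (hJ hc) hx, ?_⟩
    have h1 : ∀ x : ℝ, expSigma3 (Complex.I * etaFun n σ lam * x) *
        expSigma3 (-(Complex.I * etaFun n σ lam * x)) = 1 := fun x => by
      rw [← expSigma3_add, add_neg_cancel, expSigma3_zero]
    simp only [h1]
    exact tendsto_const_nhds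
  · rintro σ t x lam ⟨⟨ht, hx⟩, hm⟩ hc
    have h1 := hsol.hasDerivAt_matZ_t hn hS_closed hS_cone ht hx (hne ht hm) σ lam
    have h2 := hsol.hasDerivAt_matZ_x hn hS_closed hS_cone (le_of_lt ht) hx (hne ht hm) σ (hJ hc)
    have h3 := h1.mat2_mul_const (matM0 A₀ ω₀ lam)
    have h4 := h2.mat2_mul_const (matM0 A₀ ω₀ lam)
    rw [Matrix.mul_assoc] at h3 h4
    rw [matU_eq_laxMat]
    exact ⟨h3, h4, h1, h2⟩
  · intro t x lam ht hx hlam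
    have h1 : matZ n e 1 t x lam = matZ n e (-1) t x lam := by
      rw [matZ, matZ, etaFun_eq_integral hn 1 hlam, etaFun_eq_integral hn (-1) hlam]
    exact ⟨congrArg (· * matM0 A₀ ω₀ lam) h1, h1⟩
  · intro σ t x lam ht hx hc
    refine ⟨?_, det_matZ he σ t x lam⟩
    rw [Matrix.det_mul, det_matZ he, det_matM0 (hE lam), one_mul]
  · intro σ lam hc
    have h1 := hsol.contDiffOn_matZ hn hS_closed hS_cone σ (hJ hc)
    have h2 := continuous_matZ (n := n) he σ lam
    rw [hS]
    refine ⟨h1 _, ?_, ?_, h2.continuousOn⟩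
    · simpa only [mul_one] using h1 1
    · exact (Continuous.matrix_mul (B := fun _ => matM0 A₀ ω₀ lam) h2
        continuous_const).continuousOn
  · intro t x ht hx
    obtain ⟨⟨h00, h10⟩, h11, h01⟩ := hsol.isBigO_matZ_mul_matM0 hn hS_closed hS_cone ht hx
    refine ⟨fun σ => ⟨fun lam => rfl, analyticOn_matZ_mul_matM0 hA₀ he hn σ t x,
      continuousOn_matZ_mul_matM0 hA₀ he hn σ t x,
      fun ζ hζ => exists_tendsto_matZ_mul_matM0_cut hA₀ he hn σ t x hζ,
      exists_tendsto_matZ_mul_matM0_branchPt hA₀ he hn σ t x,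
      boundedNear_matZ_mul_matM0 hA₀ he hn σ t hx (by simp [reE]),
      fun ζ hζ => boundedNear_matZ_mul_matM0 hA₀ he hn σ t hx hζ.1⟩, ?_, ?_⟩
    · exact isBigO_smul_col_sub h00 (by simpa only [sub_zero] using h10)
    · exact isBigO_smul_col_sub (by simpa only [sub_zero] using h01) h11
  · intro t x ht hx
    have hmem : ∀ σ, ∀ᶠ z in atInfinity σ, z ∈ closedHalfPlane σ := fun σ =>
      mem_inf_of_right (mem_principal_self _)
    refine ⟨fun σ => ⟨fun lam => rfl, analyticOn_matZ he hn σ t x, continuousOn_matZ he hn σ t x,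
      fun ζ _ => boundedNear_matZ he hn σ t hx ζ⟩, ?_, ?_⟩
    · obtain ⟨h00, h10⟩ := hsol.isBigO_matZ_col_zero hn hS_closed hS_cone ht hx 1
        (l := atInfinity 1) inf_le_left ((hmem 1).mono fun z hz => Or.inl (by
          have hz' : 0 ≤ z.im := by simpa [closedHalfPlane_one] using hz
          linarith))
      exact isBigO_smul_col_sub h00 (by simpa only [sub_zero] using h10)
    · obtain ⟨h11, h01⟩ := hsol.isBigO_matZ_col_one hn hS_closed hS_cone ht hx (-1)
        (l := atInfinity (-1)) inf_le_left ((hmem (-1)).mono fun z hz => Or.inl (by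
          have hz' : z.im ≤ 0 := by simpa [closedHalfPlane_neg_one] using hz
          linarith))
      exact isBigO_smul_col_sub (by simpa only [sub_zero] using h01) h11
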